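/- Let $\mathbb K=\mathbb R$ or $\mathbb C$, let $m\ge 2$, let $U\subset\mathbb K^m$ be open and let $A,B$ be $m\times m$ matrices whose entries are smooth (for $\mathbb K=\mathbb C$: holomorphic) functions on $U$. All functions of $u$, of $R=(R^1,R^2)$ and of $(t,x,y)$ below are smooth (resp. holomorphic) and $\mathbb K$-valued or $\mathbb K^m$-valued; $E$ is the identity matrix. Consider the system $u_t+A(u)u_x+B(u)u_y=0$, and for $u_0\in U$ its dispersion curve $\{(\lambda,\mu): D_{u_0}(\mu,\lambda)=\det(A(u_0)+\mu B(u_0)+\lambda E)=0\}\subset\mathbb K^2$. Assume that the spectrum is simple: for every $u_0\in U$ there are $k,l\in\mathbb K$ such that $kE+A(u_0)$ is invertible and $(kE+A(u_0))^{-1}(lE+B(u_0))$ has $m$ distinct eigenvalues in $\mathbb K$. For a matrix field $v=(v^i_j(u))$ its Haantjes tensor is (summation over repeated indices) $$H^i_{jk}=N^i_{pr}v^p_jv^r_k-N^p_{jr}v^i_pv^r_k-N^p_{rk}v^i_pv^r_j+N^p_{jk}v^i_rv^r_p,\qquad N^i_{jk}=v^p_j\partial_{u^p}v^i_k-v^p_k\partial_{u^p}v^i_j-v^i_p(\partial_{u^j}v^p_k-\partial_{u^k}v^p_j).$$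 A two-component reduction is a map $u=u(R^1,R^2)$ from an open set $\Omega\subset\mathbb K^2$ to $U$ with $\partial_1u,\partial_2u$ linearly independent, together with characteristic speeds $\lambda^i(R),\mu^i(R)$, $i=1,2$, such that $(\lambda^1,\mu^1)\ne(\lambda^2,\mu^2)$ everywhere, $(A+\mu^iB+\lambda^iE)\,\partial_iu=0$, and the flows $R^i_t=\lambda^i(R)R^i_x$, $R^i_y=\mu^i(R)R^i_x$ commute, that is, $\partial_j\lambda^i\,(\mu^j-\mu^i)=\partial_j\mu^i\,(\lambda^j-\lambda^i)$ for $i\neq j$. A double wave is a solution of the system of the form $u(R^1(t,x,y),R^2(t,x,y))$, where $u(R^1,R^2)$ is a two-component reduction and $R^1,R^2$ solve these two flows with $R^i_x\ne0$. Theorem 2. The Haantjes tensor of $(kE+A)^{-1}(lE+B)$ vanishes for all constants $k,l\in\mathbb K$, at all points of $U$ where $kE+A$ is invertible, if and only if the following two conditions hold. (i) The system has double waves parametrized by four arbitrary functions of one variable, in the following sense: for every $u_0\in U$ there are base speeds $\lambda^i_0,\mu^i_0$ $(i=1,2)$, indices $r,s\in\{1,\dots,m\}$ and a dense open set $J\subset\mathbb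 K^2$ such that for any functions $f_1,f_2,f_3,f_4$ of one variable, smooth (resp. holomorphic) near $0$, with $f_1(0)=u_0^r$, $f_2(0)=u_0^s$, $f_3(0)=\mu^1_0$, $f_4(0)=\mu^2_0$ and $(f_1'(0),f_2'(0))\in J$, there is a double wave near $(t,x,y)=(0,0,0)$ which at the origin has the value $u_0$ and the speeds $\lambda^i_0,\mu^i_0$, and for which $$u^r=f_1(x),\quad u^s=f_2(x),\quad \mu^1=f_3(x),\quad \mu^2=f_4(x)\qquad\text{at }(0,x,0)\text{ for }x\text{ near }0;$$ and this double wave, with its speeds $\lambda^i,\mu^i$ as functions of $(t,x,y)$, is unique near the origin. (ii) The characteristic speeds of two-component reductions satisfy no algebraic relation beyond the dispersion relation: for every $u_0\in U$ and any two points $(\lambda^1_0,\mu^1_0),(\lambda^2_0,\mu^2_0)$ of the dispersion curve at $u_0$ in general position, there is a two-component reduction which at some point $R_0$ has $u(R_0)=u_0$, $\lambda^i(R_0)=\lambda^i_0$, $\mu^i(R_0)=\mu^i_0$. Here general position means that the line joining the two points is transversal to the dispersion curve at both of them: the restriction of $D_{u_0}$ to this line has simple zeros at the two points. -/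

import Mathlib

open scoped ContDiff Topology

namespace HydrodynamicType

/-- The partial derivative `∂f/∂xᵢ` of a function of `n` variables over `𝕜`. -/
noncomputable def pd {𝕜 : Type*} [RCLike 𝕜] {n : ℕ} {F : Type*} [NormedAddCommGroup F]
    [NormedSpace 𝕜 F] (i : Fin n) (f : (Fin n → 𝕜) → F) (x : Fin n → 𝕜) : F :=
  fderiv 𝕜 f x (Pi.single i 1)

/-- The component `N^i_{jk}` of the Nijenhuis tensor of the matrix field `v` at `u`. -/
noncomputable def nijenhuis {𝕜 : Type*} [RCLike 𝕜] {m : ℕ}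
    (v : (Fin m → 𝕜) → Matrix (Fin m) (Fin m) 𝕜) (u : Fin m → 𝕜) (i j k : Fin m) : 𝕜 :=
  ∑ p, (v u p j * pd p (fun w => v w i k) u - v u p k * pd p (fun w => v w i j) u
    - v u i p * (pd j (fun w => v w p k) u - pd k (fun w => v w p j) u))

/-- The component `H^i_{jk}` of the Haantjes tensor of the matrix field `v` at `u`. -/
noncomputable def haantjes {𝕜 : Type*} [RCLike 𝕜] {m : ℕ}
    (v : (Fin m → 𝕜) → Matrix (Fin m) (Fin m) 𝕜) (u : Fin m → 𝕜) (i j k : Fin m) : 𝕜 :=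
  ∑ p, ∑ r, (nijenhuis v u i p r * v u p j * v u r k - nijenhuis v u p j r * v u i p * v u r k
    - nijenhuis v u p r k * v u i p * v u r j + nijenhuis v u p j k * v u i r * v u r p)

/-- The member `(kE + A)⁻¹ (lE + B)` of the two-parameter family of matrix fields.
It is meaningful at the points where `kE + A` is invertible. -/
noncomputable def familyMatrix {𝕜 : Type*} [RCLike 𝕜] {m : ℕ}
    (A B : (Fin m → 𝕜) → Matrix (Fin m) (Fin m) 𝕜) (k l : 𝕜) (u : Fin m → 𝕜) :
    Matrix (Fin m) (Fin m) 𝕜 :=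
  (k • (1 : Matrix (Fin m) (Fin m) 𝕜) + A u)⁻¹ * (l • (1 : Matrix (Fin m) (Fin m) 𝕜) + B u)

/-- The Haantjes tensor of every matrix of the family vanishes, wherever that matrix is defined. -/
def HaantjesVanishes {𝕜 : Type*} [RCLike 𝕜] {m : ℕ}
    (A B : (Fin m → 𝕜) → Matrix (Fin m) (Fin m) 𝕜) (U : Set (Fin m → 𝕜)) : Prop :=
  ∀ k l : 𝕜, ∀ u ∈ U, IsUnit (k • (1 : Matrix (Fin m) (Fin m) 𝕜) + A u).det →
    ∀ i j n : Fin m, haantjes (familyMatrix A B k l) u i j n = 0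

/-- The left-hand side `D(μ, λ) = det (A + μ B + λ E)` of the dispersion relation at `u`. -/
noncomputable def dispersion {𝕜 : Type*} [RCLike 𝕜] {m : ℕ}
    (A B : (Fin m → 𝕜) → Matrix (Fin m) (Fin m) 𝕜) (u : Fin m → 𝕜) (mu lam : 𝕜) : 𝕜 :=
  (A u + mu • B u + lam • (1 : Matrix (Fin m) (Fin m) 𝕜)).det

/-- Simplicity of the spectrum at `u`: some matrix of the family is defined at `u` and has `m`
distinct eigenvalues in `𝕜` there. Equivalently, generic lines (if `𝕜 = ℂ`), or all lines from some
nonempty open set of lines (if `𝕜 = ℝ`), meet the dispersion curve at `u` in `m` distinct points. -/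
def SimpleSpectrumAt {𝕜 : Type*} [RCLike 𝕜] {m : ℕ}
    (A B : (Fin m → 𝕜) → Matrix (Fin m) (Fin m) 𝕜) (u : Fin m → 𝕜) : Prop :=
  ∃ k l : 𝕜, IsUnit (k • (1 : Matrix (Fin m) (Fin m) 𝕜) + A u).det ∧
    ∃ ν : Fin m → 𝕜, Function.Injective ν ∧
      ∀ i, Module.End.HasEigenvalue (Matrix.toLin' (familyMatrix A B k l u)) (ν i)

/-- Two points `(λ¹, μ¹)`, `(λ², μ²)` of the dispersion curve at `u` in general position: the line
joining them is transversal to the dispersion curve at both of them, that is, `D` restricted to this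
line has simple zeros there. (In particular the two points are distinct.) -/
def GenericPair {𝕜 : Type*} [RCLike 𝕜] {m : ℕ}
    (A B : (Fin m → 𝕜) → Matrix (Fin m) (Fin m) 𝕜) (u : Fin m → 𝕜) (lam mu : Fin 2 → 𝕜) : Prop :=
  (∀ i, dispersion A B u (mu i) (lam i) = 0) ∧
  deriv (fun s : 𝕜 => dispersion A B u (mu 0 + s * (mu 1 - mu 0)) (lam 0 + s * (lam 1 - lam 0))) 0
    ≠ 0 ∧
  deriv (fun s : 𝕜 => dispersion A B u (mu 0 + s * (mu 1 - mu 0)) (lam 0 + s * (lam 1 - lam 0))) 1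
    ≠ 0

/-- `u = u(R¹, R²)` with characteristic speeds `λⁱ(R)`, `μⁱ(R)`, defined on the open set `Ω`, is a
two-component hydrodynamic reduction of `u_t + A u_x + B u_y = 0`: its hodograph is a surface in
`U`, the points `(λ¹, μ¹)`, `(λ², μ²)` are distinct, `(A + μⁱ B + λⁱ E) ∂ᵢu = 0`, and the flows
`Rⁱ_t = λⁱ Rⁱ_x`, `Rⁱ_y = μⁱ Rⁱ_x` commute, i.e. `∂ⱼλⁱ / (λʲ - λⁱ) = ∂ⱼμⁱ / (μʲ - μⁱ)`. The last
relation is written without denominators; in this form it is exactly the commutativity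
`(Rⁱ_t)_y = (Rⁱ_y)_t`, also where one of the denominators vanishes. -/
structure IsReduction {𝕜 : Type*} [RCLike 𝕜] {m : ℕ}
    (A B : (Fin m → 𝕜) → Matrix (Fin m) (Fin m) 𝕜) (U : Set (Fin m → 𝕜))
    (Ω : Set (Fin 2 → 𝕜)) (u : (Fin 2 → 𝕜) → (Fin m → 𝕜))
    (lam mu : Fin 2 → (Fin 2 → 𝕜) → 𝕜) : Prop where
  isOpen : IsOpen Ω
  mapsTo : Set.MapsTo u Ω U
  smooth_u : ContDiffOn 𝕜 ∞ u Ω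
  smooth_lam : ∀ i, ContDiffOn 𝕜 ∞ (lam i) Ω
  smooth_mu : ∀ i, ContDiffOn 𝕜 ∞ (mu i) Ω
  surface : ∀ R ∈ Ω, LinearIndependent 𝕜 (fun i : Fin 2 => pd i u R)
  distinct : ∀ R ∈ Ω, (lam 0 R, mu 0 R) ≠ (lam 1 R, mu 1 R)
  eigen : ∀ R ∈ Ω, ∀ i : Fin 2,
    (A (u R) + mu i R • B (u R) + lam i R • (1 : Matrix (Fin m) (Fin m) 𝕜)).mulVec (pd i u R) = 0
  commute : ∀ R ∈ Ω, ∀ i j : Fin 2, i ≠ j →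
    pd j (lam i) R * (mu j R - mu i R) = pd j (mu i) R * (lam j R - lam i R)

/-- `w` is a solution of `w_t + A(w) w_x + B(w) w_y = 0` on the open set `W`, with values in `U`;
the independent variables are numbered `0 = t`, `1 = x`, `2 = y`. -/
structure IsSolution {𝕜 : Type*} [RCLike 𝕜] {m : ℕ}
    (A B : (Fin m → 𝕜) → Matrix (Fin m) (Fin m) 𝕜) (U : Set (Fin m → 𝕜))
    (W : Set (Fin 3 → 𝕜)) (w : (Fin 3 → 𝕜) → (Fin m → 𝕜)) : Prop where
  isOpen : IsOpen W
  mapsTo : Set.MapsTo w W U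
  smooth : ContDiffOn 𝕜 ∞ w W
  eqn : ∀ z ∈ W, pd 0 w z + (A (w z)).mulVec (pd 1 w z) + (B (w z)).mulVec (pd 2 w z) = 0

/-- `R¹(t,x,y), R²(t,x,y)` solve the diagonal systems `Rⁱ_t = λⁱ(R) Rⁱ_x`, `Rⁱ_y = μⁱ(R) Rⁱ_x` on
the open set `W`, and neither of them is stationary. -/
structure IsRiemannSolution {𝕜 : Type*} [RCLike 𝕜]
    (Ω : Set (Fin 2 → 𝕜)) (lam mu : Fin 2 → (Fin 2 → 𝕜) → 𝕜)
    (W : Set (Fin 3 → 𝕜)) (R : (Fin 3 → 𝕜) → (Fin 2 → 𝕜)) : Prop where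
  isOpen : IsOpen W
  mapsTo : Set.MapsTo R W Ω
  smooth : ContDiffOn 𝕜 ∞ R W
  eq_t : ∀ z ∈ W, ∀ i : Fin 2,
    pd 0 (fun z => R z i) z = lam i (R z) * pd 1 (fun z => R z i) z
  eq_y : ∀ z ∈ W, ∀ i : Fin 2,
    pd 2 (fun z => R z i) z = mu i (R z) * pd 1 (fun z => R z i) z
  nonstationary : ∀ z ∈ W, ∀ i : Fin 2, pd 1 (fun z => R z i) z ≠ 0

/-- `w` is a double wave on `W`: a solution of the form `w = u(R¹, R²)` where `u` is a two-component
reduction and `R¹, R²` solve the corresponding pair of diagonal systems. The functions `lamW i`,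
`muW i` are its characteristic speeds, as functions of `(t, x, y)`. -/
def IsDoubleWave {𝕜 : Type*} [RCLike 𝕜] {m : ℕ}
    (A B : (Fin m → 𝕜) → Matrix (Fin m) (Fin m) 𝕜) (U : Set (Fin m → 𝕜))
    (W : Set (Fin 3 → 𝕜)) (w : (Fin 3 → 𝕜) → (Fin m → 𝕜))
    (lamW muW : Fin 2 → (Fin 3 → 𝕜) → 𝕜) : Prop :=
  IsSolution A B U W w ∧
  ∃ (Ω : Set (Fin 2 → 𝕜)) (u : (Fin 2 → 𝕜) → (Fin m → 𝕜)) (lam mu : Fin 2 → (Fin 2 → 𝕜) → 𝕜)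
    (R : (Fin 3 → 𝕜) → (Fin 2 → 𝕜)),
    IsReduction A B U Ω u lam mu ∧ IsRiemannSolution Ω lam mu W R ∧
    ∀ z ∈ W, w z = u (R z) ∧ ∀ i, lamW i z = lam i (R z) ∧ muW i z = mu i (R z)

/-- `w`, with speeds `lamW`, `muW`, is a double wave near the origin of the space of the variables
`(t, x, y)`, which takes the value `u₀` there with speeds `lam₀`, `mu₀`, and on the `x`-axis near the
origin its components number `r`, `s` and its speeds `μ¹`, `μ²` are the functions `f 0`, `f 1`,
`f 2`, `f 3` of `x`. -/
def IsDoubleWaveWithData {𝕜 : Type*} [RCLike 𝕜] {m : ℕ}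
    (A B : (Fin m → 𝕜) → Matrix (Fin m) (Fin m) 𝕜) (U : Set (Fin m → 𝕜))
    (u₀ : Fin m → 𝕜) (lam₀ mu₀ : Fin 2 → 𝕜) (r s : Fin m) (f : Fin 4 → 𝕜 → 𝕜)
    (w : (Fin 3 → 𝕜) → (Fin m → 𝕜)) (lamW muW : Fin 2 → (Fin 3 → 𝕜) → 𝕜) : Prop :=
  (∃ W : Set (Fin 3 → 𝕜), 0 ∈ W ∧ IsDoubleWave A B U W w lamW muW) ∧
  w 0 = u₀ ∧ (∀ i, lamW i 0 = lam₀ i ∧ muW i 0 = mu₀ i) ∧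
  ∀ᶠ x : 𝕜 in 𝓝 0, w ![0, x, 0] r = f 0 x ∧ w ![0, x, 0] s = f 1 x ∧
    muW 0 ![0, x, 0] = f 2 x ∧ muW 1 ![0, x, 0] = f 3 x

/-- The system possesses double waves parametrized by four arbitrary functions of one variable:
near every `u₀`, for suitable base speeds and two suitable components of `u`, the values along the
`x`-axis of these two components and of the two speeds `μ¹`, `μ²` can be prescribed as four
arbitrary smooth functions (normalized at `x = 0`, with the first derivatives of the first two in a
dense open set), and the double wave is then uniquely determined near the origin. -/
def HasDoubleWavesOfFourFunctions {𝕜 : Type*} [RCLike 𝕜] {m : ℕ}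
    (A B : (Fin m → 𝕜) → Matrix (Fin m) (Fin m) 𝕜) (U : Set (Fin m → 𝕜)) : Prop :=
  ∀ u₀ ∈ U, ∃ (lam₀ mu₀ : Fin 2 → 𝕜) (r s : Fin m) (J : Set (𝕜 × 𝕜)), IsOpen J ∧ Dense J ∧
    ∀ (I : Set 𝕜) (f : Fin 4 → 𝕜 → 𝕜), IsOpen I → 0 ∈ I → (∀ a, ContDiffOn 𝕜 ∞ (f a) I) →
      f 0 0 = u₀ r → f 1 0 = u₀ s → f 2 0 = mu₀ 0 → f 3 0 = mu₀ 1 →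
      (deriv (f 0) 0, deriv (f 1) 0) ∈ J →
      (∃ w lamW muW, IsDoubleWaveWithData A B U u₀ lam₀ mu₀ r s f w lamW muW) ∧
      ∀ w lamW muW w' lamW' muW', IsDoubleWaveWithData A B U u₀ lam₀ mu₀ r s f w lamW muW →
        IsDoubleWaveWithData A B U u₀ lam₀ mu₀ r s f w' lamW' muW' →
        w =ᶠ[𝓝 0] w' ∧ ∀ i, lamW i =ᶠ[𝓝 0] lamW' i ∧ muW i =ᶠ[𝓝 0] muW' i

/-- The characteristic speeds of two-component reductions are restricted by the dispersion relation
only: at any `u₀`, any two points of the dispersion curve (in general position) are realised by some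
two-component reduction passing through `u₀`. -/
def SpeedsUnrestricted {𝕜 : Type*} [RCLike 𝕜] {m : ℕ}
    (A B : (Fin m → 𝕜) → Matrix (Fin m) (Fin m) 𝕜) (U : Set (Fin m → 𝕜)) : Prop :=
  ∀ u₀ ∈ U, ∀ lam₀ mu₀ : Fin 2 → 𝕜, GenericPair A B u₀ lam₀ mu₀ →
    ∃ (Ω : Set (Fin 2 → 𝕜)) (u : (Fin 2 → 𝕜) → (Fin m → 𝕜)) (lam mu : Fin 2 → (Fin 2 → 𝕜) → 𝕜),
      IsReduction A B U Ω u lam mu ∧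
      ∃ R₀ ∈ Ω, u R₀ = u₀ ∧ ∀ i, lam i R₀ = lam₀ i ∧ mu i R₀ = mu₀ i

end HydrodynamicType

/-!
The pivot of the argument is the condition `AllCompatible`. Take two points of the dispersion curve
at `u` in general position and let them move with `u(R¹, R²)` in such a way that the commutation of
the two flows holds, that is, let each of them change along the line joining them when the other
coordinate varies. Differentiating `(A + μⁱB + λⁱE) ∂ᵢu = 0` by the other coordinate gives two
equations for the one vector `∂₀∂₁u`; `Compatible` says that they have a common solution.

*Haantjes tensors and compatibility.* A line which is not parallel to the `λ`-axis is `λ = k + lμ`,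
and on it `A + μB + λE = (kE + A)(E + μv)` with `v = (kE + A)⁻¹(lE + B)`. The points of the
dispersion curve on the line correspond, by `μ ↦ -1/μ`, to the non-zero eigenvalues of `v`, and the
Haantjes tensor of `v`, evaluated on two eigenvectors (`haantjesForm_eigenvectors`), is the
obstruction to compatibility (`compatible_of_haantjesForm`, `haantjesForm_eq_zero_of_solution`). The
lines that are excluded here, those parallel to the `λ`-axis and those with `kE + A` singular, are
limits of others, and compatibility is a closed condition. Conversely, if `v` has simple spectrum then
its eigenvectors form a basis, so compatibility makes its Haantjes tensor vanish. This applies to all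
`k, l` near those given by the assumption on the spectrum, up to isolated exceptions, and the tensor
is rational in `k` and `l`, hence vanishes identically (`AllCompatible.haantjesVanishes`).

*Reductions and compatibility.* A two-component reduction through given points yields compatibility
at these points by differentiation (`SpeedsUnrestricted.allCompatible`). If, on the other hand, all
pairs of points are compatible, the equations for `u` and for the positions of the two points on the
dispersion curve become a semilinear system in characteristic coordinates that is in involution. It
is solved with arbitrary data on the diagonal `R¹ = R²`, smoothly or holomorphically, by the implicit
function theorem in a Banach space of continuous functions on a square
(`exists_characteristicSystem`), and its solution is determined by the data
(`eventuallyEq_of_characteristicSystem`). This gives `AllCompatible.speedsUnrestricted`.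

*Double waves.* Along the axis `(0, x, 0)` both Riemann invariants can be normalized to be `x`, so the
axis corresponds to the diagonal of the `R`-plane. There the four functions prescribe two components
of `u` and the two speeds `μⁱ`; the relation `u_x = ∂₀u + ∂₁u`, with `∂ᵢu` in the kernels of the two
symbols, turns into an ordinary differential equation for the remaining components by Cramer's rule.
The Riemann invariants as functions of `(t, x, y)` are found by the generalized hodograph method,
from `wⁱ(R) = x + λⁱt + μⁱy`, where the functions `wⁱ` satisfy a linear system whose coefficients are
given by the reduction, with the value `x` on the diagonal (`exists_riemannInvariants`). Since every
normalized double wave arises in this way (`IsNormalizedWave.exists_hodograph`), the uniqueness for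
the system in characteristic coordinates gives that of the double wave
(`BranchPair.eventuallyEq_of_isDoubleWaveWithData`).
-/

namespace HydrodynamicType
open Filter

/-- `f` is smooth on some neighbourhood of `x`. This is stronger than `ContDiffAt 𝕜 ∞ f x`, where
the neighbourhood may depend on the order of differentiability. -/
def SmoothNear (𝕜 : Type*) [RCLike 𝕜] {E F : Type*} [NormedAddCommGroup E] [NormedSpace 𝕜 E]
    [NormedAddCommGroup F] [NormedSpace 𝕜 F] (f : E → F) (x : E) : Prop :=
  ∀ᶠ y in 𝓝 x, ContDiffAt 𝕜 ∞ f y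

/-! ### Functions that are smooth near a point -/

section SmoothNear

variable {𝕜 : Type*} [RCLike 𝕜] {E F G : Type*} [NormedAddCommGroup E] [NormedSpace 𝕜 E]
  [NormedAddCommGroup F] [NormedSpace 𝕜 F] [NormedAddCommGroup G] [NormedSpace 𝕜 G]
  {f g : E → F} {x : E}

theorem SmoothNear.contDiffAt (h : SmoothNear 𝕜 f x) : ContDiffAt 𝕜 ∞ f x := h.self_of_nhds

theorem SmoothNear.continuousAt (h : SmoothNear 𝕜 f x) : ContinuousAt f x :=
  h.contDiffAt.continuousAt

theorem SmoothNear.differentiableAt (h : SmoothNear 𝕜 f x) : DifferentiableAt 𝕜 f x :=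
  h.contDiffAt.differentiableAt (by simp)

theorem SmoothNear.eventually (h : SmoothNear 𝕜 f x) : ∀ᶠ y in 𝓝 x, SmoothNear 𝕜 f y :=
  eventually_eventually_nhds.2 h

theorem SmoothNear.eventually_differentiableAt (h : SmoothNear 𝕜 f x) :
    ∀ᶠ y in 𝓝 x, DifferentiableAt 𝕜 f y :=
  h.eventually.mono fun _ hy => hy.differentiableAt

theorem SmoothNear.congr (h : SmoothNear 𝕜 f x) (hg : g =ᶠ[𝓝 x] f) : SmoothNear 𝕜 g x := by
  filter_upwards [h, hg.eventually_nhds] with y hy hgy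
  exact hy.congr_of_eventuallyEq hgy

theorem SmoothNear.comp {g : F → G} (hg : SmoothNear 𝕜 g (f x)) (hf : SmoothNear 𝕜 f x) :
    SmoothNear 𝕜 (fun y => g (f y)) x := by
  filter_upwards [hf, hf.continuousAt.eventually hg] with y hy hgy
  exact ContDiffAt.comp y hgy hy

theorem SmoothNear.comp_of_eq {g : F → G} {y : F} (hg : SmoothNear 𝕜 g y) (hf : SmoothNear 𝕜 f x)
    (h : f x = y) : SmoothNear 𝕜 (fun y => g (f y)) x := by
  subst h; exact hg.comp hf

theorem SmoothNear.prodMk {g : E → G} (hf : SmoothNear 𝕜 f x) (hg : SmoothNear 𝕜 g x) :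
    SmoothNear 𝕜 (fun y => (f y, g y)) x := by
  filter_upwards [hf, hg] with y h1 h2 using h1.prodMk h2

theorem SmoothNear.fderiv (h : SmoothNear 𝕜 f x) : SmoothNear 𝕜 (fderiv 𝕜 f) x := by
  filter_upwards [h] with y hy using hy.fderiv_right (m := ∞) (by simp)

theorem SmoothNear.fderiv_apply {v : E → E} (h : SmoothNear 𝕜 f x) (hv : SmoothNear 𝕜 v x) :
    SmoothNear 𝕜 (fun y => _root_.fderiv 𝕜 f y (v y)) x := by
  filter_upwards [h.fderiv, hv] with y h1 h2 using h1.clm_apply h2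

theorem SmoothNear.pi {ι : Type*} [Fintype ι] {F : ι → Type*} [∀ i, NormedAddCommGroup (F i)]
    [∀ i, NormedSpace 𝕜 (F i)] {f : E → ∀ i, F i} (h : ∀ i, SmoothNear 𝕜 (fun y => f y i) x) :
    SmoothNear 𝕜 f x := by
  filter_upwards [eventually_all.2 h] with y hy using contDiffAt_pi.2 hy

theorem _root_.ContDiff.smoothNear (h : ContDiff 𝕜 ∞ f) : SmoothNear 𝕜 f x :=
  Eventually.of_forall fun _ => h.contDiffAt

theorem SmoothNear.add (hf : SmoothNear 𝕜 f x) (hg : SmoothNear 𝕜 g x) :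
    SmoothNear 𝕜 (fun y => f y + g y) x := by
  filter_upwards [hf, hg] with y h1 h2 using h1.add h2

theorem SmoothNear.sub (hf : SmoothNear 𝕜 f x) (hg : SmoothNear 𝕜 g x) :
    SmoothNear 𝕜 (fun y => f y - g y) x := by
  filter_upwards [hf, hg] with y h1 h2 using h1.sub h2

theorem SmoothNear.smul {a : E → 𝕜} (ha : SmoothNear 𝕜 a x) (hf : SmoothNear 𝕜 f x) :
    SmoothNear 𝕜 (fun y => a y • f y) x := by
  filter_upwards [ha, hf] with y h1 h2 using h1.smul h2

theorem SmoothNear.mul {a b : E → 𝕜} (ha : SmoothNear 𝕜 a x) (hb : SmoothNear 𝕜 b x) :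
    SmoothNear 𝕜 (fun y => a y * b y) x := ha.smul hb

theorem SmoothNear.neg (hf : SmoothNear 𝕜 f x) : SmoothNear 𝕜 (fun y => - f y) x := by
  filter_upwards [hf] with y h1 using h1.neg

theorem SmoothNear.div {a b : E → 𝕜} (ha : SmoothNear 𝕜 a x) (hb : SmoothNear 𝕜 b x)
    (h0 : b x ≠ 0) : SmoothNear 𝕜 (fun y => a y / b y) x := by
  filter_upwards [ha, hb, hb.continuousAt.eventually_ne h0] with y h1 h2 h3 using h1.div h2 h3

theorem SmoothNear.sum {ι : Type*} {s : Finset ι} {f : ι → E → F}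
    (h : ∀ i ∈ s, SmoothNear 𝕜 (f i) x) : SmoothNear 𝕜 (fun y => ∑ i ∈ s, f i y) x := by
  filter_upwards [(eventually_all_finset s).2 h] with y hy using ContDiffAt.sum hy

theorem SmoothNear.prod {ι : Type*} {s : Finset ι} {f : ι → E → 𝕜}
    (h : ∀ i ∈ s, SmoothNear 𝕜 (f i) x) : SmoothNear 𝕜 (fun y => ∏ i ∈ s, f i y) x := by
  filter_upwards [(eventually_all_finset s).2 h] with y hy using contDiffAt_prod hy

theorem SmoothNear.fst {f : E → F × G} (h : SmoothNear 𝕜 f x) :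
    SmoothNear 𝕜 (fun y => (f y).1) x := contDiff_fst.smoothNear.comp h

theorem SmoothNear.snd {f : E → F × G} (h : SmoothNear 𝕜 f x) :
    SmoothNear 𝕜 (fun y => (f y).2) x := contDiff_snd.smoothNear.comp h

theorem SmoothNear.apply {ι : Type*} [Fintype ι] {f : E → ι → F} (h : SmoothNear 𝕜 f x) (i : ι) :
    SmoothNear 𝕜 (fun y => f y i) x := by
  filter_upwards [h] with y hy using contDiffAt_pi.1 hy i

theorem smoothNear_const (c : F) : SmoothNear 𝕜 (fun _ : E => c) x := contDiff_const.smoothNear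

theorem smoothNear_id : SmoothNear 𝕜 (fun y : E => y) x := contDiff_id.smoothNear

theorem ContDiffOn.smoothNear {s : Set E} (h : ContDiffOn 𝕜 ∞ f s) (hs : IsOpen s) (hx : x ∈ s) :
    SmoothNear 𝕜 f x := by
  filter_upwards [hs.mem_nhds hx] with y hy using h.contDiffAt (hs.mem_nhds hy)

theorem SmoothNear.contDiffOn {s : Set E} (h : ∀ x ∈ s, SmoothNear 𝕜 f x) : ContDiffOn 𝕜 ∞ f s :=
  fun y hy => (h y hy).contDiffAt.contDiffWithinAt

/-- Implicit function theorem for functions smooth near a point. -/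
theorem SmoothNear.exists_implicitFunction [CompleteSpace E] [CompleteSpace F] [CompleteSpace G]
    {Φ : E × F → G} {a : E} {b : F} (h : SmoothNear 𝕜 Φ (a, b)) (h0 : Φ (a, b) = 0)
    (hinv : (_root_.fderiv 𝕜 Φ (a, b) ∘L .inr 𝕜 E F).IsInvertible) :
    ∃ ψ : E → F, SmoothNear 𝕜 ψ a ∧ ψ a = b ∧ (∀ᶠ y in 𝓝 a, Φ (y, ψ y) = 0) ∧
      ∀ᶠ p in 𝓝 (a, b), Φ p = 0 → p.2 = ψ p.1 := by
  have hn : (∞ : WithTop ℕ∞) ≠ 0 := by simp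
  set ψ := h.contDiffAt.implicitFunction hn hinv with hψ
  have e1 := h.contDiffAt.eventually_apply_implicitFunction hn hinv
  have e2 := h.contDiffAt.eventually_apply_eq_iff_implicitFunction hn hinv
  have e3 : ψ a = b := h.contDiffAt.implicitFunction_apply_self hn hinv
  have e4 : ContDiffAt 𝕜 ∞ ψ a := h.contDiffAt.contDiffAt_implicitFunction hn hinv
  rw [← hψ] at e1 e2
  rw [h0] at e1 e2
  have hO : IsOpen {L : F →L[𝕜] G | L.IsInvertible} := by
    have := ContinuousLinearEquiv.isOpen (𝕜 := 𝕜) (E := F) (F := G)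
    convert! this using 1
  have e5 : ∀ᶠ p in 𝓝 (a, b), (_root_.fderiv 𝕜 Φ p ∘L .inr 𝕜 E F).IsInvertible := by
    have : ContinuousAt (fun p => _root_.fderiv 𝕜 Φ p ∘L ContinuousLinearMap.inr 𝕜 E F) (a, b) :=
      h.fderiv.continuousAt.clm_comp continuousAt_const
    exact this.eventually (hO.mem_nhds hinv)
  have hc : ContinuousAt (fun y => (y, ψ y)) a := continuousAt_id.prodMk e4.continuousAt
  have hψc : ∀ᶠ y in 𝓝 a, ContinuousAt ψ y := by
    have : ContDiffAt 𝕜 1 ψ a := e4.of_le (by simp)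
    filter_upwards [this.eventually (by simp)] with y hy using hy.continuousAt
  refine ⟨ψ, ?_, e3, e1, e2.mono fun p hp h => (hp.1 h).symm⟩
  have hm : 𝓝 (a, b) = 𝓝 (a, ψ a) := by rw [e3]
  rw [hm] at e5
  have h' : SmoothNear 𝕜 Φ (a, ψ a) := by rw [e3]; exact h
  filter_upwards [hc.eventually e5, hc.eventually h', e1, e1.eventually_nhds, hψc]
    with y i1 i2 i3 i4 i5
  have j2 := i2.eventually_apply_eq_iff_implicitFunction hn i1
  have hc' : ContinuousAt (fun z => (z, ψ z)) y := continuousAt_id.prodMk i5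
  refine (i2.contDiffAt_implicitFunction hn i1).congr_of_eventuallyEq ?_
  filter_upwards [hc'.eventually j2, i4] with z hz hz4
  exact (hz.1 (hz4.trans i3.symm)).symm

end SmoothNear
end HydrodynamicType

namespace HydrodynamicType
open Filter

/-! ### Superposition operators on spaces of continuous functions -/

section Superposition

universe v
variable {𝕜 : Type v} [RCLike 𝕜] {K : Type*} [TopologicalSpace K]
  {E F : Type v} [NormedAddCommGroup E] [NormedSpace 𝕜 E] [NormedAddCommGroup F] [NormedSpace 𝕜 F]

open Classical in
/-- The superposition operator `φ ↦ f ∘ φ` on continuous functions. Its value is `0` by convention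
when `f ∘ φ` is not continuous. -/
noncomputable def superposition (K : Type*) [TopologicalSpace K] (f : E → F) (φ : C(K, E)) :
    C(K, F) :=
  if h : Continuous (f ∘ φ) then ⟨f ∘ φ, h⟩ else 0

theorem superposition_apply {f : E → F} {φ : C(K, E)} (h : ∀ p, ContinuousAt f (φ p)) (p : K) :
    superposition K f φ p = f (φ p) := by
  have : Continuous (f ∘ φ) :=
    continuous_iff_continuousAt.2 fun p => (h p).comp φ.continuous.continuousAt
  rw [superposition, dif_pos this]; rfl

variable [CompactSpace K]

theorem isOpen_forall_mem {O : Set E} (hO : IsOpen O) : IsOpen {φ : C(K, E) | ∀ p, φ p ∈ O} := by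
  have := ContinuousMap.isOpen_setOfPred_mapsTo (X := K) (isCompact_univ) hO
  convert! this using 1
  ext φ; simp [Set.MapsTo]

theorem continuousOn_superposition {f : E → F} {O : Set E} (hO : IsOpen O)
    (hf : ContinuousOn f O) :
    ContinuousOn (superposition K f) {φ : C(K, E) | ∀ p, φ p ∈ O} := by
  have hfc : ∀ x ∈ O, ContinuousAt f x := fun x hx => hf.continuousAt (hO.mem_nhds hx)
  intro φ hφ
  refine ContinuousAt.continuousWithinAt ?_
  rw [ContinuousAt, ContinuousMap.tendsto_iff_tendstoUniformly]
  intro r hr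
  have hK : IsCompact (Set.range φ) := isCompact_range φ.continuous
  have h1 := hK.uniformContinuousAt_of_continuousAt f
    (by rintro _ ⟨p, rfl⟩; exact hfc _ (hφ p)) hr
  have h2 : ∀ᶠ ψ in 𝓝 φ, ∀ p, (φ p, ψ p) ∈ {x : E × E | x.1 ∈ Set.range φ → (f x.1, f x.2) ∈ r} := by
    have : Tendsto (fun ψ : C(K, E) => ψ) (𝓝 φ) (𝓝 φ) := tendsto_id
    rw [ContinuousMap.tendsto_iff_tendstoUniformly] at this
    exact this _ h1
  filter_upwards [h2, (isOpen_forall_mem hO).mem_nhds hφ] with ψ hψ hψO p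
  rw [superposition_apply (fun p => hfc _ (hφ p)), superposition_apply (fun p => hfc _ (hψO p))]
  exact hψ p ⟨p, rfl⟩

/-- Pointwise application, as a bounded bilinear map on spaces of continuous functions. -/
noncomputable def pointwiseApply (K : Type*) [TopologicalSpace K] [CompactSpace K] (𝕜 E F : Type v)
    [RCLike 𝕜] [NormedAddCommGroup E] [NormedSpace 𝕜 E] [NormedAddCommGroup F] [NormedSpace 𝕜 F] :
    C(K, E →L[𝕜] F) →L[𝕜] C(K, E) →L[𝕜] C(K, F) :=
  LinearMap.mkContinuous₂
    (LinearMap.mk₂ 𝕜 (fun (L : C(K, E →L[𝕜] F)) (h : C(K, E)) =>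
        (⟨fun p => L p (h p), L.continuous.clm_apply h.continuous⟩ : C(K, F)))
      (by intros; ext; simp) (by intros; ext; simp) (by intros; ext; simp) (by intros; ext; simp))
    1 (by
      intro L h
      rw [one_mul]
      refine (ContinuousMap.norm_le _ (by positivity)).2 fun p => ?_
      exact ((L p).le_opNorm _).trans
        (mul_le_mul (L.norm_coe_le_norm p) (h.norm_coe_le_norm p) (by positivity) (by positivity)))

theorem pointwiseApply_apply (L : C(K, E →L[𝕜] F)) (h : C(K, E)) (p : K) :
    pointwiseApply K 𝕜 E F L h p = L p (h p) := rfl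

theorem hasFDerivAt_superposition {f : E → F} {O : Set E} (hO : IsOpen O)
    (hf : ContDiffOn 𝕜 1 f O) {φ : C(K, E)} (hφ : ∀ p, φ p ∈ O) :
    HasFDerivAt (superposition K f)
      (pointwiseApply K 𝕜 E F (superposition K (fderiv 𝕜 f) φ)) φ := by
  have hf' : ContinuousOn (fderiv 𝕜 f) O := hf.continuousOn_fderiv_of_isOpen hO le_rfl
  have hfc : ∀ x ∈ O, ContinuousAt f x := fun x hx => hf.continuousOn.continuousAt (hO.mem_nhds hx)
  have hfc' : ∀ x ∈ O, ContinuousAt (fderiv 𝕜 f) x := fun x hx => hf'.continuousAt (hO.mem_nhds hx)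
  have hd : ∀ x ∈ O, HasFDerivAt f (fderiv 𝕜 f x) x := fun x hx =>
    ((hf.contDiffAt (hO.mem_nhds hx)).differentiableAt (by simp)).hasFDerivAt
  have hcont := (continuousOn_superposition (K := K) hO hf').continuousAt
    ((isOpen_forall_mem hO).mem_nhds hφ)
  rw [hasFDerivAt_iff_isLittleO, Asymptotics.isLittleO_iff]
  intro c hc
  rw [Metric.continuousAt_iff] at hcont
  obtain ⟨δ₁, hδ₁, h1⟩ := hcont c hc
  obtain ⟨δ₂, hδ₂, h2⟩ := Metric.isOpen_iff.1 (isOpen_forall_mem (K := K) hO) φ hφ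
  filter_upwards [Metric.ball_mem_nhds φ (lt_min hδ₁ hδ₂)] with ψ hψ
  refine (ContinuousMap.norm_le _ (by positivity)).2 fun p => ?_
  let _ : NormedSpace ℝ E := NormedSpace.restrictScalars ℝ 𝕜 E
  -- the segment from `φ` to `ψ` stays in the ball where `f'` is within `c` of `f' ∘ φ`
  have hseg : ∀ y ∈ segment ℝ (φ p) (ψ p), y ∈ O ∧ ‖fderiv 𝕜 f y - fderiv 𝕜 f (φ p)‖ ≤ c := by
    rintro y ⟨a, b, ha, hb, hab, rfl⟩
    set χ : C(K, E) := φ + (b : 𝕜) • (ψ - φ) with hχ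
    have hχd : dist χ φ ≤ dist ψ φ := by
      rw [dist_eq_norm, dist_eq_norm, hχ, add_sub_cancel_left, norm_smul]
      refine mul_le_of_le_one_left (norm_nonneg _) ?_
      rw [RCLike.norm_ofReal, abs_of_nonneg hb]; linarith
    have hχp : a • φ p + b • ψ p = χ p := by
      have e : ∀ z : E, b • z = (b : 𝕜) • z := fun z => by
        change ((algebraMap ℝ 𝕜) b) • z = _; rfl
      have ea : a = 1 - b := by linarith
      rw [ea, sub_smul, one_smul, e, e]
      simp only [hχ, ContinuousMap.add_apply, ContinuousMap.smul_apply, ContinuousMap.sub_apply,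
        smul_sub]
      abel
    have hlt : dist χ φ < min δ₁ δ₂ := hχd.trans_lt hψ
    have hχO : ∀ p, χ p ∈ O := h2 (hlt.trans_le (min_le_right _ _))
    rw [hχp]
    refine ⟨hχO p, ?_⟩
    have := h1 (hlt.trans_le (min_le_left _ _))
    have h3 := (ContinuousMap.norm_coe_le_norm (superposition K (fderiv 𝕜 f) χ
      - superposition K (fderiv 𝕜 f) φ) p)
    rw [ContinuousMap.sub_apply, superposition_apply (fun p => hfc' _ (hχO p)),
      superposition_apply (fun p => hfc' _ (hφ p)), ← dist_eq_norm (superposition K _ χ)] at h3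
    exact h3.trans this.le
  have hψO : ∀ p, ψ p ∈ O := h2 ((Metric.mem_ball.1 hψ).trans_le (min_le_right _ _))
  have key := (convex_segment (φ p) (ψ p)).norm_image_sub_le_of_norm_hasFDerivWithin_le'
    (𝕜 := 𝕜) (φ := fderiv 𝕜 f (φ p)) (fun y hy => (hd y (hseg y hy).1).hasFDerivWithinAt)
    (fun y hy => (hseg y hy).2) (left_mem_segment ℝ _ _) (right_mem_segment ℝ _ _)
  rw [ContinuousMap.sub_apply, ContinuousMap.sub_apply, pointwiseApply_apply,
    superposition_apply (fun p => hfc _ (hφ p)), superposition_apply (fun p => hfc _ (hψO p)),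
    superposition_apply (fun p => hfc' _ (hφ p))]
  refine key.trans ?_
  gcongr
  exact ContinuousMap.norm_coe_le_norm (ψ - φ) p

end Superposition

section

universe v

/-- Composition with a smooth function is a smooth operation on continuous functions: its
derivative is composition with the derivative, which permits an induction on the order. -/
theorem contDiffOn_superposition {𝕜 : Type v} [RCLike 𝕜] {K : Type*} [TopologicalSpace K]
    [CompactSpace K] {E : Type v} [NormedAddCommGroup E] [NormedSpace 𝕜 E] (n : ℕ) :
    ∀ {F : Type v} [NormedAddCommGroup F] [NormedSpace 𝕜 F] {f : E → F} {O : Set E}, IsOpen O →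
      ContDiffOn 𝕜 ∞ f O → ContDiffOn 𝕜 n (superposition K f) {φ : C(K, E) | ∀ p, φ p ∈ O} := by
  induction n with
  | zero =>
    intro F _ _ f O hO hf
    simpa using continuousOn_superposition hO hf.continuousOn
  | succ n ih =>
    intro F _ _ f O hO hf
    have hd := fun (φ : C(K, E)) (hφ : ∀ p, φ p ∈ O) =>
      hasFDerivAt_superposition hO (hf.of_le (by simp)) hφ
    have hf' : ContDiffOn 𝕜 ∞ (fderiv 𝕜 f) O := hf.fderiv_of_isOpen hO (by simp)
    push_cast
    rw [contDiffOn_succ_iff_fderiv_of_isOpen (isOpen_forall_mem hO)]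
    refine ⟨fun φ hφ => (hd φ hφ).differentiableAt.differentiableWithinAt, by simp, ?_⟩
    refine ContDiffOn.congr (f := fun φ => pointwiseApply K 𝕜 E F (superposition K (fderiv 𝕜 f) φ))
      ?_ (fun φ hφ => (hd φ hφ).fderiv)
    exact (pointwiseApply K 𝕜 E F).contDiff.comp_contDiffOn (ih hO hf')

theorem SmoothNear.superposition {𝕜 : Type v} [RCLike 𝕜] {K : Type*} [TopologicalSpace K]
    [CompactSpace K] {E F : Type v} [NormedAddCommGroup E] [NormedSpace 𝕜 E]
    [NormedAddCommGroup F] [NormedSpace 𝕜 F] {f : E → F} {z : E} (h : SmoothNear 𝕜 f z) :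
    SmoothNear 𝕜 (superposition K f) (ContinuousMap.const K z) := by
  obtain ⟨O, hO, hOo, hz⟩ := eventually_nhds_iff.1 h
  have hS := isOpen_forall_mem (K := K) hOo
  have hf : ContDiffOn 𝕜 ∞ f O := fun y hy => (hO y hy).contDiffWithinAt
  refine ContDiffOn.smoothNear (contDiffOn_infty.2 fun n => contDiffOn_superposition n hOo hf)
    hS fun _ => hz

end
end HydrodynamicType

namespace HydrodynamicType
open Filter

/-! ### Integration along segments -/

section Segment

variable {𝕜 : Type*} [RCLike 𝕜] {E : Type*} [NormedAddCommGroup E] [NormedSpace 𝕜 E]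
  [NormedSpace ℝ E] [IsScalarTower ℝ 𝕜 E] [CompleteSpace E]

theorem hasDerivAt_segment (a b : 𝕜) (r : ℝ) :
    HasDerivAt (fun r : ℝ => b + (r : 𝕜) * (a - b)) (a - b) r := by
  have h : HasDerivAt (fun r : ℝ => (r : 𝕜)) 1 r := by
    simpa using (RCLike.ofRealCLM : ℝ →L[ℝ] 𝕜).hasDerivAt (x := r)
  simpa using (h.mul_const (a - b)).const_add b

/-- Fundamental theorem of calculus along the segment from `b` to `a`. -/
theorem sub_eq_smul_integral_segment {f g : 𝕜 → E} {a b : 𝕜}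
    (hf : ∀ r ∈ Set.Icc (0 : ℝ) 1, HasDerivAt f (g (b + (r : 𝕜) * (a - b))) (b + (r : 𝕜) * (a - b)))
    (hg : ContinuousOn (fun r : ℝ => g (b + (r : 𝕜) * (a - b))) (Set.Icc 0 1)) :
    f a - f b = (a - b) • ∫ r in (0 : ℝ)..1, g (b + (r : 𝕜) * (a - b)) := by
  have h1 : ∀ r ∈ Set.uIcc (0 : ℝ) 1, HasDerivAt (f ∘ fun r : ℝ => b + (r : 𝕜) * (a - b))
      ((a - b) • g (b + (r : 𝕜) * (a - b))) r := by
    intro r hr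
    rw [Set.uIcc_of_le zero_le_one] at hr
    exact (hf r hr).scomp r (hasDerivAt_segment a b r)
  have h2 := intervalIntegral.integral_eq_sub_of_hasDerivAt h1
    ((hg.const_smul (a - b)).intervalIntegrable_of_Icc zero_le_one)
  rw [intervalIntegral.integral_smul] at h2
  rw [h2]
  simp

/-- If the differentiable function `f` is obtained by integrating `g` along the segments issuing
from `b`, then `f' = g`. -/
theorem deriv_eq_of_segment {f g : 𝕜 → E} {b : 𝕜} {ε : ℝ}
    (hd : ∀ a ∈ Metric.ball b ε, DifferentiableAt 𝕜 f a) (hg : ContinuousOn g (Metric.ball b ε))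
    (h : ∀ a ∈ Metric.ball b ε, f a = f b + (a - b) • ∫ r in (0 : ℝ)..1, g (b + (r : 𝕜) * (a - b)))
    {a : 𝕜} (ha : a ∈ Metric.ball b ε) (hab : a ≠ b) : deriv f a = g a := by
  have hpos : 0 < dist a b := dist_pos.2 hab
  rw [Metric.mem_ball] at ha
  obtain ⟨q, hq1, hq2⟩ : ∃ q : ℝ, 1 < q ∧ q * dist a b < ε := by
    refine ⟨(1 + ε / dist a b) / 2, ?_, ?_⟩
    · have : 1 < ε / dist a b := (one_lt_div hpos).2 ha
      linarith
    · have : ε / dist a b * dist a b = ε := div_mul_cancel₀ _ hpos.ne'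
      nlinarith
  have hmem : ∀ r ∈ Set.Ioo (-1 : ℝ) q, b + (r : 𝕜) * (a - b) ∈ Metric.ball b ε := by
    intro r hr
    rw [Metric.mem_ball, dist_eq_norm, add_sub_cancel_left, norm_mul, RCLike.norm_ofReal,
      ← dist_eq_norm]
    have : |r| ≤ q := abs_le.2 ⟨by linarith [hr.1], hr.2.le⟩
    nlinarith
  have hcont : ContinuousOn (fun r : ℝ => g (b + (r : 𝕜) * (a - b))) (Set.Ioo (-1 : ℝ) q) := by
    refine hg.comp (Continuous.continuousOn ?_) hmem
    exact continuous_const.add (RCLike.continuous_ofReal.mul continuous_const)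
  have hsub : Set.Icc (0 : ℝ) 1 ⊆ Set.Ioo (-1 : ℝ) q :=
    fun r hr => ⟨by linarith [hr.1], hr.2.trans_lt hq1⟩
  have h1mem : (1 : ℝ) ∈ Set.Ioo (-1 : ℝ) q := hsub ⟨zero_le_one, le_rfl⟩
  have hprim := intervalIntegral.integral_hasDerivAt_right
    ((hcont.mono hsub).intervalIntegrable_of_Icc zero_le_one)
    (hcont.stronglyMeasurableAtFilter isOpen_Ioo 1 h1mem)
    (hcont.continuousAt (isOpen_Ioo.mem_nhds h1mem))
  have hprim2 := (hprim.const_smul (a - b)).const_add (f b)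
  have hcomp : HasDerivAt (f ∘ fun r : ℝ => b + (r : 𝕜) * (a - b))
      ((a - b) • deriv f (b + ((1 : ℝ) : 𝕜) * (a - b))) 1 :=
    (hd _ (hmem 1 h1mem)).hasDerivAt.scomp 1 (hasDerivAt_segment a b 1)
  have heq : (f ∘ fun r : ℝ => b + (r : 𝕜) * (a - b)) =ᶠ[𝓝 1]
      fun r : ℝ => f b + (a - b) • ∫ x in (0 : ℝ)..r, g (b + (x : 𝕜) * (a - b)) := by
    filter_upwards [isOpen_Ioo.mem_nhds h1mem] with r hr
    have e1 := intervalIntegral.smul_integral_comp_mul_right (a := 0) (b := 1)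
      (fun x : ℝ => g (b + (x : 𝕜) * (a - b))) r
    rw [zero_mul, one_mul] at e1
    rw [← e1, Function.comp_apply, h _ (hmem r hr), add_sub_cancel_left, mul_comm, mul_smul]
    congr 2
    have e2 : ∀ z : E, (r : 𝕜) • z = r • z := fun z => by
      rw [← algebraMap_smul 𝕜 r z]
    rw [e2]
    congr 1
    refine intervalIntegral.integral_congr fun x _ => ?_
    congr 2
    push_cast
    ring
  have := (hcomp.congr_of_eventuallyEq heq.symm).unique hprim2
  have h3 := smul_right_injective E (sub_ne_zero.2 hab) this
  simpa using h3

end Segment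
end HydrodynamicType

namespace HydrodynamicType
open Filter

/-! ### The integrated system on a square -/

section Square

/-- The point `(1 - t) a + t b` of the unit interval. -/
def lerp (a b t : unitInterval) : unitInterval :=
  ⟨a + t * (b - a), by
    obtain ⟨a, ha⟩ := a; obtain ⟨b, hb⟩ := b; obtain ⟨t, ht⟩ := t
    constructor <;> simp only <;> nlinarith [ha.1, ha.2, hb.1, hb.2, ht.1, ht.2,
      mul_nonneg ht.1 hb.1, mul_nonneg (sub_nonneg.2 ht.2) ha.1,
      mul_nonneg ht.1 (sub_nonneg.2 hb.2), mul_nonneg (sub_nonneg.2 ht.2) (sub_nonneg.2 ha.2)]⟩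

theorem coe_lerp (a b t : unitInterval) : (lerp a b t : ℝ) = a + t * (b - a) := rfl

theorem lerp_lerp (a b c d t : unitInterval) :
    lerp (lerp a b c) (lerp a b d) t = lerp a b (lerp c d t) := by
  apply Subtype.ext
  simp only [coe_lerp]
  ring

/-- The retraction of the real line onto the unit interval. -/
noncomputable def clamp (r : ℝ) : unitInterval := Set.projIcc 0 1 zero_le_one r

theorem coe_clamp {r : ℝ} (h : r ∈ Set.Icc (0 : ℝ) 1) : (clamp r : ℝ) = r := by
  rw [clamp, Set.projIcc_of_mem _ h]

theorem continuous_lerp {X : Type*} [TopologicalSpace X] {a b t : X → unitInterval}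
    (ha : Continuous a) (hb : Continuous b) (ht : Continuous t) :
    Continuous fun x => lerp (a x) (b x) (t x) := by
  unfold lerp
  fun_prop

theorem continuous_clamp : Continuous clamp :=
  continuous_projIcc (h := zero_le_one)

/-- The horizontal segment of the unit square from the diagonal to the point `p`. -/
noncomputable def horizontal (p : unitInterval × unitInterval) (r : ℝ) :
    unitInterval × unitInterval := (lerp p.2 p.1 (clamp r), p.2)

/-- The vertical segment of the unit square from the diagonal to the point `p`. -/
noncomputable def vertical (p : unitInterval × unitInterval) (r : ℝ) :
    unitInterval × unitInterval := (p.1, lerp p.1 p.2 (clamp r))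

theorem continuous_horizontal : Continuous (Function.uncurry horizontal) :=
  (continuous_lerp (by fun_prop) (by fun_prop) (continuous_clamp.comp (by fun_prop))).prodMk
    (by fun_prop)

theorem continuous_vertical : Continuous (Function.uncurry vertical) :=
  Continuous.prodMk (by fun_prop)
    (continuous_lerp (by fun_prop) (by fun_prop) (continuous_clamp.comp (by fun_prop)))

variable {𝕜 : Type*} [RCLike 𝕜]

/-- The affine map from the unit square to `𝕜²` that takes the diagonal to the diagonal and the
corner `(0, 1)` to the point `R`. -/
noncomputable def squarePoint (R : Fin 2 → 𝕜) (p : unitInterval × unitInterval) : Fin 2 → 𝕜 :=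
  ![R 0 + ((p.1 : ℝ) : 𝕜) * (R 1 - R 0), R 0 + ((p.2 : ℝ) : 𝕜) * (R 1 - R 0)]

theorem continuous_squarePoint (R : Fin 2 → 𝕜) : Continuous (squarePoint R) := by
  refine continuous_pi fun i => ?_
  fin_cases i
  · exact continuous_const.add
      ((RCLike.continuous_ofReal.comp (continuous_subtype_val.comp continuous_fst)).mul
        continuous_const)
  · exact continuous_const.add
      ((RCLike.continuous_ofReal.comp (continuous_subtype_val.comp continuous_snd)).mul
        continuous_const)

theorem squarePoint_corner (R : Fin 2 → 𝕜) : squarePoint R (0, 1) = R := by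
  ext i; fin_cases i <;> simp [squarePoint]

theorem norm_squarePoint_le (R : Fin 2 → 𝕜) (p : unitInterval × unitInterval) :
    ‖squarePoint R p‖ ≤ ‖R‖ := by
  have key : ∀ t : unitInterval, ‖R 0 + ((t : ℝ) : 𝕜) * (R 1 - R 0)‖ ≤ ‖R‖ := by
    intro t
    have e : R 0 + ((t : ℝ) : 𝕜) * (R 1 - R 0)
        = ((1 - t : ℝ) : 𝕜) * R 0 + ((t : ℝ) : 𝕜) * R 1 := by push_cast; ring
    have h0 := norm_le_pi_norm R 0
    have h1 := norm_le_pi_norm R 1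
    have t0 := t.2.1
    have t1 := t.2.2
    rw [e]
    refine (norm_add_le _ _).trans ?_
    rw [norm_mul, norm_mul, RCLike.norm_ofReal, RCLike.norm_ofReal, abs_of_nonneg t0,
      abs_of_nonneg (by linarith)]
    nlinarith
  refine (pi_norm_le_iff_of_nonneg (norm_nonneg _)).2 fun i => ?_
  fin_cases i
  · exact key p.1
  · exact key p.2

/-- `squarePoint`, as a bounded linear map of `R`. -/
noncomputable def squarePointL (𝕜 : Type*) [RCLike 𝕜] :
    (Fin 2 → 𝕜) →L[𝕜] C(unitInterval × unitInterval, Fin 2 → 𝕜) :=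
  LinearMap.mkContinuous
    { toFun := fun R => ⟨squarePoint R, continuous_squarePoint R⟩
      map_add' := by
        intro R S; ext p i
        fin_cases i <;> simp [squarePoint] <;> ring
      map_smul' := by
        intro c R; ext p i
        fin_cases i <;> simp [squarePoint] <;> ring }
    1 (by
      intro R
      rw [one_mul]
      exact (ContinuousMap.norm_le _ (norm_nonneg _)).2 fun p => norm_squarePoint_le R p)

end Square

section Operator

variable {𝕜 : Type*} [RCLike 𝕜] {E₁ E₂ : Type*} [NormedAddCommGroup E₁] [NormedSpace 𝕜 E₁]
  [NormedSpace ℝ E₁] [NormedAddCommGroup E₂] [NormedSpace 𝕜 E₂] [NormedSpace ℝ E₂]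

theorem continuous_mean {E : Type*} [NormedAddCommGroup E] [NormedSpace ℝ E]
    {f : unitInterval × unitInterval → E} (hf : Continuous f)
    {γ : unitInterval × unitInterval → ℝ → unitInterval × unitInterval}
    (hγ : Continuous (Function.uncurry γ)) :
    Continuous fun p => ∫ r in (0 : ℝ)..1, f (γ p r) :=
  intervalIntegral.continuous_parametric_intervalIntegral_of_continuous' (f := fun p r => f (γ p r))
    (hf.comp hγ) 0 1

/-- Integration from the diagonal: horizontally for the first component and vertically for the
second one. -/
noncomputable def diagonalPrimitive (𝕜 E₁ E₂ : Type*) [RCLike 𝕜] [NormedAddCommGroup E₁]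
    [NormedSpace 𝕜 E₁] [NormedSpace ℝ E₁] [IsScalarTower ℝ 𝕜 E₁] [NormedAddCommGroup E₂]
    [NormedSpace 𝕜 E₂] [NormedSpace ℝ E₂] [IsScalarTower ℝ 𝕜 E₂] :
    C(unitInterval × unitInterval, E₁ × E₂) →L[𝕜] C(unitInterval × unitInterval, E₁ × E₂) :=
  LinearMap.mkContinuous
    { toFun := fun f =>
        ⟨fun p => ((((p.1 : ℝ) - (p.2 : ℝ) : ℝ) : 𝕜) • ∫ r in (0 : ℝ)..1, (f (horizontal p r)).1,
          (((p.2 : ℝ) - (p.1 : ℝ) : ℝ) : 𝕜) • ∫ r in (0 : ℝ)..1, (f (vertical p r)).2), by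
          have h1 := continuous_mean (continuous_fst.comp f.continuous) continuous_horizontal
          have h2 := continuous_mean (continuous_snd.comp f.continuous) continuous_vertical
          refine Continuous.prodMk (Continuous.smul ?_ h1) (Continuous.smul ?_ h2)
          · exact RCLike.continuous_ofReal.comp (by fun_prop)
          · exact RCLike.continuous_ofReal.comp (by fun_prop)⟩
      map_add' := by
        intro f g
        have i1 : ∀ (h : C(unitInterval × unitInterval, E₁ × E₂)) (p), IntervalIntegrable
            (fun r => (h (horizontal p r)).1) MeasureTheory.volume 0 1 := fun h p =>
          Continuous.intervalIntegrable ((continuous_fst.comp h.continuous).comp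
            (continuous_horizontal.comp (by fun_prop : Continuous fun r : ℝ => (p, r)))) 0 1
        have i2 : ∀ (h : C(unitInterval × unitInterval, E₁ × E₂)) (p), IntervalIntegrable
            (fun r => (h (vertical p r)).2) MeasureTheory.volume 0 1 := fun h p =>
          Continuous.intervalIntegrable ((continuous_snd.comp h.continuous).comp
            (continuous_vertical.comp (by fun_prop : Continuous fun r : ℝ => (p, r)))) 0 1
        ext p
        · simp [intervalIntegral.integral_add (i1 f p) (i1 g p)]
        · simp [intervalIntegral.integral_add (i2 f p) (i2 g p)]
      map_smul' := by
        intro c f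
        ext p
        · simp [intervalIntegral.integral_smul, smul_comm c]
        · simp [intervalIntegral.integral_smul, smul_comm c] }
    1 (by
      intro f
      rw [one_mul]
      refine (ContinuousMap.norm_le _ (norm_nonneg _)).2 fun p => ?_
      have hp : ∀ a b : unitInterval, ‖(((a : ℝ) - (b : ℝ) : ℝ) : 𝕜)‖ ≤ 1 := fun a b => by
        rw [RCLike.norm_ofReal, abs_le]
        constructor <;> linarith [a.2.1, a.2.2, b.2.1, b.2.2]
      have h1 : ‖∫ r in (0 : ℝ)..1, (f (horizontal p r)).1‖ ≤ ‖f‖ := by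
        simpa using intervalIntegral.norm_integral_le_of_norm_le_const (a := (0 : ℝ)) (b := 1)
          (f := fun r => (f (horizontal p r)).1) (C := ‖f‖)
          (fun r _ => (norm_fst_le _).trans (f.norm_coe_le_norm _))
      have h2 : ‖∫ r in (0 : ℝ)..1, (f (vertical p r)).2‖ ≤ ‖f‖ := by
        simpa using intervalIntegral.norm_integral_le_of_norm_le_const (a := (0 : ℝ)) (b := 1)
          (f := fun r => (f (vertical p r)).2) (C := ‖f‖)
          (fun r _ => (norm_snd_le _).trans (f.norm_coe_le_norm _))
      refine max_le ?_ ?_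
      · refine (norm_smul_le _ _).trans ?_
        simpa using mul_le_mul (hp p.1 p.2) h1 (norm_nonneg _) zero_le_one
      · refine (norm_smul_le _ _).trans ?_
        simpa using mul_le_mul (hp p.2 p.1) h2 (norm_nonneg _) zero_le_one)

theorem diagonalPrimitive_apply [IsScalarTower ℝ 𝕜 E₁] [IsScalarTower ℝ 𝕜 E₂]
    (f : C(unitInterval × unitInterval, E₁ × E₂))
    (p : unitInterval × unitInterval) : diagonalPrimitive 𝕜 E₁ E₂ f p =
      ((((p.1 : ℝ) - (p.2 : ℝ) : ℝ) : 𝕜) • ∫ r in (0 : ℝ)..1, (f (horizontal p r)).1,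
        (((p.2 : ℝ) - (p.1 : ℝ) : ℝ) : 𝕜) • ∫ r in (0 : ℝ)..1, (f (vertical p r)).2) := rfl

/-- `φ` solves, on the square with diagonal corners `(R₁, R₁)`, `(R₂, R₂)` rescaled to the unit
square, the integrated form of the system `∂₀X = F(X, Y)`, `∂₁Y = G(X, Y)` with the values
`X₀`, `Y₀` on the diagonal. -/
def IsSquareSolution (F : E₁ × E₂ → E₁) (G : E₁ × E₂ → E₂) (X₀ : 𝕜 → E₁) (Y₀ : 𝕜 → E₂)
    (R : Fin 2 → 𝕜) (φ : C(unitInterval × unitInterval, E₁ × E₂)) : Prop :=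
  ∀ p, (φ p).1 = X₀ (squarePoint R p 1) + (squarePoint R p 0 - squarePoint R p 1) •
      ∫ r in (0 : ℝ)..1, F (φ (horizontal p r)) ∧
    (φ p).2 = Y₀ (squarePoint R p 0) + (squarePoint R p 1 - squarePoint R p 0) •
      ∫ r in (0 : ℝ)..1, G (φ (vertical p r))

/-- The affine self-map of the unit square that takes the diagonal to the diagonal and the corner
`(0, 1)` to the point `p`. -/
def subsquare (p : unitInterval × unitInterval) :
    C(unitInterval × unitInterval, unitInterval × unitInterval) :=
  ⟨fun q => (lerp p.1 p.2 q.1, lerp p.1 p.2 q.2),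
    (continuous_lerp (by fun_prop) (by fun_prop) (by fun_prop)).prodMk
      (continuous_lerp (by fun_prop) (by fun_prop) (by fun_prop))⟩

theorem subsquare_apply (p q : unitInterval × unitInterval) :
    subsquare p q = (lerp p.1 p.2 q.1, lerp p.1 p.2 q.2) := rfl

theorem subsquare_corner (p : unitInterval × unitInterval) : subsquare p (0, 1) = p := by
  ext <;> simp [subsquare_apply, coe_lerp]

theorem squarePoint_squarePoint (R : Fin 2 → 𝕜) (p q : unitInterval × unitInterval) :
    squarePoint (squarePoint R p) q = squarePoint R (subsquare p q) := by
  ext i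
  fin_cases i <;> simp [squarePoint, subsquare_apply, coe_lerp] <;> ring

theorem IsSquareSolution.comp_subsquare {F : E₁ × E₂ → E₁} {G : E₁ × E₂ → E₂} {X₀ : 𝕜 → E₁}
    {Y₀ : 𝕜 → E₂} {R : Fin 2 → 𝕜} {φ : C(unitInterval × unitInterval, E₁ × E₂)}
    (h : IsSquareSolution F G X₀ Y₀ R φ) (p : unitInterval × unitInterval) :
    IsSquareSolution F G X₀ Y₀ (squarePoint R p) (φ.comp (subsquare p)) := by
  intro q
  have h1 : ∀ r, subsquare p (horizontal q r) = horizontal (subsquare p q) r := fun r => by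
    simp [horizontal, subsquare_apply, lerp_lerp]
  have h2 : ∀ r, subsquare p (vertical q r) = vertical (subsquare p q) r := fun r => by
    simp [vertical, subsquare_apply, lerp_lerp]
  simpa only [squarePoint_squarePoint, ContinuousMap.comp_apply, h1, h2] using h (subsquare p q)

variable [IsScalarTower ℝ 𝕜 E₁] [CompleteSpace E₁] [IsScalarTower ℝ 𝕜 E₂] [CompleteSpace E₂]

/-- A solution of the differential system solves the integrated system on squares. -/
theorem isSquareSolution_of_pd {F : E₁ × E₂ → E₁} {G : E₁ × E₂ → E₂}
    {Z : (Fin 2 → 𝕜) → E₁ × E₂} {X₀ : 𝕜 → E₁} {Y₀ : 𝕜 → E₂} {ε : ℝ}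
    (hZ : ∀ R : Fin 2 → 𝕜, ‖R‖ < ε → DifferentiableAt 𝕜 Z R)
    (hF : ∀ R : Fin 2 → 𝕜, ‖R‖ < ε → ContinuousAt F (Z R))
    (hG : ∀ R : Fin 2 → 𝕜, ‖R‖ < ε → ContinuousAt G (Z R))
    (h1 : ∀ R : Fin 2 → 𝕜, ‖R‖ < ε → pd 0 (fun R => (Z R).1) R = F (Z R))
    (h2 : ∀ R : Fin 2 → 𝕜, ‖R‖ < ε → pd 1 (fun R => (Z R).2) R = G (Z R))
    (h0 : ∀ s : 𝕜, ‖s‖ < ε → Z (fun _ => s) = (X₀ s, Y₀ s)) {R : Fin 2 → 𝕜} (hR : ‖R‖ < ε)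
    (φ : C(unitInterval × unitInterval, E₁ × E₂)) (hφ : ∀ p, φ p = Z (squarePoint R p)) :
    IsSquareSolution F G X₀ Y₀ R φ := by
  intro p
  set Q := squarePoint R p with hQ
  have hQn : ‖Q‖ < ε := (norm_squarePoint_le R p).trans_lt hR
  have hmem : ∀ q, ‖squarePoint R q‖ < ε := fun q => (norm_squarePoint_le R q).trans_lt hR
  have hq0 := (norm_le_pi_norm Q 0).trans_lt hQn
  have hq1 := (norm_le_pi_norm Q 1).trans_lt hQn
  have hdiag : ∀ c : 𝕜, ∀ i, Function.update Q i c = fun j => if j = i then c else Q j := fun c i => by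
    ext j; simp [Function.update_apply]
  constructor
  · have hpt : ∀ r ∈ Set.Icc (0 : ℝ) 1, Function.update Q 0 (Q 1 + (r : 𝕜) * (Q 0 - Q 1))
        = squarePoint R (horizontal p r) := by
      intro r hr
      ext i
      fin_cases i
      · simp [hQ, squarePoint, horizontal, coe_lerp, coe_clamp hr]; ring
      · simp [hQ, squarePoint, horizontal]
    have := sub_eq_smul_integral_segment (f := fun c => (Z (Function.update Q 0 c)).1)
      (g := fun c => F (Z (Function.update Q 0 c))) (a := Q 0) (b := Q 1) ?_ ?_
    · have e0 : Function.update Q 0 (Q 1) = fun _ => Q 1 := by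
        ext i; fin_cases i <;> simp
      simp only [Function.update_eq_self, e0, h0 _ hq1] at this
      rw [hφ, ← hQ, ← sub_eq_iff_eq_add', this]
      congr 1
      refine intervalIntegral.integral_congr fun r hr => ?_
      rw [Set.uIcc_of_le zero_le_one] at hr
      simp only [hpt r hr, hφ]
    · intro r hr
      have hd := (hZ _ (hmem (horizontal p r)))
      rw [← h1 _ (by rw [hpt r hr]; exact hmem _), pd]
      rw [← hpt r hr] at hd
      exact hd.fst.hasFDerivAt.comp_hasDerivAt (f := Function.update Q 0) _
        (hasDerivAt_update Q 0 _)
    · intro r hr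
      have hd := (hZ _ (hmem (horizontal p r))).continuousAt
      have hf := hF _ (hmem (horizontal p r))
      rw [← hpt r hr] at hd hf
      refine ContinuousAt.continuousWithinAt ?_
      refine ContinuousAt.comp (f := fun r : ℝ => Z (Function.update Q 0 (Q 1 + (r : 𝕜) * (Q 0 - Q 1))))
        hf (ContinuousAt.comp (f := fun r : ℝ => Function.update Q 0 (Q 1 + (r : 𝕜) * (Q 0 - Q 1))) hd ?_)
      exact (continuous_const.update 0 (continuous_const.add
        (RCLike.continuous_ofReal.mul continuous_const))).continuousAt
  · have hpt : ∀ r ∈ Set.Icc (0 : ℝ) 1, Function.update Q 1 (Q 0 + (r : 𝕜) * (Q 1 - Q 0))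
        = squarePoint R (vertical p r) := by
      intro r hr
      ext i
      fin_cases i
      · simp [hQ, squarePoint, vertical]
      · simp [hQ, squarePoint, vertical, coe_lerp, coe_clamp hr]; ring
    have := sub_eq_smul_integral_segment (f := fun c => (Z (Function.update Q 1 c)).2)
      (g := fun c => G (Z (Function.update Q 1 c))) (a := Q 1) (b := Q 0) ?_ ?_
    · have e0 : Function.update Q 1 (Q 0) = fun _ => Q 0 := by
        ext i; fin_cases i <;> simp
      simp only [Function.update_eq_self, e0, h0 _ hq0] at this
      rw [hφ, ← hQ, ← sub_eq_iff_eq_add', this]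
      congr 1
      refine intervalIntegral.integral_congr fun r hr => ?_
      rw [Set.uIcc_of_le zero_le_one] at hr
      simp only [hpt r hr, hφ]
    · intro r hr
      have hd := (hZ _ (hmem (vertical p r)))
      rw [← h2 _ (by rw [hpt r hr]; exact hmem _), pd]
      rw [← hpt r hr] at hd
      exact hd.snd.hasFDerivAt.comp_hasDerivAt (f := Function.update Q 1) _
        (hasDerivAt_update Q 1 _)
    · intro r hr
      have hd := (hZ _ (hmem (vertical p r))).continuousAt
      have hf := hG _ (hmem (vertical p r))
      rw [← hpt r hr] at hd hf
      refine ContinuousAt.continuousWithinAt ?_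
      refine ContinuousAt.comp (f := fun r : ℝ => Z (Function.update Q 1 (Q 0 + (r : 𝕜) * (Q 1 - Q 0))))
        hf (ContinuousAt.comp (f := fun r : ℝ => Function.update Q 1 (Q 0 + (r : 𝕜) * (Q 1 - Q 0))) hd ?_)
      exact (continuous_const.update 1 (continuous_const.add
        (RCLike.continuous_ofReal.mul continuous_const))).continuousAt

end Operator
end HydrodynamicType

namespace HydrodynamicType
open Filter

/-! ### Semilinear systems in characteristic coordinates -/

section CharacteristicSystem

universe v
variable {𝕜 : Type v} [RCLike 𝕜] {E₁ E₂ : Type v} [NormedAddCommGroup E₁] [NormedSpace 𝕜 E₁]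
  [NormedSpace ℝ E₁] [NormedAddCommGroup E₂] [NormedSpace 𝕜 E₂] [NormedSpace ℝ E₂]

/-- The function of `R` obtained from the solutions on squares, by taking the value at the
corner `R`, has all these solutions as its restrictions. -/
theorem eventually_squareSolution_eq {F : E₁ × E₂ → E₁} {G : E₁ × E₂ → E₂} {X₀ : 𝕜 → E₁}
    {Y₀ : 𝕜 → E₂} {z : E₁ × E₂}
    {ψ : (Fin 2 → 𝕜) → C(unitInterval × unitInterval, E₁ × E₂)} (hψ : ContinuousAt ψ 0)
    (hψ0 : ψ 0 = ContinuousMap.const _ z)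
    (h1 : ∀ᶠ R in 𝓝 0, IsSquareSolution F G X₀ Y₀ R (ψ R))
    (h2 : ∀ᶠ q in 𝓝 ((0 : Fin 2 → 𝕜), ContinuousMap.const (unitInterval × unitInterval) z),
      IsSquareSolution F G X₀ Y₀ q.1 q.2 → q.2 = ψ q.1) :
    ∀ᶠ R in 𝓝 0, ∀ p, ψ R p = ψ (squarePoint R p) (0, 1) := by
  rw [nhds_prod_eq, eventually_prod_iff] at h2
  obtain ⟨P, hP, Q, hQ, hPQ⟩ := h2
  obtain ⟨ε, hε, hPε⟩ := Metric.eventually_nhds_iff.1 hP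
  obtain ⟨δ, hδ, hQδ⟩ := Metric.eventually_nhds_iff.1 hQ
  have h3 : ∀ᶠ R in 𝓝 (0 : Fin 2 → 𝕜), dist (ψ R) (ContinuousMap.const _ z) < δ := by
    rw [ContinuousAt, hψ0] at hψ
    exact hψ.eventually (Metric.ball_mem_nhds _ hδ)
  filter_upwards [h1, h3, Metric.ball_mem_nhds (0 : Fin 2 → 𝕜) hε] with R hR1 hR2 hR3 p
  have hP' : P (squarePoint R p) := hPε (by
    rw [dist_zero_right]
    exact (norm_squarePoint_le R p).trans_lt (by simpa using hR3))
  have hQ' : Q ((ψ R).comp (subsquare p)) := hQδ (by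
    refine lt_of_le_of_lt ?_ hR2
    refine (ContinuousMap.dist_le dist_nonneg).2 fun q => ?_
    exact ContinuousMap.dist_apply_le_dist (f := ψ R) (g := ContinuousMap.const _ z)
      (subsquare p q))
  have := hPQ hP' hQ' (hR1.comp_subsquare p)
  simp only at this
  rw [← this, ContinuousMap.comp_apply, subsquare_corner]

variable [IsScalarTower ℝ 𝕜 E₁] [CompleteSpace E₁] [IsScalarTower ℝ 𝕜 E₂] [CompleteSpace E₂]

/-- The integrated system on squares, as an equation in the Banach space of continuous functions,
depends smoothly on the square, and is trivial for the degenerate square; the implicit function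
theorem therefore gives a unique small solution on every small square, depending smoothly on it. -/
theorem exists_squareSolution {F : E₁ × E₂ → E₁} {G : E₁ × E₂ → E₂} {X₀ : 𝕜 → E₁} {Y₀ : 𝕜 → E₂}
    (hF : SmoothNear 𝕜 F (X₀ 0, Y₀ 0)) (hG : SmoothNear 𝕜 G (X₀ 0, Y₀ 0))
    (hX : SmoothNear 𝕜 X₀ 0) (hY : SmoothNear 𝕜 Y₀ 0) :
    ∃ ψ : (Fin 2 → 𝕜) → C(unitInterval × unitInterval, E₁ × E₂), SmoothNear 𝕜 ψ 0 ∧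
      ψ 0 = ContinuousMap.const _ (X₀ 0, Y₀ 0) ∧
      (∀ᶠ R in 𝓝 0, IsSquareSolution F G X₀ Y₀ R (ψ R)) ∧
      ∀ᶠ q in 𝓝 ((0 : Fin 2 → 𝕜),
          ContinuousMap.const (unitInterval × unitInterval) (X₀ 0, Y₀ 0)),
        IsSquareSolution F G X₀ Y₀ q.1 q.2 → q.2 = ψ q.1 := by
  set z : E₁ × E₂ := (X₀ 0, Y₀ 0) with hz
  set D : (Fin 2 → 𝕜) → E₁ × E₂ := fun a => (X₀ (a 1), Y₀ (a 0)) with hD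
  set H : E₁ × E₂ → E₁ × E₂ := fun y => (F y, G y) with hH
  have hDs : SmoothNear 𝕜 D 0 :=
    (SmoothNear.comp (g := X₀) (f := fun a : Fin 2 → 𝕜 => a 1) hX (smoothNear_id.apply 1)).prodMk
      (SmoothNear.comp (g := Y₀) (f := fun a : Fin 2 → 𝕜 => a 0) hY (smoothNear_id.apply 0))
  have hHs : SmoothNear 𝕜 H z := hF.prodMk hG
  have hL0 : squarePointL 𝕜 0 = ContinuousMap.const _ 0 := by
    rw [map_zero]; rfl
  set Φ : (Fin 2 → 𝕜) × C(unitInterval × unitInterval, E₁ × E₂) →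
      C(unitInterval × unitInterval, E₁ × E₂) := fun q =>
    q.2 - superposition _ D (squarePointL 𝕜 q.1)
      - (q.1 1 - q.1 0) • diagonalPrimitive 𝕜 E₁ E₂ (superposition _ H q.2) with hΦ
  have hΦs : SmoothNear 𝕜 Φ (0, ContinuousMap.const _ z) := by
    have s1 : SmoothNear 𝕜 (fun q : (Fin 2 → 𝕜) × C(unitInterval × unitInterval, E₁ × E₂) => q.1)
      (0, ContinuousMap.const _ z) := smoothNear_id.fst
    have s2 : SmoothNear 𝕜 (fun q : (Fin 2 → 𝕜) × C(unitInterval × unitInterval, E₁ × E₂) => q.2)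
      (0, ContinuousMap.const _ z) := smoothNear_id.snd
    have s3 := (SmoothNear.superposition (K := unitInterval × unitInterval) hDs).comp_of_eq
      ((squarePointL 𝕜).contDiff.smoothNear.comp s1) hL0
    have s4 := (SmoothNear.superposition (K := unitInterval × unitInterval) hHs).comp_of_eq s2 rfl
    exact (s2.sub s3).sub (((s1.apply 1).sub (s1.apply 0)).smul
      ((diagonalPrimitive 𝕜 E₁ E₂).contDiff.smoothNear.comp s4))
  have hD0 : superposition _ D (squarePointL 𝕜 0) =
      (ContinuousMap.const (unitInterval × unitInterval) z) := by
    ext p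
    all_goals
      rw [hL0, superposition_apply (fun _ => hDs.continuousAt)]
      rfl
  have hD0' : superposition _ D 0 = ContinuousMap.const (unitInterval × unitInterval) z := by
    rw [← map_zero (squarePointL 𝕜)]; exact hD0
  have hΦ0 : Φ (0, ContinuousMap.const _ z) = 0 := by
    simp [hΦ, hD0']
  have hder : fderiv 𝕜 Φ (0, ContinuousMap.const _ z) ∘L .inr 𝕜 _ _ =
      ContinuousLinearMap.id 𝕜 _ := by
    have c1 := hΦs.differentiableAt.hasFDerivAt.comp
      (ContinuousMap.const (unitInterval × unitInterval) z)
      (hasFDerivAt_prodMk_right (𝕜 := 𝕜) (0 : Fin 2 → 𝕜) (ContinuousMap.const _ z))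
    have c2 : HasFDerivAt (Φ ∘ fun φ => ((0 : Fin 2 → 𝕜), φ))
        (ContinuousLinearMap.id 𝕜 C(unitInterval × unitInterval, E₁ × E₂))
        (ContinuousMap.const _ z) := by
      have : (Φ ∘ fun φ => ((0 : Fin 2 → 𝕜), φ)) =
          fun φ => φ - ContinuousMap.const (unitInterval × unitInterval) z := by
        ext1 φ
        simp [hΦ, hD0']
      rw [this]
      exact (hasFDerivAt_id _).sub_const _
    exact c1.unique c2
  obtain ⟨ψ, h1, h2, h3, h4⟩ := hΦs.exists_implicitFunction hΦ0
    (by rw [hder]; exact ContinuousLinearMap.isInvertible_equiv (f := .refl 𝕜 _))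
  -- near the base point the abstract equation is the pointwise one
  have hiff : ∀ᶠ q in 𝓝 ((0 : Fin 2 → 𝕜), ContinuousMap.const (unitInterval × unitInterval) z),
      Φ q = 0 ↔ IsSquareSolution F G X₀ Y₀ q.1 q.2 := by
    obtain ⟨O, hO, hOo, hzO⟩ := eventually_nhds_iff.1 hHs
    obtain ⟨V, hV, hVo, h0V⟩ := eventually_nhds_iff.1 hDs
    have e1 := (continuousAt_snd (p := ((0 : Fin 2 → 𝕜),
      ContinuousMap.const (unitInterval × unitInterval) z))).eventually
      ((isOpen_forall_mem hOo).mem_nhds (fun _ => hzO))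
    have e2 := ((squarePointL 𝕜).continuous.continuousAt.comp (continuousAt_fst (p :=
      ((0 : Fin 2 → 𝕜), ContinuousMap.const (unitInterval × unitInterval) z)))).eventually
      ((isOpen_forall_mem hVo).mem_nhds (fun p => by
        change (squarePointL 𝕜 0) p ∈ V
        rw [hL0]; exact h0V))
    filter_upwards [e1, e2] with q hq1 hq2
    have hDq : ∀ p, superposition _ D (squarePointL 𝕜 q.1) p = D (squarePoint q.1 p) := fun p =>
      superposition_apply (fun p => (hV _ (hq2 p)).continuousAt) p
    have hHq : ∀ p, superposition _ H q.2 p = (F (q.2 p), G (q.2 p)) := fun p =>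
      superposition_apply (fun p => (hO _ (hq1 p)).continuousAt) p
    rw [ContinuousMap.ext_iff]
    refine forall_congr' fun p => ?_
    have c1 : squarePoint q.1 p 0 - squarePoint q.1 p 1
        = (q.1 1 - q.1 0) * (((p.1 : ℝ) - (p.2 : ℝ) : ℝ) : 𝕜) := by
      simp [squarePoint]; ring
    have c2 : squarePoint q.1 p 1 - squarePoint q.1 p 0
        = (q.1 1 - q.1 0) * (((p.2 : ℝ) - (p.1 : ℝ) : ℝ) : 𝕜) := by
      simp [squarePoint]; ring
    rw [c1, c2, mul_smul, mul_smul, hΦ]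
    simp only [ContinuousMap.sub_apply, ContinuousMap.smul_apply, diagonalPrimitive_apply, hDq, hHq,
      ContinuousMap.zero_apply]
    simp only [hD]
    rw [Prod.ext_iff]
    simp only [Prod.fst_sub, Prod.snd_sub, Prod.fst_add, Prod.snd_add, Prod.smul_fst,
      Prod.smul_snd, Prod.fst_zero, Prod.snd_zero, sub_eq_zero, sub_sub]
  have hc : Tendsto (fun R => (R, ψ R)) (𝓝 0) (𝓝 (0, ContinuousMap.const _ z)) := by
    have := (continuousAt_id (x := (0 : Fin 2 → 𝕜))).prodMk h1.continuousAt
    rw [ContinuousAt, h2] at this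
    exact this
  refine ⟨ψ, h1, h2, ?_, ?_⟩
  · filter_upwards [h3, hc.eventually hiff] with R hR1 hR2 using hR2.1 hR1
  · filter_upwards [h4, hiff] with q hq1 hq2 hq3 using hq1 (hq2.2 hq3)

/-- Existence for the semilinear system `∂₀X = F(X, Y)`, `∂₁Y = G(X, Y)` in characteristic
coordinates, with data on the diagonal. -/
theorem exists_characteristicSystem {F : E₁ × E₂ → E₁} {G : E₁ × E₂ → E₂} {X₀ : 𝕜 → E₁}
    {Y₀ : 𝕜 → E₂} (hF : SmoothNear 𝕜 F (X₀ 0, Y₀ 0)) (hG : SmoothNear 𝕜 G (X₀ 0, Y₀ 0))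
    (hX : SmoothNear 𝕜 X₀ 0) (hY : SmoothNear 𝕜 Y₀ 0) :
    ∃ Z : (Fin 2 → 𝕜) → E₁ × E₂, SmoothNear 𝕜 Z 0 ∧
      (∀ᶠ R in 𝓝 0, pd 0 (fun R => (Z R).1) R = F (Z R)) ∧
      (∀ᶠ R in 𝓝 0, pd 1 (fun R => (Z R).2) R = G (Z R)) ∧
      ∀ᶠ s : 𝕜 in 𝓝 0, Z (fun _ => s) = (X₀ s, Y₀ s) := by
  obtain ⟨ψ, h1, h2, h3, h4⟩ := exists_squareSolution hF hG hX hY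
  have h5 := eventually_squareSolution_eq h1.continuousAt h2 h3 h4
  set Z : (Fin 2 → 𝕜) → E₁ × E₂ := fun R => ψ R (0, 1) with hZ
  have hZs : SmoothNear 𝕜 Z 0 :=
    (ContinuousMap.evalCLM 𝕜 ((0, 1) : unitInterval × unitInterval)).contDiff.smoothNear.comp h1
  have hZ0 : Z 0 = (X₀ 0, Y₀ 0) := by simp [hZ, h2]
  have hF' : ∀ᶠ R in 𝓝 0, ContinuousAt F (Z R) := by
    refine hZs.continuousAt.eventually ?_
    rw [hZ0]; exact hF.mono fun _ h => h.continuousAt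
  have hG' : ∀ᶠ R in 𝓝 0, ContinuousAt G (Z R) := by
    refine hZs.continuousAt.eventually ?_
    rw [hZ0]; exact hG.mono fun _ h => h.continuousAt
  obtain ⟨ε, hε, hall⟩ := Metric.eventually_nhds_iff.1
    (((h3.and h5).and (hF'.and hG')).and hZs)
  have hball : ∀ R : Fin 2 → 𝕜, (∀ i, ‖R i‖ < ε) → (IsSquareSolution F G X₀ Y₀ R (ψ R) ∧
      ∀ p, ψ R p = Z (squarePoint R p)) ∧ (ContinuousAt F (Z R) ∧ ContinuousAt G (Z R)) ∧
      ContDiffAt 𝕜 ∞ Z R := by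
    intro R hR
    have : dist R 0 < ε := by
      rw [dist_zero_right]; exact (pi_norm_lt_iff hε).2 hR
    exact ⟨(hall this).1.1, (hall this).1.2, (hall this).2⟩
  have hdiag : ∀ s : 𝕜, ‖s‖ < ε → Z (fun _ => s) = (X₀ s, Y₀ s) := by
    intro s hs
    have := (hball (fun _ => s) (fun _ => hs)).1.1 (0, 1)
    rw [squarePoint_corner] at this
    ext1
    · simpa using this.1
    · simpa using this.2
  -- the points of the ball of radius `ε / 3` have segments to the diagonal inside that of radius `ε`
  have hx : ∀ R : Fin 2 → 𝕜, ‖R‖ < ε / 3 → R 0 ≠ R 1 →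
      pd 0 (fun R => (Z R).1) R = F (Z R) ∧ pd 1 (fun R => (Z R).2) R = G (Z R) := by
    intro R hR hne
    have hR0 := (norm_le_pi_norm R 0).trans_lt hR
    have hR1 := (norm_le_pi_norm R 1).trans_lt hR
    have hsmall : ∀ a b : 𝕜, ‖b‖ < ε / 3 → a ∈ Metric.ball b (2 * ε / 3) → ‖a‖ < ε := by
      intro a b hb ha
      rw [Metric.mem_ball, dist_eq_norm] at ha
      calc ‖a‖ = ‖(a - b) + b‖ := by rw [sub_add_cancel]
        _ ≤ ‖a - b‖ + ‖b‖ := norm_add_le _ _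
        _ < ε := by linarith
    have hdist : ∀ a b : 𝕜, ‖a‖ < ε / 3 → ‖b‖ < ε / 3 → a ∈ Metric.ball b (2 * ε / 3) := by
      intro a b ha hb
      rw [Metric.mem_ball, dist_eq_norm]
      have := norm_sub_le a b
      linarith
    have hRm : ContDiffAt 𝕜 ∞ Z R := (hball R fun i => by
      fin_cases i
      · exact hsmall _ _ hR1 (hdist _ _ hR0 hR1)
      · exact hsmall _ _ hR1 (hdist _ _ hR1 hR1)).2.2
    constructor
    · have hup : ∀ a ∈ Metric.ball (R 1) (2 * ε / 3), ∀ i, ‖Function.update R 0 a i‖ < ε := by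
        intro a ha i
        fin_cases i
        · simpa using hsmall a (R 1) hR1 ha
        · simpa using (hR1.trans (by linarith))
      have key := deriv_eq_of_segment (f := fun a => (Z (Function.update R 0 a)).1)
        (g := fun a => F (Z (Function.update R 0 a))) (b := R 1) (ε := 2 * ε / 3) ?_ ?_ ?_
        (hdist _ _ hR0 hR1) hne
      · have hd := (hRm.differentiableAt (by simp)).fst.hasFDerivAt
        rw [← Function.update_eq_self 0 R] at hd
        have := hd.comp_hasDerivAt (f := Function.update R 0) _ (hasDerivAt_update R 0 _)
        rw [Function.update_eq_self] at this
        have h6 := this.deriv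
        rw [pd, ← h6]
        simpa [Function.comp_def] using key
      · intro a ha
        have hd := ((hball _ (hup a ha)).2.2.differentiableAt (by simp)).fst
        exact hd.comp (f := Function.update R 0) a (hasDerivAt_update R 0 a).differentiableAt
      · intro a ha
        refine ContinuousAt.continuousWithinAt ?_
        have h7 := (hball _ (hup a ha)).2
        exact h7.1.1.comp (f := fun a => Z (Function.update R 0 a)) (h7.2.continuousAt.comp
          (f := Function.update R 0) (hasDerivAt_update R 0 a).continuousAt)
      · intro a ha
        have h8 := (hball _ (hup a ha)).1
        have h9 := (h8.1 (0, 1)).1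
        have hd : Function.update R 0 (R 1) = fun _ => R 1 := by
          ext i; fin_cases i <;> simp
        rw [squarePoint_corner] at h9
        simp only [hd, hdiag _ (hR1.trans (by linarith))]
        change (ψ _ (0, 1)).1 = _
        rw [h9]
        simp only [Function.update_self, ne_eq, one_ne_zero, not_false_eq_true,
          Function.update_of_ne]
        congr 2
        refine intervalIntegral.integral_congr fun r hr => ?_
        rw [Set.uIcc_of_le zero_le_one] at hr
        simp only [h8.2]
        congr 2
        ext i
        fin_cases i
        · simp [squarePoint, horizontal, coe_lerp, coe_clamp hr]; ring
        · simp [squarePoint, horizontal]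
    · have hup : ∀ a ∈ Metric.ball (R 0) (2 * ε / 3), ∀ i, ‖Function.update R 1 a i‖ < ε := by
        intro a ha i
        fin_cases i
        · simpa using (hR0.trans (by linarith))
        · simpa using hsmall a (R 0) hR0 ha
      have key := deriv_eq_of_segment (f := fun a => (Z (Function.update R 1 a)).2)
        (g := fun a => G (Z (Function.update R 1 a))) (b := R 0) (ε := 2 * ε / 3) ?_ ?_ ?_
        (hdist _ _ hR1 hR0) hne.symm
      · have hd := (hRm.differentiableAt (by simp)).snd.hasFDerivAt
        rw [← Function.update_eq_self 1 R] at hd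
        have := hd.comp_hasDerivAt (f := Function.update R 1) _ (hasDerivAt_update R 1 _)
        rw [Function.update_eq_self] at this
        have h6 := this.deriv
        rw [pd, ← h6]
        simpa [Function.comp_def] using key
      · intro a ha
        have hd := ((hball _ (hup a ha)).2.2.differentiableAt (by simp)).snd
        exact hd.comp (f := Function.update R 1) a (hasDerivAt_update R 1 a).differentiableAt
      · intro a ha
        refine ContinuousAt.continuousWithinAt ?_
        have h7 := (hball _ (hup a ha)).2
        exact h7.1.2.comp (f := fun a => Z (Function.update R 1 a)) (h7.2.continuousAt.comp
          (f := Function.update R 1) (hasDerivAt_update R 1 a).continuousAt)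
      · intro a ha
        have h8 := (hball _ (hup a ha)).1
        have h9 := (h8.1 (0, 1)).2
        have hd : Function.update R 1 (R 0) = fun _ => R 0 := by
          ext i; fin_cases i <;> simp
        rw [squarePoint_corner] at h9
        simp only [hd, hdiag _ (hR0.trans (by linarith))]
        change (ψ _ (0, 1)).2 = _
        rw [h9]
        simp only [Function.update_self, ne_eq, zero_ne_one, not_false_eq_true,
          Function.update_of_ne]
        congr 2
        refine intervalIntegral.integral_congr fun r hr => ?_
        rw [Set.uIcc_of_le zero_le_one] at hr
        simp only [h8.2]
        congr 2
        ext i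
        fin_cases i
        · simp [squarePoint, vertical]
        · simp [squarePoint, vertical, coe_lerp, coe_clamp hr]
  -- the diagonal is nowhere dense
  have hext : ∀ᶠ R : Fin 2 → 𝕜 in 𝓝 0,
      pd 0 (fun R => (Z R).1) R = F (Z R) ∧ pd 1 (fun R => (Z R).2) R = G (Z R) := by
    filter_upwards [Metric.ball_mem_nhds (0 : Fin 2 → 𝕜) (by positivity : 0 < ε / 3),
      hZs.eventually, hF', hG'] with R hR hZR hFR hGR
    rw [mem_ball_zero_iff] at hR
    by_cases hne : R 0 = R 1
    swap
    · exact hx R hR hne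
    have hcurve : Continuous fun c : 𝕜 => Function.update R 0 (R 0 + c) := by fun_prop
    have hlim : Tendsto (fun c : 𝕜 => Function.update R 0 (R 0 + c)) (𝓝[≠] 0) (𝓝 R) := by
      have := hcurve.tendsto 0
      simp only [add_zero, Function.update_eq_self] at this
      exact this.mono_left nhdsWithin_le_nhds
    have hev : ∀ᶠ c : 𝕜 in 𝓝[≠] 0, pd 0 (fun R => (Z R).1) (Function.update R 0 (R 0 + c))
          = F (Z (Function.update R 0 (R 0 + c))) ∧
        pd 1 (fun R => (Z R).2) (Function.update R 0 (R 0 + c))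
          = G (Z (Function.update R 0 (R 0 + c))) := by
      have : ∀ᶠ S in 𝓝 R, ‖S‖ < ε / 3 := continuous_norm.continuousAt.eventually (gt_mem_nhds hR)
      filter_upwards [hlim.eventually this, self_mem_nhdsWithin] with c hc hc0
      refine hx _ hc ?_
      simp only [Function.update_self, ne_eq, one_ne_zero, not_false_eq_true,
        Function.update_of_ne, hne]
      simpa using hc0
    have hp0 : ContinuousAt (pd 0 (fun R => (Z R).1)) R :=
      (hZR.fst.fderiv_apply (smoothNear_const (Pi.single 0 1))).continuousAt
    have hp1 : ContinuousAt (pd 1 (fun R => (Z R).2)) R :=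
      (hZR.snd.fderiv_apply (smoothNear_const (Pi.single 1 1))).continuousAt
    have hFc : ContinuousAt (fun R => F (Z R)) R := hFR.comp (f := Z) hZR.continuousAt
    have hGc : ContinuousAt (fun R => G (Z R)) R := hGR.comp (f := Z) hZR.continuousAt
    exact ⟨tendsto_nhds_unique_of_eventuallyEq (hp0.tendsto.comp hlim) (hFc.tendsto.comp hlim)
        (hev.mono fun c hc => hc.1),
      tendsto_nhds_unique_of_eventuallyEq (hp1.tendsto.comp hlim) (hGc.tendsto.comp hlim)
        (hev.mono fun c hc => hc.2)⟩
  refine ⟨Z, hZs, hext.mono fun _ h => h.1, hext.mono fun _ h => h.2, ?_⟩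
  filter_upwards [Metric.ball_mem_nhds (0 : 𝕜) hε] with s hs
  exact hdiag s (by simpa using hs)

/-- Uniqueness for the semilinear system `∂₀X = F(X, Y)`, `∂₁Y = G(X, Y)` in characteristic
coordinates, with data on the diagonal. -/
theorem eventuallyEq_of_characteristicSystem {F : E₁ × E₂ → E₁} {G : E₁ × E₂ → E₂}
    {Z Z' : (Fin 2 → 𝕜) → E₁ × E₂} (hF : SmoothNear 𝕜 F (Z 0)) (hG : SmoothNear 𝕜 G (Z 0))
    (hZ : SmoothNear 𝕜 Z 0) (hZ' : SmoothNear 𝕜 Z' 0)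
    (h1 : ∀ᶠ R in 𝓝 0, pd 0 (fun R => (Z R).1) R = F (Z R))
    (h2 : ∀ᶠ R in 𝓝 0, pd 1 (fun R => (Z R).2) R = G (Z R))
    (h1' : ∀ᶠ R in 𝓝 0, pd 0 (fun R => (Z' R).1) R = F (Z' R))
    (h2' : ∀ᶠ R in 𝓝 0, pd 1 (fun R => (Z' R).2) R = G (Z' R))
    (h0 : ∀ᶠ s : 𝕜 in 𝓝 0, Z (fun _ => s) = Z' (fun _ => s)) : Z =ᶠ[𝓝 0] Z' := by
  set X₀ : 𝕜 → E₁ := fun s => (Z (fun _ => s)).1 with hX₀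
  set Y₀ : 𝕜 → E₂ := fun s => (Z (fun _ => s)).2 with hY₀
  have hc : SmoothNear 𝕜 (fun s : 𝕜 => (fun _ => s : Fin 2 → 𝕜)) 0 :=
    SmoothNear.pi fun _ => smoothNear_id
  have hZc : SmoothNear 𝕜 (fun s : 𝕜 => Z (fun _ => s)) 0 := SmoothNear.comp hZ hc
  obtain ⟨ψ, i1, i2, i3, i4⟩ := exists_squareSolution (X₀ := X₀) (Y₀ := Y₀) hF hG hZc.fst hZc.snd
  have i5 := eventually_squareSolution_eq i1.continuousAt i2 i3 i4
  have key : ∀ Z₁ : (Fin 2 → 𝕜) → E₁ × E₂, SmoothNear 𝕜 Z₁ 0 →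
      (∀ᶠ R in 𝓝 0, pd 0 (fun R => (Z₁ R).1) R = F (Z₁ R)) →
      (∀ᶠ R in 𝓝 0, pd 1 (fun R => (Z₁ R).2) R = G (Z₁ R)) →
      (∀ᶠ s : 𝕜 in 𝓝 0, Z₁ (fun _ => s) = (X₀ s, Y₀ s)) → ∀ᶠ R in 𝓝 0, Z₁ R = ψ R (0, 1) := by
    intro Z₁ k1 k2 k3 k4
    have hz : Z₁ 0 = Z 0 := k4.self_of_nhds
    have kF : ∀ᶠ R in 𝓝 0, ContinuousAt F (Z₁ R) := by
      refine k1.continuousAt.eventually ?_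
      rw [hz]; exact hF.mono fun _ h => h.continuousAt
    have kG : ∀ᶠ R in 𝓝 0, ContinuousAt G (Z₁ R) := by
      refine k1.continuousAt.eventually ?_
      rw [hz]; exact hG.mono fun _ h => h.continuousAt
    rw [nhds_prod_eq, eventually_prod_iff] at i4
    obtain ⟨P, hP, Q, hQ, hPQ⟩ := i4
    obtain ⟨δ, hδ, hQδ⟩ := Metric.eventually_nhds_iff.1 hQ
    have k5 : ∀ᶠ R in 𝓝 0, dist (Z₁ R) (Z 0) < δ / 2 := by
      have := k1.continuousAt.eventually (Metric.ball_mem_nhds _ (half_pos hδ))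
      rwa [hz] at this
    obtain ⟨ε₁, hε₁, hall⟩ := Metric.eventually_nhds_iff.1
      (((k1.and k2).and (k3.and kF)).and (kG.and k5))
    obtain ⟨ε₂, hε₂, hdiag⟩ := Metric.eventually_nhds_iff.1 k4
    have hε : 0 < min ε₁ ε₂ := lt_min hε₁ hε₂
    have hall' : ∀ R : Fin 2 → 𝕜, ‖R‖ < min ε₁ ε₂ → _ := fun R hR =>
      hall (y := R) (by rw [dist_zero_right]; exact hR.trans_le (min_le_left _ _))
    filter_upwards [Metric.ball_mem_nhds (0 : Fin 2 → 𝕜) hε, hP] with R hR hPR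
    rw [mem_ball_zero_iff] at hR
    have hmem := fun p => hall' _ ((norm_squarePoint_le R p).trans_lt hR)
    let φ : C(unitInterval × unitInterval, E₁ × E₂) := ⟨fun p => Z₁ (squarePoint R p),
      continuous_iff_continuousAt.2 fun p => ((hmem p).1.1.1.continuousAt).comp
        (continuous_squarePoint R).continuousAt⟩
    have hφ : ∀ p, φ p = Z₁ (squarePoint R p) := fun p => rfl
    have hsol : IsSquareSolution F G X₀ Y₀ R φ := isSquareSolution_of_pd
      (fun S hS => (hall' S hS).1.1.1.differentiableAt (by simp)) (fun S hS => (hall' S hS).1.2.2)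
      (fun S hS => (hall' S hS).2.1) (fun S hS => (hall' S hS).1.1.2)
      (fun S hS => (hall' S hS).1.2.1)
      (fun s hs => hdiag (by rw [dist_zero_right]; exact hs.trans_le (min_le_right _ _))) hR φ hφ
    have hQφ : Q φ := hQδ (lt_of_le_of_lt ((ContinuousMap.dist_le (half_pos hδ).le).2
      fun p => (hmem p).2.2.le) (half_lt_self hδ))
    have := hPQ hPR hQφ hsol
    simp only at this
    rw [← this, hφ, squarePoint_corner]
  filter_upwards [key Z hZ h1 h2 (Eventually.of_forall fun s => rfl),
    key Z' hZ' h1' h2' (h0.mono fun s hs => hs.symm)] with R a b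
  rw [a, b]

end CharacteristicSystem
end HydrodynamicType

namespace HydrodynamicType
open Filter

/-! ### Partial derivatives -/

section PartialDerivatives

variable {𝕜 : Type*} [RCLike 𝕜] {n : ℕ} {F G : Type*} [NormedAddCommGroup F] [NormedSpace 𝕜 F]
  [NormedAddCommGroup G] [NormedSpace 𝕜 G] {x : Fin n → 𝕜} {i j : Fin n}

theorem SmoothNear.pd {f : (Fin n → 𝕜) → F} (h : SmoothNear 𝕜 f x) (i : Fin n) :
    SmoothNear 𝕜 (pd i f) x :=
  h.fderiv_apply (smoothNear_const _)

theorem pd_comp {g : F → G} {f : (Fin n → 𝕜) → F} (hg : DifferentiableAt 𝕜 g (f x))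
    (hf : DifferentiableAt 𝕜 f x) :
    pd i (fun y => g (f y)) x = fderiv 𝕜 g (f x) (pd i f x) := by
  rw [pd, pd, fderiv_fun_comp x hg hf]; rfl

theorem pd_prodMk {g : (Fin n → 𝕜) → G} {f : (Fin n → 𝕜) → F} (hf : DifferentiableAt 𝕜 f x)
    (hg : DifferentiableAt 𝕜 g x) :
    pd i (fun y => (f y, g y)) x = (pd i f x, pd i g x) := by
  rw [pd, hf.fderiv_prodMk hg]; rfl

theorem pd_fst {f : (Fin n → 𝕜) → F × G} (hf : DifferentiableAt 𝕜 f x) :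
    pd i (fun y => (f y).1) x = (pd i f x).1 := by
  rw [pd, pd, fderiv.fst hf]; rfl

theorem pd_snd {f : (Fin n → 𝕜) → F × G} (hf : DifferentiableAt 𝕜 f x) :
    pd i (fun y => (f y).2) x = (pd i f x).2 := by
  rw [pd, pd, fderiv.snd hf]; rfl

theorem pd_apply {ι : Type*} [Fintype ι] {f : (Fin n → 𝕜) → ι → F} (hf : DifferentiableAt 𝕜 f x)
    (a : ι) : pd i (fun y => f y a) x = pd i f x a := by
  rw [pd, pd, fderiv_apply hf]
  rfl

theorem pd_add {f g : (Fin n → 𝕜) → F} (hf : DifferentiableAt 𝕜 f x)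
    (hg : DifferentiableAt 𝕜 g x) : pd i (fun y => f y + g y) x = pd i f x + pd i g x := by
  rw [pd, fderiv_fun_add hf hg]; rfl

theorem pd_sub {f g : (Fin n → 𝕜) → F} (hf : DifferentiableAt 𝕜 f x)
    (hg : DifferentiableAt 𝕜 g x) : pd i (fun y => f y - g y) x = pd i f x - pd i g x := by
  rw [pd, fderiv_fun_sub hf hg]; rfl

theorem pd_smul {a : (Fin n → 𝕜) → 𝕜} {f : (Fin n → 𝕜) → F} (ha : DifferentiableAt 𝕜 a x)
    (hf : DifferentiableAt 𝕜 f x) :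
    pd i (fun y => a y • f y) x = a x • pd i f x + pd i a x • f x := by
  rw [pd, fderiv_fun_smul ha hf]; rfl

theorem pd_mul {a b : (Fin n → 𝕜) → 𝕜} (ha : DifferentiableAt 𝕜 a x)
    (hb : DifferentiableAt 𝕜 b x) :
    pd i (fun y => a y * b y) x = a x * pd i b x + pd i a x * b x := pd_smul ha hb

theorem pd_congr {f g : (Fin n → 𝕜) → F} (h : f =ᶠ[𝓝 x] g) : pd i f x = pd i g x := by
  rw [pd, pd, h.fderiv_eq]

theorem pd_comm {f : (Fin n → 𝕜) → F} (hf : SmoothNear 𝕜 f x) :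
    pd i (pd j f) x = pd j (pd i f) x := by
  have hs : IsSymmSndFDerivAt 𝕜 f x := hf.contDiffAt.isSymmSndFDerivAt (n := ∞)
    (by rw [minSmoothness_of_isRCLikeNormedField]; exact WithTop.coe_le_coe.2 le_top)
  have key : ∀ k l : Fin n, pd k (pd l f) x
      = fderiv 𝕜 (fderiv 𝕜 f) x (Pi.single k 1) (Pi.single l 1) := by
    intro k l
    have e : pd l f = fun y => fderiv 𝕜 f y (Pi.single l 1) := rfl
    rw [e, pd, fderiv_clm_apply hf.fderiv.differentiableAt (differentiableAt_const _)]
    simp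
  rw [key, key, hs]

end PartialDerivatives

/-! ### The system governing two-component reductions -/

section WaveSystem

universe v
variable {𝕜 : Type v} [RCLike 𝕜] {m : ℕ}

/-- The coefficients of the system governing a two-component reduction: `ξᵢ(u, sᵢ)` spans the
admissible directions of `∂ᵢu`, while `γᵢ` and `κᵢ` are the coefficients of the equations for the
parameters `sᵢ` of the characteristic speeds and for the lengths `pᵢ` of `∂ᵢu` relative to `ξᵢ`.
The field `compat` expresses that the mixed derivatives `∂₀∂₁u` and `∂₁∂₀u` agree. -/
structure WaveCoefficients (𝕜 : Type v) [RCLike 𝕜] (m : ℕ) (u₀ : Fin m → 𝕜) (s₀ : Fin 2 → 𝕜) where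
  ξ : Fin 2 → (Fin m → 𝕜) × 𝕜 → Fin m → 𝕜
  γ : Fin 2 → (Fin m → 𝕜) × (Fin 2 → 𝕜) → 𝕜
  κ : Fin 2 → (Fin m → 𝕜) × (Fin 2 → 𝕜) → 𝕜
  smooth_ξ : ∀ i, SmoothNear 𝕜 (ξ i) (u₀, s₀ i)
  smooth_γ : ∀ i, SmoothNear 𝕜 (γ i) (u₀, s₀)
  smooth_κ : ∀ i, SmoothNear 𝕜 (κ i) (u₀, s₀)
  compat : ∀ᶠ q in 𝓝 (u₀, s₀),
    κ 0 q • ξ 0 (q.1, q.2 0)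
        + fderiv 𝕜 (ξ 0) (q.1, q.2 0) (ξ 1 (q.1, q.2 1), γ 0 q * (q.2 1 - q.2 0)) =
      κ 1 q • ξ 1 (q.1, q.2 1)
        + fderiv 𝕜 (ξ 1) (q.1, q.2 1) (ξ 0 (q.1, q.2 0), γ 1 q * (q.2 0 - q.2 1))

/-- The functions `u`, `sᵢ`, `pᵢ`, `wᵢ` of the Riemann invariants solve, near the origin, the system
with the coefficients `c`. The functions `wᵢ` are those of the generalized hodograph method. -/
structure IsWaveSolution {u₀ : Fin m → 𝕜} {s₀ : Fin 2 → 𝕜} (c : WaveCoefficients 𝕜 m u₀ s₀)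
    (u : (Fin 2 → 𝕜) → Fin m → 𝕜) (s p w : Fin 2 → (Fin 2 → 𝕜) → 𝕜) : Prop where
  u_zero : u 0 = u₀
  s_zero : ∀ i, s i 0 = s₀ i
  smooth_u : SmoothNear 𝕜 u 0
  smooth_s : ∀ i, SmoothNear 𝕜 (s i) 0
  smooth_p : ∀ i, SmoothNear 𝕜 (p i) 0
  smooth_w : ∀ i, SmoothNear 𝕜 (w i) 0
  eq_u : ∀ᶠ R in 𝓝 0, ∀ i, pd i u R = p i R • c.ξ i (u R, s i R)
  eq_s : ∀ᶠ R in 𝓝 0, ∀ i j, i ≠ j →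
    pd j (s i) R = p j R * c.γ i (u R, fun k => s k R) * (s j R - s i R)
  eq_p : ∀ᶠ R in 𝓝 0, ∀ i j, i ≠ j →
    pd j (p i) R = p 0 R * p 1 R * c.κ i (u R, fun k => s k R)
  eq_w : ∀ᶠ R in 𝓝 0, ∀ i j, i ≠ j →
    pd j (w i) R = p j R * c.γ i (u R, fun k => s k R) * (w j R - w i R)

/-- The unknowns with a prescribed derivative along the first Riemann invariant, `(u, s₁, p₁, w₁)`,
followed by those with a prescribed derivative along the second one, `(s₀, p₀, w₀)`. -/
abbrev WaveState (𝕜 : Type v) (m : ℕ) : Type v :=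
  ((Fin m → 𝕜) × 𝕜 × 𝕜 × 𝕜) × (𝕜 × 𝕜 × 𝕜)

namespace WaveCoefficients

/-- The point `(u, s₀, s₁)` of a state. -/
def point (z : WaveState 𝕜 m) : (Fin m → 𝕜) × (Fin 2 → 𝕜) := (z.1.1, ![z.2.1, z.1.2.1])

theorem point_eq {z : WaveState 𝕜 m} {u₀ : Fin m → 𝕜} {s₀ : Fin 2 → 𝕜} (hu : z.1.1 = u₀)
    (h0 : z.2.1 = s₀ 0) (h1 : z.1.2.1 = s₀ 1) : point z = (u₀, s₀) := by
  ext i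
  · simp [point, hu]
  · fin_cases i <;> simp [point, h0, h1]

variable {u₀ : Fin m → 𝕜} {s₀ : Fin 2 → 𝕜} (c : WaveCoefficients 𝕜 m u₀ s₀)

/-- The derivative of `(u, s₁, p₁, w₁)` along the first Riemann invariant. -/
def rhs₀ (z : WaveState 𝕜 m) : (Fin m → 𝕜) × 𝕜 × 𝕜 × 𝕜 :=
  (z.2.2.1 • c.ξ 0 (z.1.1, z.2.1), z.2.2.1 * c.γ 1 (point z) * (z.2.1 - z.1.2.1),
    z.2.2.1 * z.1.2.2.1 * c.κ 1 (point z), z.2.2.1 * c.γ 1 (point z) * (z.2.2.2 - z.1.2.2.2))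

/-- The derivative of `(s₀, p₀, w₀)` along the second Riemann invariant. -/
def rhs₁ (z : WaveState 𝕜 m) : 𝕜 × 𝕜 × 𝕜 :=
  (z.1.2.2.1 * c.γ 0 (point z) * (z.1.2.1 - z.2.1),
    z.2.2.1 * z.1.2.2.1 * c.κ 0 (point z), z.1.2.2.1 * c.γ 0 (point z) * (z.1.2.2.2 - z.2.2.2))

theorem smoothNear_point (z : WaveState 𝕜 m) : SmoothNear 𝕜 (point (𝕜 := 𝕜) (m := m)) z := by
  refine smoothNear_id.fst.fst.prodMk (SmoothNear.pi fun i => ?_)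
  fin_cases i
  · exact smoothNear_id.snd.fst
  · exact smoothNear_id.fst.snd.fst

theorem smoothNear_rhs₀ {z : WaveState 𝕜 m} (hu : z.1.1 = u₀) (h0 : z.2.1 = s₀ 0)
    (h1 : z.1.2.1 = s₀ 1) : SmoothNear 𝕜 c.rhs₀ z := by
  have i : SmoothNear 𝕜 (fun z : WaveState 𝕜 m => z) z := smoothNear_id
  have hp := point_eq hu h0 h1
  have hγ := (c.smooth_γ 1).comp_of_eq (smoothNear_point z) hp
  have hκ := (c.smooth_κ 1).comp_of_eq (smoothNear_point z) hp
  have hξ := (c.smooth_ξ 0).comp_of_eq (i.fst.fst.prodMk i.snd.fst) (by rw [hu, h0])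
  exact (i.snd.snd.fst.smul hξ).prodMk (((i.snd.snd.fst.mul hγ).mul (i.snd.fst.sub i.fst.snd.fst)).prodMk
    (((i.snd.snd.fst.mul i.fst.snd.snd.fst).mul hκ).prodMk
      ((i.snd.snd.fst.mul hγ).mul (i.snd.snd.snd.sub i.fst.snd.snd.snd))))

theorem smoothNear_rhs₁ {z : WaveState 𝕜 m} (hu : z.1.1 = u₀) (h0 : z.2.1 = s₀ 0)
    (h1 : z.1.2.1 = s₀ 1) : SmoothNear 𝕜 c.rhs₁ z := by
  have i : SmoothNear 𝕜 (fun z : WaveState 𝕜 m => z) z := smoothNear_id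
  have hp := point_eq hu h0 h1
  have hγ := (c.smooth_γ 0).comp_of_eq (smoothNear_point z) hp
  have hκ := (c.smooth_κ 0).comp_of_eq (smoothNear_point z) hp
  exact ((i.fst.snd.snd.fst.mul hγ).mul (i.fst.snd.fst.sub i.snd.fst)).prodMk
    (((i.snd.snd.fst.mul i.fst.snd.snd.fst).mul hκ).prodMk
      ((i.fst.snd.snd.fst.mul hγ).mul (i.fst.snd.snd.snd.sub i.snd.snd.snd)))

end WaveCoefficients

theorem vec_eq {α β : Type*} (s : Fin 2 → α → β) (R : α) :
    ![s 0 R, s 1 R] = fun k => s k R := by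
  ext k; fin_cases k <;> rfl

/-- Two solutions with the same values on the diagonal coincide. -/
theorem IsWaveSolution.eventuallyEq {u₀ : Fin m → 𝕜} {s₀ : Fin 2 → 𝕜}
    {c : WaveCoefficients 𝕜 m u₀ s₀} {u u' : (Fin 2 → 𝕜) → Fin m → 𝕜}
    {s p w s' p' w' : Fin 2 → (Fin 2 → 𝕜) → 𝕜} (h : IsWaveSolution c u s p w)
    (h' : IsWaveSolution c u' s' p' w')
    (hu : ∀ᶠ a : 𝕜 in 𝓝 0, u (fun _ => a) = u' (fun _ => a))
    (hs : ∀ᶠ a : 𝕜 in 𝓝 0, ∀ i, s i (fun _ => a) = s' i (fun _ => a))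
    (hp : ∀ᶠ a : 𝕜 in 𝓝 0, ∀ i, p i (fun _ => a) = p' i (fun _ => a))
    (hw : ∀ᶠ a : 𝕜 in 𝓝 0, ∀ i, w i (fun _ => a) = w' i (fun _ => a)) :
    ∀ᶠ R in 𝓝 0, u R = u' R ∧ (∀ i, s i R = s' i R) ∧ ∀ i, w i R = w' i R := by
  have key : ∀ {u : (Fin 2 → 𝕜) → Fin m → 𝕜} {s p w : Fin 2 → (Fin 2 → 𝕜) → 𝕜},
      IsWaveSolution c u s p w →
      SmoothNear 𝕜 (fun R => (((u R, s 1 R, p 1 R, w 1 R), (s 0 R, p 0 R, w 0 R)) :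
        WaveState 𝕜 m)) 0 ∧
      (∀ᶠ R in 𝓝 0, pd 0 (fun R => (u R, s 1 R, p 1 R, w 1 R)) R
        = c.rhs₀ ((u R, s 1 R, p 1 R, w 1 R), (s 0 R, p 0 R, w 0 R))) ∧
      ∀ᶠ R in 𝓝 0, pd 1 (fun R => (s 0 R, p 0 R, w 0 R)) R
        = c.rhs₁ ((u R, s 1 R, p 1 R, w 1 R), (s 0 R, p 0 R, w 0 R)) := by
    intro u s p w h
    have d0 := h.smooth_u.eventually_differentiableAt
    have d1 := fun i => (h.smooth_s i).eventually_differentiableAt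
    have d2 := fun i => (h.smooth_p i).eventually_differentiableAt
    have d3 := fun i => (h.smooth_w i).eventually_differentiableAt
    refine ⟨(h.smooth_u.prodMk ((h.smooth_s 1).prodMk ((h.smooth_p 1).prodMk (h.smooth_w 1)))).prodMk
      ((h.smooth_s 0).prodMk ((h.smooth_p 0).prodMk (h.smooth_w 0))), ?_, ?_⟩
    · filter_upwards [d0, d1 1, d2 1, d3 1, h.eq_u, h.eq_s, h.eq_p, h.eq_w]
        with R e0 e1 e2 e3 f0 f1 f2 f3
      rw [pd_prodMk e0 (e1.prodMk (e2.prodMk e3)), pd_prodMk e1 (e2.prodMk e3), pd_prodMk e2 e3,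
        f0, f1 1 0 (by decide), f2 1 0 (by decide), f3 1 0 (by decide)]
      simp only [WaveCoefficients.rhs₀, WaveCoefficients.point, vec_eq]
    · filter_upwards [d1 0, d2 0, d3 0, h.eq_s, h.eq_p, h.eq_w]
        with R e1 e2 e3 f1 f2 f3
      rw [pd_prodMk e1 (e2.prodMk e3), pd_prodMk e2 e3,
        f1 0 1 (by decide), f2 0 1 (by decide), f3 0 1 (by decide)]
      simp only [WaveCoefficients.rhs₁, WaveCoefficients.point, vec_eq]
  obtain ⟨k1, k2, k3⟩ := key h
  obtain ⟨k1', k2', k3'⟩ := key h'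
  have := eventuallyEq_of_characteristicSystem (F := c.rhs₀) (G := c.rhs₁)
    (c.smoothNear_rhs₀ h.u_zero (h.s_zero 0) (h.s_zero 1))
    (c.smoothNear_rhs₁ h.u_zero (h.s_zero 0) (h.s_zero 1)) k1 k1' k2 k3 k2' k3'
    (by filter_upwards [hu, hs, hp, hw] with a a1 a2 a3 a4
        rw [a1, a2, a2, a3, a3, a4, a4])
  filter_upwards [this] with R hR
  simp only [Prod.mk.injEq] at hR
  obtain ⟨⟨r1, r2, r3, r4⟩, r5, r6, r7⟩ := hR
  refine ⟨r1, fun i => ?_, fun i => ?_⟩ <;> fin_cases i <;> assumption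

/-- Existence of a solution with given values on the diagonal, provided that the values of `u` move
in the direction prescribed by the sum of the equations for `∂₀u` and `∂₁u`. -/
theorem exists_isWaveSolution {u₀ : Fin m → 𝕜} {s₀ : Fin 2 → 𝕜} (c : WaveCoefficients 𝕜 m u₀ s₀)
    {uΔ : 𝕜 → Fin m → 𝕜} {sΔ pΔ wΔ : Fin 2 → 𝕜 → 𝕜} (hu : SmoothNear 𝕜 uΔ 0)
    (hs : ∀ i, SmoothNear 𝕜 (sΔ i) 0) (hp : ∀ i, SmoothNear 𝕜 (pΔ i) 0)
    (hw : ∀ i, SmoothNear 𝕜 (wΔ i) 0) (hu0 : uΔ 0 = u₀) (hs0 : ∀ i, sΔ i 0 = s₀ i)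
    (hder : ∀ᶠ a in 𝓝 0, deriv uΔ a = pΔ 0 a • c.ξ 0 (uΔ a, sΔ 0 a) + pΔ 1 a • c.ξ 1 (uΔ a, sΔ 1 a)) :
    ∃ (u : (Fin 2 → 𝕜) → Fin m → 𝕜) (s p w : Fin 2 → (Fin 2 → 𝕜) → 𝕜),
      IsWaveSolution c u s p w ∧ ∀ᶠ a : 𝕜 in 𝓝 0, u (fun _ => a) = uΔ a ∧
        ∀ i, s i (fun _ => a) = sΔ i a ∧ p i (fun _ => a) = pΔ i a ∧ w i (fun _ => a) = wΔ i a := by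
  obtain ⟨Z, hZ, hZ0, hZ1, hZd⟩ := exists_characteristicSystem (F := c.rhs₀) (G := c.rhs₁)
    (X₀ := fun a => (uΔ a, sΔ 1 a, pΔ 1 a, wΔ 1 a)) (Y₀ := fun a => (sΔ 0 a, pΔ 0 a, wΔ 0 a))
    (c.smoothNear_rhs₀ hu0 (hs0 0) (hs0 1)) (c.smoothNear_rhs₁ hu0 (hs0 0) (hs0 1))
    (hu.prodMk ((hs 1).prodMk ((hp 1).prodMk (hw 1)))) ((hs 0).prodMk ((hp 0).prodMk (hw 0)))
  set u : (Fin 2 → 𝕜) → Fin m → 𝕜 := fun R => (Z R).1.1 with hudef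
  set s : Fin 2 → (Fin 2 → 𝕜) → 𝕜 := ![fun R => (Z R).2.1, fun R => (Z R).1.2.1] with hsdef
  set p : Fin 2 → (Fin 2 → 𝕜) → 𝕜 := ![fun R => (Z R).2.2.1, fun R => (Z R).1.2.2.1] with hpdef
  set w : Fin 2 → (Fin 2 → 𝕜) → 𝕜 := ![fun R => (Z R).2.2.2, fun R => (Z R).1.2.2.2] with hwdef
  have su : SmoothNear 𝕜 u 0 := hZ.fst.fst
  have ss : ∀ i, SmoothNear 𝕜 (s i) 0 := by
    intro i; fin_cases i
    exacts [hZ.snd.fst, hZ.fst.snd.fst]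
  have sp : ∀ i, SmoothNear 𝕜 (p i) 0 := by
    intro i; fin_cases i
    exacts [hZ.snd.snd.fst, hZ.fst.snd.snd.fst]
  have sw : ∀ i, SmoothNear 𝕜 (w i) 0 := by
    intro i; fin_cases i
    exacts [hZ.snd.snd.snd, hZ.fst.snd.snd.snd]
  have hpt : ∀ R, WaveCoefficients.point (Z R) = (u R, fun k => s k R) := by
    intro R
    ext k
    · rfl
    · fin_cases k <;> rfl
  have hdZ := hZ.eventually_differentiableAt
  -- the equations contained in the characteristic system
  have e0 : ∀ᶠ R in 𝓝 0, pd 0 u R = p 0 R • c.ξ 0 (u R, s 0 R) ∧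
      pd 0 (s 1) R = p 0 R * c.γ 1 (u R, fun k => s k R) * (s 0 R - s 1 R) ∧
      pd 0 (p 1) R = p 0 R * p 1 R * c.κ 1 (u R, fun k => s k R) ∧
      pd 0 (w 1) R = p 0 R * c.γ 1 (u R, fun k => s k R) * (w 0 R - w 1 R) := by
    filter_upwards [hdZ, hZ0] with R hd h
    have a1 : pd 0 u R = (pd 0 (fun R => (Z R).1) R).1 := pd_fst hd.fst
    have a2 : pd 0 (s 1) R = (pd 0 (fun R => (Z R).1) R).2.1 :=
      (pd_fst hd.fst.snd).trans (by rw [pd_snd hd.fst])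
    have a3 : pd 0 (p 1) R = (pd 0 (fun R => (Z R).1) R).2.2.1 :=
      (pd_fst hd.fst.snd.snd).trans (by rw [pd_snd hd.fst.snd, pd_snd hd.fst])
    have a4 : pd 0 (w 1) R = (pd 0 (fun R => (Z R).1) R).2.2.2 :=
      (pd_snd hd.fst.snd.snd).trans (by rw [pd_snd hd.fst.snd, pd_snd hd.fst])
    rw [a1, a2, a3, a4, h, ← hpt]
    exact ⟨rfl, rfl, rfl, rfl⟩
  have e1 : ∀ᶠ R in 𝓝 0,
      pd 1 (s 0) R = p 1 R * c.γ 0 (u R, fun k => s k R) * (s 1 R - s 0 R) ∧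
      pd 1 (p 0) R = p 0 R * p 1 R * c.κ 0 (u R, fun k => s k R) ∧
      pd 1 (w 0) R = p 1 R * c.γ 0 (u R, fun k => s k R) * (w 1 R - w 0 R) := by
    filter_upwards [hdZ, hZ1] with R hd h
    have a2 : pd 1 (s 0) R = (pd 1 (fun R => (Z R).2) R).1 := pd_fst hd.snd
    have a3 : pd 1 (p 0) R = (pd 1 (fun R => (Z R).2) R).2.1 :=
      (pd_fst hd.snd.snd).trans (by rw [pd_snd hd.snd])
    have a4 : pd 1 (w 0) R = (pd 1 (fun R => (Z R).2) R).2.2 :=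
      (pd_snd hd.snd.snd).trans (by rw [pd_snd hd.snd])
    rw [a2, a3, a4, h, ← hpt]
    exact ⟨rfl, rfl, rfl⟩
  have hZdiag0 : Z 0 = ((uΔ 0, sΔ 1 0, pΔ 1 0, wΔ 1 0), (sΔ 0 0, pΔ 0 0, wΔ 0 0)) := hZd.self_of_nhds
  have hu0' : u 0 = u₀ := by simp only [hudef, hZdiag0, hu0]
  have hs0' : ∀ i, s i 0 = s₀ i := by
    intro i; fin_cases i <;> simp [hsdef, hZdiag0, hs0]
  have hq : Tendsto (fun R => (u R, fun k => s k R)) (𝓝 0) (𝓝 (u₀, s₀)) := by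
    have := (su.prodMk (SmoothNear.pi (f := fun R k => s k R) ss)).continuousAt
    rw [ContinuousAt, hu0', funext hs0'] at this
    exact this
  have hξ : ∀ i, SmoothNear 𝕜 (fun R => c.ξ i (u R, s i R)) 0 := fun i =>
    (c.smooth_ξ i).comp_of_eq (su.prodMk (ss i)) (by rw [hu0', hs0'])
  have hξd : ∀ i, ∀ᶠ R in 𝓝 0, DifferentiableAt 𝕜 (c.ξ i) (u R, s i R) := by
    intro i
    have : Tendsto (fun R => (u R, s i R)) (𝓝 0) (𝓝 (u₀, s₀ i)) := by
      have := (su.prodMk (ss i)).continuousAt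
      rw [ContinuousAt, hu0', hs0'] at this
      exact this
    exact this.eventually (c.smooth_ξ i).eventually_differentiableAt
  -- the defect in the equation for `∂₁u` satisfies a linear equation along the first coordinate
  set ζ : (Fin 2 → 𝕜) → Fin m → 𝕜 := fun R => pd 1 u R - p 1 R • c.ξ 1 (u R, s 1 R) with hζdef
  have sζ : SmoothNear 𝕜 ζ 0 := (su.pd 1).sub ((sp 1).smul (hξ 1))
  have eζ : ∀ᶠ R in 𝓝 0, pd 0 ζ R = p 0 R • fderiv 𝕜 (c.ξ 0) (u R, s 0 R) (ζ R, 0) := by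
    filter_upwards [su.eventually, (ss 0).eventually_differentiableAt,
      (ss 1).eventually_differentiableAt, (sp 0).eventually_differentiableAt,
      (sp 1).eventually_differentiableAt, e0, e1, e0.eventually_nhds, hξd 0, hξd 1,
      hq.eventually c.compat] with R ru d0 d1 g0 g1 h0 h1 h0n x0 x1 hc
    have x0' : DifferentiableAt 𝕜 (fun R => c.ξ 0 (u R, s 0 R)) R :=
      DifferentiableAt.fun_comp' (f := fun R => (u R, s 0 R)) R x0 (ru.differentiableAt.prodMk d0)
    have x1' : DifferentiableAt 𝕜 (fun R => c.ξ 1 (u R, s 1 R)) R :=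
      DifferentiableAt.fun_comp' (f := fun R => (u R, s 1 R)) R x1 (ru.differentiableAt.prodMk d1)
    have b1 : pd 0 (pd 1 u) R = pd 1 (fun R => p 0 R • c.ξ 0 (u R, s 0 R)) R := by
      rw [pd_comm ru]
      exact pd_congr (h0n.mono fun S hS => hS.1)
    have b2 : pd 1 u R = p 1 R • c.ξ 1 (u R, s 1 R) + ζ R := by simp [hζdef]
    rw [hζdef, pd_sub (ru.pd 1).differentiableAt (g1.fun_smul x1'), b1, pd_smul g0 x0', pd_smul g1 x1',
      pd_comp (g := c.ξ 0) (f := fun R => (u R, s 0 R)) x0 (ru.differentiableAt.prodMk d0),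
      pd_comp (g := c.ξ 1) (f := fun R => (u R, s 1 R)) x1 (ru.differentiableAt.prodMk d1),
      pd_prodMk ru.differentiableAt d0, pd_prodMk ru.differentiableAt d1, b2, h0.1, h0.2.1, h0.2.2.1,
      h1.1, h1.2.1]
    have l0 : ((p 1 R • c.ξ 1 (u R, s 1 R) + ζ R,
        p 1 R * c.γ 0 (u R, fun k => s k R) * (s 1 R - s 0 R)) : (Fin m → 𝕜) × 𝕜)
        = p 1 R • (c.ξ 1 (u R, s 1 R), c.γ 0 (u R, fun k => s k R) * (s 1 R - s 0 R))
          + (ζ R, 0) := by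
      ext1 <;> simp [mul_assoc]
    have l1 : ((p 0 R • c.ξ 0 (u R, s 0 R),
        p 0 R * c.γ 1 (u R, fun k => s k R) * (s 0 R - s 1 R)) : (Fin m → 𝕜) × 𝕜)
        = p 0 R • (c.ξ 0 (u R, s 0 R), c.γ 1 (u R, fun k => s k R) * (s 0 R - s 1 R)) := by
      ext1 <;> simp [mul_assoc]
    rw [l0, l1, map_add, map_smul, map_smul]
    have hc' := congrArg (fun v => (p 0 R * p 1 R) • v) hc
    simp only [smul_add, ← mul_smul] at hc' ⊢
    rw [mul_comm (p 1 R) (p 0 R)]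
    rw [← sub_eq_zero] at hc' ⊢
    rw [← hc']
    abel
  have hζ0 : ζ =ᶠ[𝓝 0] 0 := by
    set F : (((Fin m → 𝕜) × 𝕜 × 𝕜 × 𝕜) × (Fin m → 𝕜)) × (𝕜 × 𝕜 × 𝕜) →
        ((Fin m → 𝕜) × 𝕜 × 𝕜 × 𝕜) × (Fin m → 𝕜) := fun z => (c.rhs₀ (z.1.1, z.2),
      z.2.2.1 • fderiv 𝕜 (c.ξ 0) (z.1.1.1, z.2.1) (z.1.2, 0)) with hF
    set G : (((Fin m → 𝕜) × 𝕜 × 𝕜 × 𝕜) × (Fin m → 𝕜)) × (𝕜 × 𝕜 × 𝕜) → 𝕜 × 𝕜 × 𝕜 :=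
      fun z => c.rhs₁ (z.1.1, z.2) with hG
    have hz1 : (Z 0).1.1 = u₀ := hu0'
    have hz2 : (Z 0).2.1 = s₀ 0 := hs0' 0
    have hz3 : (Z 0).1.2.1 = s₀ 1 := hs0' 1
    have hι : SmoothNear 𝕜 (fun z : (((Fin m → 𝕜) × 𝕜 × 𝕜 × 𝕜) × (Fin m → 𝕜)) × (𝕜 × 𝕜 × 𝕜) => z)
      (((Z 0).1, ζ 0), (Z 0).2) := smoothNear_id
    have hG' : SmoothNear 𝕜 G (((Z 0).1, ζ 0), (Z 0).2) :=
      (c.smoothNear_rhs₁ hz1 hz2 hz3).comp_of_eq (hι.fst.fst.prodMk hι.snd) rfl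
    have hF' : SmoothNear 𝕜 F (((Z 0).1, ζ 0), (Z 0).2) := by
      refine ((c.smoothNear_rhs₀ hz1 hz2 hz3).comp_of_eq (hι.fst.fst.prodMk hι.snd) rfl).prodMk
        (hι.snd.snd.fst.smul ?_)
      have k1 := (c.smooth_ξ 0).fderiv.comp_of_eq (hι.fst.fst.fst.prodMk hι.snd.fst)
        (by rw [hz1, hz2])
      filter_upwards [k1, hι.fst.snd.prodMk (smoothNear_const (0 : 𝕜))] with z z1 z2
      exact z1.clm_apply z2
    have hZ'1 : SmoothNear 𝕜 (fun R => (((Z R).1, ζ R), (Z R).2)) 0 :=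
      (hZ.fst.prodMk sζ).prodMk hZ.snd
    have hZ'2 : SmoothNear 𝕜 (fun R => (((Z R).1, (0 : Fin m → 𝕜)), (Z R).2)) 0 :=
      (hZ.fst.prodMk (smoothNear_const _)).prodMk hZ.snd
    have := eventuallyEq_of_characteristicSystem (F := F) (G := G) hF' hG' hZ'1 hZ'2 ?_ ?_ ?_ ?_ ?_
    · filter_upwards [this] with R hR
      simp only [Prod.mk.injEq] at hR
      exact hR.1.2
    · filter_upwards [hdZ, sζ.eventually_differentiableAt, hZ0, eζ] with R r1 r2 r3 r4
      rw [pd_prodMk r1.fst r2, r3, r4]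
      rfl
    · exact hZ1
    · filter_upwards [hdZ, hZ0] with R r1 r3
      rw [pd_prodMk r1.fst (differentiableAt_const _), r3]
      have : ((0 : Fin m → 𝕜), (0 : 𝕜)) = 0 := rfl
      simp [hF, this, pd]
    · exact hZ1
    · have hdg : Tendsto (fun a : 𝕜 => (fun _ => a : Fin 2 → 𝕜)) (𝓝 0) (𝓝 0) :=
        (continuous_pi fun _ => continuous_id).tendsto' _ _ rfl
      filter_upwards [hZd.eventually_nhds, hder, hdg.eventually e0,
        hdg.eventually su.eventually_differentiableAt] with a a1 a2 a3 a4
      have a5 : deriv uΔ a = pd 0 u (fun _ => a) + pd 1 u (fun _ => a) := by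
        have b1 : uΔ =ᶠ[𝓝 a] fun a => u (fun _ => a) := by
          filter_upwards [a1] with b hb
          simp only [hudef, hb]
        have b2 : HasDerivAt (fun a : 𝕜 => (fun _ => a : Fin 2 → 𝕜)) (fun _ => 1) a :=
          hasDerivAt_pi.2 fun _ => hasDerivAt_id a
        have b3 := a4.hasFDerivAt.comp_hasDerivAt (f := fun a : 𝕜 => (fun _ => a : Fin 2 → 𝕜)) a b2
        rw [b1.deriv_eq]
        refine b3.deriv.trans ?_
        rw [pd, pd, ← map_add]
        congr 1
        ext i; fin_cases i <;> simp
      have hza := a1.self_of_nhds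
      have : ζ (fun _ => a) = 0 := by
        simp only [hζdef]
        rw [a2, a3.1] at a5
        simp only [hudef, hsdef, hpdef, hza, Matrix.cons_val_zero, Matrix.cons_val_one] at a5 ⊢
        rw [sub_eq_zero]
        exact (add_left_cancel a5).symm
      simp only [this]
  refine ⟨u, s, p, w, ⟨hu0', hs0', su, ss, sp, sw, ?_, ?_, ?_, ?_⟩, ?_⟩
  · filter_upwards [e0, hζ0] with R h0 h1 i
    fin_cases i
    · exact h0.1
    · exact sub_eq_zero.1 h1
  · filter_upwards [e0, e1] with R h0 h1 i j hij
    fin_cases i <;> fin_cases j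
    exacts [absurd rfl hij, h1.1, h0.2.1, absurd rfl hij]
  · filter_upwards [e0, e1] with R h0 h1 i j hij
    fin_cases i <;> fin_cases j
    exacts [absurd rfl hij, h1.2.1, h0.2.2.1, absurd rfl hij]
  · filter_upwards [e0, e1] with R h0 h1 i j hij
    fin_cases i <;> fin_cases j
    exacts [absurd rfl hij, h1.2.2, h0.2.2.2, absurd rfl hij]
  · filter_upwards [hZd] with a ha
    refine ⟨by simp only [hudef, ha], fun i => ?_⟩
    fin_cases i <;> simp [hsdef, hpdef, hwdef, ha]

end WaveSystem
end HydrodynamicType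

namespace HydrodynamicType
open Filter Matrix

/-! ### Matrices with a simple kernel -/

section SimpleKernel

variable {𝕜 : Type*} [Field 𝕜] {m : ℕ}

/-- The singular matrix `V` has corank one: `ξ` spans its kernel and `η` spans its left kernel, the
latter being expressed as a description of the range. -/
structure IsSimplePair (V : Matrix (Fin m) (Fin m) 𝕜) (ξ η : Fin m → 𝕜) : Prop where
  ne_zero : ξ ≠ 0
  mulVec_eq : V *ᵥ ξ = 0
  vecMul_eq : η ᵥ* V = 0
  ker : ∀ x, V *ᵥ x = 0 → ∃ c : 𝕜, x = c • ξ
  range : ∀ r, η ⬝ᵥ r = 0 → ∃ x, V *ᵥ x = r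

theorem adjugate_column_mem_ker {V : Matrix (Fin m) (Fin m) 𝕜} (h : V.det = 0) (b : Fin m) :
    V *ᵥ (fun k => V.adjugate k b) = 0 := by
  ext i
  have := congrFun (congrFun (mul_adjugate V) i) b
  rw [h, zero_smul] at this
  simpa [mul_apply, mulVec, dotProduct] using this

theorem adjugate_row_vecMul {V : Matrix (Fin m) (Fin m) 𝕜} (h : V.det = 0) (a : Fin m) :
    (fun k => V.adjugate a k) ᵥ* V = 0 := by
  ext i
  have := congrFun (congrFun (adjugate_mul V) a) i
  rw [h, zero_smul] at this
  simpa [mul_apply, vecMul, dotProduct] using this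

theorem eq_of_updateRow {V : Matrix (Fin m) (Fin m) 𝕜} {a b : Fin m} (hp : V.adjugate a b ≠ 0)
    {x y : Fin m → 𝕜} (h : ∀ i, i ≠ b → (V *ᵥ x) i = (V *ᵥ y) i) (ha : x a = y a) : x = y := by
  rw [adjugate_apply] at hp
  have hinj := mulVec_injective_of_isUnit
    ((isUnit_iff_isUnit_det (V.updateRow b (Pi.single a 1))).2 (isUnit_iff_ne_zero.2 hp))
  apply hinj
  ext i
  by_cases hi : i = b
  · subst hi
    simp [mulVec, ha]
  · have := h i hi
    simpa [mulVec, updateRow_ne hi] using this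

/-- If the adjugate of the singular matrix `V` has a nonzero entry, then the column of that entry
spans the kernel and its row spans the left kernel. -/
theorem isSimplePair_adjugate {V : Matrix (Fin m) (Fin m) 𝕜} (h : V.det = 0) {a b : Fin m}
    (hp : V.adjugate a b ≠ 0) :
    IsSimplePair V (fun k => V.adjugate k b) (fun k => V.adjugate a k) := by
  refine ⟨fun h0 => hp (congrFun h0 a), adjugate_column_mem_ker h b, adjugate_row_vecMul h a,
    fun x hx => ⟨x a / V.adjugate a b, ?_⟩, fun r hr => ?_⟩
  · refine eq_of_updateRow hp (fun i _ => ?_) (by simp [hp])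
    rw [hx, mulVec_smul, adjugate_column_mem_ker h, smul_zero]
  · have hp' := hp
    rw [adjugate_apply] at hp'
    have hu : IsUnit (V.updateRow b (Pi.single a 1)).det := isUnit_iff_ne_zero.2 hp'
    refine ⟨(V.updateRow b (Pi.single a 1))⁻¹ *ᵥ Function.update r b 0, ?_⟩
    set x := (V.updateRow b (Pi.single a 1))⁻¹ *ᵥ Function.update r b 0 with hx
    have h1 : V.updateRow b (Pi.single a 1) *ᵥ x = Function.update r b 0 := by
      rw [hx, mulVec_mulVec, mul_nonsing_inv _ hu, one_mulVec]
    have h2 : ∀ i, i ≠ b → (V *ᵥ x) i = r i := by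
      intro i hi
      have := congrFun h1 i
      rw [Function.update_of_ne hi] at this
      simpa [mulVec, updateRow_ne hi] using this
    ext i
    by_cases hi : i = b
    swap
    · exact h2 i hi
    subst hi
    -- the remaining entry is determined by the orthogonality to the left kernel
    have h3 : (fun k => V.adjugate a k) ⬝ᵥ (V *ᵥ x - r) = 0 := by
      rw [dotProduct_sub, dotProduct_mulVec, adjugate_row_vecMul h a, zero_dotProduct, hr, sub_zero]
    rw [dotProduct, Finset.sum_eq_single i] at h3
    · have := (mul_eq_zero.1 h3).resolve_left hp
      exact sub_eq_zero.1 this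
    · intro k _ hk
      rw [Pi.sub_apply, h2 k hk, sub_self, mul_zero]
    · simp

theorem adjugate_mul_trace {V : Matrix (Fin m) (Fin m) 𝕜} (h : V.det = 0) {a b : Fin m}
    (hp : V.adjugate a b ≠ 0) (M : Matrix (Fin m) (Fin m) 𝕜) :
    (fun k => V.adjugate a k) ⬝ᵥ M *ᵥ (fun k => V.adjugate k b)
      = V.adjugate a b * (V.adjugate * M).trace := by
  have hrank : ∀ i k, V.adjugate a b * V.adjugate i k = V.adjugate i b * V.adjugate a k := by
    intro i k
    obtain ⟨c, hc⟩ := (isSimplePair_adjugate h hp).ker _ (adjugate_column_mem_ker h k)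
    have h1 := congrFun hc i
    have h2 := congrFun hc a
    simp only [Pi.smul_apply, smul_eq_mul] at h1 h2
    rw [h1, h2]; ring
  simp only [dotProduct, mulVec, trace, diag_apply, mul_apply, Finset.mul_sum]
  rw [Finset.sum_comm]
  refine Finset.sum_congr rfl fun i _ => Finset.sum_congr rfl fun k _ => ?_
  rw [← mul_assoc (V.adjugate a b), hrank]; ring

theorem exists_adjugate_ne_zero {V M : Matrix (Fin m) (Fin m) 𝕜}
    (h : (V.adjugate * M).trace ≠ 0) : ∃ a b, V.adjugate a b ≠ 0 := by
  by_contra! h0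
  apply h
  have : V.adjugate = 0 := by ext a b; exact h0 a b
  simp [this]

theorem IsSimplePair.smul_eq_zero {V : Matrix (Fin m) (Fin m) 𝕜} {ξ η : Fin m → 𝕜}
    (h : IsSimplePair V ξ η) {M : Matrix (Fin m) (Fin m) 𝕜} (hM : η ⬝ᵥ M *ᵥ ξ ≠ 0) {x : Fin m → 𝕜}
    {c : 𝕜} (hx : V *ᵥ x + c • M *ᵥ ξ = 0) : c = 0 := by
  have := congrArg (fun y => η ⬝ᵥ y) hx
  simp only [dotProduct_add, dotProduct_mulVec η V, h.vecMul_eq, zero_dotProduct, zero_add,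
    dotProduct_smul, dotProduct_zero, smul_eq_mul] at this
  exact (mul_eq_zero.1 this).resolve_right hM

/-- Two non-proportional vectors have a nonvanishing minor. -/
theorem exists_minor_ne_zero {x y : Fin m → 𝕜} (hx : x ≠ 0) (h : ∀ c : 𝕜, y ≠ c • x) :
    ∃ r s, x r * y s - x s * y r ≠ 0 := by
  by_contra! h0
  obtain ⟨r, hr⟩ := Function.ne_iff.1 hx
  refine h (y r / x r) (funext fun s => ?_)
  have := h0 r s
  simp only [Pi.zero_apply] at hr
  simp only [Pi.smul_apply, smul_eq_mul]
  field_simp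
  linear_combination this

end SimpleKernel

section Jacobi

variable {𝕜 : Type*} [RCLike 𝕜] {m : ℕ}

/-- Jacobi's formula for the derivative of a determinant along a line. -/
theorem hasDerivAt_det (V M : Matrix (Fin m) (Fin m) 𝕜) (t : 𝕜) :
    HasDerivAt (fun t : 𝕜 => (V + t • M).det) (((V + t • M).adjugate * M).trace) t := by
  have h1 : HasDerivAt (fun t : 𝕜 => ∑ σ : Equiv.Perm (Fin m), (Equiv.Perm.sign σ : 𝕜) *
      ∏ i, (V (σ i) i + t * M (σ i) i)) (∑ σ : Equiv.Perm (Fin m), (Equiv.Perm.sign σ : 𝕜) *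
      ∑ i, (∏ j ∈ Finset.univ.erase i, (V (σ j) j + t * M (σ j) j)) * M (σ i) i) t := by
    refine HasDerivAt.fun_sum fun σ _ => HasDerivAt.const_mul _ ?_
    have := HasDerivAt.fun_finsetProd (u := Finset.univ) (x := t)
      (f := fun i t => V (σ i) i + t * M (σ i) i) (f' := fun i => M (σ i) i) (fun i _ => by
        simpa using ((hasDerivAt_id t).mul_const (M (σ i) i)).const_add (V (σ i) i))
    simpa using this
  have e1 : (fun t : 𝕜 => (V + t • M).det) = fun t : 𝕜 => ∑ σ : Equiv.Perm (Fin m),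
      (Equiv.Perm.sign σ : 𝕜) * ∏ i, (V (σ i) i + t * M (σ i) i) := by
    ext t
    rw [det_apply']
    simp
  rw [e1]
  convert h1 using 1
  have e2 : ((V + t • M).adjugate * M).trace = ∑ i, ((V + t • M).updateCol i (fun k => M k i)).det := by
    rw [trace]
    refine Finset.sum_congr rfl fun i _ => ?_
    rw [← cramer_apply, cramer_eq_adjugate_mulVec]
    rfl
  rw [e2]
  simp only [det_apply', Finset.mul_sum]
  rw [Finset.sum_comm]
  refine Finset.sum_congr rfl fun σ _ => Finset.sum_congr rfl fun i _ => ?_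
  congr 1
  rw [← Finset.mul_prod_erase _ _ (Finset.mem_univ i), mul_comm]
  congr 1
  · refine Finset.prod_congr rfl fun j hj => ?_
    simp [(Finset.mem_erase.1 hj).1]
  · simp

end Jacobi
end HydrodynamicType

namespace HydrodynamicType
open Filter Matrix

/-! ### Matrix fields and branches of the dispersion curve -/

section MatrixFields

variable {𝕜 : Type*} [RCLike 𝕜] {m : ℕ} {X : Type*} [NormedAddCommGroup X] [NormedSpace 𝕜 X]

/-- The entrywise directional derivative of a matrix field. -/
noncomputable def matDeriv (M : X → Matrix (Fin m) (Fin m) 𝕜) (x h : X) :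
    Matrix (Fin m) (Fin m) 𝕜 :=
  of fun i j => fderiv 𝕜 (fun x => M x i j) x h

theorem matDeriv_apply (M : X → Matrix (Fin m) (Fin m) 𝕜) (x h : X) (i j : Fin m) :
    matDeriv M x h i j = fderiv 𝕜 (fun x => M x i j) x h := rfl

theorem matDeriv_add (M : X → Matrix (Fin m) (Fin m) 𝕜) (x h k : X) :
    matDeriv M x (h + k) = matDeriv M x h + matDeriv M x k := by
  ext; simp [matDeriv_apply]

theorem matDeriv_smul (M : X → Matrix (Fin m) (Fin m) 𝕜) (x : X) (c : 𝕜) (h : X) :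
    matDeriv M x (c • h) = c • matDeriv M x h := by
  ext; simp [matDeriv_apply]

theorem matDeriv_const (M : Matrix (Fin m) (Fin m) 𝕜) (x h : X) :
    matDeriv (fun _ => M) x h = 0 := by
  ext; simp [matDeriv_apply]

theorem fderiv_mulVec {M : X → Matrix (Fin m) (Fin m) 𝕜} {y : X → Fin m → 𝕜} {x : X}
    (hM : ∀ i j, DifferentiableAt 𝕜 (fun x => M x i j) x) (hy : DifferentiableAt 𝕜 y x) (h : X) :
    fderiv 𝕜 (fun x => M x *ᵥ y x) x h = matDeriv M x h *ᵥ y x + M x *ᵥ fderiv 𝕜 y x h := by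
  have hyi := fun i => differentiableAt_pi.1 hy i
  have hd : ∀ i, HasFDerivAt (fun x => (M x *ᵥ y x) i)
      (∑ j, (M x i j • fderiv 𝕜 (fun x => y x j) x + y x j • fderiv 𝕜 (fun x => M x i j) x)) x := by
    intro i
    exact HasFDerivAt.fun_sum (u := Finset.univ) (A := fun j x => M x i j * y x j)
      fun j _ => (hM i j).hasFDerivAt.mul (hyi j).hasFDerivAt
  rw [(hasFDerivAt_pi.2 hd).fderiv]
  ext i
  have e : ∀ j, fderiv 𝕜 y x h j = fderiv 𝕜 (fun x => y x j) x h := fun j => by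
    rw [fderiv_apply hy]; rfl
  simp only [ContinuousLinearMap.pi_apply, _root_.sum_apply,
    _root_.add_apply, _root_.smul_apply, smul_eq_mul, Pi.add_apply,
    mulVec, dotProduct, e, matDeriv_apply, ← Finset.sum_add_distrib]
  exact Finset.sum_congr rfl fun j _ => by ring

theorem SmoothNear.det {M : X → Matrix (Fin m) (Fin m) 𝕜} {x : X}
    (h : ∀ i j, SmoothNear 𝕜 (fun x => M x i j) x) : SmoothNear 𝕜 (fun x => (M x).det) x := by
  simp only [det_apply']
  exact SmoothNear.sum fun σ _ => (smoothNear_const _).mul (SmoothNear.prod fun i _ => h _ _)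

theorem SmoothNear.adjugate {M : X → Matrix (Fin m) (Fin m) 𝕜} {x : X}
    (h : ∀ i j, SmoothNear 𝕜 (fun x => M x i j) x) (a b : Fin m) :
    SmoothNear 𝕜 (fun x => (M x).adjugate a b) x := by
  simp only [adjugate_apply]
  refine SmoothNear.det fun i j => ?_
  by_cases hi : i = b
  · subst hi; simpa using smoothNear_const _
  · simpa [updateRow_ne hi] using h i j

theorem SmoothNear.mulVec {M : X → Matrix (Fin m) (Fin m) 𝕜} {y : X → Fin m → 𝕜} {x : X}
    (h : ∀ i j, SmoothNear 𝕜 (fun x => M x i j) x) (hy : SmoothNear 𝕜 y x) :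
    SmoothNear 𝕜 (fun x => M x *ᵥ y x) x :=
  SmoothNear.pi fun i => SmoothNear.sum (s := Finset.univ) (f := fun j x => M x i j * y x j)
    fun j _ => (h i j).mul (hy.apply j)

theorem SmoothNear.dotProduct {y z : X → Fin m → 𝕜} {x : X} (hy : SmoothNear 𝕜 y x)
    (hz : SmoothNear 𝕜 z x) : SmoothNear 𝕜 (fun x => y x ⬝ᵥ z x) x :=
  SmoothNear.sum fun j _ => (hy.apply j).mul (hz.apply j)

end MatrixFields

section Pencil

variable {𝕜 : Type*} [RCLike 𝕜] {m : ℕ} {X : Type*} [NormedAddCommGroup X] [NormedSpace 𝕜 X]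
  {A B C : (Fin m → 𝕜) → Matrix (Fin m) (Fin m) 𝕜}

/-- The matrix `A + s B + q C` at `u`. -/
def pencil (A B C : (Fin m → 𝕜) → Matrix (Fin m) (Fin m) 𝕜) (u : Fin m → 𝕜) (s q : 𝕜) :
    Matrix (Fin m) (Fin m) 𝕜 :=
  A u + s • B u + q • C u

/-- The derivative of `A + s B + q C` at `u` in the direction `h`, with `s` and `q` constant. -/
noncomputable def pencilDeriv (A B C : (Fin m → 𝕜) → Matrix (Fin m) (Fin m) 𝕜) (u : Fin m → 𝕜)
    (s q : 𝕜) (h : Fin m → 𝕜) : Matrix (Fin m) (Fin m) 𝕜 :=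
  matDeriv A u h + s • matDeriv B u h + q • matDeriv C u h

theorem pencilDeriv_smul (u : Fin m → 𝕜) (s q c : 𝕜) (h : Fin m → 𝕜) :
    pencilDeriv A B C u s q (c • h) = c • pencilDeriv A B C u s q h := by
  simp only [pencilDeriv, matDeriv_smul, smul_add, smul_comm c]

/-- The matrix field `A` is smooth near `u`. -/
def SmoothField (A : (Fin m → 𝕜) → Matrix (Fin m) (Fin m) 𝕜) (u : Fin m → 𝕜) : Prop :=
  ∀ i j, SmoothNear 𝕜 (fun w => A w i j) u

theorem SmoothField.eventually {u : Fin m → 𝕜} (h : SmoothField A u) :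
    ∀ᶠ w in 𝓝 u, SmoothField A w :=
  eventually_all.2 fun i => eventually_all.2 fun j => (h i j).eventually

theorem SmoothNear.pencil {U : X → Fin m → 𝕜} {S Q : X → 𝕜} {x : X} (hA : SmoothField A (U x))
    (hB : SmoothField B (U x)) (hC : SmoothField C (U x)) (hU : SmoothNear 𝕜 U x)
    (hS : SmoothNear 𝕜 S x) (hQ : SmoothNear 𝕜 Q x) (i j : Fin m) :
    SmoothNear 𝕜 (fun x => pencil A B C (U x) (S x) (Q x) i j) x := by
  simp only [HydrodynamicType.pencil, Matrix.add_apply, Matrix.smul_apply, smul_eq_mul]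
  exact (((hA i j).comp hU).add (hS.mul ((hB i j).comp hU))).add (hQ.mul ((hC i j).comp hU))

theorem SmoothField.smoothNear_matDeriv {U Y : X → Fin m → 𝕜} {x : X} (hA : SmoothField A (U x))
    (hU : SmoothNear 𝕜 U x) (hY : SmoothNear 𝕜 Y x) (i j : Fin m) :
    SmoothNear 𝕜 (fun x => matDeriv A (U x) (Y x) i j) x := by
  simp only [matDeriv_apply]
  filter_upwards [(hA i j).fderiv.comp hU, hY] with z h1 h2 using h1.clm_apply h2

theorem SmoothNear.pencilDeriv {U Y : X → Fin m → 𝕜} {S Q : X → 𝕜} {x : X}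
    (hA : SmoothField A (U x)) (hB : SmoothField B (U x)) (hC : SmoothField C (U x))
    (hU : SmoothNear 𝕜 U x) (hS : SmoothNear 𝕜 S x) (hQ : SmoothNear 𝕜 Q x)
    (hY : SmoothNear 𝕜 Y x) (i j : Fin m) :
    SmoothNear 𝕜 (fun x => pencilDeriv A B C (U x) (S x) (Q x) (Y x) i j) x := by
  simp only [HydrodynamicType.pencilDeriv, Matrix.add_apply, Matrix.smul_apply, smul_eq_mul]
  exact ((hA.smoothNear_matDeriv hU hY i j).add (hS.mul (hB.smoothNear_matDeriv hU hY i j))).add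
    (hQ.mul (hC.smoothNear_matDeriv hU hY i j))

theorem matDeriv_pencil {U : X → Fin m → 𝕜} {S Q : X → 𝕜} {x : X} (hA : SmoothField A (U x))
    (hB : SmoothField B (U x)) (hC : SmoothField C (U x)) (hU : DifferentiableAt 𝕜 U x)
    (hS : DifferentiableAt 𝕜 S x) (hQ : DifferentiableAt 𝕜 Q x) (h : X) :
    matDeriv (fun x => pencil A B C (U x) (S x) (Q x)) x h =
      pencilDeriv A B C (U x) (S x) (Q x) (fderiv 𝕜 U x h)
        + fderiv 𝕜 S x h • B (U x) + fderiv 𝕜 Q x h • C (U x) := by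
  ext i j
  have d := fun {M : (Fin m → 𝕜) → Matrix (Fin m) (Fin m) 𝕜} (hM : SmoothField M (U x)) =>
    (hM i j).differentiableAt.hasFDerivAt.comp x hU.hasFDerivAt
  have := ((d hA).add (hS.hasFDerivAt.mul (d hB))).add (hQ.hasFDerivAt.mul (d hC))
  have e : HasFDerivAt (fun x => pencil A B C (U x) (S x) (Q x) i j) _ x := this
  rw [matDeriv_apply, e.fderiv]
  simp [pencilDeriv, matDeriv_apply]
  ring

/-- Derivative of a kernel vector of the pencil `A + s B + q C`, where `u`, `s`, `q` and the vector
depend on parameters. -/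
theorem pencilDeriv_mulVec_add {U Y : X → Fin m → 𝕜} {S Q : X → 𝕜} {x : X}
    (hA : SmoothField A (U x)) (hB : SmoothField B (U x)) (hC : SmoothField C (U x))
    (hU : SmoothNear 𝕜 U x) (hS : SmoothNear 𝕜 S x) (hQ : SmoothNear 𝕜 Q x)
    (hY : SmoothNear 𝕜 Y x) (h0 : ∀ᶠ x in 𝓝 x, pencil A B C (U x) (S x) (Q x) *ᵥ Y x = 0) (h : X) :
    pencilDeriv A B C (U x) (S x) (Q x) (fderiv 𝕜 U x h) *ᵥ Y x
      + (fderiv 𝕜 S x h • B (U x) + fderiv 𝕜 Q x h • C (U x)) *ᵥ Y x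
      + pencil A B C (U x) (S x) (Q x) *ᵥ fderiv 𝕜 Y x h = 0 := by
  have e : (fun x => pencil A B C (U x) (S x) (Q x) *ᵥ Y x) =ᶠ[𝓝 x]
      fun _ => (0 : Fin m → 𝕜) := h0
  have h1 := e.fderiv_eq (𝕜 := 𝕜)
  have h2 := fderiv_mulVec (M := fun x => pencil A B C (U x) (S x) (Q x))
    (fun i j => (SmoothNear.pencil hA hB hC hU hS hQ i j).differentiableAt) hY.differentiableAt h
  rw [h1, matDeriv_pencil hA hB hC hU.differentiableAt hS.differentiableAt hQ.differentiableAt] at h2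
  rw [← add_mulVec, ← add_assoc, ← h2]
  simp

/-- A branch of the curve `det (A + s B + q C) = 0` near `(s₀, q₀)`, written as the graph of a
function `q = Q(u, s)`, together with the position of a nonzero entry of the adjugate matrix. -/
structure PencilBranch (A B C : (Fin m → 𝕜) → Matrix (Fin m) (Fin m) 𝕜) (u₀ : Fin m → 𝕜)
    (s₀ q₀ : 𝕜) where
  Q : (Fin m → 𝕜) × 𝕜 → 𝕜
  a : Fin m
  b : Fin m
  base : Q (u₀, s₀) = q₀
  smooth_Q : SmoothNear 𝕜 Q (u₀, s₀)
  det_eq : ∀ᶠ y in 𝓝 (u₀, s₀), (pencil A B C y.1 y.2 (Q y)).det = 0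
  unique : ∀ᶠ z in 𝓝 ((u₀, s₀), q₀), (pencil A B C z.1.1 z.1.2 z.2).det = 0 → z.2 = Q z.1
  pivot : ∀ᶠ y in 𝓝 (u₀, s₀), (pencil A B C y.1 y.2 (Q y)).adjugate a b ≠ 0
  transversal : ∀ᶠ y in 𝓝 (u₀, s₀), ((pencil A B C y.1 y.2 (Q y)).adjugate * C y.1).trace ≠ 0
  smooth_A : SmoothField A u₀
  smooth_B : SmoothField B u₀
  smooth_C : SmoothField C u₀

theorem exists_pencilBranch {u₀ : Fin m → 𝕜} {s₀ q₀ : 𝕜} (hA : SmoothField A u₀)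
    (hB : SmoothField B u₀) (hC : SmoothField C u₀) (h0 : (pencil A B C u₀ s₀ q₀).det = 0)
    (ht : ((pencil A B C u₀ s₀ q₀).adjugate * C u₀).trace ≠ 0) :
    Nonempty (PencilBranch A B C u₀ s₀ q₀) := by
  set D : ((Fin m → 𝕜) × 𝕜) × 𝕜 → 𝕜 := fun z => (pencil A B C z.1.1 z.1.2 z.2).det with hD
  have i : SmoothNear 𝕜 (fun z : ((Fin m → 𝕜) × 𝕜) × 𝕜 => z) ((u₀, s₀), q₀) := smoothNear_id
  have hV := SmoothNear.pencil (x := ((u₀, s₀), q₀)) (U := fun z : ((Fin m → 𝕜) × 𝕜) × 𝕜 => z.1.1)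
    hA hB hC i.fst.fst i.fst.snd i.snd
  have hDs : SmoothNear 𝕜 D ((u₀, s₀), q₀) := SmoothNear.det hV
  have hder : fderiv 𝕜 D ((u₀, s₀), q₀) ∘L .inr 𝕜 _ _ =
      ContinuousLinearMap.toSpanSingleton 𝕜 (((pencil A B C u₀ s₀ q₀).adjugate * C u₀).trace) := by
    have c1 := hDs.differentiableAt.hasFDerivAt.comp q₀
      (hasFDerivAt_prodMk_right (𝕜 := 𝕜) (u₀, s₀) q₀)
    exact c1.unique (hasDerivAt_det (A u₀ + s₀ • B u₀) (C u₀) q₀).hasFDerivAt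
  obtain ⟨Q, h1, h2, h3, h4⟩ := hDs.exists_implicitFunction h0 (by
    rw [hder]
    refine ⟨ContinuousLinearEquiv.unitsEquivAut 𝕜 (Units.mk0 _ ht), ?_⟩
    ext
    simp)
  obtain ⟨a, b, hab⟩ := exists_adjugate_ne_zero ht
  have hι : SmoothNear 𝕜 (fun z : (Fin m → 𝕜) × 𝕜 => z) (u₀, s₀) := smoothNear_id
  have hV' := SmoothNear.pencil (x := (u₀, s₀)) (U := fun z : (Fin m → 𝕜) × 𝕜 => z.1)
    hA hB hC hι.fst hι.snd h1
  have hadj := fun a b => SmoothNear.adjugate hV' a b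
  refine ⟨⟨Q, a, b, h2, h1, h3, h4, ?_, ?_, hA, hB, hC⟩⟩
  · refine (hadj a b).continuousAt.eventually_ne ?_
    simpa only [h2] using hab
  · have : SmoothNear 𝕜 (fun y : (Fin m → 𝕜) × 𝕜 =>
        ((pencil A B C y.1 y.2 (Q y)).adjugate * C y.1).trace) (u₀, s₀) := by
      simp only [trace, diag_apply, mul_apply]
      exact SmoothNear.sum fun i _ => SmoothNear.sum fun j _ => (hadj i j).mul
        ((hC j i).comp_of_eq hι.fst rfl)
    refine this.continuousAt.eventually_ne ?_
    simpa only [h2] using ht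

namespace PencilBranch

variable {u₀ : Fin m → 𝕜} {s₀ q₀ : 𝕜} (β : PencilBranch A B C u₀ s₀ q₀)

/-- The matrix `A + s B + Q(u, s) C` of the branch. -/
def V (y : (Fin m → 𝕜) × 𝕜) : Matrix (Fin m) (Fin m) 𝕜 := pencil A B C y.1 y.2 (β.Q y)

/-- The kernel vector of `β.V`, a column of the adjugate matrix. -/
def ξ (y : (Fin m → 𝕜) × 𝕜) : Fin m → 𝕜 := fun k => (β.V y).adjugate k β.b

/-- The left kernel vector of `β.V`, a row of the adjugate matrix. -/
def η (y : (Fin m → 𝕜) × 𝕜) : Fin m → 𝕜 := fun k => (β.V y).adjugate β.a k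

theorem smooth_V (i j : Fin m) : SmoothNear 𝕜 (fun y => β.V y i j) (u₀, s₀) := by
  have hι : SmoothNear 𝕜 (fun z : (Fin m → 𝕜) × 𝕜 => z) (u₀, s₀) := smoothNear_id
  exact SmoothNear.pencil (x := (u₀, s₀)) (U := fun z : (Fin m → 𝕜) × 𝕜 => z.1)
    β.smooth_A β.smooth_B β.smooth_C hι.fst hι.snd β.smooth_Q i j

theorem smooth_ξ : SmoothNear 𝕜 β.ξ (u₀, s₀) :=
  SmoothNear.pi fun k => SmoothNear.adjugate β.smooth_V k β.b

theorem smooth_η : SmoothNear 𝕜 β.η (u₀, s₀) :=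
  SmoothNear.pi fun k => SmoothNear.adjugate β.smooth_V β.a k

theorem isSimplePair : ∀ᶠ y in 𝓝 (u₀, s₀), IsSimplePair (β.V y) (β.ξ y) (β.η y) := by
  filter_upwards [β.det_eq, β.pivot] with y h1 h2
  exact isSimplePair_adjugate h1 h2

theorem transversal' : ∀ᶠ y in 𝓝 (u₀, s₀), β.η y ⬝ᵥ C y.1 *ᵥ β.ξ y ≠ 0 := by
  filter_upwards [β.det_eq, β.pivot, β.transversal] with y h1 h2 h3
  have := adjugate_mul_trace (V := β.V y) h1 h2 (C y.1)
  change (fun k => (β.V y).adjugate β.a k) ⬝ᵥ C y.1 *ᵥ (fun k => (β.V y).adjugate k β.b) ≠ 0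
  rw [this]
  exact mul_ne_zero h2 h3

/-- Derivative of the equation `V ξ = 0` along the branch. -/
theorem deriv_kernel : ∀ᶠ y in 𝓝 (u₀, s₀), ∀ (h : Fin m → 𝕜) (σ : 𝕜),
    pencilDeriv A B C y.1 y.2 (β.Q y) h *ᵥ β.ξ y
      + (σ • B y.1 + fderiv 𝕜 β.Q y (h, σ) • C y.1) *ᵥ β.ξ y
      + β.V y *ᵥ fderiv 𝕜 β.ξ y (h, σ) = 0 := by
  have hc : Tendsto (fun y : (Fin m → 𝕜) × 𝕜 => y.1) (𝓝 (u₀, s₀)) (𝓝 u₀) := continuousAt_fst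
  filter_upwards [β.isSimplePair.eventually_nhds, β.smooth_Q.eventually, β.smooth_ξ.eventually,
    hc.eventually β.smooth_A.eventually, hc.eventually β.smooth_B.eventually,
    hc.eventually β.smooth_C.eventually] with y h1 h2 h3 h4 h5 h6 h σ
  have hι : SmoothNear 𝕜 (fun z : (Fin m → 𝕜) × 𝕜 => z) y := smoothNear_id
  have := pencilDeriv_mulVec_add (U := fun z : (Fin m → 𝕜) × 𝕜 => z.1) (x := y) h4 h5 h6 hι.fst
    hι.snd h2 h3 (h1.mono fun z hz => hz.mulVec_eq) (h, σ)
  simpa [fderiv_fst, fderiv_snd, V] using this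

end PencilBranch

end Pencil
end HydrodynamicType

namespace HydrodynamicType
open Filter Matrix

/-! ### Compatibility for a pair of branches -/

section Compatible

/-- The compatibility condition, at the point `u`, of the two equations `(A + sᵢ B + qᵢ C) ∂ᵢu = 0`,
where the point `(sᵢ, qᵢ)` moves along the line joining the two points when the other Riemann
invariant varies. The vector `x` stands for the mixed derivative `∂₀∂₁u`. -/
def Compatible {𝕜 : Type*} [RCLike 𝕜] {m : ℕ} (A B C : (Fin m → 𝕜) → Matrix (Fin m) (Fin m) 𝕜)
    (u : Fin m → 𝕜) (s q : Fin 2 → 𝕜) : Prop :=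
  ∀ ξ : Fin 2 → Fin m → 𝕜, (∀ i, pencil A B C u (s i) (q i) *ᵥ ξ i = 0) →
    ∃ (x : Fin m → 𝕜) (a : Fin 2 → 𝕜), ∀ i j, i ≠ j →
      pencil A B C u (s i) (q i) *ᵥ x + pencilDeriv A B C u (s i) (q i) (ξ j) *ᵥ ξ i
        + a i • (pencil A B C u (s j) (q j) - pencil A B C u (s i) (q i)) *ᵥ ξ i = 0

end Compatible

section BranchPair

universe v
variable {𝕜 : Type v} [RCLike 𝕜] {m : ℕ} {A B C : (Fin m → 𝕜) → Matrix (Fin m) (Fin m) 𝕜}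

/-- Two branches of the curve `det (A + s B + q C) = 0`, both transversal to the line joining their
base points. -/
structure TransversalBranches (A B C : (Fin m → 𝕜) → Matrix (Fin m) (Fin m) 𝕜) (u₀ : Fin m → 𝕜)
    (s₀ q₀ : Fin 2 → 𝕜) where
  β : ∀ i, PencilBranch A B C u₀ (s₀ i) (q₀ i)
  chord : ∀ i j, i ≠ j → ((pencil A B C u₀ (s₀ i) (q₀ i)).adjugate *
    (pencil A B C u₀ (s₀ j) (q₀ j) - pencil A B C u₀ (s₀ i) (q₀ i))).trace ≠ 0

theorem ne_one_sub (i : Fin 2) : i ≠ 1 - i := by fin_cases i <;> decide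

theorem eq_one_sub {i j : Fin 2} (h : i ≠ j) : j = 1 - i := by
  fin_cases i <;> fin_cases j <;> first | rfl | exact absurd rfl h

/-- It suffices to solve the compatibility conditions for spanning vectors of the two kernels. -/
theorem compatible_of_exists {u : Fin m → 𝕜} {s q : Fin 2 → 𝕜} {ξ : Fin 2 → Fin m → 𝕜}
    (hk : ∀ i y, pencil A B C u (s i) (q i) *ᵥ y = 0 → ∃ c : 𝕜, y = c • ξ i)
    {x : Fin m → 𝕜} {a : Fin 2 → 𝕜} (hx : ∀ i j, i ≠ j →
      pencil A B C u (s i) (q i) *ᵥ x + pencilDeriv A B C u (s i) (q i) (ξ j) *ᵥ ξ i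
        + a i • (pencil A B C u (s j) (q j) - pencil A B C u (s i) (q i)) *ᵥ ξ i = 0) :
    Compatible A B C u s q := by
  intro ξ' hξ'
  choose c hc using fun i => hk i (ξ' i) (hξ' i)
  refine ⟨(c 0 * c 1) • x, fun i => a i * c (1 - i), fun i j hij => ?_⟩
  have e : c 0 * c 1 = c i * c j := by
    fin_cases i <;> fin_cases j
    · exact absurd rfl hij
    · rfl
    · exact mul_comm _ _
    · exact absurd rfl hij
  dsimp only
  rw [hc i, hc j, e, ← eq_one_sub hij]
  have := congrArg (fun y => (c i * c j) • y) (hx i j hij)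
  simp only [smul_add, smul_zero] at this
  rw [← this, pencilDeriv_smul, smul_mulVec, mulVec_smul, mulVec_smul, mulVec_smul]
  module

namespace TransversalBranches

variable {u₀ : Fin m → 𝕜} {s₀ q₀ : Fin 2 → 𝕜} (P : TransversalBranches A B C u₀ s₀ q₀)

/-- The value of `qᵢ`, as a function of `(u, s₀, s₁)`. -/
def q (i : Fin 2) (y : (Fin m → 𝕜) × (Fin 2 → 𝕜)) : 𝕜 := (P.β i).Q (y.1, y.2 i)

/-- The matrix of the `i`-th branch, as a function of `(u, s₀, s₁)`. -/
def V (i : Fin 2) (y : (Fin m → 𝕜) × (Fin 2 → 𝕜)) : Matrix (Fin m) (Fin m) 𝕜 :=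
  (P.β i).V (y.1, y.2 i)

/-- The kernel vector of the `i`-th branch, as a function of `(u, s₀, s₁)`. -/
def ξ (i : Fin 2) (y : (Fin m → 𝕜) × (Fin 2 → 𝕜)) : Fin m → 𝕜 := (P.β i).ξ (y.1, y.2 i)

/-- The left kernel vector of the `i`-th branch, as a function of `(u, s₀, s₁)`. -/
def η (i : Fin 2) (y : (Fin m → 𝕜) × (Fin 2 → 𝕜)) : Fin m → 𝕜 := (P.β i).η (y.1, y.2 i)

/-- The velocity with which the `i`-th point moves along the line joining the two points, when `u`
moves in the direction `ξⱼ`, `j ≠ i`. -/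
noncomputable def γ (i : Fin 2) (y : (Fin m → 𝕜) × (Fin 2 → 𝕜)) : 𝕜 :=
  -(P.η i y ⬝ᵥ pencilDeriv A B C y.1 (y.2 i) (P.q i y) (P.ξ (1 - i) y) *ᵥ P.ξ i y) /
    (P.η i y ⬝ᵥ (P.V (1 - i) y - P.V i y) *ᵥ P.ξ i y)

/-- The derivative of `ξᵢ` in the direction `ξⱼ`, `j ≠ i`, with the line joining the two points
fixed. -/
noncomputable def δ (i : Fin 2) (y : (Fin m → 𝕜) × (Fin 2 → 𝕜)) : Fin m → 𝕜 :=
  fderiv 𝕜 (P.β i).ξ (y.1, y.2 i) (P.ξ (1 - i) y, P.γ i y * (y.2 (1 - i) - y.2 i))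

theorem smooth_pt (i : Fin 2) (y : (Fin m → 𝕜) × (Fin 2 → 𝕜)) :
    SmoothNear 𝕜 (fun y : (Fin m → 𝕜) × (Fin 2 → 𝕜) => (y.1, y.2 i)) y :=
  smoothNear_id.fst.prodMk (smoothNear_id.snd.apply i)

theorem tendsto_pt (i : Fin 2) : Tendsto (fun y : (Fin m → 𝕜) × (Fin 2 → 𝕜) => (y.1, y.2 i))
    (𝓝 (u₀, s₀)) (𝓝 (u₀, s₀ i)) := (smooth_pt i (u₀, s₀)).continuousAt

theorem smooth_q (i : Fin 2) : SmoothNear 𝕜 (P.q i) (u₀, s₀) :=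
  (P.β i).smooth_Q.comp_of_eq (smooth_pt i _) rfl

theorem smooth_V (i : Fin 2) (k l : Fin m) : SmoothNear 𝕜 (fun y => P.V i y k l) (u₀, s₀) :=
  ((P.β i).smooth_V k l).comp_of_eq (smooth_pt i _) rfl

theorem smooth_ξ (i : Fin 2) : SmoothNear 𝕜 (P.ξ i) (u₀, s₀) :=
  (P.β i).smooth_ξ.comp_of_eq (smooth_pt i _) rfl

theorem smooth_η (i : Fin 2) : SmoothNear 𝕜 (P.η i) (u₀, s₀) :=
  (P.β i).smooth_η.comp_of_eq (smooth_pt i _) rfl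

theorem isSimplePair : ∀ᶠ y in 𝓝 (u₀, s₀), ∀ i, IsSimplePair (P.V i y) (P.ξ i y) (P.η i y) :=
  eventually_all.2 fun i => (tendsto_pt i).eventually (P.β i).isSimplePair

theorem V_base (i : Fin 2) : P.V i (u₀, s₀) = pencil A B C u₀ (s₀ i) (q₀ i) := by
  simp only [V, PencilBranch.V, (P.β i).base]

theorem smooth_chord (i : Fin 2) : SmoothNear 𝕜
    (fun y => P.η i y ⬝ᵥ (P.V (1 - i) y - P.V i y) *ᵥ P.ξ i y) (u₀, s₀) :=
  (P.smooth_η i).dotProduct (SmoothNear.mulVec (M := fun y => P.V (1 - i) y - P.V i y)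
    (fun k l => (P.smooth_V (1 - i) k l).sub (P.smooth_V i k l)) (P.smooth_ξ i))

theorem chord_base (i : Fin 2) :
    P.η i (u₀, s₀) ⬝ᵥ (P.V (1 - i) (u₀, s₀) - P.V i (u₀, s₀)) *ᵥ P.ξ i (u₀, s₀) ≠ 0 := by
  have h1 := ((tendsto_pt i).eventually (P.β i).det_eq).self_of_nhds
  have h2 := ((tendsto_pt i).eventually (P.β i).pivot).self_of_nhds
  have := adjugate_mul_trace (V := P.V i (u₀, s₀)) h1 h2 (P.V (1 - i) (u₀, s₀) - P.V i (u₀, s₀))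
  change (fun k => (P.V i (u₀, s₀)).adjugate (P.β i).a k) ⬝ᵥ _ *ᵥ
    (fun k => (P.V i (u₀, s₀)).adjugate k (P.β i).b) ≠ 0
  rw [this]
  refine mul_ne_zero h2 ?_
  rw [P.V_base, P.V_base]
  exact P.chord i (1 - i) (ne_one_sub i)

theorem chord' : ∀ᶠ y in 𝓝 (u₀, s₀), ∀ i,
    P.η i y ⬝ᵥ (P.V (1 - i) y - P.V i y) *ᵥ P.ξ i y ≠ 0 :=
  eventually_all.2 fun i => (P.smooth_chord i).continuousAt.eventually_ne (P.chord_base i)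

theorem smooth_γ (i : Fin 2) : SmoothNear 𝕜 (P.γ i) (u₀, s₀) := by
  have hι : SmoothNear 𝕜 (fun y : (Fin m → 𝕜) × (Fin 2 → 𝕜) => y) (u₀, s₀) := smoothNear_id
  refine SmoothNear.div (SmoothNear.neg ?_) (P.smooth_chord i) (P.chord_base i)
  refine (P.smooth_η i).dotProduct (SmoothNear.mulVec (M := fun y : (Fin m → 𝕜) × (Fin 2 → 𝕜) =>
    pencilDeriv A B C y.1 (y.2 i) (P.q i y) (P.ξ (1 - i) y)) ?_ (P.smooth_ξ i))
  exact SmoothNear.pencilDeriv (x := (u₀, s₀)) (U := fun y : (Fin m → 𝕜) × (Fin 2 → 𝕜) => y.1)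
    (P.β i).smooth_A (P.β i).smooth_B (P.β i).smooth_C hι.fst (hι.snd.apply i) (P.smooth_q i)
    (P.smooth_ξ (1 - i))

theorem smooth_δ (i : Fin 2) : SmoothNear 𝕜 (P.δ i) (u₀, s₀) := by
  have hι : SmoothNear 𝕜 (fun y : (Fin m → 𝕜) × (Fin 2 → 𝕜) => y) (u₀, s₀) := smoothNear_id
  filter_upwards [(P.β i).smooth_ξ.fderiv.comp_of_eq (smooth_pt i (u₀, s₀)) rfl,
    (P.smooth_ξ (1 - i)).prodMk
      ((P.smooth_γ i).mul ((hι.snd.apply (1 - i)).sub (hι.snd.apply i)))] with y h1 h2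
  exact h1.clm_apply h2

theorem V_sub (i j : Fin 2) (y : (Fin m → 𝕜) × (Fin 2 → 𝕜)) :
    P.V j y - P.V i y = (y.2 j - y.2 i) • B y.1 + (P.q j y - P.q i y) • C y.1 := by
  simp only [V, PencilBranch.V, pencil, q, sub_smul]
  abel

/-- Along `ξⱼ`, the `i`-th point moves along the line joining the two points, and `ξᵢ` moves as the
derivative of its equation prescribes. -/
theorem deriv_along : ∀ᶠ y in 𝓝 (u₀, s₀), ∀ i,
    fderiv 𝕜 (P.β i).Q (y.1, y.2 i) (P.ξ (1 - i) y, P.γ i y * (y.2 (1 - i) - y.2 i))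
        = P.γ i y * (P.q (1 - i) y - P.q i y) ∧
      pencilDeriv A B C y.1 (y.2 i) (P.q i y) (P.ξ (1 - i) y) *ᵥ P.ξ i y
        + P.γ i y • (P.V (1 - i) y - P.V i y) *ᵥ P.ξ i y + P.V i y *ᵥ P.δ i y = 0 := by
  have hd := eventually_all.2 fun i => (tendsto_pt (s₀ := s₀) (u₀ := u₀) i).eventually
    (P.β i).deriv_kernel
  have ht := eventually_all.2 fun i => (tendsto_pt (s₀ := s₀) (u₀ := u₀) i).eventually
    (P.β i).transversal'
  filter_upwards [hd, ht, P.isSimplePair, P.chord'] with y h1 h2 h3 h4 i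
  have k1 := h1 i (P.ξ (1 - i) y) (P.γ i y * (y.2 (1 - i) - y.2 i))
  have k2 : P.η i y ⬝ᵥ C y.1 *ᵥ P.ξ i y ≠ 0 := h2 i
  set d := fderiv 𝕜 (P.β i).Q (y.1, y.2 i) (P.ξ (1 - i) y, P.γ i y * (y.2 (1 - i) - y.2 i))
  change pencilDeriv A B C y.1 (y.2 i) (P.q i y) (P.ξ (1 - i) y) *ᵥ P.ξ i y
      + ((P.γ i y * (y.2 (1 - i) - y.2 i)) • B y.1 + d • C y.1) *ᵥ P.ξ i y
      + P.V i y *ᵥ P.δ i y = 0 at k1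
  have k3 : P.η i y ⬝ᵥ pencilDeriv A B C y.1 (y.2 i) (P.q i y) (P.ξ (1 - i) y) *ᵥ P.ξ i y
      = -(P.γ i y * (P.η i y ⬝ᵥ (P.V (1 - i) y - P.V i y) *ᵥ P.ξ i y)) := by
    rw [γ, div_mul_cancel₀ _ (h4 i), neg_neg]
  have hdeq : d = P.γ i y * (P.q (1 - i) y - P.q i y) := by
    have := congrArg (fun x => P.η i y ⬝ᵥ x) k1
    simp only [dotProduct_add, k3, dotProduct_mulVec (P.η i y) (P.V i y), (h3 i).vecMul_eq,
      zero_dotProduct, dotProduct_zero, P.V_sub, add_mulVec, smul_mulVec, dotProduct_smul,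
      smul_eq_mul] at this
    refine mul_right_cancel₀ k2 ?_
    linear_combination this
  refine ⟨hdeq, ?_⟩
  rw [← k1, hdeq, P.V_sub, ← smul_mulVec, smul_add, ← mul_smul, ← mul_smul]

theorem ne_smul : ∀ᶠ y in 𝓝 (u₀, s₀), ∀ c : 𝕜, P.ξ 1 y ≠ c • P.ξ 0 y := by
  filter_upwards [P.isSimplePair, P.chord'] with y h1 h2 c hc
  have e1 := (h1 1).mulVec_eq
  rw [hc, mulVec_smul] at e1
  have hc0 : c ≠ 0 := by
    rintro rfl
    exact (h1 1).ne_zero (by rw [hc, zero_smul])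
  have e2 : P.V 1 y *ᵥ P.ξ 0 y = 0 := (smul_eq_zero.1 e1).resolve_left hc0
  refine h2 0 ?_
  rw [sub_mulVec, (h1 0).mulVec_eq, sub_zero]
  change P.η 0 y ⬝ᵥ P.V 1 y *ᵥ P.ξ 0 y = 0
  rw [e2, dotProduct_zero]

theorem exists_minor : ∃ r s, P.ξ 0 (u₀, s₀) r * P.ξ 1 (u₀, s₀) s
    - P.ξ 0 (u₀, s₀) s * P.ξ 1 (u₀, s₀) r ≠ 0 :=
  exists_minor_ne_zero (P.isSimplePair.self_of_nhds 0).ne_zero P.ne_smul.self_of_nhds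

/-- The rows of a nonvanishing minor of the matrix with the columns `ξ₀`, `ξ₁`. -/
noncomputable def rows : Fin m × Fin m :=
  (P.exists_minor.choose, P.exists_minor.choose_spec.choose)

/-- The minor of two vectors in the rows `P.rows`. -/
noncomputable def minor (x y : Fin m → 𝕜) : 𝕜 := x P.rows.1 * y P.rows.2 - x P.rows.2 * y P.rows.1

theorem minor_base : P.minor (P.ξ 0 (u₀, s₀)) (P.ξ 1 (u₀, s₀)) ≠ 0 :=
  P.exists_minor.choose_spec.choose_spec

theorem smooth_minor {X : Type*} [NormedAddCommGroup X] [NormedSpace 𝕜 X] {f g : X → Fin m → 𝕜}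
    {x : X} (hf : SmoothNear 𝕜 f x) (hg : SmoothNear 𝕜 g x) :
    SmoothNear 𝕜 (fun x => P.minor (f x) (g x)) x :=
  ((hf.apply _).mul (hg.apply _)).sub ((hf.apply _).mul (hg.apply _))

theorem minor_ne_zero : ∀ᶠ y in 𝓝 (u₀, s₀), P.minor (P.ξ 0 y) (P.ξ 1 y) ≠ 0 :=
  (P.smooth_minor (P.smooth_ξ 0) (P.smooth_ξ 1)).continuousAt.eventually_ne P.minor_base

theorem eq_of_minor_ne_zero {x y : Fin m → 𝕜} (h : P.minor x y ≠ 0) {a b a' b' : 𝕜}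
    (hab : a • x + b • y = a' • x + b' • y) : a = a' ∧ b = b' := by
  have h1 := congrFun hab P.rows.1
  have h2 := congrFun hab P.rows.2
  simp only [Pi.add_apply, Pi.smul_apply, smul_eq_mul] at h1 h2
  constructor <;> refine mul_right_cancel₀ h ?_ <;> simp only [minor]
  · linear_combination y P.rows.2 * h1 - y P.rows.1 * h2
  · linear_combination x P.rows.1 * h2 - x P.rows.2 * h1

/-- The coefficients of `ξ₀` and `ξ₁` in a relation `κ₀ ξ₀ + δ₀ = κ₁ ξ₁ + δ₁`, as they are given by
Cramer's rule. The relation itself is equivalent to compatibility. -/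
noncomputable def κ : Fin 2 → (Fin m → 𝕜) × (Fin 2 → 𝕜) → 𝕜 :=
  ![fun y => P.minor (P.δ 1 y - P.δ 0 y) (P.ξ 1 y) / P.minor (P.ξ 0 y) (P.ξ 1 y),
    fun y => P.minor (P.δ 1 y - P.δ 0 y) (P.ξ 0 y) / P.minor (P.ξ 0 y) (P.ξ 1 y)]

theorem smooth_κ (i : Fin 2) : SmoothNear 𝕜 (P.κ i) (u₀, s₀) := by
  have h := (P.smooth_δ 1).sub (P.smooth_δ 0)
  have h' := P.smooth_minor (P.smooth_ξ 0) (P.smooth_ξ 1)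
  fin_cases i
  · exact (P.smooth_minor h (P.smooth_ξ 1)).div h' P.minor_base
  · exact (P.smooth_minor h (P.smooth_ξ 0)).div h' P.minor_base

/-- The vectors on the two sides are the coefficients of `p₀ p₁` in the mixed derivatives `∂₁∂₀u` and
`∂₀∂₁u` for `∂ᵢu = pᵢ ξᵢ`, so compatibility says that these agree. -/
theorem compatible_iff : ∀ᶠ y in 𝓝 (u₀, s₀),
    (Compatible A B C y.1 y.2 fun i => (P.β i).Q (y.1, y.2 i)) ↔
      P.κ 0 y • P.ξ 0 y + P.δ 0 y = P.κ 1 y • P.ξ 1 y + P.δ 1 y := by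
  filter_upwards [P.isSimplePair, P.chord', P.deriv_along, P.minor_ne_zero] with y h1 h2 h3 h4
  constructor
  · intro h5
    obtain ⟨x, a, hx⟩ := h5 (fun i => P.ξ i y) fun i => (h1 i).mulVec_eq
    have key : ∀ i, ∃ c : 𝕜, P.δ i y - x = c • P.ξ i y := by
      intro i
      have e1 := (h3 i).2
      have e2 : P.V i y *ᵥ x + pencilDeriv A B C y.1 (y.2 i) (P.q i y) (P.ξ (1 - i) y) *ᵥ P.ξ i y
        + a i • (P.V (1 - i) y - P.V i y) *ᵥ P.ξ i y = 0 := hx i (1 - i) (ne_one_sub i)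
      have e3 : P.V i y *ᵥ (P.δ i y - x)
          + (P.γ i y - a i) • (P.V (1 - i) y - P.V i y) *ᵥ P.ξ i y = 0 := by
        rw [mulVec_sub, sub_smul]
        rw [← sub_eq_zero.2 (e1.trans e2.symm)]
        abel
      have e4 := (h1 i).smul_eq_zero (h2 i) e3
      rw [e4, zero_smul, add_zero] at e3
      exact (h1 i).ker _ e3
    obtain ⟨c₀, hc₀⟩ := key 0
    obtain ⟨c₁, hc₁⟩ := key 1
    have hW : P.δ 1 y - P.δ 0 y = c₁ • P.ξ 1 y - c₀ • P.ξ 0 y := by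
      rw [← hc₀, ← hc₁]; abel
    have k0 : P.κ 0 y = -c₀ := by
      simp only [κ, cons_val_zero]
      rw [div_eq_iff h4, hW]
      simp only [minor, Pi.sub_apply, Pi.smul_apply, smul_eq_mul]; ring
    have k1 : P.κ 1 y = -c₁ := by
      simp only [κ, cons_val_one, cons_val_fin_one]
      rw [div_eq_iff h4, hW]
      simp only [minor, Pi.sub_apply, Pi.smul_apply, smul_eq_mul]; ring
    rw [k0, k1, neg_smul, neg_smul, ← hc₀, ← hc₁]; abel
  · intro h5
    refine compatible_of_exists (ξ := fun i => P.ξ i y) (fun i => (h1 i).ker)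
      (x := P.κ 0 y • P.ξ 0 y + P.δ 0 y) (a := fun i => P.γ i y) fun i j hij => ?_
    obtain rfl := eq_one_sub hij
    have hx : ∀ i, P.κ 0 y • P.ξ 0 y + P.δ 0 y = P.κ i y • P.ξ i y + P.δ i y := fun i => by
      fin_cases i
      exacts [rfl, h5]
    have e1 := (h3 i).2
    rw [hx i]
    change P.V i y *ᵥ _ + pencilDeriv A B C y.1 (y.2 i) (P.q i y) (P.ξ (1 - i) y) *ᵥ P.ξ i y
      + P.γ i y • (P.V (1 - i) y - P.V i y) *ᵥ P.ξ i y = 0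
    rw [mulVec_add, mulVec_smul, (h1 i).mulVec_eq, smul_zero, zero_add, ← e1]
    abel

/-- Compatibility is a closed condition. -/
theorem compatible_of_frequently
    (h : ∃ᶠ y in 𝓝 (u₀, s₀), Compatible A B C y.1 y.2 fun i => (P.β i).Q (y.1, y.2 i)) :
    Compatible A B C u₀ s₀ q₀ := by
  have hc : ∀ i, ContinuousAt (fun y => P.κ i y • P.ξ i y + P.δ i y) (u₀, s₀) := fun i =>
    (((P.smooth_κ i).smul (P.smooth_ξ i)).add (P.smooth_δ i)).continuousAt
  have he : P.κ 0 (u₀, s₀) • P.ξ 0 (u₀, s₀) + P.δ 0 (u₀, s₀)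
      = P.κ 1 (u₀, s₀) • P.ξ 1 (u₀, s₀) + P.δ 1 (u₀, s₀) := by
    by_contra hne
    refine (h.and_eventually (P.compatible_iff.and ((hc 0).sub (hc 1) |>.eventually_ne
      (sub_ne_zero.2 hne)))).exists.elim fun y hy => ?_
    exact hy.2.2 (sub_eq_zero.2 (hy.2.1.1 hy.1))
  have := P.compatible_iff.self_of_nhds.2 he
  simpa only [(P.β _).base] using this

end TransversalBranches

/-- Two branches of the curve `det (A + s B + q C) = 0`, both transversal to the line joining their
base points, such that all pairs of nearby points of the two branches are compatible. -/
structure BranchPair (A B C : (Fin m → 𝕜) → Matrix (Fin m) (Fin m) 𝕜) (u₀ : Fin m → 𝕜)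
    (s₀ q₀ : Fin 2 → 𝕜) extends TransversalBranches A B C u₀ s₀ q₀ where
  compatible : ∀ᶠ y in 𝓝 (u₀, s₀), Compatible A B C y.1 y.2 fun i => (β i).Q (y.1, y.2 i)

/-- The coefficients of the system for two-component reductions with speeds near the base points. -/
noncomputable def BranchPair.coefficients {u₀ : Fin m → 𝕜} {s₀ q₀ : Fin 2 → 𝕜}
    (P : BranchPair A B C u₀ s₀ q₀) : WaveCoefficients 𝕜 m u₀ s₀ where
  ξ i := (P.β i).ξ
  γ := P.γ
  κ := P.κ
  smooth_ξ i := (P.β i).smooth_ξ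
  smooth_γ := P.smooth_γ
  smooth_κ := P.smooth_κ
  compat := by
    filter_upwards [P.compatible_iff, P.compatible] with y h1 h2 using h1.1 h2

end BranchPair
end HydrodynamicType

namespace HydrodynamicType
open Filter Matrix

/-! ### Ordinary differential equations -/

section OrdinaryDifferentialEquations

theorem eventuallyEq_of_deriv_eq {𝕜 E : Type*} [RCLike 𝕜] [NormedAddCommGroup E] [NormedSpace 𝕜 E]
    {f g : 𝕜 → E} (hf : SmoothNear 𝕜 f 0) (hg : SmoothNear 𝕜 g 0)
    (h0 : f 0 = g 0) (h : ∀ᶠ t in 𝓝 0, deriv f t = deriv g t) : f =ᶠ[𝓝 0] g := by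
  obtain ⟨ε, hε, h1⟩ := Metric.eventually_nhds_iff_ball.1
    ((hf.eventually_differentiableAt.and hg.eventually_differentiableAt).and h)
  filter_upwards [Metric.ball_mem_nhds (0 : 𝕜) hε] with t ht
  have hc := (convex_ball (0 : 𝕜) ε).is_const_of_fderivWithin_eq_zero (𝕜 := 𝕜)
    (f := fun t => f t - g t) (fun t ht => ((h1 t ht).1.1.sub (h1 t ht).1.2).differentiableWithinAt)
    (fun t ht => by
      rw [fderivWithin_of_isOpen Metric.isOpen_ball ht, fderiv_fun_sub (h1 t ht).1.1 (h1 t ht).1.2]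
      ext
      simpa using sub_eq_zero.2 (h1 t ht).2) ht (Metric.mem_ball_self hε)
  simpa [h0, sub_eq_zero] using hc

universe v
variable {𝕜 : Type v} [RCLike 𝕜] {E : Type v} [NormedAddCommGroup E] [NormedSpace 𝕜 E]
  [NormedSpace ℝ E] [IsScalarTower ℝ 𝕜 E] [CompleteSpace E]

/-- Local solvability of ordinary differential equations with a smooth (if `𝕜 = ℂ`, holomorphic)
right-hand side, with a smooth solution. -/
theorem exists_smoothNear_deriv_eq {g : 𝕜 × E → E} {x₀ : E} (hg : SmoothNear 𝕜 g (0, x₀)) :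
    ∃ x : 𝕜 → E, SmoothNear 𝕜 x 0 ∧ x 0 = x₀ ∧ ∀ᶠ t in 𝓝 0, deriv x t = g (t, x t) := by
  obtain ⟨Z, hZ, hZ0, -, hZd⟩ := exists_characteristicSystem (E₁ := 𝕜 × E) (E₂ := 𝕜)
    (F := fun z => (1, g z.1)) (G := fun _ => 0) (X₀ := fun _ => ((0 : 𝕜), x₀)) (Y₀ := fun _ => 0)
    ((smoothNear_const _).prodMk (hg.comp_of_eq smoothNear_id.fst rfl)) (smoothNear_const _)
    (smoothNear_const _) (smoothNear_const _)
  set e : 𝕜 → Fin 2 → 𝕜 := fun t => Pi.single 0 t with he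
  have hed : ∀ t, HasDerivAt e (Pi.single 0 1) t := fun t => by
    simpa [he] using (ContinuousLinearMap.single 𝕜 (fun _ : Fin 2 => 𝕜) 0).hasFDerivAt.hasDerivAt
      (x := t)
  have hes : SmoothNear 𝕜 e 0 :=
    (ContinuousLinearMap.single 𝕜 (fun _ : Fin 2 => 𝕜) 0).contDiff.smoothNear
  have he0 : e 0 = 0 := by simp [he]
  set X : 𝕜 → 𝕜 × E := fun t => (Z (e t)).1 with hX
  have hXs : SmoothNear 𝕜 X 0 := hZ.fst.comp_of_eq hes he0
  have hX0 : X 0 = (0, x₀) := by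
    have := hZd.self_of_nhds
    simp only [hX, he0]
    rw [show (0 : Fin 2 → 𝕜) = fun _ => 0 from rfl, this]
  have htend : Tendsto e (𝓝 0) (𝓝 0) := by
    simpa [he0] using hes.continuousAt.tendsto
  have hXd : ∀ᶠ t in 𝓝 0, HasDerivAt X (1, g (X t)) t := by
    filter_upwards [htend.eventually hZ0, htend.eventually hZ.fst.eventually_differentiableAt]
      with t h1 h2
    have := h2.hasFDerivAt.comp_hasDerivAt t (hed t)
    rwa [show fderiv 𝕜 (fun y => (Z y).1) (e t) (Pi.single 0 1) = _ from h1] at this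
  have hτ : (fun t => (X t).1) =ᶠ[𝓝 0] fun t => t := by
    refine eventuallyEq_of_deriv_eq hXs.fst smoothNear_id (congrArg Prod.fst hX0) ?_
    filter_upwards [hXd] with t ht
    rw [deriv_id'']
    exact (hasFDerivAt_fst.comp_hasDerivAt t ht).deriv
  refine ⟨fun t => (X t).2, hXs.snd, congrArg Prod.snd hX0, ?_⟩
  filter_upwards [hXd, hτ] with t ht h1
  refine (hasFDerivAt_snd.comp_hasDerivAt t ht).deriv.trans ?_
  exact congrArg g (Prod.ext h1 rfl)

/-- Uniqueness for ordinary differential equations, from that for systems in characteristic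
coordinates. -/
theorem eventuallyEq_of_deriv_eq_comp {g : 𝕜 × E → E} {x x' : 𝕜 → E}
    (hg : SmoothNear 𝕜 g (0, x 0)) (hx : SmoothNear 𝕜 x 0) (hx' : SmoothNear 𝕜 x' 0)
    (h0 : x 0 = x' 0) (h : ∀ᶠ t in 𝓝 0, deriv x t = g (t, x t))
    (h' : ∀ᶠ t in 𝓝 0, deriv x' t = g (t, x' t)) : x =ᶠ[𝓝 0] x' := by
  -- the solutions are read as functions of the difference of two variables
  set d : (Fin 2 → 𝕜) → 𝕜 := fun R => R 0 - R 1 with hd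
  have hds : ∀ R, SmoothNear 𝕜 d R := fun R => (smoothNear_id.apply 0).sub (smoothNear_id.apply 1)
  have hdd : ∀ R, pd 0 d R = 1 := fun R => by
    have e : ∀ i : Fin 2, DifferentiableAt 𝕜 (fun R : Fin 2 → 𝕜 => R i) R := fun i =>
      (smoothNear_id.apply i).differentiableAt
    rw [hd, pd_sub (e 0) (e 1), pd_apply differentiableAt_fun_id, pd_apply differentiableAt_fun_id]
    simp [pd]
  have hd0 : d 0 = 0 := by simp [hd]
  have htend : Tendsto d (𝓝 0) (𝓝 0) := by
    simpa [hd0] using (hds 0).continuousAt.tendsto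
  have key : ∀ y : 𝕜 → E, SmoothNear 𝕜 y 0 → (∀ᶠ t in 𝓝 0, deriv y t = g (t, y t)) →
      SmoothNear 𝕜 (fun R => (((d R, y (d R)), 0) : (𝕜 × E) × 𝕜)) 0 ∧
      (∀ᶠ R in 𝓝 0, pd 0 (fun R => (d R, y (d R))) R = (1, g (d R, y (d R)))) := by
    intro y hy hyd
    refine ⟨((hds 0).prodMk (hy.comp_of_eq (hds 0) hd0)).prodMk (smoothNear_const _), ?_⟩
    filter_upwards [htend.eventually hyd, htend.eventually hy.eventually_differentiableAt]
      with R h1 h2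
    rw [pd_prodMk (hds R).differentiableAt
      (DifferentiableAt.fun_comp' (g := y) R h2 (hds R).differentiableAt),
      pd_comp h2 (hds R).differentiableAt, hdd, ← h1]
    simp
  obtain ⟨k1, k2⟩ := key x hx h
  obtain ⟨k1', k2'⟩ := key x' hx' h'
  have := eventuallyEq_of_characteristicSystem (F := fun z : (𝕜 × E) × 𝕜 => ((1 : 𝕜), g z.1))
    (G := fun _ => 0) ((smoothNear_const _).prodMk (hg.comp_of_eq smoothNear_id.fst (by simp [hd0])))
    (smoothNear_const _) k1 k1' k2 (Eventually.of_forall fun R => by simp [pd]) k2'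
    (Eventually.of_forall fun R => by simp [pd]) (Eventually.of_forall fun a => by simp [hd, h0])
  have he : Tendsto (fun t : 𝕜 => (Pi.single 0 t : Fin 2 → 𝕜)) (𝓝 0) (𝓝 0) := by
    have : Continuous (fun t : 𝕜 => (Pi.single 0 t : Fin 2 → 𝕜)) := continuous_single (A := fun _ : Fin 2 => 𝕜) 0
    simpa using this.tendsto 0
  filter_upwards [he.eventually this] with t ht
  simpa [hd] using congrArg (fun z => z.1.2) ht

end OrdinaryDifferentialEquations

/-! ### Reductions from solutions of the system -/

section ReductionFromWave

universe v
variable {𝕜 : Type v} [RCLike 𝕜] {m : ℕ} {A B C : (Fin m → 𝕜) → Matrix (Fin m) (Fin m) 𝕜}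
  {u₀ : Fin m → 𝕜} {s₀ q₀ : Fin 2 → 𝕜} {P : BranchPair A B C u₀ s₀ q₀}
  {u : (Fin 2 → 𝕜) → Fin m → 𝕜} {s p w : Fin 2 → (Fin 2 → 𝕜) → 𝕜}

namespace IsWaveSolution

theorem smooth_point (h : IsWaveSolution P.coefficients u s p w) :
    SmoothNear 𝕜 (fun R => (u R, fun k => s k R)) 0 :=
  h.smooth_u.prodMk (SmoothNear.pi h.smooth_s)

theorem point_zero (h : IsWaveSolution P.coefficients u s p w) :
    (u 0, fun k => s k 0) = (u₀, s₀) := by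
  ext1
  · exact h.u_zero
  · exact funext h.s_zero

theorem tendsto_point (h : IsWaveSolution P.coefficients u s p w) :
    Tendsto (fun R => (u R, fun k => s k R)) (𝓝 0) (𝓝 (u₀, s₀)) := by
  simpa only [h.point_zero] using h.smooth_point.continuousAt.tendsto

theorem smooth_q (h : IsWaveSolution P.coefficients u s p w) (i : Fin 2) :
    SmoothNear 𝕜 (fun R => P.q i (u R, fun k => s k R)) 0 :=
  (P.smooth_q i).comp_of_eq h.smooth_point h.point_zero

theorem pd_q (h : IsWaveSolution P.coefficients u s p w) : ∀ᶠ R in 𝓝 0, ∀ i j, i ≠ j →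
    pd j (fun R => P.q i (u R, fun k => s k R)) R = p j R * P.γ i (u R, fun k => s k R) *
      (P.q j (u R, fun k => s k R) - P.q i (u R, fun k => s k R)) := by
  have hQ := eventually_all.2 fun i => h.tendsto_point.eventually
    ((TransversalBranches.tendsto_pt (u₀ := u₀) (s₀ := s₀) i).eventually (P.β i).smooth_Q.eventually_differentiableAt)
  filter_upwards [hQ, h.tendsto_point.eventually P.deriv_along, h.eq_u, h.eq_s,
    h.smooth_u.eventually_differentiableAt,
    eventually_all.2 fun i => (h.smooth_s i).eventually_differentiableAt] with R h1 h2 h3 h4 h5 h6 i j hij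
  obtain rfl := eq_one_sub hij
  have e : pd (1 - i) (fun R => P.q i (u R, fun k => s k R)) R
      = fderiv 𝕜 (P.β i).Q (u R, s i R) (pd (1 - i) (fun R => (u R, s i R)) R) :=
    pd_comp (g := (P.β i).Q) (f := fun R => (u R, s i R)) (h1 i) (h5.prodMk (h6 i))
  have e2 : (pd (1 - i) u R, pd (1 - i) (s i) R) = p (1 - i) R •
      (P.ξ (1 - i) (u R, fun k => s k R),
        P.γ i (u R, fun k => s k R) * (s (1 - i) R - s i R)) := by
    rw [h3, h4 i (1 - i) hij, Prod.smul_mk, smul_eq_mul, mul_assoc]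
    rfl
  rw [e, pd_prodMk h5 (h6 i), e2, map_smul, (h2 i).1, smul_eq_mul, mul_assoc]

end IsWaveSolution

/-- A solution of the system with the coefficients of a pair of compatible branches, with nonzero
`pᵢ`, is a two-component reduction with the speeds of these branches. Here the branches are
parametrized by `s` and `q`, for which `(λ, μ) = s e + q n` with linearly independent `e`, `n`. -/
theorem exists_isReduction {A B B' C' : (Fin m → 𝕜) → Matrix (Fin m) (Fin m) 𝕜} {e n : 𝕜 × 𝕜}
    (hen : e.1 * n.2 - e.2 * n.1 ≠ 0)
    (hB' : ∀ u, B' u = e.2 • B u + e.1 • (1 : Matrix (Fin m) (Fin m) 𝕜))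
    (hC' : ∀ u, C' u = n.2 • B u + n.1 • (1 : Matrix (Fin m) (Fin m) 𝕜))
    {P : BranchPair A B' C' u₀ s₀ q₀} (h : IsWaveSolution P.coefficients u s p w)
    (hp : ∀ i, p i 0 ≠ 0) {U : Set (Fin m → 𝕜)} (hU : IsOpen U) (hu₀ : u₀ ∈ U) :
    ∃ Ω, (0 : Fin 2 → 𝕜) ∈ Ω ∧ IsReduction A B U Ω u
      (fun i R => s i R * e.1 + P.q i (u R, fun k => s k R) * n.1)
      (fun i R => s i R * e.2 + P.q i (u R, fun k => s k R) * n.2) := by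
  have hq := h.smooth_q
  have hlam : ∀ i, SmoothNear 𝕜
      (fun R => s i R * e.1 + P.q i (u R, fun k => s k R) * n.1) 0 := fun i =>
    ((h.smooth_s i).mul (smoothNear_const _)).add ((hq i).mul (smoothNear_const _))
  have hmu : ∀ i, SmoothNear 𝕜
      (fun R => s i R * e.2 + P.q i (u R, fun k => s k R) * n.2) 0 := fun i =>
    ((h.smooth_s i).mul (smoothNear_const _)).add ((hq i).mul (smoothNear_const _))
  have hmapsTo : ∀ᶠ R in 𝓝 0, u R ∈ U :=
    h.smooth_u.continuousAt.eventually_mem (by rw [h.u_zero]; exact hU.mem_nhds hu₀)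
  have hp' : ∀ᶠ R in 𝓝 0, ∀ i, p i R ≠ 0 :=
    eventually_all.2 fun i => (h.smooth_p i).continuousAt.eventually_ne (hp i)
  have hpencil : ∀ i R, A (u R) + (s i R * e.2 + P.q i (u R, fun k => s k R) * n.2) • B (u R)
      + (s i R * e.1 + P.q i (u R, fun k => s k R) * n.1) • (1 : Matrix (Fin m) (Fin m) 𝕜)
      = P.V i (u R, fun k => s k R) := by
    intro i R
    change _ = A (u R) + s i R • B' (u R) + P.q i (u R, fun k => s k R) • C' (u R)
    rw [hB', hC']
    module
  have hall : ∀ᶠ R in 𝓝 0, u R ∈ U ∧ SmoothNear 𝕜 u R ∧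
      (∀ i, SmoothNear 𝕜 (fun R => s i R * e.1 + P.q i (u R, fun k => s k R) * n.1) R) ∧
      (∀ i, SmoothNear 𝕜 (fun R => s i R * e.2 + P.q i (u R, fun k => s k R) * n.2) R) ∧
      LinearIndependent 𝕜 (fun i : Fin 2 => pd i u R) ∧
      (s 0 R * e.1 + P.q 0 (u R, fun k => s k R) * n.1,
        s 0 R * e.2 + P.q 0 (u R, fun k => s k R) * n.2)
        ≠ (s 1 R * e.1 + P.q 1 (u R, fun k => s k R) * n.1,
          s 1 R * e.2 + P.q 1 (u R, fun k => s k R) * n.2) ∧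
      (∀ i, P.V i (u R, fun k => s k R) *ᵥ pd i u R = 0) ∧
      ∀ i j, i ≠ j →
        pd j (fun R => s i R * e.1 + P.q i (u R, fun k => s k R) * n.1) R
          * ((s j R * e.2 + P.q j (u R, fun k => s k R) * n.2)
            - (s i R * e.2 + P.q i (u R, fun k => s k R) * n.2))
        = pd j (fun R => s i R * e.2 + P.q i (u R, fun k => s k R) * n.2) R
          * ((s j R * e.1 + P.q j (u R, fun k => s k R) * n.1)
            - (s i R * e.1 + P.q i (u R, fun k => s k R) * n.1)) := by
    filter_upwards [hmapsTo, h.smooth_u.eventually, eventually_all.2 fun i => (hlam i).eventually,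
      eventually_all.2 fun i => (hmu i).eventually, hp', h.eq_u, h.eq_s, h.pd_q,
      h.tendsto_point.eventually P.isSimplePair, h.tendsto_point.eventually P.ne_smul,
      h.tendsto_point.eventually P.chord',
      eventually_all.2 fun i => (h.smooth_s i).eventually_differentiableAt,
      eventually_all.2 fun i => (hq i).eventually_differentiableAt]
      with R h1 h2 h3 h4 h5 h6 h7 h8 h9 h10 h11 h12 h13
    refine ⟨h1, h2, h3, h4, ?_, ?_, ?_, ?_⟩
    · rw [show (fun i : Fin 2 => pd i u R) = ![pd 0 u R, pd 1 u R] from by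
        ext i; fin_cases i <;> rfl, LinearIndependent.pair_iff]
      intro a b hab
      rw [h6, h6] at hab
      change a • p 0 R • P.ξ 0 (u R, fun k => s k R) + b • p 1 R • P.ξ 1 (u R, fun k => s k R) = 0
        at hab
      have hb : b = 0 := by
        by_contra hb
        refine h10 (-(b * p 1 R)⁻¹ * (a * p 0 R)) ?_
        have hc : b * p 1 R ≠ 0 := mul_ne_zero hb (h5 1)
        rw [smul_smul, smul_smul] at hab
        have : P.ξ 1 (u R, fun k => s k R) = (b * p 1 R)⁻¹ • (b * p 1 R) •
          P.ξ 1 (u R, fun k => s k R) := by rw [smul_smul, inv_mul_cancel₀ hc, one_smul]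
        rw [this, eq_neg_of_add_eq_zero_right hab, smul_neg, smul_smul, neg_mul, neg_smul]
      rw [hb, zero_smul, add_zero, smul_smul] at hab
      exact ⟨(mul_eq_zero.1 ((smul_eq_zero.1 hab).resolve_right (h9 0).ne_zero)).resolve_right
        (h5 0), hb⟩
    · intro heq
      rw [Prod.mk.injEq] at heq
      obtain ⟨k1, k2⟩ := heq
      have ks : s 1 R - s 0 R = 0 := by
        refine (mul_eq_zero.1 ?_).resolve_right hen
        linear_combination (-n.2) * k1 + n.1 * k2
      have kq : P.q 1 (u R, fun k => s k R) - P.q 0 (u R, fun k => s k R) = 0 := by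
        refine (mul_eq_zero.1 ?_).resolve_right hen
        linear_combination e.2 * k1 - e.1 * k2
      refine h11 0 ?_
      change P.η 0 _ ⬝ᵥ (P.V 1 _ - P.V 0 _) *ᵥ P.ξ 0 _ = 0
      rw [P.V_sub]
      change P.η 0 _ ⬝ᵥ ((s 1 R - s 0 R) • _ + _) *ᵥ P.ξ 0 _ = 0
      rw [ks, kq]
      simp
    · intro i
      rw [h6, mulVec_smul]
      change p i R • P.V i (u R, fun k => s k R) *ᵥ P.ξ i (u R, fun k => s k R) = 0
      rw [(h9 i).mulVec_eq, smul_zero]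
    · intro i j hij
      have hd : ∀ a b : 𝕜, pd j (fun R => s i R * a + P.q i (u R, fun k => s k R) * b) R
          = pd j (s i) R * a + pd j (fun R => P.q i (u R, fun k => s k R)) R * b := by
        intro a b
        have hc : ∀ (f : (Fin 2 → 𝕜) → 𝕜) (a : 𝕜), DifferentiableAt 𝕜 f R →
            pd j (fun R => f R * a) R = pd j f R * a := by
          intro f a hf
          rw [pd_mul hf (differentiableAt_const a)]
          simp [pd]
        rw [pd_add ((h12 i).mul_const a) ((h13 i).mul_const b), hc _ _ (h12 i), hc _ _ (h13 i)]
      rw [hd, hd, h7 i j hij, h8 i j hij]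
      change (p j R * P.γ i (u R, fun k => s k R) * (s j R - s i R) * _ + _) * _
        = (p j R * P.γ i (u R, fun k => s k R) * (s j R - s i R) * _ + _) * _
      ring
  obtain ⟨Ω, hΩ, hΩo, h0⟩ := eventually_nhds_iff.1 hall
  refine ⟨Ω, h0, ⟨hΩo, fun R hR => (hΩ R hR).1, SmoothNear.contDiffOn fun R hR => (hΩ R hR).2.1,
    fun i => SmoothNear.contDiffOn fun R hR => (hΩ R hR).2.2.1 i,
    fun i => SmoothNear.contDiffOn fun R hR => (hΩ R hR).2.2.2.1 i,
    fun R hR => (hΩ R hR).2.2.2.2.1, fun R hR => (hΩ R hR).2.2.2.2.2.1, fun R hR i => ?_,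
    fun R hR => (hΩ R hR).2.2.2.2.2.2.2⟩⟩
  rw [hpencil]
  exact (hΩ R hR).2.2.2.2.2.2.1 i

end ReductionFromWave
end HydrodynamicType

namespace HydrodynamicType
open Filter Matrix

/-! ### Pairs of points in general position -/

section GenericPairs

variable {𝕜 : Type*} [RCLike 𝕜] {m : ℕ} {A B : (Fin m → 𝕜) → Matrix (Fin m) (Fin m) 𝕜}

/-- The matrix `A + μ B + λ E` whose determinant defines the dispersion curve. -/
def symbol (A B : (Fin m → 𝕜) → Matrix (Fin m) (Fin m) 𝕜) (u : Fin m → 𝕜) (mu lam : 𝕜) :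
    Matrix (Fin m) (Fin m) 𝕜 :=
  pencil A B (fun _ => 1) u mu lam

theorem symbol_sub (u : Fin m → 𝕜) (mu lam mu' lam' : 𝕜) :
    symbol A B u mu' lam' - symbol A B u mu lam
      = (mu' - mu) • B u + (lam' - lam) • (1 : Matrix (Fin m) (Fin m) 𝕜) := by
  simp only [symbol, pencil]
  module

theorem symbol_line (u : Fin m → 𝕜) (mu lam mu' lam' t : 𝕜) :
    symbol A B u (mu + t * (mu' - mu)) (lam + t * (lam' - lam))
      = symbol A B u mu lam + t • (symbol A B u mu' lam' - symbol A B u mu lam) := by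
  rw [symbol_sub]
  simp only [symbol, pencil]
  module

theorem hasDerivAt_dispersion_line (u : Fin m → 𝕜) (mu lam mu' lam' t : 𝕜) :
    HasDerivAt (fun t => dispersion A B u (mu + t * (mu' - mu)) (lam + t * (lam' - lam)))
      (((symbol A B u (mu + t * (mu' - mu)) (lam + t * (lam' - lam))).adjugate *
        (symbol A B u mu' lam' - symbol A B u mu lam)).trace) t := by
  have := hasDerivAt_det (symbol A B u mu lam) (symbol A B u mu' lam' - symbol A B u mu lam) t
  simp only [← symbol_line] at this
  exact this

/-- Jacobi's formula turns the transversality conditions into conditions on the adjugate matrices. -/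
theorem genericPair_iff {u : Fin m → 𝕜} {lam mu : Fin 2 → 𝕜} : GenericPair A B u lam mu ↔
    (∀ i, (symbol A B u (mu i) (lam i)).det = 0) ∧ ∀ i j, i ≠ j →
      ((symbol A B u (mu i) (lam i)).adjugate *
        (symbol A B u (mu j) (lam j) - symbol A B u (mu i) (lam i))).trace ≠ 0 := by
  have h0 := (hasDerivAt_dispersion_line (A := A) (B := B) u (mu 0) (lam 0) (mu 1) (lam 1) 0).deriv
  have h1 := (hasDerivAt_dispersion_line (A := A) (B := B) u (mu 0) (lam 0) (mu 1) (lam 1) 1).deriv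
  simp only [zero_mul, add_zero, one_mul, add_sub_cancel] at h0 h1
  rw [GenericPair, h0, h1]
  refine and_congr Iff.rfl ⟨fun ⟨k0, k1⟩ i j hij => ?_, fun k => ⟨k 0 1 (by decide), ?_⟩⟩
  · fin_cases i <;> fin_cases j
    · exact absurd rfl hij
    · exact k0
    · have : ∀ V : Matrix (Fin m) (Fin m) 𝕜, (V.adjugate * (symbol A B u (mu 0) (lam 0) - V)).trace
          = -(V.adjugate * (V - symbol A B u (mu 0) (lam 0))).trace := fun V => by
        rw [← neg_sub V, mul_neg, trace_neg]
      rw [← neg_ne_zero] at k1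
      rwa [← this] at k1
    · exact absurd rfl hij
  · have := k 1 0 (by decide)
    rw [← neg_sub, mul_neg, trace_neg] at this
    exact neg_ne_zero.1 this

theorem matDeriv_smul_add_const {M : (Fin m → 𝕜) → Matrix (Fin m) (Fin m) 𝕜} {u : Fin m → 𝕜}
    (c : 𝕜) (N : Matrix (Fin m) (Fin m) 𝕜) (h : Fin m → 𝕜) :
    matDeriv (fun u => c • M u + N) u h = c • matDeriv M u h := by
  ext i j
  simp only [matDeriv_apply, Matrix.add_apply, Matrix.smul_apply, fderiv_add_const]
  have := congrFun (fderiv_const_smul_field (𝕜 := 𝕜) (f := fun y => M y i j) c) u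
  exact congrArg (fun L : (Fin m → 𝕜) →L[𝕜] 𝕜 => L h) this

variable {B' C' : (Fin m → 𝕜) → Matrix (Fin m) (Fin m) 𝕜} {e n : 𝕜 × 𝕜}

theorem pencil_eq_symbol (hB' : ∀ u, B' u = e.2 • B u + e.1 • (1 : Matrix (Fin m) (Fin m) 𝕜))
    (hC' : ∀ u, C' u = n.2 • B u + n.1 • (1 : Matrix (Fin m) (Fin m) 𝕜)) (u : Fin m → 𝕜) (s q : 𝕜) :
    pencil A B' C' u s q = symbol A B u (s * e.2 + q * n.2) (s * e.1 + q * n.1) := by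
  simp only [symbol, pencil, hB', hC']
  module

/-- Compatibility is invariant under a linear change of coordinates in the `(λ, μ)`-plane. -/
theorem compatible_iff_symbol
    (hB' : ∀ u, B' u = e.2 • B u + e.1 • (1 : Matrix (Fin m) (Fin m) 𝕜))
    (hC' : ∀ u, C' u = n.2 • B u + n.1 • (1 : Matrix (Fin m) (Fin m) 𝕜)) {u : Fin m → 𝕜}
    {s q : Fin 2 → 𝕜} : Compatible A B' C' u s q ↔
      Compatible A B (fun _ => 1) u (fun i => s i * e.2 + q i * n.2)
        (fun i => s i * e.1 + q i * n.1) := by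
  have hd : ∀ i X, pencilDeriv A B' C' u (s i) (q i) X = pencilDeriv A B (fun _ => 1) u
      (s i * e.2 + q i * n.2) (s i * e.1 + q i * n.1) X := by
    intro i X
    have e1 : B' = fun u => e.2 • B u + e.1 • 1 := funext hB'
    have e2 : C' = fun u => n.2 • B u + n.1 • 1 := funext hC'
    rw [pencilDeriv, e1, e2, matDeriv_smul_add_const, matDeriv_smul_add_const, pencilDeriv,
      matDeriv_const]
    module
  simp only [Compatible, pencil_eq_symbol hB' hC', hd]
  rfl

theorem GenericPair.ne {u : Fin m → 𝕜} {lam mu : Fin 2 → 𝕜} (hg : GenericPair A B u lam mu) :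
    lam 1 - lam 0 ≠ 0 ∨ mu 1 - mu 0 ≠ 0 := by
  by_contra! h0
  have := (genericPair_iff.1 hg).2 0 1 (by decide)
  rw [symbol_sub, h0.1, h0.2] at this
  simp at this

/-- The coordinates `s`, `q` with `(λ, μ) = s e + q n`, where `n` is the direction of the line
joining the two points and `e` a complementary direction. -/
theorem GenericPair.exists_coordinates {u : Fin m → 𝕜} {lam mu : Fin 2 → 𝕜}
    (hg : GenericPair A B u lam mu)
    (hC' : ∀ u, C' u = (mu 1 - mu 0) • B u + (lam 1 - lam 0) • (1 : Matrix (Fin m) (Fin m) 𝕜))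
    (he : e.1 * (mu 1 - mu 0) - e.2 * (lam 1 - lam 0) ≠ 0) :
    ∃ (s : 𝕜) (q : Fin 2 → 𝕜), (∀ i, s * e.1 + q i * (lam 1 - lam 0) = lam i) ∧
      (∀ i, s * e.2 + q i * (mu 1 - mu 0) = mu i) ∧
      ∀ i, ((symbol A B u (mu i) (lam i)).adjugate * C' u).trace ≠ 0 := by
  obtain ⟨n, hn⟩ : ∃ n : 𝕜 × 𝕜, n = (lam 1 - lam 0, mu 1 - mu 0) := ⟨_, rfl⟩
  have hn1 : lam 1 - lam 0 = n.1 := by rw [hn]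
  have hn2 : mu 1 - mu 0 = n.2 := by rw [hn]
  have hl1 : lam 1 = lam 0 + n.1 := by rw [← hn1]; ring
  have hm1 : mu 1 = mu 0 + n.2 := by rw [← hn2]; ring
  rw [hn1, hn2] at he ⊢
  obtain ⟨s, hs⟩ : ∃ s, s * (e.1 * n.2 - e.2 * n.1) = lam 0 * n.2 - mu 0 * n.1 :=
    ⟨_, div_mul_cancel₀ _ he⟩
  obtain ⟨q, hq⟩ : ∃ q, q * (e.1 * n.2 - e.2 * n.1) = e.1 * mu 0 - e.2 * lam 0 :=
    ⟨_, div_mul_cancel₀ _ he⟩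
  have e1 : s * e.1 + q * n.1 = lam 0 := by
    refine mul_right_cancel₀ he ?_
    linear_combination e.1 * hs + n.1 * hq
  have e2 : s * e.2 + q * n.2 = mu 0 := by
    refine mul_right_cancel₀ he ?_
    linear_combination e.2 * hs + n.2 * hq
  refine ⟨s, ![q, q + 1], fun i => ?_, fun i => ?_, fun i => ?_⟩
  · fin_cases i
    · exact e1
    · change s * e.1 + (q + 1) * n.1 = lam 1
      rw [hl1, ← e1]; ring
  · fin_cases i
    · exact e2
    · change s * e.2 + (q + 1) * n.2 = mu 1
      rw [hm1, ← e2]; ring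
  · rw [hC', ← symbol_sub]
    fin_cases i
    · exact (genericPair_iff.1 hg).2 0 1 (by decide)
    · have := (genericPair_iff.1 hg).2 1 0 (by decide)
      rw [← neg_sub, mul_neg, trace_neg] at this
      exact neg_ne_zero.1 this

end GenericPairs

/-! ### Reductions from compatibility -/

section ExistenceOfReductions

universe v
variable {𝕜 : Type v} [RCLike 𝕜] {m : ℕ} {A B : (Fin m → 𝕜) → Matrix (Fin m) (Fin m) 𝕜}
  {U : Set (Fin m → 𝕜)}

/-- All pairs of points of the dispersion curves in general position are compatible. -/
def AllCompatible (A B : (Fin m → 𝕜) → Matrix (Fin m) (Fin m) 𝕜) (U : Set (Fin m → 𝕜)) : Prop :=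
  ∀ u ∈ U, ∀ lam mu : Fin 2 → 𝕜, GenericPair A B u lam mu →
    Compatible A B (fun _ => 1) u mu lam

theorem SmoothField.smul_add {B : (Fin m → 𝕜) → Matrix (Fin m) (Fin m) 𝕜} {u : Fin m → 𝕜}
    (h : SmoothField B u) (c : 𝕜) (N : Matrix (Fin m) (Fin m) 𝕜) :
    SmoothField (fun u => c • B u + N) u := fun i j =>
  ((smoothNear_const c).mul (h i j)).add (smoothNear_const (N i j))

variable {B' C' : (Fin m → 𝕜) → Matrix (Fin m) (Fin m) 𝕜} {e n : 𝕜 × 𝕜}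

/-- The branches of the dispersion curve through a pair of points in general position, in the
coordinates `s`, `q` with `(λ, μ) = s e + q n`. -/
theorem GenericPair.exists_transversalBranches {u₀ : Fin m → 𝕜} (hA : SmoothField A u₀)
    (hB : SmoothField B u₀)
    (hB' : ∀ u, B' u = e.2 • B u + e.1 • (1 : Matrix (Fin m) (Fin m) 𝕜))
    (hC' : ∀ u, C' u = n.2 • B u + n.1 • (1 : Matrix (Fin m) (Fin m) 𝕜)) {s₀ q₀ : Fin 2 → 𝕜}
    (hg : GenericPair A B u₀ (fun i => s₀ i * e.1 + q₀ i * n.1) fun i => s₀ i * e.2 + q₀ i * n.2)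
    (ht : ∀ i, ((pencil A B' C' u₀ (s₀ i) (q₀ i)).adjugate * C' u₀).trace ≠ 0) :
    Nonempty (TransversalBranches A B' C' u₀ s₀ q₀) := by
  obtain ⟨hg0, hg1⟩ := genericPair_iff.1 hg
  have sB : SmoothField B' u₀ := by
    rw [show B' = fun u => e.2 • B u + e.1 • 1 from funext hB']; exact hB.smul_add _ _
  have sC : SmoothField C' u₀ := by
    rw [show C' = fun u => n.2 • B u + n.1 • 1 from funext hC']; exact hB.smul_add _ _
  have hβ : ∀ i, Nonempty (PencilBranch A B' C' u₀ (s₀ i) (q₀ i)) := fun i =>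
    exists_pencilBranch hA sB sC (by rw [pencil_eq_symbol hB' hC']; exact hg0 i) (ht i)
  refine ⟨⟨fun i => (hβ i).some, ?_⟩⟩
  simp only [pencil_eq_symbol hB' hC']
  exact hg1

theorem TransversalBranches.eventually_genericPair {u₀ : Fin m → 𝕜}
    (hB' : ∀ u, B' u = e.2 • B u + e.1 • (1 : Matrix (Fin m) (Fin m) 𝕜))
    (hC' : ∀ u, C' u = n.2 • B u + n.1 • (1 : Matrix (Fin m) (Fin m) 𝕜)) {s₀ q₀ : Fin 2 → 𝕜}
    (P : TransversalBranches A B' C' u₀ s₀ q₀) :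
    ∀ᶠ y in 𝓝 (u₀, s₀), GenericPair A B y.1 (fun i => y.2 i * e.1 + P.q i y * n.1)
      fun i => y.2 i * e.2 + P.q i y * n.2 := by
  have hdet := eventually_all.2 fun i =>
    (tendsto_pt (u₀ := u₀) (s₀ := s₀) i).eventually (P.β i).det_eq
  have hchord : ∀ᶠ y in 𝓝 (u₀, s₀), ∀ i j, i ≠ j →
      ((P.V i y).adjugate * (P.V j y - P.V i y)).trace ≠ 0 := by
    refine eventually_all.2 fun i => eventually_all.2 fun j => ?_
    by_cases hij : i = j
    · exact Eventually.of_forall fun y h => absurd hij h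
    have : SmoothNear 𝕜 (fun y => ((P.V i y).adjugate * (P.V j y - P.V i y)).trace) (u₀, s₀) := by
      simp only [trace, diag_apply, mul_apply]
      exact SmoothNear.sum fun k _ => SmoothNear.sum fun l _ =>
        (SmoothNear.adjugate (P.smooth_V i) k l).mul ((P.smooth_V j l k).sub (P.smooth_V i l k))
    filter_upwards [this.continuousAt.eventually_ne
      (by simpa only [P.V_base] using P.chord i j hij)] with y hy _ using hy
  filter_upwards [hdet, hchord] with y h1 h2
  refine genericPair_iff.2 ⟨fun i => ?_, fun i j hij => ?_⟩
  · rw [← pencil_eq_symbol (A := A) hB' hC']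
    exact h1 i
  · rw [← pencil_eq_symbol (A := A) hB' hC', ← pencil_eq_symbol (A := A) hB' hC']
    exact h2 i j hij

/-- The pairs of nearby points of the two branches are again in general position, hence compatible. -/
theorem AllCompatible.exists_branchPair (h : AllCompatible A B U) (hU : IsOpen U)
    {u₀ : Fin m → 𝕜} (hu₀ : u₀ ∈ U) (hA : SmoothField A u₀) (hB : SmoothField B u₀)
    (hB' : ∀ u, B' u = e.2 • B u + e.1 • (1 : Matrix (Fin m) (Fin m) 𝕜))
    (hC' : ∀ u, C' u = n.2 • B u + n.1 • (1 : Matrix (Fin m) (Fin m) 𝕜)) {s₀ q₀ : Fin 2 → 𝕜}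
    (hg : GenericPair A B u₀ (fun i => s₀ i * e.1 + q₀ i * n.1) fun i => s₀ i * e.2 + q₀ i * n.2)
    (ht : ∀ i, ((pencil A B' C' u₀ (s₀ i) (q₀ i)).adjugate * C' u₀).trace ≠ 0) :
    Nonempty (BranchPair A B' C' u₀ s₀ q₀) := by
  obtain ⟨P⟩ := hg.exists_transversalBranches hA hB hB' hC' ht
  refine ⟨⟨P, ?_⟩⟩
  have hmem : ∀ᶠ y : (Fin m → 𝕜) × (Fin 2 → 𝕜) in 𝓝 (u₀, s₀), y.1 ∈ U :=
    continuousAt_fst.eventually_mem (hU.mem_nhds hu₀)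
  filter_upwards [P.eventually_genericPair hB' hC', hmem] with y h1 h2
  exact (compatible_iff_symbol hB' hC').2 (h y.1 h2 _ _ h1)

/-- A reduction through a pair of compatible branches, for which `u` moves along the diagonal with
constant `s`. -/
theorem BranchPair.exists_isWaveSolution_const {C : (Fin m → 𝕜) → Matrix (Fin m) (Fin m) 𝕜}
    {u₀ : Fin m → 𝕜} {s₀ q₀ : Fin 2 → 𝕜} (P : BranchPair A B C u₀ s₀ q₀) :
    ∃ u s p w, IsWaveSolution P.coefficients u s p w ∧ ∀ i, p i 0 = 1 := by
  obtain ⟨x, hx, hx0, hxd⟩ := exists_smoothNear_deriv_eq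
    (g := fun z : 𝕜 × (Fin m → 𝕜) => (P.β 0).ξ (z.2, s₀ 0) + (P.β 1).ξ (z.2, s₀ 1)) (x₀ := u₀)
    (SmoothNear.add
      ((P.β 0).smooth_ξ.comp_of_eq (smoothNear_id.snd.prodMk (smoothNear_const _)) rfl)
      ((P.β 1).smooth_ξ.comp_of_eq (smoothNear_id.snd.prodMk (smoothNear_const _)) rfl))
  obtain ⟨u, s, p, w, h, hd⟩ := exists_isWaveSolution P.coefficients (uΔ := x)
    (sΔ := fun i _ => s₀ i) (pΔ := fun _ _ => 1) (wΔ := fun _ _ => 0) hx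
    (fun _ => smoothNear_const _) (fun _ => smoothNear_const _) (fun _ => smoothNear_const _) hx0
    (fun _ => rfl) (by
      filter_upwards [hxd] with t ht
      rw [ht, one_smul, one_smul]
      rfl)
  exact ⟨u, s, p, w, h, fun i => (hd.self_of_nhds.2 i).2.1⟩

theorem AllCompatible.speedsUnrestricted (h : AllCompatible A B U) (hU : IsOpen U)
    (hA : ∀ u ∈ U, SmoothField A u) (hB : ∀ u ∈ U, SmoothField B u) :
    SpeedsUnrestricted A B U := by
  intro u₀ hu₀ lam₀ mu₀ hg
  obtain ⟨e, he⟩ : ∃ e : 𝕜 × 𝕜, e.1 * (mu₀ 1 - mu₀ 0) - e.2 * (lam₀ 1 - lam₀ 0) ≠ 0 := by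
    rcases hg.ne with h0 | h0
    · exact ⟨(0, -1), by simpa using h0⟩
    · exact ⟨(1, 0), by simpa using h0⟩
  set n : 𝕜 × 𝕜 := (lam₀ 1 - lam₀ 0, mu₀ 1 - mu₀ 0) with hn
  have hB' : ∀ u, (fun u => e.2 • B u + e.1 • 1) u
    = e.2 • B u + e.1 • (1 : Matrix (Fin m) (Fin m) 𝕜) := fun _ => rfl
  have hC' : ∀ u, (fun u => n.2 • B u + n.1 • 1) u
    = n.2 • B u + n.1 • (1 : Matrix (Fin m) (Fin m) 𝕜) := fun _ => rfl
  obtain ⟨s, q, hlam, hmu, ht⟩ := hg.exists_coordinates hC' he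
  obtain ⟨P⟩ := h.exists_branchPair (n := n) hU hu₀ (hA u₀ hu₀) (hB u₀ hu₀) hB' hC'
    (s₀ := fun _ => s) (q₀ := q) (by simpa only [n, hlam, hmu] using hg) (fun i => by
      rw [pencil_eq_symbol hB' hC']
      simpa only [n, hlam, hmu] using ht i)
  obtain ⟨u, s', p, w, hW, hp⟩ := P.exists_isWaveSolution_const
  obtain ⟨Ω, h0, hΩ⟩ := exists_isReduction he hB' hC' hW (fun i => by simp [hp i]) hU hu₀
  refine ⟨Ω, u, _, _, hΩ, 0, h0, hW.u_zero, fun i => ?_⟩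
  have hqb : P.q i (u 0, fun k => s' k 0) = q i := by
    rw [hW.point_zero]
    exact (P.β i).base
  simp only [hqb, hW.s_zero i]
  exact ⟨hlam i, hmu i⟩

end ExistenceOfReductions
end HydrodynamicType

namespace HydrodynamicType
open Filter Matrix

/-! ### The Haantjes tensor on eigenvectors -/

section TensorForms

variable {𝕜 : Type*} [RCLike 𝕜] {m : ℕ}

/-- The Nijenhuis tensor as a bilinear map, for a matrix `M` with the directional derivatives
`D`. -/
def nijenhuisForm (M : Matrix (Fin m) (Fin m) 𝕜)
    (D : (Fin m → 𝕜) →ₗ[𝕜] Matrix (Fin m) (Fin m) 𝕜) :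
    (Fin m → 𝕜) →ₗ[𝕜] (Fin m → 𝕜) →ₗ[𝕜] (Fin m → 𝕜) :=
  LinearMap.mk₂ 𝕜
    (fun X Y => D (M *ᵥ X) *ᵥ Y - D (M *ᵥ Y) *ᵥ X - M *ᵥ (D X *ᵥ Y - D Y *ᵥ X))
    (fun X X' Y => by simp only [mulVec_add, map_add, add_mulVec, mulVec_sub]; abel)
    (fun c X Y => by simp only [mulVec_smul, map_smul, smul_mulVec, mulVec_sub, smul_sub])
    (fun X Y Y' => by simp only [mulVec_add, map_add, add_mulVec, mulVec_sub]; abel)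
    (fun c X Y => by simp only [mulVec_smul, map_smul, smul_mulVec, mulVec_sub, smul_sub])

/-- The Haantjes tensor as a bilinear map, for a matrix `M` with the directional derivatives `D`. -/
def haantjesForm (M : Matrix (Fin m) (Fin m) 𝕜)
    (D : (Fin m → 𝕜) →ₗ[𝕜] Matrix (Fin m) (Fin m) 𝕜) :
    (Fin m → 𝕜) →ₗ[𝕜] (Fin m → 𝕜) →ₗ[𝕜] (Fin m → 𝕜) :=
  LinearMap.mk₂ 𝕜
    (fun X Y => nijenhuisForm M D (M *ᵥ X) (M *ᵥ Y) - M *ᵥ nijenhuisForm M D X (M *ᵥ Y)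
      - M *ᵥ nijenhuisForm M D (M *ᵥ X) Y + M *ᵥ M *ᵥ nijenhuisForm M D X Y)
    (fun X X' Y => by simp only [mulVec_add, map_add, LinearMap.add_apply]; abel)
    (fun c X Y => by
      simp only [mulVec_smul, map_smul, LinearMap.smul_apply, smul_sub, smul_add])
    (fun X Y Y' => by simp only [mulVec_add, map_add]; abel)
    (fun c X Y => by simp only [mulVec_smul, map_smul, smul_sub, smul_add])

/-- The directional derivative of a matrix field at a point, as a linear map. -/
noncomputable def matDerivₗ (v : (Fin m → 𝕜) → Matrix (Fin m) (Fin m) 𝕜) (u : Fin m → 𝕜) :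
    (Fin m → 𝕜) →ₗ[𝕜] Matrix (Fin m) (Fin m) 𝕜 where
  toFun := matDeriv v u
  map_add' := matDeriv_add v u
  map_smul' := matDeriv_smul v u

theorem mulVec_single_eq_sum (M : Matrix (Fin m) (Fin m) 𝕜) (j : Fin m) :
    M *ᵥ Pi.single j 1 = ∑ p, M p j • (Pi.single p 1 : Fin m → 𝕜) := by
  ext i
  simp [Finset.sum_apply, Pi.single_apply]

theorem nijenhuis_eq (v : (Fin m → 𝕜) → Matrix (Fin m) (Fin m) 𝕜) (u : Fin m → 𝕜) (i j k : Fin m) :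
    nijenhuis v u i j k
      = nijenhuisForm (v u) (matDerivₗ v u) (Pi.single j 1) (Pi.single k 1) i := by
  have e : ∀ a b c, (matDeriv v u (v u *ᵥ Pi.single a 1) *ᵥ Pi.single b 1) c
      = ∑ p, v u p a * pd p (fun w => v w c b) u := by
    intro a b c
    rw [mulVec_single_eq_sum (v u) a, mulVec_single_one, col_apply, matDeriv_apply, map_sum]
    simp only [map_smul, smul_eq_mul]
    rfl
  have e' : ∀ a b, matDeriv v u (Pi.single a 1) *ᵥ Pi.single b 1
      = fun c => pd a (fun w => v w c b) u := fun a b => by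
    rw [mulVec_single_one]; rfl
  change _ = (matDeriv v u (v u *ᵥ Pi.single j 1) *ᵥ Pi.single k 1
    - matDeriv v u (v u *ᵥ Pi.single k 1) *ᵥ Pi.single j 1 - v u *ᵥ
    (matDeriv v u (Pi.single j 1) *ᵥ Pi.single k 1
      - matDeriv v u (Pi.single k 1) *ᵥ Pi.single j 1)) i
  rw [Pi.sub_apply, Pi.sub_apply, e, e, e', e', nijenhuis, Finset.sum_sub_distrib,
    Finset.sum_sub_distrib]
  rfl

theorem haantjes_eq (v : (Fin m → 𝕜) → Matrix (Fin m) (Fin m) 𝕜) (u : Fin m → 𝕜) (i j k : Fin m) :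
    haantjes v u i j k
      = haantjesForm (v u) (matDerivₗ v u) (Pi.single j 1) (Pi.single k 1) i := by
  set N := nijenhuisForm (v u) (matDerivₗ v u) with hN
  change _ = (N (v u *ᵥ Pi.single j 1) (v u *ᵥ Pi.single k 1)
    - v u *ᵥ N (Pi.single j 1) (v u *ᵥ Pi.single k 1)
    - v u *ᵥ N (v u *ᵥ Pi.single j 1) (Pi.single k 1)
    + v u *ᵥ v u *ᵥ N (Pi.single j 1) (Pi.single k 1)) i
  have e1 : N (v u *ᵥ Pi.single j 1) (v u *ᵥ Pi.single k 1) i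
      = ∑ p, ∑ r, nijenhuis v u i p r * v u p j * v u r k := by
    rw [mulVec_single_eq_sum _ j, map_sum, LinearMap.sum_apply, Finset.sum_apply]
    refine Finset.sum_congr rfl fun p _ => ?_
    rw [mulVec_single_eq_sum _ k, map_sum, Finset.sum_apply]
    refine Finset.sum_congr rfl fun r _ => ?_
    rw [map_smul, map_smul, nijenhuis_eq]
    simp only [LinearMap.smul_apply, Pi.smul_apply, smul_eq_mul]
    ring
  have e2 : (v u *ᵥ N (Pi.single j 1) (v u *ᵥ Pi.single k 1)) i
      = ∑ p, ∑ r, nijenhuis v u p j r * v u i p * v u r k := by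
    rw [mulVec_single_eq_sum _ k, map_sum, mulVec, dotProduct]
    refine Finset.sum_congr rfl fun p _ => ?_
    rw [Finset.sum_apply, Finset.mul_sum]
    refine Finset.sum_congr rfl fun r _ => ?_
    rw [map_smul, nijenhuis_eq, Pi.smul_apply, smul_eq_mul]
    ring
  have e3 : (v u *ᵥ N (v u *ᵥ Pi.single j 1) (Pi.single k 1)) i
      = ∑ p, ∑ r, nijenhuis v u p r k * v u i p * v u r j := by
    rw [mulVec_single_eq_sum _ j, map_sum, LinearMap.sum_apply, mulVec, dotProduct]
    refine Finset.sum_congr rfl fun p _ => ?_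
    rw [Finset.sum_apply, Finset.mul_sum]
    refine Finset.sum_congr rfl fun r _ => ?_
    rw [map_smul, nijenhuis_eq, LinearMap.smul_apply, Pi.smul_apply, smul_eq_mul]
    ring
  have e4 : (v u *ᵥ v u *ᵥ N (Pi.single j 1) (Pi.single k 1)) i
      = ∑ p, ∑ r, nijenhuis v u p j k * v u i r * v u r p := by
    rw [mulVec, dotProduct, Finset.sum_comm]
    refine Finset.sum_congr rfl fun r _ => ?_
    rw [mulVec, dotProduct, Finset.mul_sum]
    refine Finset.sum_congr rfl fun p _ => ?_
    rw [nijenhuis_eq]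
    ring
  rw [Pi.add_apply, Pi.sub_apply, Pi.sub_apply, e1, e2, e3, e4, haantjes]
  simp only [Finset.sum_add_distrib, Finset.sum_sub_distrib]

theorem haantjesForm_eq_zero_iff (v : (Fin m → 𝕜) → Matrix (Fin m) (Fin m) 𝕜) (u : Fin m → 𝕜) :
    haantjesForm (v u) (matDerivₗ v u) = 0 ↔ ∀ i j k, haantjes v u i j k = 0 := by
  constructor
  · intro h i j k
    rw [haantjes_eq, h]
    rfl
  · intro h
    refine LinearMap.ext_basis (Pi.basisFun 𝕜 (Fin m)) (Pi.basisFun 𝕜 (Fin m)) fun j k => ?_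
    ext i
    simpa [haantjes_eq] using h i j k

theorem haantjesForm_self (M : Matrix (Fin m) (Fin m) 𝕜)
    (D : (Fin m → 𝕜) →ₗ[𝕜] Matrix (Fin m) (Fin m) 𝕜) {X : Fin m → 𝕜} {ν : 𝕜}
    (hX : M *ᵥ X = ν • X) : haantjesForm M D X X = 0 := by
  have h0 : nijenhuisForm M D X X = 0 := by simp [nijenhuisForm]
  simp [haantjesForm, hX, h0]

/-- On eigenvectors, the Nijenhuis and Haantjes tensors involve only the derivatives of the matrix
along one of them, applied to the other. -/
theorem haantjesForm_eigenvectors {M : Matrix (Fin m) (Fin m) 𝕜}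
    {D : (Fin m → 𝕜) →ₗ[𝕜] Matrix (Fin m) (Fin m) 𝕜} {X Y : Fin m → 𝕜} {ν ρ : 𝕜}
    (hX : M *ᵥ X = ν • X) (hY : M *ᵥ Y = ρ • Y) :
    haantjesForm M D X Y = (M - ν • 1) *ᵥ (M - ρ • 1) *ᵥ
      ((M - ρ • 1) *ᵥ D Y *ᵥ X - (M - ν • 1) *ᵥ D X *ᵥ Y) := by
  have hN : nijenhuisForm M D X Y = (M - ρ • 1) *ᵥ D Y *ᵥ X - (M - ν • 1) *ᵥ D X *ᵥ Y := by
    simp only [nijenhuisForm, LinearMap.mk₂_apply, hX, hY, map_smul, smul_mulVec, sub_mulVec,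
      one_mulVec, mulVec_sub]
    abel
  rw [← hN]
  simp only [haantjesForm, LinearMap.mk₂_apply, hX, hY, map_smul, LinearMap.smul_apply, sub_mulVec,
    smul_mulVec, one_mulVec, mulVec_sub, mulVec_smul, smul_sub]
  rw [smul_comm ρ ν]
  abel

/-- Two vectors `d₀`, `d₁` can be written as `-((M - νᵢ) x + aᵢ ξᵢ)` with the same `x` if they
satisfy the equation expressing the vanishing of the Haantjes tensor on the eigenvectors `ξ₀`, `ξ₁`
with simple eigenvalues. -/
theorem exists_common_solution {L₀ L₁ : Matrix (Fin m) (Fin m) 𝕜} {ξ₀ ξ₁ d₀ d₁ : Fin m → 𝕜} {c : 𝕜}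
    (hc : c ≠ 0) (hL : L₀ - L₁ = c • 1) (h₀ : L₀ *ᵥ ξ₀ = 0) (h₁ : L₁ *ᵥ ξ₁ = 0)
    (k₀ : ∀ x, L₀ *ᵥ x = 0 → ∃ a : 𝕜, x = a • ξ₀) (k₁ : ∀ x, L₁ *ᵥ x = 0 → ∃ a : 𝕜, x = a • ξ₁)
    (r₀ : ∃ x, ∃ a : 𝕜, L₀ *ᵥ x + d₀ + a • ξ₀ = 0) (r₁ : ∃ x, ∃ a : 𝕜, L₁ *ᵥ x + d₁ + a • ξ₁ = 0)
    (n₀ : ∀ x, ∀ a : 𝕜, L₀ *ᵥ x = a • ξ₀ → a = 0) (n₁ : ∀ x, ∀ a : 𝕜, L₁ *ᵥ x = a • ξ₁ → a = 0)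
    (hH : L₀ *ᵥ L₁ *ᵥ (L₁ *ᵥ d₀ - L₀ *ᵥ d₁) = 0) :
    ∃ x, ∃ a b : 𝕜, L₀ *ᵥ x + d₀ + a • ξ₀ = 0 ∧ L₁ *ᵥ x + d₁ + b • ξ₁ = 0 := by
  have hcomm : ∀ x, L₀ *ᵥ L₁ *ᵥ x = L₁ *ᵥ L₀ *ᵥ x := by
    intro x
    have : L₀ = L₁ + c • 1 := by rw [← hL]; abel
    rw [mulVec_mulVec, mulVec_mulVec, this, add_mul, mul_add]
    simp
  have hd : ∀ x, L₀ *ᵥ x - L₁ *ᵥ x = c • x := fun x => by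
    rw [← sub_mulVec, hL, smul_mulVec, one_mulVec]
  have hLξ : L₀ *ᵥ ξ₁ = c • ξ₁ := by rw [← hd, h₁, sub_zero]
  have s₀ : ∀ x, L₀ *ᵥ L₀ *ᵥ x = 0 → L₀ *ᵥ x = 0 := fun x hx => by
    obtain ⟨a, ha⟩ := k₀ _ hx
    rw [ha, n₀ _ _ ha, zero_smul]
  have s₁ : ∀ x, L₁ *ᵥ L₁ *ᵥ x = 0 → L₁ *ᵥ x = 0 := fun x hx => by
    obtain ⟨a, ha⟩ := k₁ _ hx
    rw [ha, n₁ _ _ ha, zero_smul]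
  obtain ⟨x₀, a₀, e₀⟩ := r₀
  obtain ⟨x₁, a₁, e₁⟩ := r₁
  have f₀ : d₀ = -(L₀ *ᵥ x₀) - a₀ • ξ₀ := by
    rw [← sub_eq_zero, ← e₀]; abel
  have f₁ : d₁ = -(L₁ *ᵥ x₁) - a₁ • ξ₁ := by
    rw [← sub_eq_zero, ← e₁]; abel
  have hz : L₀ *ᵥ L₀ *ᵥ L₁ *ᵥ L₁ *ᵥ (x₁ - x₀) = 0 := by
    rw [← hH, f₀, f₁]
    simp only [mulVec_sub, mulVec_neg, mulVec_smul, hcomm, hLξ, h₀, h₁, mulVec_zero, smul_zero]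
    abel
  have h1 : L₁ *ᵥ L₀ *ᵥ (x₁ - x₀) = 0 := by
    have t1 := s₀ _ hz
    rw [hcomm, hcomm] at t1
    have t2 := s₁ _ t1
    exact t2
  obtain ⟨b, hb⟩ := k₁ _ h1
  obtain ⟨a, ha⟩ := k₀ (x₁ - x₀ - (b / c) • ξ₁) (by
    rw [mulVec_sub, hb, mulVec_smul, hLξ, smul_smul, div_mul_cancel₀ _ hc, sub_self])
  refine ⟨x₀ + a • ξ₀, a₀, a₁, ?_, ?_⟩
  · rw [mulVec_add, mulVec_smul, h₀, smul_zero, add_zero, e₀]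
  · have : x₀ + a • ξ₀ = x₁ - (b / c) • ξ₁ := by
      rw [← ha]; abel
    rw [this, mulVec_sub, mulVec_smul, h₁, smul_zero, sub_zero, e₁]

end TensorForms

/-! ### The derivative of the family of matrices -/

section Family

variable {𝕜 : Type*} [RCLike 𝕜] {m : ℕ} {A B : (Fin m → 𝕜) → Matrix (Fin m) (Fin m) 𝕜}
  {u : Fin m → 𝕜} {k l : 𝕜}

theorem matDeriv_mul {M N : (Fin m → 𝕜) → Matrix (Fin m) (Fin m) 𝕜} {u : Fin m → 𝕜}
    (hM : ∀ i j, DifferentiableAt 𝕜 (fun w => M w i j) u)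
    (hN : ∀ i j, DifferentiableAt 𝕜 (fun w => N w i j) u) (h : Fin m → 𝕜) :
    matDeriv (fun w => M w * N w) u h = matDeriv M u h * N u + M u * matDeriv N u h := by
  ext i j
  have := HasFDerivAt.fun_sum (u := Finset.univ) (A := fun p w => M w i p * N w p j)
    fun p _ => (hM i p).hasFDerivAt.mul (hN p j).hasFDerivAt
  have e : HasFDerivAt (fun w => (M w * N w) i j) _ u := this
  rw [matDeriv_apply, e.fderiv]
  simp only [_root_.sum_apply, _root_.add_apply, _root_.smul_apply, smul_eq_mul, Matrix.add_apply,
    mul_apply, matDeriv_apply, ← Finset.sum_add_distrib]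
  exact Finset.sum_congr rfl fun p _ => by ring

theorem smoothField_familyMatrix (hA : SmoothField A u) (hB : SmoothField B u)
    (hP : IsUnit (k • (1 : Matrix (Fin m) (Fin m) 𝕜) + A u).det) :
    SmoothField (familyMatrix A B k l) u := by
  have h1 : SmoothField (fun w => k • (1 : Matrix (Fin m) (Fin m) 𝕜) + A w) u := fun i j =>
    (smoothNear_const ((k • (1 : Matrix (Fin m) (Fin m) 𝕜)) i j)).add (hA i j)
  have h2 : SmoothField (fun w => l • (1 : Matrix (Fin m) (Fin m) 𝕜) + B w) u := fun i j =>
    (smoothNear_const ((l • (1 : Matrix (Fin m) (Fin m) 𝕜)) i j)).add (hB i j)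
  have h3 : SmoothField (fun w => (k • (1 : Matrix (Fin m) (Fin m) 𝕜) + A w)⁻¹) u := by
    intro i j
    refine ((SmoothNear.adjugate h1 i j).div (SmoothNear.det h1) hP.ne_zero).congr ?_
    filter_upwards with w
    rw [inv_def, Ring.inverse_eq_inv', Matrix.smul_apply, smul_eq_mul, div_eq_inv_mul]
  intro i j
  simp only [familyMatrix, mul_apply]
  exact SmoothNear.sum fun p _ => (h3 i p).mul (h2 p j)

theorem mul_familyMatrix (hP : IsUnit (k • (1 : Matrix (Fin m) (Fin m) 𝕜) + A u).det) :
    (k • 1 + A u) * familyMatrix A B k l u = l • 1 + B u :=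
  mul_nonsing_inv_cancel_left _ _ hP

/-- The derivative of `(kE + A)⁻¹(lE + B)`, multiplied by `kE + A`. -/
theorem mul_matDeriv_familyMatrix (hA : SmoothField A u) (hB : SmoothField B u)
    (hP : IsUnit (k • (1 : Matrix (Fin m) (Fin m) 𝕜) + A u).det) (X : Fin m → 𝕜) :
    (k • 1 + A u) * matDeriv (familyMatrix A B k l) u X
      = matDeriv B u X - matDeriv A u X * familyMatrix A B k l u := by
  have h1 : SmoothField (fun w => k • (1 : Matrix (Fin m) (Fin m) 𝕜) + A w) u := fun i j =>
    (smoothNear_const ((k • (1 : Matrix (Fin m) (Fin m) 𝕜)) i j)).add (hA i j)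
  have hev : ∀ᶠ w in 𝓝 u, IsUnit (k • (1 : Matrix (Fin m) (Fin m) 𝕜) + A w).det :=
    ((SmoothNear.det h1).continuousAt.eventually_ne hP.ne_zero).mono fun w hw =>
      isUnit_iff_ne_zero.2 hw
  have hd : ∀ (M : (Fin m → 𝕜) → Matrix (Fin m) (Fin m) 𝕜) (N : Matrix (Fin m) (Fin m) 𝕜),
      matDeriv (fun w => N + M w) u X = matDeriv M u X := by
    intro M N
    ext i j
    simp [matDeriv_apply, fderiv_const_add]
  have h2 := matDeriv_mul (fun i j => (h1 i j).differentiableAt)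
    (fun i j => (smoothField_familyMatrix (l := l) hA hB hP i j).differentiableAt) X
  have h3 : matDeriv (fun w => (k • (1 : Matrix (Fin m) (Fin m) 𝕜) + A w)
      * familyMatrix A B k l w) u X = matDeriv B u X := by
    rw [← hd B (l • 1)]
    ext i j
    rw [matDeriv_apply, matDeriv_apply]
    congr 1
    refine Filter.EventuallyEq.fderiv_eq ?_
    filter_upwards [hev] with w hw
    rw [mul_familyMatrix hw]
  rw [h3, hd] at h2
  rw [h2]
  abel

/-- On the line `λ = k + l μ`, the matrix of the dispersion relation is, up to an invertible
factor, a shift of the matrix `(kE + A)⁻¹(lE + B)`. -/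
theorem symbol_eq_mul (hP : IsUnit (k • (1 : Matrix (Fin m) (Fin m) 𝕜) + A u).det) {mu : 𝕜}
    (hmu : mu ≠ 0) : symbol A B u mu (k + l * mu)
      = mu • ((k • 1 + A u) * (familyMatrix A B k l u - (-mu⁻¹) • 1)) := by
  rw [mul_sub, mul_familyMatrix hP, symbol, pencil, mul_smul_comm, mul_one, smul_sub, smul_smul,
    mul_neg, mul_inv_cancel₀ hmu]
  module

theorem ne_zero_of_symbol_det (hP : IsUnit (k • (1 : Matrix (Fin m) (Fin m) 𝕜) + A u).det) {mu : 𝕜}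
    (h : (symbol A B u mu (k + l * mu)).det = 0) : mu ≠ 0 := by
  rintro rfl
  refine hP.ne_zero ?_
  rw [← h, symbol, pencil]
  simp [add_comm]

/-- The compatibility conditions, written in terms of `v = (kE + A)⁻¹(lE + B)`. -/
theorem compatible_expr_eq (hA : SmoothField A u) (hB : SmoothField B u)
    (hP : IsUnit (k • (1 : Matrix (Fin m) (Fin m) 𝕜) + A u).det) {mu mu' : 𝕜} (hmu : mu ≠ 0)
    {ξ : Fin m → 𝕜} (hξ : symbol A B u mu (k + l * mu) *ᵥ ξ = 0) (x X : Fin m → 𝕜) (a : 𝕜) :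
    symbol A B u mu (k + l * mu) *ᵥ x
      + pencilDeriv A B (fun _ => 1) u mu (k + l * mu) X *ᵥ ξ
      + a • (symbol A B u mu' (k + l * mu') - symbol A B u mu (k + l * mu)) *ᵥ ξ
    = mu • (k • 1 + A u) *ᵥ ((familyMatrix A B k l u - (-mu⁻¹) • 1) *ᵥ x
      + matDeriv (familyMatrix A B k l) u X *ᵥ ξ + (-(a * (mu' - mu) * (mu⁻¹ * mu⁻¹))) • ξ) := by
  have hv : familyMatrix A B k l u *ᵥ ξ = (-mu⁻¹) • ξ := by
    have h1 := hξ
    rw [symbol_eq_mul hP hmu, smul_mulVec, ← mulVec_mulVec] at h1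
    have h2 := (smul_eq_zero.1 h1).resolve_left hmu
    have h3 := congrArg (fun y => (k • (1 : Matrix (Fin m) (Fin m) 𝕜) + A u)⁻¹ *ᵥ y) h2
    simp only [mulVec_mulVec, nonsing_inv_mul_cancel_left _ _ hP, mulVec_zero] at h3
    rw [sub_mulVec, smul_mulVec, one_mulVec] at h3
    exact sub_eq_zero.1 h3
  have hQ : (l • 1 + B u) *ᵥ ξ = (-mu⁻¹) • (k • 1 + A u) *ᵥ ξ := by
    rw [← mul_familyMatrix hP, ← mulVec_mulVec, hv, mulVec_smul]
  have e1 : symbol A B u mu' (k + l * mu') - symbol A B u mu (k + l * mu)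
      = (mu' - mu) • (l • 1 + B u) := by
    rw [symbol_sub]; module
  have e2 : mu • (k • 1 + A u) *ᵥ matDeriv (familyMatrix A B k l) u X *ᵥ ξ
      = pencilDeriv A B (fun _ => 1) u mu (k + l * mu) X *ᵥ ξ := by
    rw [mulVec_mulVec, mul_matDeriv_familyMatrix hA hB hP, sub_mulVec, ← mulVec_mulVec, hv,
      mulVec_smul, pencilDeriv, matDeriv_const, smul_zero, add_zero, add_mulVec, smul_mulVec,
      smul_sub, smul_smul, mul_neg, mul_inv_cancel₀ hmu]
    module
  rw [symbol_eq_mul hP hmu, mulVec_add, mulVec_add, smul_add, smul_add, e2, smul_mulVec,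
    ← mulVec_mulVec, ← symbol_eq_mul hP hmu, e1, smul_mulVec, hQ, mulVec_smul]
  congr 1
  rw [smul_smul, smul_smul, smul_smul]
  congr 1
  field_simp

end Family
end HydrodynamicType

namespace HydrodynamicType
open Filter Matrix

/-! ### Compatibility on a line and the Haantjes tensor -/

section CompatibilityOnLines

variable {𝕜 : Type*} [RCLike 𝕜] {m : ℕ} {A B : (Fin m → 𝕜) → Matrix (Fin m) (Fin m) 𝕜}
  {u : Fin m → 𝕜} {k l : 𝕜}

theorem symbol_mulVec_eq_zero_iff (hP : IsUnit (k • (1 : Matrix (Fin m) (Fin m) 𝕜) + A u).det)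
    {mu : 𝕜} (hmu : mu ≠ 0) {x : Fin m → 𝕜} : symbol A B u mu (k + l * mu) *ᵥ x = 0 ↔
      (familyMatrix A B k l u - (-mu⁻¹) • 1) *ᵥ x = 0 := by
  rw [symbol_eq_mul hP hmu, smul_mulVec, ← mulVec_mulVec, smul_eq_zero]
  refine ⟨fun h => ?_, fun h => Or.inr (by rw [h, mulVec_zero])⟩
  exact mulVec_injective_of_isUnit ((isUnit_iff_isUnit_det _).2 hP)
    (by rw [mulVec_zero]; exact h.resolve_left hmu)

theorem mulVec_eq_smul_of_sub {M : Matrix (Fin m) (Fin m) 𝕜} {ν : 𝕜} {x : Fin m → 𝕜} :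
    (M - ν • 1) *ᵥ x = 0 ↔ M *ᵥ x = ν • x := by
  rw [sub_mulVec, smul_mulVec, one_mulVec, sub_eq_zero]

/-- Compatibility along a pair of kernel vectors implies that the Haantjes tensor vanishes on
them. -/
theorem haantjesForm_eq_zero_of_solution (hA : SmoothField A u) (hB : SmoothField B u)
    (hP : IsUnit (k • (1 : Matrix (Fin m) (Fin m) 𝕜) + A u).det) {mu lam : Fin 2 → 𝕜}
    (hmu : ∀ i, mu i ≠ 0) (hlam : ∀ i, lam i = k + l * mu i) {ξ : Fin 2 → Fin m → 𝕜}
    (hξ : ∀ i, symbol A B u (mu i) (lam i) *ᵥ ξ i = 0) {x : Fin m → 𝕜} {a : Fin 2 → 𝕜}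
    (hx : ∀ i j, i ≠ j → symbol A B u (mu i) (lam i) *ᵥ x
      + pencilDeriv A B (fun _ => 1) u (mu i) (lam i) (ξ j) *ᵥ ξ i
      + a i • (symbol A B u (mu j) (lam j) - symbol A B u (mu i) (lam i)) *ᵥ ξ i = 0) :
    haantjesForm (familyMatrix A B k l u) (matDerivₗ (familyMatrix A B k l) u) (ξ 0) (ξ 1) = 0 := by
  simp only [hlam] at hξ hx
  set v := familyMatrix A B k l u with hv
  have hL : ∀ i, (v - (-(mu i)⁻¹) • 1) *ᵥ ξ i = 0 := fun i =>
    (symbol_mulVec_eq_zero_iff hP (hmu i)).1 (hξ i)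
  have hE : ∀ i j, i ≠ j → ∃ b : 𝕜, matDeriv (familyMatrix A B k l) u (ξ j) *ᵥ ξ i
      = -((v - (-(mu i)⁻¹) • 1) *ᵥ x) - b • ξ i := by
    intro i j hij
    have h1 := hx i j hij
    rw [compatible_expr_eq hA hB hP (hmu i) (hξ i), smul_eq_zero] at h1
    have h2 := mulVec_injective_of_isUnit ((isUnit_iff_isUnit_det _).2 hP)
      ((h1.resolve_left (hmu i)).trans (mulVec_zero _).symm)
    exact ⟨_, eq_sub_of_add_eq (eq_neg_of_add_eq_zero_right (by rw [← add_assoc]; exact h2))⟩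
  obtain ⟨b₀, e₀⟩ := hE 0 1 (by decide)
  obtain ⟨b₁, e₁⟩ := hE 1 0 (by decide)
  rw [haantjesForm_eigenvectors (mulVec_eq_smul_of_sub.1 (hL 0)) (mulVec_eq_smul_of_sub.1 (hL 1))]
  change (v - _) *ᵥ (v - _) *ᵥ ((v - _) *ᵥ matDeriv _ u (ξ 1) *ᵥ ξ 0
    - (v - _) *ᵥ matDeriv _ u (ξ 0) *ᵥ ξ 1) = 0
  rw [e₀, e₁]
  set L₀ := v - (-(mu 0)⁻¹) • 1
  set L₁ := v - (-(mu 1)⁻¹) • 1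
  have hcomm : ∀ y, L₀ *ᵥ L₁ *ᵥ y = L₁ *ᵥ L₀ *ᵥ y := by
    intro y
    have : L₀ * L₁ = L₁ * L₀ := by
      simp only [L₀, L₁, sub_mul, mul_sub, smul_mul_assoc, mul_smul_comm, one_mul, mul_one]
      module
    rw [mulVec_mulVec, mulVec_mulVec, this]
  have e1 : L₀ *ᵥ L₁ *ᵥ L₁ *ᵥ (b₀ • ξ 0) = 0 := by
    rw [hcomm, hcomm, mulVec_smul, hL 0]; simp
  have e2 : L₀ *ᵥ L₁ *ᵥ L₀ *ᵥ (b₁ • ξ 1) = 0 := by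
    rw [← hcomm, mulVec_smul, hL 1]; simp
  simp only [mulVec_sub, mulVec_neg, hcomm x, e1, e2]
  abel

/-- Points in general position, in terms of the kernels of their matrices. -/
theorem GenericPair.exists_isSimplePair {lam mu : Fin 2 → 𝕜} (h : GenericPair A B u lam mu) :
    ∃ ξ η : Fin 2 → Fin m → 𝕜, (∀ i, IsSimplePair (symbol A B u (mu i) (lam i)) (ξ i) (η i)) ∧
      ∀ i j, i ≠ j → η i ⬝ᵥ
        (symbol A B u (mu j) (lam j) - symbol A B u (mu i) (lam i)) *ᵥ ξ i ≠ 0 := by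
  obtain ⟨h0, h1⟩ := genericPair_iff.1 h
  choose a b hab using fun i => exists_adjugate_ne_zero (h1 i (1 - i) (ne_one_sub i))
  refine ⟨fun i k => (symbol A B u (mu i) (lam i)).adjugate k (b i),
    fun i k => (symbol A B u (mu i) (lam i)).adjugate (a i) k,
    fun i => isSimplePair_adjugate (h0 i) (hab i), fun i j hij => ?_⟩
  rw [adjugate_mul_trace (h0 i) (hab i)]
  exact mul_ne_zero (hab i) (h1 i j hij)

/-- The vanishing of the Haantjes tensor of `(kE + A)⁻¹(lE + B)` implies compatibility for the pairs of
points on the line `λ = k + l μ`. -/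
theorem compatible_of_haantjesForm (hA : SmoothField A u) (hB : SmoothField B u)
    (hP : IsUnit (k • (1 : Matrix (Fin m) (Fin m) 𝕜) + A u).det) {mu lam : Fin 2 → 𝕜}
    (hg : GenericPair A B u lam mu) (hlam : ∀ i, lam i = k + l * mu i)
    (hH : haantjesForm (familyMatrix A B k l u) (matDerivₗ (familyMatrix A B k l) u) = 0) :
    Compatible A B (fun _ => 1) u mu lam := by
  obtain ⟨ξ, η, hs, hη⟩ := hg.exists_isSimplePair
  have hmu : ∀ i, mu i ≠ 0 := fun i => ne_zero_of_symbol_det (l := l) hP (by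
    rw [← hlam]; exact (genericPair_iff.1 hg).1 i)
  have hξ := fun i => (hs i).mulVec_eq
  have hPinj := mulVec_injective_of_isUnit ((isUnit_iff_isUnit_det _).2 hP)
  set v := familyMatrix A B k l u with hv
  set L : Fin 2 → Matrix (Fin m) (Fin m) 𝕜 := fun i => v - (-(mu i)⁻¹) • 1 with hLdef
  have hV : ∀ i y, symbol A B u (mu i) (lam i) *ᵥ y = mu i • (k • 1 + A u) *ᵥ L i *ᵥ y := by
    intro i y
    rw [hlam, symbol_eq_mul hP (hmu i), smul_mulVec, ← mulVec_mulVec]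
  have hL : ∀ i y, symbol A B u (mu i) (lam i) *ᵥ y = 0 ↔ L i *ᵥ y = 0 := fun i y => by
    rw [hlam]; exact symbol_mulVec_eq_zero_iff hP (hmu i)
  have hvξ : ∀ i, v *ᵥ ξ i = (-(mu i)⁻¹) • ξ i := fun i =>
    mulVec_eq_smul_of_sub.1 ((hL i _).1 (hξ i))
  have hchord : ∀ i j, (symbol A B u (mu j) (lam j) - symbol A B u (mu i) (lam i)) *ᵥ ξ i
      = ((mu j - mu i) * (-(mu i)⁻¹)) • (k • 1 + A u) *ᵥ ξ i := by
    intro i j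
    have : symbol A B u (mu j) (lam j) - symbol A B u (mu i) (lam i)
        = (mu j - mu i) • (l • 1 + B u) := by
      rw [symbol_sub, hlam, hlam]; module
    rw [this, smul_mulVec, ← mul_familyMatrix hP, ← mulVec_mulVec, ← hv, hvξ, mulVec_smul, smul_smul]
  have hne : ∀ i j, i ≠ j → mu j - mu i ≠ 0 ∧ η i ⬝ᵥ (k • 1 + A u) *ᵥ ξ i ≠ 0 := by
    intro i j hij
    have := hη i j hij
    rw [hchord, dotProduct_smul, smul_eq_mul] at this
    exact ⟨left_ne_zero_of_mul (left_ne_zero_of_mul this), right_ne_zero_of_mul this⟩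
  have hker : ∀ i y, L i *ᵥ y = 0 → ∃ c : 𝕜, y = c • ξ i := fun i y hy =>
    (hs i).ker y ((hL i y).2 hy)
  have hvec : ∀ i y, η i ⬝ᵥ symbol A B u (mu i) (lam i) *ᵥ y = 0 := fun i y => by
    rw [dotProduct_mulVec, (hs i).vecMul_eq, zero_dotProduct]
  have hrange : ∀ i j, i ≠ j → ∀ d, ∃ y, ∃ c : 𝕜, L i *ᵥ y + d + c • ξ i = 0 := by
    intro i j hij d
    have hη0 := (hne i j hij).2
    set c : 𝕜 := -(η i ⬝ᵥ (k • 1 + A u) *ᵥ d) / (η i ⬝ᵥ (k • 1 + A u) *ᵥ ξ i) with hc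
    obtain ⟨y, hy⟩ := (hs i).range (-(mu i) • (k • 1 + A u) *ᵥ (d + c • ξ i)) (by
      rw [mulVec_add, mulVec_smul, dotProduct_smul, dotProduct_add, dotProduct_smul, smul_eq_mul c,
        hc, div_mul_cancel₀ _ hη0]
      simp)
    refine ⟨y, c, hPinj ?_⟩
    rw [hV, neg_smul, ← smul_neg] at hy
    have := smul_right_injective (Fin m → 𝕜) (hmu i) hy
    rw [add_assoc, mulVec_add, this, mulVec_zero, neg_add_cancel]
  have hnil : ∀ i j, i ≠ j → ∀ y, ∀ c : 𝕜, L i *ᵥ y = c • ξ i → c = 0 := by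
    intro i j hij y c hy
    have h1 := hvec i y
    rw [hV, hy, mulVec_smul, dotProduct_smul, dotProduct_smul, smul_eq_mul, smul_eq_mul] at h1
    exact ((mul_eq_zero.1 ((mul_eq_zero.1 h1).resolve_left (hmu i))).resolve_right (hne i j hij).2)
  have hc : (mu 1)⁻¹ - (mu 0)⁻¹ ≠ 0 := by
    intro h0
    exact (hne 0 1 (by decide)).1 (sub_eq_zero.2 (inv_injective (sub_eq_zero.1 h0)))
  obtain ⟨x, a, b, h0, h1⟩ := exists_common_solution (L₀ := L 0) (L₁ := L 1) (ξ₀ := ξ 0) (ξ₁ := ξ 1)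
    (d₀ := matDeriv (familyMatrix A B k l) u (ξ 1) *ᵥ ξ 0)
    (d₁ := matDeriv (familyMatrix A B k l) u (ξ 0) *ᵥ ξ 1) (c := (mu 0)⁻¹ - (mu 1)⁻¹)
    (by rw [← neg_sub]; exact neg_ne_zero.2 hc)
    (by simp only [hLdef]; module) ((hL 0 _).1 (hξ 0)) ((hL 1 _).1 (hξ 1)) (hker 0) (hker 1)
    (hrange 0 1 (by decide) _) (hrange 1 0 (by decide) _) (hnil 0 1 (by decide))
    (hnil 1 0 (by decide)) (by
      have := haantjesForm_eigenvectors (D := matDerivₗ (familyMatrix A B k l) u) (hvξ 0) (hvξ 1)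
      rw [hH] at this
      exact this.symm)
  have key : ∀ i j, i ≠ j → ∀ c : 𝕜,
      L i *ᵥ x + matDeriv (familyMatrix A B k l) u (ξ j) *ᵥ ξ i + c • ξ i = 0 →
      symbol A B u (mu i) (lam i) *ᵥ x
        + pencilDeriv A B (fun _ => 1) u (mu i) (lam i) (ξ j) *ᵥ ξ i
        + (-c * (mu i * mu i) / (mu j - mu i)) • (symbol A B u (mu j) (lam j)
          - symbol A B u (mu i) (lam i)) *ᵥ ξ i = 0 := by
    intro i j hij c h
    have h1 := hξ i
    rw [hlam] at h1 ⊢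
    rw [hlam j, compatible_expr_eq hA hB hP (hmu i) h1]
    have h2 := (hne i j hij).1
    have : -(-c * (mu i * mu i) / (mu j - mu i) * (mu j - mu i) * ((mu i)⁻¹ * (mu i)⁻¹)) = c := by
      have := hmu i
      rw [div_mul_cancel₀ _ h2]
      field_simp
    rw [this]
    change mu i • (k • 1 + A u) *ᵥ (L i *ᵥ x + _ + _) = 0
    rw [h, mulVec_zero, smul_zero]
  refine compatible_of_exists (ξ := ξ) (fun i y hy => (hs i).ker y hy) (x := x)
    (a := ![-a * (mu 0 * mu 0) / (mu 1 - mu 0), -b * (mu 1 * mu 1) / (mu 0 - mu 1)])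
    fun i j hij => ?_
  fin_cases i <;> fin_cases j
  · exact absurd rfl hij
  · exact key 0 1 (by decide) a h0
  · exact key 1 0 (by decide) b h1
  · exact absurd rfl hij

end CompatibilityOnLines
end HydrodynamicType

namespace HydrodynamicType
open Filter Matrix

/-! ### Compatibility from the vanishing of the Haantjes tensors -/

section AllCompatible

universe v
variable {𝕜 : Type v} [RCLike 𝕜] {m : ℕ} {A B : (Fin m → 𝕜) → Matrix (Fin m) (Fin m) 𝕜}
  {U : Set (Fin m → 𝕜)} {u : Fin m → 𝕜}

theorem eventually_isUnit_det (M : Matrix (Fin m) (Fin m) 𝕜) (k₀ : 𝕜) :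
    ∀ᶠ k in 𝓝[≠] k₀, IsUnit (k • (1 : Matrix (Fin m) (Fin m) 𝕜) + M).det := by
  have hfin : {k : 𝕜 | (k • (1 : Matrix (Fin m) (Fin m) 𝕜) + M).det = 0}.Finite := by
    refine ((-M).charpoly.roots.toFinset.finite_toSet).subset fun k hk => ?_
    rw [Finset.mem_coe, Multiset.mem_toFinset, Polynomial.mem_roots (charpoly_monic _).ne_zero,
      Polynomial.IsRoot, eval_charpoly, sub_neg_eq_add]
    rw [scalar_apply, ← smul_one_eq_diagonal]
    exact hk
  have := (hfin.subset (Set.sdiff_subset (t := {k₀}))).isClosed.isOpen_compl.mem_nhds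
    (show k₀ ∈ ({k : 𝕜 | (k • (1 : Matrix (Fin m) (Fin m) 𝕜) + M).det = 0} \ {k₀})ᶜ from
      fun h => h.2 rfl)
  filter_upwards [nhdsWithin_le_nhds this, self_mem_nhdsWithin] with k h1 h2
  exact isUnit_iff_ne_zero.2 fun h3 => h1 ⟨h3, h2⟩

/-- A line which is not parallel to the `λ`-axis has parallel lines `λ = k + l μ` nearby for which
`kE + A` is invertible. -/
theorem HaantjesVanishes.compatible_of_ne (h : HaantjesVanishes A B U) (hu : u ∈ U)
    (hA : SmoothField A u) (hB : SmoothField B u) {lam mu : Fin 2 → 𝕜}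
    (hg : GenericPair A B u lam mu) (hne : mu 1 - mu 0 ≠ 0) :
    Compatible A B (fun _ => 1) u mu lam := by
  set n : 𝕜 × 𝕜 := (lam 1 - lam 0, mu 1 - mu 0) with hn
  obtain ⟨B', hB'⟩ : ∃ B' : (Fin m → 𝕜) → Matrix (Fin m) (Fin m) 𝕜, ∀ u,
    B' u = ((1, 0) : 𝕜 × 𝕜).2 • B u + ((1, 0) : 𝕜 × 𝕜).1 • 1 := ⟨_, fun _ => rfl⟩
  obtain ⟨C', hC'⟩ : ∃ C' : (Fin m → 𝕜) → Matrix (Fin m) (Fin m) 𝕜, ∀ u,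
    C' u = n.2 • B u + n.1 • 1 := ⟨_, fun _ => rfl⟩
  obtain ⟨s, q, hlam, hmu, ht⟩ := hg.exists_coordinates (e := (1, 0)) hC' (by simpa using hne)
  obtain ⟨P⟩ := GenericPair.exists_transversalBranches (n := n) hA hB hB' hC'
    (s₀ := fun _ => s) (q₀ := q) (by simpa only [n, hlam, hmu] using hg) (fun i => by
      rw [pencil_eq_symbol hB' hC']
      simpa only [n, hlam, hmu] using ht i)
  have hc : Tendsto (fun k : 𝕜 => (u, fun _ : Fin 2 => k)) (𝓝[≠] s) (𝓝 (u, fun _ => s)) := by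
    have : Continuous (fun k : 𝕜 => (u, fun _ : Fin 2 => k)) := by fun_prop
    exact (this.tendsto s).mono_left nhdsWithin_le_nhds
  have hev : ∀ᶠ k in 𝓝[≠] s, Compatible A B' C' u (fun _ => k) fun i => (P.β i).Q (u, k) := by
    filter_upwards [eventually_isUnit_det (A u) s, hc.eventually (P.eventually_genericPair hB' hC')]
      with k h1 h2
    refine (compatible_iff_symbol hB' hC').2 (compatible_of_haantjesForm (k := k) (l := n.1 / n.2)
      hA hB h1 h2 (fun i => ?_) ((haantjesForm_eq_zero_iff _ _).2 (h _ _ u hu h1)))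
    have : n.2 ≠ 0 := hne
    change k * 1 + _ = k + n.1 / n.2 * (k * 0 + _)
    field_simp
    ring
  have := P.compatible_of_frequently (hc.frequently hev.frequently)
  rw [compatible_iff_symbol hB' hC'] at this
  simpa only [n, hlam, hmu] using this

/-- Pairs on a line parallel to the `λ`-axis are limits of pairs with distinct `μ`. -/
theorem HaantjesVanishes.allCompatible (h : HaantjesVanishes A B U)
    (hA : ∀ u ∈ U, SmoothField A u) (hB : ∀ u ∈ U, SmoothField B u) : AllCompatible A B U := by
  intro u hu lam mu hg
  by_cases hne : mu 1 - mu 0 = 0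
  swap
  · exact h.compatible_of_ne hu (hA u hu) (hB u hu) hg hne
  have hB' : ∀ u, B u = ((0, 1) : 𝕜 × 𝕜).2 • B u
      + ((0, 1) : 𝕜 × 𝕜).1 • (1 : Matrix (Fin m) (Fin m) 𝕜) := fun _ => by simp
  have hC' : ∀ u, (fun _ => 1 : (Fin m → 𝕜) → Matrix (Fin m) (Fin m) 𝕜) u = ((1, 0) : 𝕜 × 𝕜).2 • B u
      + ((1, 0) : 𝕜 × 𝕜).1 • (1 : Matrix (Fin m) (Fin m) 𝕜) := fun _ => by simp
  obtain ⟨P⟩ := GenericPair.exists_transversalBranches (hA u hu) (hB u hu) hB' hC'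
    (s₀ := mu) (q₀ := lam) (by simpa using hg) (fun i => by
      have h1 := (genericPair_iff.1 hg).2 i (1 - i) (ne_one_sub i)
      have h2 : mu (1 - i) - mu i = 0 := by
        fin_cases i
        · exact hne
        · change mu 0 - mu 1 = 0
          rw [← neg_sub, hne, neg_zero]
      rw [symbol_sub, h2, zero_smul, zero_add, mul_smul_comm, trace_smul, smul_eq_mul] at h1
      exact right_ne_zero_of_mul h1)
  have hc : Tendsto (fun t : 𝕜 => (u, (![mu 0, t] : Fin 2 → 𝕜))) (𝓝[≠] (mu 1)) (𝓝 (u, mu)) := by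
    have : Continuous (fun t : 𝕜 => (u, (![mu 0, t] : Fin 2 → 𝕜))) := by fun_prop
    have h1 := this.tendsto (mu 1)
    rw [show (![mu 0, mu 1] : Fin 2 → 𝕜) = mu from by ext i; fin_cases i <;> rfl] at h1
    exact h1.mono_left nhdsWithin_le_nhds
  have hev : ∀ᶠ t in 𝓝[≠] (mu 1), Compatible A B (fun _ => 1) u ![mu 0, t]
      fun i => (P.β i).Q (u, (![mu 0, t] : Fin 2 → 𝕜) i) := by
    filter_upwards [hc.eventually (P.eventually_genericPair hB' hC'), self_mem_nhdsWithin]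
      with t h1 h2
    refine (compatible_iff_symbol hB' hC').2
      (h.compatible_of_ne hu (hA u hu) (hB u hu) h1 ?_)
    simpa [sub_eq_zero.1 hne, sub_eq_zero] using h2
  exact P.compatible_of_frequently (hc.frequently hev.frequently)

end AllCompatible
end HydrodynamicType

namespace HydrodynamicType
open Filter Matrix

/-! ### Compatibility from reductions -/

section CompatibilityFromReductions

universe v
variable {𝕜 : Type v} [RCLike 𝕜] {m : ℕ} {A B : (Fin m → 𝕜) → Matrix (Fin m) (Fin m) 𝕜}
  {U : Set (Fin m → 𝕜)} {Ω : Set (Fin 2 → 𝕜)} {u : (Fin 2 → 𝕜) → Fin m → 𝕜}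
  {lam mu : Fin 2 → (Fin 2 → 𝕜) → 𝕜} {R : Fin 2 → 𝕜}

/-- Commutativity of the flows means that the point `(λⁱ, μⁱ)` moves along the line joining the two
points when the other Riemann invariant varies. -/
theorem IsReduction.exists_pd_eq (h : IsReduction A B U Ω u lam mu) (hR : R ∈ Ω) :
    ∃ a : Fin 2 → 𝕜, ∀ i j, i ≠ j →
      pd j (mu i) R = a i * (mu j R - mu i R) ∧ pd j (lam i) R = a i * (lam j R - lam i R) := by
  have key : ∀ i, ∃ a : 𝕜, pd (1 - i) (mu i) R = a * (mu (1 - i) R - mu i R) ∧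
      pd (1 - i) (lam i) R = a * (lam (1 - i) R - lam i R) := by
    intro i
    have hc := h.commute R hR i (1 - i) (ne_one_sub i)
    by_cases hmu : mu (1 - i) R - mu i R = 0
    · have hlam : lam (1 - i) R - lam i R ≠ 0 := by
        intro hlam
        refine h.distinct R hR ?_
        have h1 := sub_eq_zero.1 hmu
        have h2 := sub_eq_zero.1 hlam
        fin_cases i
        · exact Prod.ext h2.symm h1.symm
        · exact Prod.ext h2 h1
      refine ⟨pd (1 - i) (lam i) R / (lam (1 - i) R - lam i R), ?_, (div_mul_cancel₀ _ hlam).symm⟩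
      rw [hmu, mul_zero] at hc ⊢
      exact (mul_eq_zero.1 hc.symm).resolve_right hlam
    · refine ⟨pd (1 - i) (mu i) R / (mu (1 - i) R - mu i R), (div_mul_cancel₀ _ hmu).symm, ?_⟩
      rw [div_mul_eq_mul_div, ← hc, mul_div_cancel_right₀ _ hmu]
  choose a ha using key
  exact ⟨a, fun i j hij => by rw [eq_one_sub hij]; exact ha i⟩

/-- The derivatives of the equations `(A + μⁱB + λⁱE) ∂ᵢu = 0` of a reduction along the other Riemann
invariant are the compatibility conditions. -/
theorem IsReduction.exists_solution (h : IsReduction A B U Ω u lam mu)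
    (hA : ∀ u ∈ U, SmoothField A u) (hB : ∀ u ∈ U, SmoothField B u) (hR : R ∈ Ω) :
    ∃ a : Fin 2 → 𝕜, ∀ i j, i ≠ j →
      symbol A B (u R) (mu i R) (lam i R) *ᵥ pd 0 (pd 1 u) R
        + pencilDeriv A B (fun _ => 1) (u R) (mu i R) (lam i R) (pd j u R) *ᵥ pd i u R
        + a i • (symbol A B (u R) (mu j R) (lam j R) - symbol A B (u R) (mu i R) (lam i R)) *ᵥ
          pd i u R = 0 := by
  obtain ⟨a, ha⟩ := h.exists_pd_eq hR
  have hu := HydrodynamicType.ContDiffOn.smoothNear h.smooth_u h.isOpen hR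
  refine ⟨a, fun i j hij => ?_⟩
  have hx : pd 0 (pd 1 u) R = pd j (pd i u) R := by
    fin_cases i <;> fin_cases j
    · exact absurd rfl hij
    · exact pd_comm hu
    · rfl
    · exact absurd rfl hij
  have := pencilDeriv_mulVec_add (U := u) (S := mu i) (Q := lam i) (Y := pd i u) (x := R)
    (hA _ (h.mapsTo hR)) (hB _ (h.mapsTo hR)) (C := fun _ => 1) (fun k l => smoothNear_const _) hu
    (HydrodynamicType.ContDiffOn.smoothNear (h.smooth_mu i) h.isOpen hR)
    (HydrodynamicType.ContDiffOn.smoothNear (h.smooth_lam i) h.isOpen hR) (hu.pd i)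
    (by filter_upwards [h.isOpen.mem_nhds hR] with R' hR' using h.eigen R' hR' i)
    (Pi.single j 1)
  change pencilDeriv A B (fun _ => 1) (u R) (mu i R) (lam i R) (pd j u R) *ᵥ pd i u R
    + (pd j (mu i) R • B (u R) + pd j (lam i) R • (1 : Matrix (Fin m) (Fin m) 𝕜)) *ᵥ pd i u R
    + symbol A B (u R) (mu i R) (lam i R) *ᵥ pd j (pd i u) R = 0 at this
  rw [hx, ← this, (ha i j hij).1, (ha i j hij).2, symbol_sub, mul_smul, mul_smul, ← smul_add,
    smul_mulVec]
  abel

/-- The kernels of the two symbols at a pair in general position are one-dimensional, so the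
derivatives `∂ᵢu` of the reduction through it span them. -/
theorem SpeedsUnrestricted.allCompatible (h : SpeedsUnrestricted A B U)
    (hA : ∀ u ∈ U, SmoothField A u) (hB : ∀ u ∈ U, SmoothField B u) : AllCompatible A B U := by
  intro u₀ hu₀ lam₀ mu₀ hg
  obtain ⟨Ω, u, lam, mu, hr, R, hR, huR, hs⟩ := h u₀ hu₀ lam₀ mu₀ hg
  obtain ⟨ξ, η, hξ, -⟩ := hg.exists_isSimplePair
  obtain ⟨a, ha⟩ := hr.exists_solution hA hB hR
  simp only [huR, (hs _).1, (hs _).2] at ha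
  refine compatible_of_exists (ξ := fun i => pd i u R) (fun i y hy => ?_)
    (x := pd 0 (pd 1 u) R) (a := a) ha
  obtain ⟨c, hc⟩ := (hξ i).ker y hy
  obtain ⟨d, hd⟩ := (hξ i).ker (pd i u R) (by
    have := hr.eigen R hR i
    rwa [huR, (hs i).1, (hs i).2] at this)
  have hd0 : d ≠ 0 := by
    rintro rfl
    exact (hr.surface R hR).ne_zero i (by rw [hd, zero_smul])
  exact ⟨c / d, by rw [hd, smul_smul, div_mul_cancel₀ _ hd0, hc]⟩

end CompatibilityFromReductions

/-! ### Simple spectra -/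

section SimpleSpectrum

variable {𝕜 : Type*} [RCLike 𝕜] {m : ℕ}

/-- The matrix `M` has `m` distinct eigenvalues in `𝕜`. -/
def HasSimpleSpectrum (M : Matrix (Fin m) (Fin m) 𝕜) : Prop :=
  ∃ ν : Fin m → 𝕜, Function.Injective ν ∧ ∀ i, (M - ν i • 1).det = 0

theorem exists_eigenvectors {M : Matrix (Fin m) (Fin m) 𝕜} {ν : Fin m → 𝕜}
    (hν : Function.Injective ν) (h : ∀ i, (M - ν i • 1).det = 0) :
    ∃ ξ : Fin m → Fin m → 𝕜, LinearIndependent 𝕜 ξ ∧ ∀ i, M *ᵥ ξ i = ν i • ξ i := by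
  choose ξ h0 hξ using fun i => exists_mulVec_eq_zero_iff.2 (h i)
  have hξ' : ∀ i, M *ᵥ ξ i = ν i • ξ i := fun i => mulVec_eq_smul_of_sub.1 (hξ i)
  refine ⟨ξ, Module.End.eigenvectors_linearIndependent' (toLin' M) ν hν ξ fun i => ?_, hξ'⟩
  exact Module.End.hasEigenvector_iff.2 ⟨Module.End.mem_eigenspace_iff.2 (by simp [hξ']), h0 i⟩

theorem det_smul_one_add_smul {M : Matrix (Fin m) (Fin m) 𝕜} {ν : Fin m → 𝕜}
    (hν : Function.Injective ν) (h : ∀ i, (M - ν i • 1).det = 0) (a b : 𝕜) :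
    (a • 1 + b • M).det = ∏ i, (a + b * ν i) := by
  obtain ⟨ξ, hli, hξ⟩ := exists_eigenvectors hν h
  set S : Matrix (Fin m) (Fin m) 𝕜 := of fun i j => ξ j i with hS
  have hdet : S.det ≠ 0 :=
    ((isUnit_iff_isUnit_det _).1 (linearIndependent_cols_iff_isUnit.1 hli)).ne_zero
  have hmul : (a • 1 + b • M) * S = S * diagonal fun i => a + b * ν i := by
    ext i j
    have := congrFun (hξ j) i
    rw [mul_diagonal, add_mul, smul_mul_assoc, one_mul, smul_mul_assoc, Matrix.add_apply,
      Matrix.smul_apply, Matrix.smul_apply]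
    change a • ξ j i + b • (M *ᵥ ξ j) i = ξ j i * _
    rw [this]
    simp only [Pi.smul_apply, smul_eq_mul]
    ring
  have := congrArg det hmul
  rw [det_mul, det_mul, det_diagonal, mul_comm] at this
  exact mul_left_cancel₀ hdet this

/-- The factor of a determinant with a simple eigenvalue has a nonzero derivative. -/
theorem hasDerivAt_prod_factor {ν : Fin m → 𝕜} (hν : Function.Injective ν) {a b : 𝕜} {i : Fin m}
    (hi : a + b * ν i = 0) (hne : a ≠ 0 ∨ b ≠ 0) (α β : 𝕜) :
    ∃ c : 𝕜, c ≠ 0 ∧ HasDerivAt (fun t : 𝕜 => ∏ k, ((a + t * α) + (b + t * β) * ν k))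
      ((α + β * ν i) * c) 0 := by
  have hb : b ≠ 0 := by
    rintro rfl
    simp only [zero_mul, add_zero, ne_eq, not_true_eq_false, or_false] at hi hne
    exact hne hi
  refine ⟨∏ k ∈ Finset.univ.erase i, (a + b * ν k), ?_, ?_⟩
  · refine Finset.prod_ne_zero_iff.2 fun k hk h0 => (Finset.mem_erase.1 hk).1 (hν ?_)
    refine mul_left_cancel₀ hb ?_
    linear_combination h0 - hi
  · have h1 : ∀ k, HasDerivAt (fun t : 𝕜 => (a + t * α) + (b + t * β) * ν k) (α + β * ν k) 0 := by
      intro k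
      have := (((hasDerivAt_id (0 : 𝕜)).mul_const α).const_add a).add
        ((((hasDerivAt_id (0 : 𝕜)).mul_const β).const_add b).mul_const (ν k))
      rw [one_mul, one_mul] at this
      exact this
    have h2 : DifferentiableAt 𝕜 (fun t : 𝕜 => ∏ k ∈ Finset.univ.erase i,
        ((a + t * α) + (b + t * β) * ν k)) 0 := by fun_prop
    have h3 := (h1 i).mul h2.hasDerivAt
    simp only [zero_mul, add_zero, hi, zero_mul] at h3
    have e : (fun t : 𝕜 => ∏ k, ((a + t * α) + (b + t * β) * ν k)) = fun t =>
        ((a + t * α) + (b + t * β) * ν i) * ∏ k ∈ Finset.univ.erase i,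
          ((a + t * α) + (b + t * β) * ν k) :=
      funext fun t => (Finset.mul_prod_erase _ _ (Finset.mem_univ i)).symm
    rw [e]
    exact h3

/-- Having `m` distinct eigenvalues is an open condition, by the implicit function theorem applied to
the characteristic equation. -/
theorem HasSimpleSpectrum.eventually {M : 𝕜 → Matrix (Fin m) (Fin m) 𝕜} {t₀ : 𝕜}
    (hM : ∀ i j, SmoothNear 𝕜 (fun t => M t i j) t₀) (h : HasSimpleSpectrum (M t₀)) :
    ∀ᶠ t in 𝓝 t₀, HasSimpleSpectrum (M t) := by
  obtain ⟨ν, hν, h0⟩ := h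
  have key : ∀ i, ∃ ψ : 𝕜 → 𝕜, SmoothNear 𝕜 ψ t₀ ∧ ψ t₀ = ν i ∧
      ∀ᶠ t in 𝓝 t₀, (M t - ψ t • 1).det = 0 := by
    intro i
    set Φ : 𝕜 × 𝕜 → 𝕜 := fun z => (M z.1 - z.2 • 1).det with hΦ
    have hι : SmoothNear 𝕜 (fun z : 𝕜 × 𝕜 => z) (t₀, ν i) := smoothNear_id
    have hs : SmoothNear 𝕜 Φ (t₀, ν i) := SmoothNear.det fun k l =>
      ((hM k l).comp_of_eq hι.fst rfl).sub (hι.snd.mul (smoothNear_const _))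
    obtain ⟨c, hc, hd⟩ := hasDerivAt_prod_factor hν (a := -ν i) (b := 1) (i := i) (by ring)
      (Or.inr one_ne_zero) (-1) 0
    have hd' : HasDerivAt (fun q => Φ (t₀, q)) ((-1 + 0 * ν i) * c) (ν i) := by
      have e : (fun q => Φ (t₀, q)) = fun q => ∏ k, ((-ν i + (q - ν i) * -1)
          + (1 + (q - ν i) * 0) * ν k) := by
        funext q
        simp only [hΦ]
        rw [show M t₀ - q • (1 : Matrix (Fin m) (Fin m) 𝕜) = (-q) • 1 + (1 : 𝕜) • M t₀ from by module,
          det_smul_one_add_smul hν h0]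
        refine Finset.prod_congr rfl fun k _ => ?_
        ring
      rw [e]
      have h1 : HasDerivAt (fun q => q - ν i) 1 (ν i) := (hasDerivAt_id _).sub_const _
      have := HasDerivAt.comp (h := fun q => q - ν i) (ν i) (by rw [sub_self]; exact hd) h1
      rw [mul_one] at this
      exact this
    have hder : fderiv 𝕜 Φ (t₀, ν i) ∘L .inr 𝕜 _ _ =
        ContinuousLinearMap.toSpanSingleton 𝕜 ((-1 + 0 * ν i) * c) := by
      have c1 := hs.differentiableAt.hasFDerivAt.comp (ν i)
        (hasFDerivAt_prodMk_right (𝕜 := 𝕜) t₀ (ν i))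
      exact c1.unique hd'.hasFDerivAt
    obtain ⟨ψ, p1, p2, p3, -⟩ := hs.exists_implicitFunction (h0 i) (by
      rw [hder]
      refine ⟨ContinuousLinearEquiv.unitsEquivAut 𝕜 (Units.mk0 ((-1 + 0 * ν i) * c) (by simpa using hc)), ?_⟩
      ext
      simp)
    exact ⟨ψ, p1, p2, p3⟩
  choose ψ p1 p2 p3 using key
  have hinj : ∀ᶠ t in 𝓝 t₀, ∀ i j, i ≠ j → ψ i t - ψ j t ≠ 0 := by
    refine eventually_all.2 fun i => eventually_all.2 fun j => ?_
    by_cases hij : i = j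
    · exact Eventually.of_forall fun y h => absurd hij h
    filter_upwards [((p1 i).continuousAt.sub (p1 j).continuousAt).eventually_ne
      (show ψ i t₀ - ψ j t₀ ≠ 0 by rw [p2, p2]; exact sub_ne_zero.2 (hν.ne hij))] with t ht _ using ht
  filter_upwards [hinj, eventually_all.2 p3] with t h1 h2
  refine ⟨fun i => ψ i t, fun i j hij => ?_, h2⟩
  by_contra hne
  exact h1 i j hne (sub_eq_zero.2 hij)

theorem SimpleSpectrumAt.exists_hasSimpleSpectrum
    {A B : (Fin m → 𝕜) → Matrix (Fin m) (Fin m) 𝕜} {u : Fin m → 𝕜} (h : SimpleSpectrumAt A B u) :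
    ∃ k l : 𝕜, IsUnit (k • (1 : Matrix (Fin m) (Fin m) 𝕜) + A u).det ∧
      HasSimpleSpectrum (familyMatrix A B k l u) := by
  obtain ⟨k, l, hP, ν, hν, he⟩ := h
  refine ⟨k, l, hP, ν, hν, fun i => exists_mulVec_eq_zero_iff.1 ?_⟩
  obtain ⟨ξ, hξ⟩ := (he i).exists_hasEigenvector
  refine ⟨ξ, hξ.2, mulVec_eq_smul_of_sub.2 ?_⟩
  simpa using hξ.apply_eq_smul

end SimpleSpectrum
end HydrodynamicType

namespace HydrodynamicType
open Filter Matrix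

/-! ### The Haantjes tensors of matrices with simple spectrum -/

section SimpleMembers

variable {𝕜 : Type*} [RCLike 𝕜] {m : ℕ} {A B : (Fin m → 𝕜) → Matrix (Fin m) (Fin m) 𝕜}
  {U : Set (Fin m → 𝕜)} {u : Fin m → 𝕜} {k l : 𝕜}

/-- Two nonzero eigenvalues of a matrix of the family with a simple spectrum give points of the
dispersion curve in general position. -/
theorem genericPair_of_eigenvalues (hP : IsUnit (k • (1 : Matrix (Fin m) (Fin m) 𝕜) + A u).det)
    {ν : Fin m → 𝕜} (hν : Function.Injective ν)
    (h : ∀ i, (familyMatrix A B k l u - ν i • 1).det = 0) (hν0 : ∀ i, ν i ≠ 0) {c : Fin 2 → Fin m}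
    (hc : c 0 ≠ c 1) : GenericPair A B u (fun i => k + l * -(ν (c i))⁻¹) fun i => -(ν (c i))⁻¹ := by
  have hd : ∀ s, (symbol A B u s (k + l * s)).det
      = (k • (1 : Matrix (Fin m) (Fin m) 𝕜) + A u).det * ∏ a, (1 + s * ν a) := by
    intro s
    rw [← det_smul_one_add_smul hν h, ← det_mul]
    congr 1
    rw [mul_add, mul_smul_comm, mul_one, mul_smul_comm, mul_familyMatrix hP, symbol, pencil]
    module
  have h0 : ∀ i, 1 + -(ν (c i))⁻¹ * ν (c i) = 0 := fun i => by
    rw [neg_mul, inv_mul_cancel₀ (hν0 _), add_neg_cancel]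
  refine genericPair_iff.2 ⟨fun i => ?_, fun i j hij => ?_⟩
  · rw [hd, Finset.prod_eq_zero (Finset.mem_univ (c i)) (h0 i), mul_zero]
  · obtain ⟨e, he, hder⟩ := hasDerivAt_prod_factor hν (h0 i) (Or.inl one_ne_zero) 0
      (-(ν (c j))⁻¹ - -(ν (c i))⁻¹)
    have h1 := hasDerivAt_dispersion_line (A := A) (B := B) u (-(ν (c i))⁻¹)
      (k + l * -(ν (c i))⁻¹) (-(ν (c j))⁻¹) (k + l * -(ν (c j))⁻¹) 0
    rw [zero_mul, zero_mul, add_zero, add_zero] at h1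
    have h2 := hder.const_mul (k • (1 : Matrix (Fin m) (Fin m) 𝕜) + A u).det
    have e1 : (fun t => dispersion A B u (-(ν (c i))⁻¹ + t * (-(ν (c j))⁻¹ - -(ν (c i))⁻¹))
        (k + l * -(ν (c i))⁻¹ + t * (k + l * -(ν (c j))⁻¹ - (k + l * -(ν (c i))⁻¹))))
        = fun t => (k • (1 : Matrix (Fin m) (Fin m) 𝕜) + A u).det *
          ∏ a, ((1 + t * 0) + (-(ν (c i))⁻¹ + t * (-(ν (c j))⁻¹ - -(ν (c i))⁻¹)) * ν a) := by
      funext t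
      have := hd (-(ν (c i))⁻¹ + t * (-(ν (c j))⁻¹ - -(ν (c i))⁻¹))
      simp only [mul_zero, add_zero]
      rw [← this, dispersion, symbol, pencil]
      congr 3
      ring
    rw [e1] at h1
    rw [h1.unique h2]
    have hne : c j ≠ c i := by
      fin_cases i <;> fin_cases j
      · exact absurd rfl hij
      · exact hc.symm
      · exact hc
      · exact absurd rfl hij
    have hsub : -(ν (c j))⁻¹ - -(ν (c i))⁻¹ ≠ 0 := by
      rw [sub_ne_zero]
      exact fun h3 => hne (hν (inv_injective (neg_injective h3)))
    refine mul_ne_zero hP.ne_zero (mul_ne_zero ?_ he)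
    rw [zero_add]
    exact mul_ne_zero hsub (hν0 _)

theorem ne_zero_of_isUnit_det (hP : IsUnit (k • (1 : Matrix (Fin m) (Fin m) 𝕜) + A u).det)
    (hQ : IsUnit (l • (1 : Matrix (Fin m) (Fin m) 𝕜) + B u).det) {ν : Fin m → 𝕜}
    (h : ∀ i, (familyMatrix A B k l u - ν i • 1).det = 0) (i : Fin m) : ν i ≠ 0 := by
  intro h0
  have h1 := h i
  rw [h0, zero_smul, sub_zero] at h1
  refine hQ.ne_zero ?_
  rw [← mul_familyMatrix hP, det_mul, h1, mul_zero]

/-- The Haantjes tensor vanishes on pairs of eigenvectors by compatibility, hence everywhere if the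
eigenvectors form a basis. -/
theorem AllCompatible.haantjes_eq_zero (h : AllCompatible A B U) (hu : u ∈ U)
    (hA : SmoothField A u) (hB : SmoothField B u)
    (hP : IsUnit (k • (1 : Matrix (Fin m) (Fin m) 𝕜) + A u).det)
    (hQ : IsUnit (l • (1 : Matrix (Fin m) (Fin m) 𝕜) + B u).det)
    (hs : HasSimpleSpectrum (familyMatrix A B k l u)) (i j n : Fin m) :
    haantjes (familyMatrix A B k l) u i j n = 0 := by
  refine (haantjesForm_eq_zero_iff _ _).1 ?_ i j n
  obtain ⟨ν, hν, h0⟩ := hs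
  have hν0 := ne_zero_of_isUnit_det hP hQ h0
  obtain ⟨ξ, hli, hξ⟩ := exists_eigenvectors hν h0
  have : Nonempty (Fin m) := ⟨i⟩
  obtain ⟨b, hbξ⟩ : ∃ b : Module.Basis (Fin m) 𝕜 (Fin m → 𝕜), ∀ i, b i = ξ i :=
    ⟨basisOfLinearIndependentOfCardEqFinrank hli (by simp), fun i => by
      rw [coe_basisOfLinearIndependentOfCardEqFinrank]⟩
  refine LinearMap.ext_basis b b fun p q => ?_
  rw [hbξ, hbξ]
  by_cases hpq : p = q
  · subst hpq
    exact haantjesForm_self _ _ (hξ p)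
  set c : Fin 2 → Fin m := ![p, q] with hc
  have hmu : ∀ i, -(ν (c i))⁻¹ ≠ 0 := fun i => neg_ne_zero.2 (inv_ne_zero (hν0 _))
  have hg := genericPair_of_eigenvalues hP hν h0 hν0 (c := c) hpq
  have hker : ∀ i, symbol A B u (-(ν (c i))⁻¹) (k + l * -(ν (c i))⁻¹) *ᵥ ξ (c i) = 0 := fun i =>
    (symbol_mulVec_eq_zero_iff hP (hmu i)).2 (by
      rw [mulVec_eq_smul_of_sub, inv_neg, inv_inv, neg_neg]
      exact hξ _)
  obtain ⟨x, a, hx⟩ := h u hu _ _ hg (fun i => ξ (c i)) hker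
  have := haantjesForm_eq_zero_of_solution (mu := fun i => -(ν (c i))⁻¹)
    (lam := fun i => k + l * -(ν (c i))⁻¹) (ξ := fun i => ξ (c i)) hA hB hP hmu (fun _ => rfl) hker hx
  exact this

end SimpleMembers

/-! ### Rational functions of a parameter -/

section Rational

open Polynomial

variable {𝕜 : Type*} [RCLike 𝕜] {m : ℕ} {d : 𝕜[X]} {f g : 𝕜 → 𝕜}

/-- The function `f` is a rational function with a power of `d` as denominator; no condition is
imposed at the zeros of `d`. -/
def RationalWith (d : 𝕜[X]) (f : 𝕜 → 𝕜) : Prop :=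
  ∃ (p : 𝕜[X]) (N : ℕ), ∀ t, d.eval t ≠ 0 → f t * d.eval t ^ N = p.eval t

theorem RationalWith.congr (hf : RationalWith d f) (h : ∀ t, d.eval t ≠ 0 → g t = f t) :
    RationalWith d g := by
  obtain ⟨p, N, hp⟩ := hf
  exact ⟨p, N, fun t ht => by rw [h t ht, hp t ht]⟩

theorem RationalWith.const (d : 𝕜[X]) (c : 𝕜) : RationalWith d fun _ => c :=
  ⟨C c, 0, fun t _ => by simp⟩

theorem RationalWith.id (d : 𝕜[X]) : RationalWith d fun t => t :=
  ⟨X, 0, fun t _ => by simp⟩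

theorem RationalWith.add (hf : RationalWith d f) (hg : RationalWith d g) :
    RationalWith d fun t => f t + g t := by
  obtain ⟨p, N, hp⟩ := hf
  obtain ⟨q, M, hq⟩ := hg
  refine ⟨p * d ^ M + q * d ^ N, N + M, fun t ht => ?_⟩
  simp only [eval_add, eval_mul, eval_pow, ← hp t ht, ← hq t ht, pow_add]
  ring

theorem RationalWith.mul (hf : RationalWith d f) (hg : RationalWith d g) :
    RationalWith d fun t => f t * g t := by
  obtain ⟨p, N, hp⟩ := hf
  obtain ⟨q, M, hq⟩ := hg
  refine ⟨p * q, N + M, fun t ht => ?_⟩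
  simp only [eval_mul, ← hp t ht, ← hq t ht, pow_add]
  ring

theorem RationalWith.sub (hf : RationalWith d f) (hg : RationalWith d g) :
    RationalWith d fun t => f t - g t :=
  (hf.add ((RationalWith.const d (-1)).mul hg)).congr fun t _ => by ring

theorem RationalWith.sum {ι : Type*} {s : Finset ι} {f : ι → 𝕜 → 𝕜}
    (h : ∀ i, RationalWith d (f i)) : RationalWith d fun t => ∑ i ∈ s, f i t := by
  classical
  induction s using Finset.induction_on with
  | empty => simpa using RationalWith.const d 0
  | insert a s ha ih => simpa [Finset.sum_insert ha] using (h a).add ih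

theorem eventually_eval_ne_zero {p : 𝕜[X]} (hp : p ≠ 0) (t₀ : 𝕜) :
    ∀ᶠ t in 𝓝[≠] t₀, p.eval t ≠ 0 := by
  have hfin : {t : 𝕜 | p.eval t = 0}.Finite :=
    (p.roots.toFinset.finite_toSet).subset fun t ht => by
      rw [Finset.mem_coe, Multiset.mem_toFinset, Polynomial.mem_roots hp]
      exact ht
  have := (hfin.subset (Set.sdiff_subset (t := {t₀}))).isClosed.isOpen_compl.mem_nhds
    (show t₀ ∈ ({t : 𝕜 | p.eval t = 0} \ {t₀})ᶜ from fun h => h.2 rfl)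
  filter_upwards [nhdsWithin_le_nhds this, self_mem_nhdsWithin] with t h1 h2 h3
  exact h1 ⟨h3, h2⟩

/-- The identity principle for rational functions. -/
theorem RationalWith.eq_zero (hf : RationalWith d f) {t₀ : 𝕜}
    (h : ∃ᶠ t in 𝓝[≠] t₀, d.eval t ≠ 0 ∧ f t = 0) {t : 𝕜} (ht : d.eval t ≠ 0) : f t = 0 := by
  obtain ⟨p, N, hp⟩ := hf
  have hp0 : p = 0 := by
    by_contra hne
    obtain ⟨s, h1, h2⟩ := (h.and_eventually (eventually_eval_ne_zero hne t₀)).exists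
    exact h2 (by rw [← hp s h1.1, h1.2, zero_mul])
  have := hp t ht
  rw [hp0, eval_zero] at this
  exact (mul_eq_zero.1 this).resolve_right (pow_ne_zero _ ht)

theorem RationalWith.matrix_mul {M N : 𝕜 → Matrix (Fin m) (Fin m) 𝕜}
    (hM : ∀ i j, RationalWith d fun t => M t i j) (hN : ∀ i j, RationalWith d fun t => N t i j)
    (i j : Fin m) : RationalWith d fun t => (M t * N t) i j := by
  simp only [mul_apply]
  exact RationalWith.sum fun p => (hM i p).mul (hN p j)

theorem RationalWith.haantjes {v : 𝕜 → (Fin m → 𝕜) → Matrix (Fin m) (Fin m) 𝕜} {u : Fin m → 𝕜}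
    (hv : ∀ i j, RationalWith d fun t => v t u i j)
    (hdv : ∀ p i j, RationalWith d fun t => matDeriv (v t) u (Pi.single p 1) i j) (i j n : Fin m) :
    RationalWith d fun t => haantjes (v t) u i j n := by
  have hN : ∀ i j n, RationalWith d fun t => nijenhuis (v t) u i j n := fun i j n =>
    RationalWith.sum fun p => (((hv p j).mul (hdv p i n)).sub ((hv p n).mul (hdv p i j))).sub
      ((hv i p).mul ((hdv j p n).sub (hdv n p j)))
  exact RationalWith.sum fun p => RationalWith.sum fun r =>
    (((((hN i p r).mul (hv p j)).mul (hv r n)).sub (((hN p j r).mul (hv i p)).mul (hv r n))).sub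
      (((hN p r n).mul (hv i p)).mul (hv r j))).add (((hN p j n).mul (hv i r)).mul (hv r p))

variable {A B : (Fin m → 𝕜) → Matrix (Fin m) (Fin m) 𝕜} {u : Fin m → 𝕜}

theorem matDeriv_familyMatrix {k l : 𝕜} (hA : SmoothField A u) (hB : SmoothField B u)
    (hP : IsUnit (k • (1 : Matrix (Fin m) (Fin m) 𝕜) + A u).det) (X : Fin m → 𝕜) :
    matDeriv (familyMatrix A B k l) u X = (k • (1 : Matrix (Fin m) (Fin m) 𝕜) + A u)⁻¹ *
      (matDeriv B u X - matDeriv A u X * familyMatrix A B k l u) := by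
  rw [← mul_matDeriv_familyMatrix hA hB hP, nonsing_inv_mul_cancel_left _ _ hP]

/-- If the inverses of `k(t)E + A` are rational in `t`, then so is the Haantjes tensor. -/
theorem rationalWith_haantjes_family {k l : 𝕜 → 𝕜} (hA : SmoothField A u) (hB : SmoothField B u)
    (hd : ∀ t, d.eval t ≠ 0 → IsUnit (k t • (1 : Matrix (Fin m) (Fin m) 𝕜) + A u).det)
    (hl : RationalWith d l)
    (hinv : ∀ i j, RationalWith d fun t => (k t • (1 : Matrix (Fin m) (Fin m) 𝕜) + A u)⁻¹ i j)
    (i j n : Fin m) :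
    RationalWith d fun t => haantjes (familyMatrix A B (k t) (l t)) u i j n := by
  have hv : ∀ i j, RationalWith d fun t => familyMatrix A B (k t) (l t) u i j :=
    RationalWith.matrix_mul hinv fun i j =>
      (hl.mul (RationalWith.const d _)).add (RationalWith.const d _)
  refine RationalWith.haantjes hv (fun p i j => ?_) i j n
  refine (RationalWith.matrix_mul hinv (N := fun t => matDeriv B u (Pi.single p 1)
    - matDeriv A u (Pi.single p 1) * familyMatrix A B (k t) (l t) u) (fun i j => ?_) i j).congr
    fun t ht => by rw [matDeriv_familyMatrix hA hB (hd t ht)]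
  exact (RationalWith.const d _).sub
    (RationalWith.matrix_mul (M := fun _ => matDeriv A u (Pi.single p 1))
      (fun i j => RationalWith.const d _) hv i j)

theorem rationalWith_inv (M : Matrix (Fin m) (Fin m) 𝕜) (i j : Fin m) :
    RationalWith (-M).charpoly fun k => (k • (1 : Matrix (Fin m) (Fin m) 𝕜) + M)⁻¹ i j := by
  set Q : Matrix (Fin m) (Fin m) 𝕜[X] := charmatrix (-M) with hQ
  have hev : ∀ k : 𝕜, (evalRingHom k).mapMatrix Q = k • 1 + M := by
    intro k
    ext a b
    simp only [RingHom.mapMatrix_apply, map_apply, hQ, charmatrix_apply, coe_evalRingHom]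
    by_cases hab : a = b
    · subst hab; simp
    · simp [hab]
  have hdet : ∀ k : 𝕜, (-M).charpoly.eval k = (k • (1 : Matrix (Fin m) (Fin m) 𝕜) + M).det := by
    intro k
    rw [← hev, ← RingHom.map_det]
    rfl
  refine ⟨Q.adjugate i j, 1, fun k hk => ?_⟩
  have hadj : (Q.adjugate i j).eval k = (k • (1 : Matrix (Fin m) (Fin m) 𝕜) + M).adjugate i j := by
    rw [← hev, ← RingHom.map_adjugate]
    rfl
  dsimp only
  rw [hadj, hdet, inv_def, Ring.inverse_eq_inv', Matrix.smul_apply, smul_eq_mul, pow_one]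
  rw [hdet] at hk
  field_simp

theorem eval_charpoly_neg (M : Matrix (Fin m) (Fin m) 𝕜) (k : 𝕜) :
    (-M).charpoly.eval k = (k • (1 : Matrix (Fin m) (Fin m) 𝕜) + M).det := by
  rw [eval_charpoly, sub_neg_eq_add, scalar_apply, ← smul_one_eq_diagonal]

end Rational

/-! ### The Haantjes tensors of the whole family -/

section Vanishing

open Polynomial

variable {𝕜 : Type*} [RCLike 𝕜] {m : ℕ} {A B : (Fin m → 𝕜) → Matrix (Fin m) (Fin m) 𝕜}
  {U : Set (Fin m → 𝕜)}

/-- Compatibility implies that the Haantjes tensor vanishes for the matrices of the family close to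
one with a simple spectrum; being rational in `k` and `l`, it vanishes identically. -/
theorem AllCompatible.haantjesVanishes (h : AllCompatible A B U)
    (hA : ∀ u ∈ U, SmoothField A u) (hB : ∀ u ∈ U, SmoothField B u)
    (hsimple : ∀ u ∈ U, SimpleSpectrumAt A B u) : HaantjesVanishes A B U := by
  intro k l u hu hP i j n
  obtain ⟨k₀, l₀, hP₀, hs₀⟩ := (hsimple u hu).exists_hasSimpleSpectrum
  have hl : ∀ᶠ l in 𝓝[≠] l₀, ∀ k, IsUnit (k • (1 : Matrix (Fin m) (Fin m) 𝕜) + A u).det →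
      haantjes (familyMatrix A B k l) u i j n = 0 := by
    have hs : ∀ᶠ l in 𝓝[≠] l₀, HasSimpleSpectrum (familyMatrix A B k₀ l u) := by
      refine nhdsWithin_le_nhds (HasSimpleSpectrum.eventually (fun a b => ?_) hs₀)
      simp only [familyMatrix, mul_apply]
      exact SmoothNear.sum fun p _ => (smoothNear_const _).mul
        ((smoothNear_id.mul (smoothNear_const _)).add (smoothNear_const _))
    filter_upwards [hs, eventually_isUnit_det (B u) l₀] with l h1 h2 k hk
    have hP' : ∀ a b, SmoothNear 𝕜 (fun k => (k • (1 : Matrix (Fin m) (Fin m) 𝕜) + A u) a b) k₀ :=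
      fun a b => (smoothNear_id.mul (smoothNear_const _)).add (smoothNear_const _)
    have hs' : ∀ᶠ k in 𝓝[≠] k₀, HasSimpleSpectrum (familyMatrix A B k l u) := by
      refine nhdsWithin_le_nhds (HasSimpleSpectrum.eventually (fun a b => ?_) h1)
      simp only [familyMatrix, mul_apply, inv_def, Ring.inverse_eq_inv', Matrix.smul_apply,
        smul_eq_mul]
      exact SmoothNear.sum fun p _ => ((((smoothNear_const (1 : 𝕜)).div (SmoothNear.det hP')
        hP₀.ne_zero).congr (Eventually.of_forall fun k => by simp)).mul
          (SmoothNear.adjugate hP' a p)).mul (smoothNear_const _)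
    refine RationalWith.eq_zero (d := (-(A u)).charpoly) (t₀ := k₀)
      (rationalWith_haantjes_family (l := fun _ => l) (hA u hu) (hB u hu) (fun t ht => ?_)
        (RationalWith.const _ _) (rationalWith_inv (A u)) i j n) (Eventually.frequently ?_)
      (by rw [eval_charpoly_neg]; exact hk.ne_zero)
    · rw [eval_charpoly_neg] at ht
      exact isUnit_iff_ne_zero.2 ht
    · filter_upwards [hs', eventually_isUnit_det (A u) k₀] with k h3 h4
      exact ⟨by rw [eval_charpoly_neg]; exact h4.ne_zero,
        h.haantjes_eq_zero hu (hA u hu) (hB u hu) h4 h2 h3 i j n⟩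
  refine RationalWith.eq_zero (d := 1) (t₀ := l₀)
    (rationalWith_haantjes_family (k := fun _ => k) (hA u hu) (hB u hu) (fun t _ => hP)
      (RationalWith.id _) (fun _ _ => RationalWith.const _ _) i j n) (Eventually.frequently ?_)
    (by simp)
  filter_upwards [hl] with l h1
  exact ⟨by simp, h1 k hP⟩

end Vanishing
end HydrodynamicType

namespace HydrodynamicType
open Filter Matrix

/-! ### The base speeds of the double waves -/

section BasePair

universe v
variable {𝕜 : Type v} [RCLike 𝕜] {m : ℕ} {A B C : (Fin m → 𝕜) → Matrix (Fin m) (Fin m) 𝕜}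
  {u₀ : Fin m → 𝕜}

/-- A branch `q = Q(s)` which is not constant is transversal to the line `q = const` at suitable
nearby points. -/
theorem PencilBranch.frequently_transversal {s₀ q₀ : 𝕜} (β : PencilBranch A B C u₀ s₀ q₀)
    (hne : ¬∀ᶠ s in 𝓝 s₀, (pencil A B C u₀ s q₀).det = 0) :
    ∃ᶠ s in 𝓝 s₀, ((β.V (u₀, s)).adjugate * B u₀).trace ≠ 0 := by
  intro h
  have ht : Tendsto (fun s : 𝕜 => (u₀, s)) (𝓝 s₀) (𝓝 (u₀, s₀)) :=
    (Continuous.prodMk_right u₀).tendsto s₀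
  have hs : ∀ᶠ s in 𝓝 s₀, HasDerivAt (fun s => β.Q (u₀, s)) 0 s := by
    filter_upwards [h, ht.eventually β.isSimplePair, ht.eventually β.transversal',
      ht.eventually β.deriv_kernel, ht.eventually β.smooth_Q.eventually_differentiableAt,
      ht.eventually β.det_eq, ht.eventually β.pivot] with s h1 h2 h3 h4 h5 h6 h7
    have h1' : ((β.V (u₀, s)).adjugate * B u₀).trace = 0 := not_not.1 h1
    have e0 := adjugate_mul_trace (V := β.V (u₀, s)) h6 h7 (B u₀)
    rw [h1', mul_zero] at e0
    change β.η (u₀, s) ⬝ᵥ B u₀ *ᵥ β.ξ (u₀, s) = 0 at e0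
    have e1 := congrArg (fun y => β.η (u₀, s) ⬝ᵥ y) (h4 0 1)
    have e2 : pencilDeriv A B C u₀ s (β.Q (u₀, s)) 0 = 0 := by
      have := pencilDeriv_smul (A := A) (B := B) (C := C) u₀ s (β.Q (u₀, s)) 0 0
      rwa [zero_smul, zero_smul] at this
    simp only [e2, zero_mulVec, zero_add, one_smul, dotProduct_add, add_mulVec, smul_mulVec,
      dotProduct_smul, e0, dotProduct_mulVec (β.η (u₀, s)) (β.V (u₀, s)), h2.vecMul_eq,
      zero_dotProduct, add_zero, dotProduct_zero, smul_eq_mul] at e1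
    have e3 := (mul_eq_zero.1 e1).resolve_right h3
    have h6 := h5.hasFDerivAt.comp_hasDerivAt s ((hasFDerivAt_prodMk_right (𝕜 := 𝕜) u₀ s).hasDerivAt)
    rw [show fderiv 𝕜 β.Q (u₀, s) ((ContinuousLinearMap.inr 𝕜 (Fin m → 𝕜) 𝕜) 1) = 0 from e3] at h6
    exact h6
  refine hne ?_
  have hcomp : ∀ᶠ s in 𝓝 s₀, β.Q (u₀, s) = q₀ := by
    have hQ : SmoothNear 𝕜 (fun s => β.Q (u₀, s)) s₀ :=
      β.smooth_Q.comp_of_eq ((smoothNear_const _).prodMk smoothNear_id) rfl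
    have hsh : SmoothNear 𝕜 (fun s : 𝕜 => s₀ + s) 0 := (smoothNear_const _).add smoothNear_id
    have ht0 : Tendsto (fun s : 𝕜 => s₀ + s) (𝓝 0) (𝓝 s₀) := by
      simpa using hsh.continuousAt.tendsto
    have := eventuallyEq_of_deriv_eq (f := fun s => β.Q (u₀, s₀ + s)) (g := fun _ => q₀)
      (hQ.comp_of_eq hsh (add_zero _)) (smoothNear_const _) (by simp [β.base]) (by
        filter_upwards [ht0.eventually hs] with s hs
        rw [deriv_const]
        have h1 : HasDerivAt (fun s => s₀ + s) 1 s := (hasDerivAt_id s).const_add s₀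
        have h2 := (HasDerivAt.comp (h := fun s => s₀ + s) s hs h1).deriv
        rw [zero_mul] at h2
        exact h2)
    have ht1 : Tendsto (fun s : 𝕜 => s - s₀) (𝓝 s₀) (𝓝 0) := by
      have : Continuous (fun s : 𝕜 => s - s₀) := by fun_prop
      simpa using this.tendsto s₀
    filter_upwards [ht1.eventually this] with s hs
    simpa using hs
  filter_upwards [hcomp, ht.eventually β.det_eq] with s h1 h2
  rwa [h1] at h2

/-- A simple spectrum provides two points of the dispersion curve in general position where `λ` is
locally a function of `μ`, with different values of `μ`. -/
theorem SimpleSpectrumAt.exists_basePair (h : SimpleSpectrumAt A B u₀) (hm : 2 ≤ m)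
    (hA : SmoothField A u₀) (hB : SmoothField B u₀) :
    ∃ lam mu : Fin 2 → 𝕜, GenericPair A B u₀ lam mu ∧ mu 1 - mu 0 ≠ 0 ∧
      ∀ i, ((symbol A B u₀ (mu i) (lam i)).adjugate * 1).trace ≠ 0 := by
  obtain ⟨k, l₀, hP, hs₀⟩ := h.exists_hasSimpleSpectrum
  obtain ⟨l, ⟨ν, hν, h0⟩, hQ⟩ : ∃ l, HasSimpleSpectrum (familyMatrix A B k l u₀) ∧
      IsUnit (l • (1 : Matrix (Fin m) (Fin m) 𝕜) + B u₀).det := by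
    have hs : ∀ᶠ l in 𝓝[≠] l₀, HasSimpleSpectrum (familyMatrix A B k l u₀) := by
      refine nhdsWithin_le_nhds (HasSimpleSpectrum.eventually (fun a b => ?_) hs₀)
      simp only [familyMatrix, mul_apply]
      exact SmoothNear.sum fun p _ => (smoothNear_const _).mul
        ((smoothNear_id.mul (smoothNear_const _)).add (smoothNear_const _))
    exact (hs.and (eventually_isUnit_det (B u₀) l₀)).exists
  have hν0 := ne_zero_of_isUnit_det hP hQ h0
  set c : Fin 2 → Fin m := ![⟨0, by omega⟩, ⟨1, by omega⟩] with hc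
  have hc01 : c 0 ≠ c 1 := by simp [hc]
  have hg := genericPair_of_eigenvalues hP hν h0 hν0 hc01
  obtain ⟨q, hq⟩ : ∃ q : Fin 2 → 𝕜, ∀ i, q i = -(ν (c i))⁻¹ := ⟨_, fun _ => rfl⟩
  simp only [← hq] at hg
  have hq01 : q 1 - q 0 ≠ 0 := by
    rw [hq, hq, sub_ne_zero]
    exact fun h3 => hc01 (hν (inv_injective (neg_injective h3))).symm
  have hqij : ∀ i, q (1 - i) - q i ≠ 0 := by
    intro i
    fin_cases i
    · exact hq01
    · change q 0 - q 1 ≠ 0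
      rw [← neg_sub]; exact neg_ne_zero.2 hq01
  -- the coordinates are those for which the lines `s = const` are parallel to the line of the pair
  have hB' : ∀ u, (fun _ => 1 : (Fin m → 𝕜) → Matrix (Fin m) (Fin m) 𝕜) u
    = ((1, 0) : 𝕜 × 𝕜).2 • B u + ((1, 0) : 𝕜 × 𝕜).1 • (1 : Matrix (Fin m) (Fin m) 𝕜) := by simp
  obtain ⟨C', hC'⟩ : ∃ C' : (Fin m → 𝕜) → Matrix (Fin m) (Fin m) 𝕜, ∀ u,
    C' u = ((l, 1) : 𝕜 × 𝕜).2 • B u + ((l, 1) : 𝕜 × 𝕜).1 • 1 := ⟨_, fun _ => rfl⟩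
  obtain ⟨P⟩ := GenericPair.exists_transversalBranches hA hB hB' hC'
    (s₀ := fun _ => k) (q₀ := q) (by simpa [mul_comm l] using hg) (fun i => by
      have h1 := (genericPair_iff.1 hg).2 i (1 - i) (ne_one_sub i)
      have h2 : symbol A B u₀ (q (1 - i)) (k + l * q (1 - i)) - symbol A B u₀ (q i) (k + l * q i)
          = (q (1 - i) - q i) • C' u₀ := by
        rw [symbol_sub, hC']
        module
      rw [h2, mul_smul_comm, trace_smul, smul_eq_mul] at h1
      rw [pencil_eq_symbol hB' hC']
      have h3 := right_ne_zero_of_mul h1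
      simpa [mul_comm l] using h3)
  have hfreq : ∀ i, ∃ᶠ s in 𝓝 k, (((P.β i).V (u₀, s)).adjugate * 1).trace ≠ 0 := by
    intro i
    refine (P.β i).frequently_transversal fun hev => ?_
    have h1 := eventually_isUnit_det (A u₀ + q i • C' u₀) k
    obtain ⟨s, h2, h3⟩ := (h1.and (nhdsWithin_le_nhds hev)).exists
    refine h2.ne_zero ?_
    rw [← h3, pencil]
    congr 1
    abel
  have hmune : ∀ᶠ y in 𝓝 (u₀, fun _ : Fin 2 => k), P.q 1 y - P.q 0 y ≠ 0 := by
    refine ((P.smooth_q 1).sub (P.smooth_q 0)).continuousAt.eventually_ne ?_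
    simpa only [TransversalBranches.q, (P.β _).base] using hq01
  have htend : Tendsto (fun z : 𝕜 × 𝕜 => (u₀, (![z.1, z.2] : Fin 2 → 𝕜))) (𝓝 k ×ˢ 𝓝 k)
      (𝓝 (u₀, fun _ => k)) := by
    have : Continuous (fun z : 𝕜 × 𝕜 => (u₀, (![z.1, z.2] : Fin 2 → 𝕜))) := by fun_prop
    have h1 := this.tendsto (k, k)
    rw [nhds_prod_eq] at h1
    rwa [show (![(k, k).1, (k, k).2] : Fin 2 → 𝕜) = fun _ => k from by
      ext i; fin_cases i <;> rfl] at h1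
  obtain ⟨p₀, hp₀, p₁, hp₁, hp⟩ := eventually_prod_iff.1
    (htend.eventually ((P.eventually_genericPair hB' hC').and hmune))
  obtain ⟨x, hx1, hx2⟩ := ((hfreq 0).and_eventually hp₀).exists
  obtain ⟨y, hy1, hy2⟩ := ((hfreq 1).and_eventually hp₁).exists
  obtain ⟨h1, h2⟩ := hp hx2 hy2
  refine ⟨_, _, h1, ?_, fun i => ?_⟩
  · simpa using h2
  · rw [← pencil_eq_symbol (A := A) hB' hC']
    fin_cases i
    · exact hx1
    · exact hy1

end BasePair
end HydrodynamicType

namespace HydrodynamicType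
open Filter Matrix

/-! ### The data on the axis -/

section Cramer

universe v
variable {𝕜 : Type v} [RCLike 𝕜] {m : ℕ} {A B C : (Fin m → 𝕜) → Matrix (Fin m) (Fin m) 𝕜}
  {u₀ : Fin m → 𝕜} {s₀ q₀ : Fin 2 → 𝕜}

namespace TransversalBranches

variable (P : TransversalBranches A B C u₀ s₀ q₀)

/-- The coefficients of the combination of `ξ₀` and `ξ₁` whose entries in the rows `P.rows` are
given, as functions of these two entries and of `(u, s₀, s₁)`. -/
noncomputable def cramer (i : Fin 2) (z : (𝕜 × 𝕜) × ((Fin m → 𝕜) × (Fin 2 → 𝕜))) : 𝕜 :=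
  ![z.1.1 * P.ξ 1 z.2 P.rows.2 - z.1.2 * P.ξ 1 z.2 P.rows.1,
    P.ξ 0 z.2 P.rows.1 * z.1.2 - P.ξ 0 z.2 P.rows.2 * z.1.1] i / P.minor (P.ξ 0 z.2) (P.ξ 1 z.2)

theorem smooth_cramer (i : Fin 2) (z : 𝕜 × 𝕜) : SmoothNear 𝕜 (P.cramer i) (z, (u₀, s₀)) := by
  have hι : SmoothNear 𝕜 (fun z : (𝕜 × 𝕜) × ((Fin m → 𝕜) × (Fin 2 → 𝕜)) => z) (z, (u₀, s₀)) :=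
    smoothNear_id
  have hξ : ∀ i k, SmoothNear 𝕜 (fun z : (𝕜 × 𝕜) × ((Fin m → 𝕜) × (Fin 2 → 𝕜)) => P.ξ i z.2 k)
      (z, (u₀, s₀)) := fun i k => ((P.smooth_ξ i).comp_of_eq hι.snd rfl).apply k
  have hm : SmoothNear 𝕜 (fun z : (𝕜 × 𝕜) × ((Fin m → 𝕜) × (Fin 2 → 𝕜)) =>
      P.minor (P.ξ 0 z.2) (P.ξ 1 z.2)) (z, (u₀, s₀)) :=
    ((hξ 0 _).mul (hξ 1 _)).sub ((hξ 0 _).mul (hξ 1 _))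
  fin_cases i
  · exact ((hι.fst.fst.mul (hξ 1 _)).sub (hι.fst.snd.mul (hξ 1 _))).div hm P.minor_base
  · exact (((hξ 0 _).mul hι.fst.snd).sub ((hξ 0 _).mul hι.fst.fst)).div hm P.minor_base

theorem cramer_combination {y : (Fin m → 𝕜) × (Fin 2 → 𝕜)} (h : P.minor (P.ξ 0 y) (P.ξ 1 y) ≠ 0)
    (z : 𝕜 × 𝕜) :
    (P.cramer 0 (z, y) • P.ξ 0 y + P.cramer 1 (z, y) • P.ξ 1 y) P.rows.1 = z.1 ∧
      (P.cramer 0 (z, y) • P.ξ 0 y + P.cramer 1 (z, y) • P.ξ 1 y) P.rows.2 = z.2 := by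
  simp only [Pi.add_apply, Pi.smul_apply, smul_eq_mul, cramer, cons_val_zero, cons_val_one]
  constructor <;> rw [div_mul_eq_mul_div, div_mul_eq_mul_div, ← add_div, div_eq_iff h, minor] <;> ring

theorem eq_cramer {y : (Fin m → 𝕜) × (Fin 2 → 𝕜)} (h : P.minor (P.ξ 0 y) (P.ξ 1 y) ≠ 0)
    {x : Fin m → 𝕜} {p : Fin 2 → 𝕜} (hx : x = p 0 • P.ξ 0 y + p 1 • P.ξ 1 y) (i : Fin 2) :
    p i = P.cramer i ((x P.rows.1, x P.rows.2), y) := by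
  subst hx
  simp only [cramer, Pi.add_apply, Pi.smul_apply, smul_eq_mul]
  rw [eq_div_iff h, minor]
  fin_cases i <;> simp <;> ring

/-- The derivatives of the two prescribed components of `u` for which both Riemann invariants of the
double wave vary along the axis. -/
def admissible : Set (𝕜 × 𝕜) := {z | ∀ i, P.cramer i (z, (u₀, s₀)) ≠ 0}

theorem isOpen_admissible : IsOpen P.admissible := by
  have : P.admissible = ⋂ i, {z | P.cramer i (z, (u₀, s₀)) ≠ 0} := by
    ext; simp [admissible]
  rw [this]
  refine isOpen_iInter_of_finite fun i => isOpen_ne.preimage ?_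
  refine continuous_iff_continuousAt.2 fun z => ?_
  exact (P.smooth_cramer i z).continuousAt.comp
    (f := fun z : 𝕜 × 𝕜 => (z, (u₀, s₀))) (by fun_prop)

theorem dense_admissible : Dense P.admissible := by
  -- the lines in the direction with both coefficients equal to `1` meet the complement in at most
  -- two points
  intro z
  set v := P.ξ 0 (u₀, s₀) + P.ξ 1 (u₀, s₀) with hv
  have key : ∀ (t : 𝕜) (i : Fin 2), P.cramer i (z + t • (v P.rows.1, v P.rows.2), (u₀, s₀))
      = P.cramer i (z, (u₀, s₀)) + t := by
    intro t i
    have h1 := P.eq_cramer (y := (u₀, s₀)) P.minor_base (x := v) (p := fun _ => 1)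
      (by simp [hv]) i
    have h2 : P.cramer i (z + t • (v P.rows.1, v P.rows.2), (u₀, s₀))
        = P.cramer i (z, (u₀, s₀)) + t * P.cramer i ((v P.rows.1, v P.rows.2), (u₀, s₀)) := by
      fin_cases i <;> simp [cramer] <;> ring
    rw [h2, ← h1, mul_one]
  have hcont : Tendsto (fun t : 𝕜 => z + t • (v P.rows.1, v P.rows.2)) (𝓝[≠] 0) (𝓝 z) := by
    have : Continuous (fun t : 𝕜 => z + t • (v P.rows.1, v P.rows.2)) := by fun_prop
    exact (this.tendsto' 0 z (by simp)).mono_left nhdsWithin_le_nhds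
  refine mem_closure_of_tendsto hcont (eventually_all.2 fun i => ?_)
  simp only [key]
  by_cases h : P.cramer i (z, (u₀, s₀)) = 0
  · rw [h]
    filter_upwards [self_mem_nhdsWithin] with t ht
    simpa using ht
  · refine nhdsWithin_le_nhds (ContinuousAt.eventually_ne (by fun_prop) ?_)
    simpa using h

/-- The coefficients of the equation of the curve on which two components of `u` have the values `φ`
and the parameters `sᵢ` the values `σᵢ`. -/
theorem smooth_cramer_comp {φ : 𝕜 → 𝕜 × 𝕜} {σ : Fin 2 → 𝕜 → 𝕜} (hφ : SmoothNear 𝕜 φ 0)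
    (hσ : ∀ i, SmoothNear 𝕜 (σ i) 0) (hσ0 : (fun k => σ k 0) = s₀) (i : Fin 2) :
    SmoothNear 𝕜 (fun z : 𝕜 × (Fin m → 𝕜) =>
        P.cramer i (deriv φ z.1, (z.2, fun k => σ k z.1))) (0, u₀) ∧
      SmoothNear 𝕜 (fun z : 𝕜 × (Fin m → 𝕜) => P.ξ i (z.2, fun k => σ k z.1)) (0, u₀) := by
  have hφ' : SmoothNear 𝕜 (fun a => deriv φ a) 0 := hφ.fderiv_apply (smoothNear_const _)
  have hι : SmoothNear 𝕜 (fun z : 𝕜 × (Fin m → 𝕜) => z) (0, u₀) := smoothNear_id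
  have hσp : SmoothNear 𝕜 (fun a k => σ k a) 0 := SmoothNear.pi hσ
  have hpt : SmoothNear 𝕜 (fun z : 𝕜 × (Fin m → 𝕜) => (z.2, fun k => σ k z.1)) (0, u₀) :=
    hι.snd.prodMk (hσp.comp_of_eq hι.fst rfl)
  exact ⟨(P.smooth_cramer i (deriv φ 0)).comp_of_eq ((hφ'.comp_of_eq hι.fst rfl).prodMk hpt)
    (by simp only [hσ0]), (P.smooth_ξ i).comp_of_eq hpt (by simp only [hσ0])⟩

theorem minor_ne_zero_comp {x : 𝕜 → Fin m → 𝕜} {σ : Fin 2 → 𝕜 → 𝕜} (hx : SmoothNear 𝕜 x 0)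
    (hσ : ∀ i, SmoothNear 𝕜 (σ i) 0) (hx0 : x 0 = u₀) (hσ0 : (fun k => σ k 0) = s₀) :
    ∀ᶠ a in 𝓝 0, P.minor (P.ξ 0 (x a, fun k => σ k a)) (P.ξ 1 (x a, fun k => σ k a)) ≠ 0 := by
  have h1 := (hx.prodMk (SmoothNear.pi (f := fun a k => σ k a) hσ)).continuousAt
  rw [ContinuousAt, hx0, hσ0] at h1
  exact h1.eventually P.minor_ne_zero

/-- The curve in the space of the `u` along which two components and the parameters `sᵢ` are
prescribed. -/
theorem exists_curve {φ : 𝕜 → 𝕜 × 𝕜} {σ : Fin 2 → 𝕜 → 𝕜} (hφ : SmoothNear 𝕜 φ 0)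
    (hσ : ∀ i, SmoothNear 𝕜 (σ i) 0) (hφ0 : φ 0 = (u₀ P.rows.1, u₀ P.rows.2))
    (hσ0 : ∀ i, σ i 0 = s₀ i) :
    ∃ (x : 𝕜 → Fin m → 𝕜) (p : Fin 2 → 𝕜 → 𝕜), SmoothNear 𝕜 x 0 ∧ x 0 = u₀ ∧
      (∀ i, SmoothNear 𝕜 (p i) 0) ∧ (∀ i, p i 0 = P.cramer i (deriv φ 0, (u₀, s₀))) ∧
      (∀ᶠ a in 𝓝 0, deriv x a = p 0 a • (P.β 0).ξ (x a, σ 0 a) + p 1 a • (P.β 1).ξ (x a, σ 1 a)) ∧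
      ∀ᶠ a in 𝓝 0, (x a P.rows.1, x a P.rows.2) = φ a := by
  have hσp0 : (fun k => σ k 0) = s₀ := funext hσ0
  have hc := fun i => (P.smooth_cramer_comp hφ hσ hσp0 i).1
  have hξ := fun i => (P.smooth_cramer_comp hφ hσ hσp0 i).2
  obtain ⟨x, hx, hx0, hxd⟩ := exists_smoothNear_deriv_eq
    (((hc 0).smul (hξ 0)).add ((hc 1).smul (hξ 1)))
  obtain ⟨p, hp⟩ : ∃ p : Fin 2 → 𝕜 → 𝕜, ∀ i a,
    p i a = P.cramer i (deriv φ a, (x a, fun k => σ k a)) := ⟨_, fun _ _ => rfl⟩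
  have hps : ∀ i, SmoothNear 𝕜 (p i) 0 := fun i => by
    rw [show p i = _ from funext (hp i)]
    exact SmoothNear.comp_of_eq (f := fun a => (a, x a)) (hc i) (smoothNear_id.prodMk hx)
      (by rw [hx0])
  refine ⟨x, p, hx, hx0, hps, fun i => by rw [hp, hx0, hσp0], ?_, ?_⟩
  · filter_upwards [hxd] with a ha
    rw [hp, hp]
    exact ha
  have hmin := P.minor_ne_zero_comp hx hσ hx0 hσp0
  refine eventuallyEq_of_deriv_eq ((hx.apply _).prodMk (hx.apply _)) hφ (by rw [hx0, hφ0]) ?_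
  filter_upwards [hxd, hmin, hx.eventually_differentiableAt] with a h1 h2 h3
  obtain ⟨k1, k2⟩ := P.cramer_combination h2 (deriv φ a)
  have h4 := hasDerivAt_pi.1 h3.hasDerivAt
  rw [((h4 P.rows.1).prodMk (h4 P.rows.2)).deriv, h1]
  exact Prod.ext k1 k2

/-- The curve in the space of the `u` is determined by two components and by the parameters
`sᵢ`. -/
theorem curve_unique {σ : Fin 2 → 𝕜 → 𝕜} (hσ : ∀ i, SmoothNear 𝕜 (σ i) 0)
    (hσ0 : ∀ i, σ i 0 = s₀ i) {x x' : 𝕜 → Fin m → 𝕜} {p p' : Fin 2 → 𝕜 → 𝕜}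
    (hx : SmoothNear 𝕜 x 0) (hx' : SmoothNear 𝕜 x' 0) (hx0 : x 0 = u₀) (hx0' : x' 0 = u₀)
    (h : ∀ᶠ a in 𝓝 0, deriv x a = p 0 a • (P.β 0).ξ (x a, σ 0 a) + p 1 a • (P.β 1).ξ (x a, σ 1 a))
    (h' : ∀ᶠ a in 𝓝 0,
      deriv x' a = p' 0 a • (P.β 0).ξ (x' a, σ 0 a) + p' 1 a • (P.β 1).ξ (x' a, σ 1 a))
    (he : ∀ᶠ a in 𝓝 0, x a P.rows.1 = x' a P.rows.1 ∧ x a P.rows.2 = x' a P.rows.2) :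
    ∀ᶠ a in 𝓝 0, x a = x' a ∧ ∀ i, p i a = p' i a := by
  set φ : 𝕜 → 𝕜 × 𝕜 := fun a => (x a P.rows.1, x a P.rows.2) with hφdef
  have hφ : SmoothNear 𝕜 φ 0 := (hx.apply _).prodMk (hx.apply _)
  have hσp0 : (fun k => σ k 0) = s₀ := funext hσ0
  have hc := fun i => (P.smooth_cramer_comp hφ hσ hσp0 i).1
  have hξ := fun i => (P.smooth_cramer_comp hφ hσ hσp0 i).2
  have key : ∀ {x : 𝕜 → Fin m → 𝕜} {p : Fin 2 → 𝕜 → 𝕜}, SmoothNear 𝕜 x 0 → x 0 = u₀ →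
      (∀ᶠ a in 𝓝 0,
        deriv x a = p 0 a • (P.β 0).ξ (x a, σ 0 a) + p 1 a • (P.β 1).ξ (x a, σ 1 a)) →
      (fun a => (x a P.rows.1, x a P.rows.2)) =ᶠ[𝓝 0] φ →
      ∀ᶠ a in 𝓝 0, (∀ i, p i a = P.cramer i (deriv φ a, (x a, fun k => σ k a))) ∧
        deriv x a = P.cramer 0 (deriv φ a, (x a, fun k => σ k a)) • P.ξ 0 (x a, fun k => σ k a)
          + P.cramer 1 (deriv φ a, (x a, fun k => σ k a)) • P.ξ 1 (x a, fun k => σ k a) := by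
    intro x p hx hx0 h hxφ
    filter_upwards [h, P.minor_ne_zero_comp hx hσ hx0 hσp0, hx.eventually_differentiableAt,
      hxφ.eventuallyEq_nhds] with a h1 h2 h3 h4
    have h5 := hasDerivAt_pi.1 h3.hasDerivAt
    have h6 : deriv φ a = (deriv x a P.rows.1, deriv x a P.rows.2) := by
      rw [← h4.deriv_eq, ((h5 P.rows.1).prodMk (h5 P.rows.2)).deriv]
    have h7 := P.eq_cramer h2 (p := fun i => p i a) h1
    simp only [← h6] at h7
    refine ⟨h7, ?_⟩
    rw [← h7, ← h7]
    exact h1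
  have k1 := key hx hx0 h EventuallyEq.rfl
  have k2 := key hx' hx0' h' (he.mono fun a ha => by simp only [hφdef, ha.1, ha.2])
  have h5 := eventuallyEq_of_deriv_eq_comp (x := x) (x' := x') (by
    rw [hx0]; exact ((hc 0).smul (hξ 0)).add ((hc 1).smul (hξ 1))) hx hx' (by rw [hx0, hx0'])
    (k1.mono fun a ha => ha.2) (k2.mono fun a ha => ha.2)
  filter_upwards [h5, k1, k2] with a a1 a2 a3
  refine ⟨a1, fun i => ?_⟩
  rw [a2.1, a3.1, a1]

end TransversalBranches

end Cramer

end HydrodynamicType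

namespace HydrodynamicType
open Filter Matrix

/-! ### The generalized hodograph method -/

section RiemannInvariants

universe v
variable {𝕜 : Type v} [RCLike 𝕜] {F : Type v} [NormedAddCommGroup F] [NormedSpace 𝕜 F]

theorem pd_comp_pi {n k : ℕ} {g : (Fin k → 𝕜) → F} {R : (Fin n → 𝕜) → Fin k → 𝕜} {z : Fin n → 𝕜}
    (hg : DifferentiableAt 𝕜 g (R z)) (hR : DifferentiableAt 𝕜 R z) (j : Fin n) :
    pd j (fun z => g (R z)) z = ∑ i, pd j (fun z => R z i) z • pd i g (R z) := by
  rw [pd_comp hg hR]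
  conv_lhs => rw [← Finset.univ_sum_single (pd j R z)]
  rw [map_sum]
  refine Finset.sum_congr rfl fun i _ => ?_
  rw [pd_apply hR, pd, pd, ← map_smul, ← Pi.single_smul, smul_eq_mul, mul_one]

/-- The generalized hodograph method: if `wᵢ` solve the same linear system as the speeds `λⁱ`, `μⁱ`
of commuting flows, then the equations `wᵢ(R) = x + λⁱ(R) t + μⁱ(R) y` define Riemann invariants as
functions of `(t, x, y)`. Here the `wᵢ` are normalized on the diagonal. -/
theorem exists_riemannInvariants {lam mu w c : Fin 2 → (Fin 2 → 𝕜) → 𝕜}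
    (sl : ∀ i, SmoothNear 𝕜 (lam i) 0) (sm : ∀ i, SmoothNear 𝕜 (mu i) 0)
    (sw : ∀ i, SmoothNear 𝕜 (w i) 0)
    (hl : ∀ᶠ R in 𝓝 0, ∀ i j, i ≠ j → pd j (lam i) R = c i R * (lam j R - lam i R))
    (hm : ∀ᶠ R in 𝓝 0, ∀ i j, i ≠ j → pd j (mu i) R = c i R * (mu j R - mu i R))
    (hw : ∀ᶠ R in 𝓝 0, ∀ i j, i ≠ j → pd j (w i) R = c i R * (w j R - w i R))
    (hd : ∀ᶠ a : 𝕜 in 𝓝 0, ∀ i, w i (fun _ => a) = a) :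
    ∃ R : (Fin 3 → 𝕜) → Fin 2 → 𝕜, SmoothNear 𝕜 R 0 ∧ R 0 = 0 ∧
      (∀ᶠ z : (Fin 3 → 𝕜) × (Fin 2 → 𝕜) in 𝓝 (0, 0), (∀ i, w i z.2 = z.1 1 + lam i z.2 * z.1 0 + mu i z.2 * z.1 2) →
        z.2 = R z.1) ∧
      ∀ᶠ z in 𝓝 0, ∀ i, pd 1 (fun z => R z i) z ≠ 0 ∧
        pd 0 (fun z => R z i) z = lam i (R z) * pd 1 (fun z => R z i) z ∧
        pd 2 (fun z => R z i) z = mu i (R z) * pd 1 (fun z => R z i) z := by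
  have hdiff : ∀ i j : Fin 2, pd j (w i) 0 = if i = j then 1 else 0 := by
    have h0 : ∀ i, w i 0 = 0 := fun i => hd.self_of_nhds i
    have h1 : ∀ i j, i ≠ j → pd j (w i) 0 = 0 := fun i j hij => by
      rw [hw.self_of_nhds i j hij, h0, h0, sub_zero, mul_zero]
    have h2 : ∀ i, pd 0 (w i) 0 + pd 1 (w i) 0 = 1 := by
      intro i
      have b2 : HasDerivAt (fun a : 𝕜 => (fun _ => a : Fin 2 → 𝕜)) (fun _ => 1) 0 :=
        hasDerivAt_pi.2 fun _ => hasDerivAt_id _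
      have b3 := (sw i).differentiableAt.hasFDerivAt.comp_hasDerivAt
        (f := fun a : 𝕜 => (fun _ => a : Fin 2 → 𝕜)) 0 b2
      have b4 : (w i ∘ fun a : 𝕜 => (fun _ => a : Fin 2 → 𝕜)) =ᶠ[𝓝 0] fun a => a :=
        hd.mono fun a ha => ha i
      have b5 := b3.deriv
      rw [b4.deriv_eq, deriv_id''] at b5
      refine Eq.trans ?_ b5.symm
      rw [pd, pd, ← map_add]
      congr 1
      ext k; fin_cases k <;> simp
    intro i j
    have h3 := h2 i
    fin_cases i <;> fin_cases j
    · simpa [h1 0 1 (by decide)] using h3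
    · simpa using h1 0 1 (by decide)
    · simpa using h1 1 0 (by decide)
    · simpa [h1 1 0 (by decide)] using h3
  set Φ : (Fin 3 → 𝕜) × (Fin 2 → 𝕜) → Fin 2 → 𝕜 := fun z i =>
    w i z.2 - (z.1 1 + lam i z.2 * z.1 0 + mu i z.2 * z.1 2) with hΦ
  have hι : SmoothNear 𝕜 (fun z : (Fin 3 → 𝕜) × (Fin 2 → 𝕜) => z) (0, 0) := smoothNear_id
  have sΦ : SmoothNear 𝕜 Φ (0, 0) := SmoothNear.pi fun i =>
    ((sw i).comp_of_eq hι.snd rfl).sub (((hι.fst.apply 1).add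
      (((sl i).comp_of_eq hι.snd rfl).mul (hι.fst.apply 0))).add
      (((sm i).comp_of_eq hι.snd rfl).mul (hι.fst.apply 2)))
  have hΦ0 : Φ (0, 0) = 0 := by
    ext i
    have : w i 0 = 0 := hd.self_of_nhds i
    simp [hΦ, this]
  have hder : fderiv 𝕜 Φ (0, 0) ∘L .inr 𝕜 (Fin 3 → 𝕜) (Fin 2 → 𝕜)
      = ContinuousLinearMap.id 𝕜 (Fin 2 → 𝕜) := by
    have c1 := sΦ.differentiableAt.hasFDerivAt.comp (0 : Fin 2 → 𝕜)
      (hasFDerivAt_prodMk_right (𝕜 := 𝕜) (0 : Fin 3 → 𝕜) (0 : Fin 2 → 𝕜))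
    refine c1.unique ?_
    have c2 : (Φ ∘ fun R => ((0 : Fin 3 → 𝕜), R)) = fun R i => w i R := by
      funext R i
      simp [hΦ]
    rw [c2]
    refine hasFDerivAt_pi'.2 fun i => ?_
    convert (sw i).differentiableAt.hasFDerivAt using 1
    refine ContinuousLinearMap.coe_injective (LinearMap.pi_ext' fun j => LinearMap.ext_ring ?_)
    change (Pi.single j (1 : 𝕜) : Fin 2 → 𝕜) i = pd j (w i) 0
    rw [hdiff, Pi.single_apply]
  obtain ⟨R, h1, h2, h3, h4⟩ := sΦ.exists_implicitFunction hΦ0 (by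
    rw [hder]
    exact ⟨ContinuousLinearEquiv.refl 𝕜 _, rfl⟩)
  refine ⟨R, h1, h2, ?_, ?_⟩
  · filter_upwards [h4] with z hz h
    exact hz (funext fun i => sub_eq_zero.2 (h i))
  have ht : Tendsto R (𝓝 0) (𝓝 0) := by
    simpa only [h2] using h1.continuousAt.tendsto
  filter_upwards [h1.eventually_differentiableAt, h3.eventually_nhds, ht.eventually hl,
    ht.eventually hm, ht.eventually hw,
    ht.eventually (eventually_all.2 fun i => (sl i).eventually_differentiableAt),
    ht.eventually (eventually_all.2 fun i => (sm i).eventually_differentiableAt),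
    ht.eventually (eventually_all.2 fun i => (sw i).eventually_differentiableAt)]
    with z dR hz kl km kw dl dm dw i
  have hz0 : ∀ i, w i (R z) = z 1 + lam i (R z) * z 0 + mu i (R z) * z 2 := fun i =>
    sub_eq_zero.1 (congrFun hz.self_of_nhds i)
  obtain ⟨M, hM⟩ : ∃ M, M = pd i (w i) (R z) - (pd i (lam i) (R z) * z 0 + pd i (mu i) (R z) * z 2) :=
    ⟨_, rfl⟩
  have key : ∀ k : Fin 3, M * pd k (fun z => R z i) z
      = (Pi.single k 1 : Fin 3 → 𝕜) 1 + lam i (R z) * (Pi.single k 1 : Fin 3 → 𝕜) 0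
        + mu i (R z) * (Pi.single k 1 : Fin 3 → 𝕜) 2 := by
    intro k
    have dc : ∀ l : Fin 3, DifferentiableAt 𝕜 (fun z : Fin 3 → 𝕜 => z l) z := fun l =>
      (smoothNear_id.apply l).differentiableAt
    have pc : ∀ l : Fin 3, pd k (fun z : Fin 3 → 𝕜 => z l) z = (Pi.single k 1 : Fin 3 → 𝕜) l :=
      fun l => by rw [pd_apply differentiableAt_fun_id]; simp [pd]
    have dlR : DifferentiableAt 𝕜 (fun z => lam i (R z)) z :=
      DifferentiableAt.fun_comp' (g := lam i) z (dl i) dR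
    have dmR : DifferentiableAt 𝕜 (fun z => mu i (R z)) z :=
      DifferentiableAt.fun_comp' (g := mu i) z (dm i) dR
    have e1 : pd k (fun z => w i (R z)) z
        = pd k (fun z => z 1 + lam i (R z) * z 0 + mu i (R z) * z 2) z :=
      pd_congr (hz.mono fun z hz => sub_eq_zero.1 (congrFun hz i))
    rw [pd_add ((dc 1).fun_add (dlR.fun_mul (dc 0))) (dmR.fun_mul (dc 2)),
      pd_add (dc 1) (dlR.fun_mul (dc 0)),
      pd_mul dlR (dc 0), pd_mul dmR (dc 2), pc, pc, pc, pd_comp_pi (dw i) dR,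
      pd_comp_pi (dl i) dR, pd_comp_pi (dm i) dR] at e1
    have hsum : ∀ g : Fin 2 → 𝕜, ∑ i, g i = g i + g (1 - i) := by
      intro g
      rw [Fin.sum_univ_two]
      fin_cases i
      · rfl
      · exact add_comm _ _
    have hij := ne_one_sub i
    simp only [hsum, smul_eq_mul, kl i _ hij, km i _ hij, kw i _ hij, hz0] at e1
    rw [hM]
    linear_combination e1
  have k1 := key 1
  have k0 := key 0
  have k2 := key 2
  simp at k0 k1 k2
  have hM0 : M ≠ 0 := left_ne_zero_of_mul (k1.trans_ne one_ne_zero)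
  refine ⟨right_ne_zero_of_mul (k1.trans_ne one_ne_zero), ?_, ?_⟩ <;> refine mul_left_cancel₀ hM0 ?_
  · linear_combination k0 - lam i (R z) * k1
  · linear_combination k2 - mu i (R z) * k1

end RiemannInvariants
end HydrodynamicType

namespace HydrodynamicType
open Filter Matrix

/-! ### Existence of double waves -/

section DoubleWaveExistence

universe v
variable {𝕜 : Type v} [RCLike 𝕜] {m : ℕ} {A B : (Fin m → 𝕜) → Matrix (Fin m) (Fin m) 𝕜}

/-- Riemann invariants which solve the diagonal systems of a reduction yield a double wave. -/
theorem IsReduction.isDoubleWave {U : Set (Fin m → 𝕜)} {Ω : Set (Fin 2 → 𝕜)}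
    {u : (Fin 2 → 𝕜) → Fin m → 𝕜} {lam mu : Fin 2 → (Fin 2 → 𝕜) → 𝕜}
    (h : IsReduction A B U Ω u lam mu) {W : Set (Fin 3 → 𝕜)} {R : (Fin 3 → 𝕜) → Fin 2 → 𝕜}
    (hR : IsRiemannSolution Ω lam mu W R) :
    IsDoubleWave A B U W (fun z => u (R z)) (fun i z => lam i (R z)) (fun i z => mu i (R z)) := by
  refine ⟨⟨hR.isOpen, fun z hz => h.mapsTo (hR.mapsTo hz),
    h.smooth_u.comp hR.smooth hR.mapsTo, fun z hz => ?_⟩, Ω, u, lam, mu, R, h, hR,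
    fun z _ => ⟨rfl, fun i => ⟨rfl, rfl⟩⟩⟩
  have hu := (HydrodynamicType.ContDiffOn.smoothNear h.smooth_u h.isOpen
    (hR.mapsTo hz)).differentiableAt
  have hd := (HydrodynamicType.ContDiffOn.smoothNear hR.smooth hR.isOpen hz).differentiableAt
  have key : ∀ i, pd 0 (fun z => R z i) z • pd i u (R z)
      + A (u (R z)) *ᵥ (pd 1 (fun z => R z i) z • pd i u (R z))
      + B (u (R z)) *ᵥ (pd 2 (fun z => R z i) z • pd i u (R z)) = 0 := by
    intro i
    have e := congrArg (fun y => pd 1 (fun z => R z i) z • y) (h.eigen (R z) (hR.mapsTo hz) i)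
    simp only [smul_zero, add_mulVec, smul_mulVec, one_mulVec] at e
    rw [← e, hR.eq_t z hz, hR.eq_y z hz, mulVec_smul, mulVec_smul]
    module
  rw [pd_comp_pi hu hd, pd_comp_pi hu hd, pd_comp_pi hu hd, mulVec_sum, mulVec_sum,
    ← Finset.sum_add_distrib, ← Finset.sum_add_distrib]
  exact Finset.sum_eq_zero fun i _ => key i

/-- The Riemann invariants of the generalized hodograph method for a reduction. -/
theorem IsWaveSolution.exists_riemannInvariants {u₀ : Fin m → 𝕜} {lam₀ mu₀ : Fin 2 → 𝕜}
    {P : BranchPair A B (fun _ => 1) u₀ mu₀ lam₀} {u : (Fin 2 → 𝕜) → Fin m → 𝕜}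
    {mu p w : Fin 2 → (Fin 2 → 𝕜) → 𝕜} (h : IsWaveSolution P.coefficients u mu p w)
    (hd : ∀ᶠ a : 𝕜 in 𝓝 0, ∀ i, w i (fun _ => a) = a) :
    ∃ R : (Fin 3 → 𝕜) → Fin 2 → 𝕜, SmoothNear 𝕜 R 0 ∧ R 0 = 0 ∧
      (∀ᶠ z : (Fin 3 → 𝕜) × (Fin 2 → 𝕜) in 𝓝 (0, 0), (∀ i, w i z.2 = z.1 1 +
        P.q i (u z.2, fun k => mu k z.2) * z.1 0 + mu i z.2 * z.1 2) → z.2 = R z.1) ∧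
      ∀ᶠ z in 𝓝 0, ∀ i, pd 1 (fun z => R z i) z ≠ 0 ∧
        pd 0 (fun z => R z i) z
          = P.q i (u (R z), fun k => mu k (R z)) * pd 1 (fun z => R z i) z ∧
        pd 2 (fun z => R z i) z = mu i (R z) * pd 1 (fun z => R z i) z := by
  refine HydrodynamicType.exists_riemannInvariants
    (c := fun i R => p (1 - i) R * P.γ i (u R, fun k => mu k R)) h.smooth_q h.smooth_s h.smooth_w
    ?_ ?_ ?_ hd
  · filter_upwards [h.pd_q] with R hR i j hij
    rw [hR i j hij, eq_one_sub hij]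
  · filter_upwards [h.eq_s] with R hR i j hij
    rw [hR i j hij, eq_one_sub hij]; rfl
  · filter_upwards [h.eq_w] with R hR i j hij
    rw [hR i j hij, eq_one_sub hij]; rfl

/-- The double wave with four prescribed functions on the axis: these functions determine the
reduction on the diagonal of the plane of the Riemann invariants, which corresponds to the axis. -/
theorem BranchPair.exists_isDoubleWaveWithData {U : Set (Fin m → 𝕜)} (hU : IsOpen U)
    {u₀ : Fin m → 𝕜} (hu₀ : u₀ ∈ U) {lam₀ mu₀ : Fin 2 → 𝕜}
    (P : BranchPair A B (fun _ => 1) u₀ mu₀ lam₀) {f : Fin 4 → 𝕜 → 𝕜}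
    (hf : ∀ a, SmoothNear 𝕜 (f a) 0) (h0 : f 0 0 = u₀ P.rows.1) (h1 : f 1 0 = u₀ P.rows.2)
    (h2 : f 2 0 = mu₀ 0) (h3 : f 3 0 = mu₀ 1)
    (hJ : (deriv (f 0) 0, deriv (f 1) 0) ∈ P.admissible) :
    ∃ w lamW muW, IsDoubleWaveWithData A B U u₀ lam₀ mu₀ P.rows.1 P.rows.2 f w lamW muW := by
  obtain ⟨σ, hσ⟩ : ∃ σ : Fin 2 → 𝕜 → 𝕜, σ = ![f 2, f 3] := ⟨_, rfl⟩
  have hσs : ∀ i, SmoothNear 𝕜 (σ i) 0 := by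
    intro i; rw [hσ]; fin_cases i
    exacts [hf 2, hf 3]
  have hσ0 : ∀ i, σ i 0 = mu₀ i := by
    intro i; rw [hσ]; fin_cases i
    exacts [h2, h3]
  obtain ⟨x, q, hx, hx0, hq, hq0, hxd, hxf⟩ := P.exists_curve (φ := fun a => (f 0 a, f 1 a))
    ((hf 0).prodMk (hf 1)) hσs (by rw [h0, h1]) hσ0
  obtain ⟨u, s, p, w, hs, hd⟩ := exists_isWaveSolution P.coefficients (wΔ := fun _ a => a) hx hσs hq
    (fun _ => smoothNear_id) hx0 hσ0 hxd
  have hp0 : ∀ i, p i 0 ≠ 0 := by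
    intro i
    have e : p i 0 = q i 0 := (hd.self_of_nhds.2 i).2.1
    rw [e, hq0]
    rw [((hf 0).differentiableAt.hasDerivAt.prodMk (hf 1).differentiableAt.hasDerivAt).deriv]
    exact hJ i
  have hB' : ∀ u, B u = ((0, 1) : 𝕜 × 𝕜).2 • B u + ((0, 1) : 𝕜 × 𝕜).1 • 1 := by simp
  have hC' : ∀ u, (fun _ => 1 : (Fin m → 𝕜) → Matrix (Fin m) (Fin m) 𝕜) u
      = ((1, 0) : 𝕜 × 𝕜).2 • B u + ((1, 0) : 𝕜 × 𝕜).1 • 1 := by simp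
  obtain ⟨Ω, hΩ0, hΩ⟩ := exists_isReduction (by simp) hB' hC' hs hp0 hU hu₀
  simp only [mul_zero, mul_one, zero_add, add_zero] at hΩ
  obtain ⟨R, hR, hR0, hRu, hRe⟩ := hs.exists_riemannInvariants (hd.mono fun a ha i => (ha.2 i).2.2)
  obtain ⟨W, hW, hWo, h0W⟩ := eventually_nhds_iff.1 (hRe.and (hR.eventually.and
    (hR.continuousAt.eventually_mem (by rw [hR0]; exact hΩ.isOpen.mem_nhds hΩ0))))
  have hRW : IsRiemannSolution Ω (fun i R => P.q i (u R, fun k => s k R)) (fun i R => s i R) W R :=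
    { isOpen := hWo
      mapsTo := fun z hz => (hW z hz).2.2
      smooth := SmoothNear.contDiffOn fun z hz => (hW z hz).2.1
      eq_t := fun z hz i => ((hW z hz).1 i).2.1
      eq_y := fun z hz i => ((hW z hz).1 i).2.2
      nonstationary := fun z hz i => ((hW z hz).1 i).1 }
  refine ⟨_, _, _, ⟨W, h0W, hΩ.isDoubleWave hRW⟩, ?_, fun i => ⟨?_, ?_⟩, ?_⟩
  · rw [hR0, hs.u_zero]
  · rw [hR0, hs.point_zero, TransversalBranches.q, (P.β i).base]
  · rw [hR0, hs.s_zero]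
  · -- on the axis both Riemann invariants are equal to `x`
    have hι : SmoothNear 𝕜 (fun a : 𝕜 => (![0, a, 0] : Fin 3 → 𝕜)) 0 := by
      refine SmoothNear.pi fun i => ?_
      fin_cases i
      exacts [smoothNear_const _, smoothNear_id, smoothNear_const _]
    have hι2 : SmoothNear 𝕜 (fun a : 𝕜 => (fun _ => a : Fin 2 → 𝕜)) 0 :=
      SmoothNear.pi fun _ => smoothNear_id
    have hz : (![0, 0, 0] : Fin 3 → 𝕜) = 0 := by
      ext i; fin_cases i <;> rfl
    have ht : Tendsto (fun a : 𝕜 => ((![0, a, 0] : Fin 3 → 𝕜), (fun _ => a : Fin 2 → 𝕜))) (𝓝 0)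
        (𝓝 (0, 0)) := by
      have := (hι.prodMk hι2).continuousAt
      rw [ContinuousAt, hz] at this
      exact this
    filter_upwards [ht.eventually hRu, hd, hxf] with a a1 a2 a3
    have e := a1 fun i => by
      change w i (fun _ => a) = a + _ * 0 + _ * 0
      rw [(a2.2 i).2.2, mul_zero, mul_zero, add_zero, add_zero]
    change (fun _ => a) = R ![0, a, 0] at e
    rw [← e, a2.1, (a2.2 0).1, (a2.2 1).1, hσ]
    exact ⟨congrArg Prod.fst a3, congrArg Prod.snd a3, rfl, rfl⟩

end DoubleWaveExistence
end HydrodynamicType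

namespace HydrodynamicType
open Filter Matrix

/-! ### Normalization of the Riemann invariants -/

section Normalization

universe v
variable {𝕜 : Type v} [RCLike 𝕜] {m : ℕ} {A B : (Fin m → 𝕜) → Matrix (Fin m) (Fin m) 𝕜}

/-- A two-component reduction with a solution `R` of its diagonal systems, near the origin, whose
Riemann invariants are normalized: both are equal to `x` on the axis `t = y = 0`. -/
structure IsNormalizedWave (A B : (Fin m → 𝕜) → Matrix (Fin m) (Fin m) 𝕜)
    (u : (Fin 2 → 𝕜) → Fin m → 𝕜) (lam mu : Fin 2 → (Fin 2 → 𝕜) → 𝕜)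
    (R : (Fin 3 → 𝕜) → Fin 2 → 𝕜) : Prop where
  smooth_u : SmoothNear 𝕜 u 0
  smooth_lam : ∀ i, SmoothNear 𝕜 (lam i) 0
  smooth_mu : ∀ i, SmoothNear 𝕜 (mu i) 0
  smooth_R : SmoothNear 𝕜 R 0
  axis : ∀ᶠ a : 𝕜 in 𝓝 0, R ![0, a, 0] = fun _ => a
  ne_zero : ∀ᶠ S in 𝓝 0, ∀ i, pd i u S ≠ 0
  eigen : ∀ᶠ S in 𝓝 0, ∀ i, symbol A B (u S) (mu i S) (lam i S) *ᵥ pd i u S = 0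
  commute : ∀ᶠ S in 𝓝 0, ∀ i j, i ≠ j →
    pd j (lam i) S * (mu j S - mu i S) = pd j (mu i) S * (lam j S - lam i S)
  nonstationary : ∀ᶠ z in 𝓝 0, ∀ i, pd 1 (fun z => R z i) z ≠ 0
  eq_t : ∀ᶠ z in 𝓝 0, ∀ i, pd 0 (fun z => R z i) z = lam i (R z) * pd 1 (fun z => R z i) z
  eq_y : ∀ᶠ z in 𝓝 0, ∀ i, pd 2 (fun z => R z i) z = mu i (R z) * pd 1 (fun z => R z i) z

theorem smoothNear_axis (a : 𝕜) : SmoothNear 𝕜 (fun a : 𝕜 => (![0, a, 0] : Fin 3 → 𝕜)) a := by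
  refine SmoothNear.pi fun i => ?_
  fin_cases i
  exacts [smoothNear_const _, smoothNear_id, smoothNear_const _]

theorem axis_zero : (![0, 0, 0] : Fin 3 → 𝕜) = 0 := by
  ext i; fin_cases i <;> rfl

theorem tendsto_axis : Tendsto (fun a : 𝕜 => (![0, a, 0] : Fin 3 → 𝕜)) (𝓝 0) (𝓝 0) := by
  have := (smoothNear_axis (0 : 𝕜)).continuousAt
  rwa [ContinuousAt, axis_zero] at this

theorem hasDerivAt_axis (a : 𝕜) :
    HasDerivAt (fun a : 𝕜 => (![0, a, 0] : Fin 3 → 𝕜)) (Pi.single 1 1) a := by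
  refine hasDerivAt_pi.2 fun i => ?_
  fin_cases i
  exacts [hasDerivAt_const _ _, hasDerivAt_id _, hasDerivAt_const _ _]

theorem tendsto_diagonal : Tendsto (fun a : 𝕜 => (fun _ => a : Fin 2 → 𝕜)) (𝓝 0) (𝓝 0) :=
  (continuous_pi fun _ => continuous_id).tendsto' _ _ rfl

/-- Derivatives after a change of the parameters of the Riemann invariants. -/
theorem pd_comp_reparametrization {F : Type v} [NormedAddCommGroup F] [NormedSpace 𝕜 F]
    {n : ℕ} {r : Fin n → 𝕜 → 𝕜} {g : (Fin n → 𝕜) → F} {S : Fin n → 𝕜}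
    (hr : ∀ i, DifferentiableAt 𝕜 (r i) (S i)) (hg : DifferentiableAt 𝕜 g fun i => r i (S i))
    (j : Fin n) :
    pd j (fun S => g fun i => r i (S i)) S = deriv (r j) (S j) • pd j g fun i => r i (S i) := by
  have e : ∀ i, DifferentiableAt 𝕜 (fun S : Fin n → 𝕜 => S i) S := fun i =>
    (smoothNear_id.apply i).differentiableAt
  have e1 : ∀ i, pd j (fun S : Fin n → 𝕜 => r i (S i)) S = if i = j then deriv (r j) (S j) else 0 := by
    intro i
    rw [pd_comp (g := r i) (f := fun S : Fin n → 𝕜 => S i) (hr i) (e i),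
      pd_apply differentiableAt_fun_id]
    have : pd j (fun S : Fin n → 𝕜 => S) S i = if i = j then 1 else 0 := by
      simp [pd, Pi.single_apply]
    rw [this]
    split_ifs with h
    · subst h; exact fderiv_apply_one_eq_deriv
    · exact map_zero _
  rw [pd_comp_pi (R := fun S i => r i (S i)) hg
    (differentiableAt_pi.2 fun i => DifferentiableAt.fun_comp' (g := r i) S (hr i) (e i))]
  simp only [e1, ite_smul, zero_smul, Finset.sum_ite_eq', Finset.mem_univ, if_true]

/-- The Riemann invariants of a double wave can be normalized. -/
theorem IsDoubleWave.exists_isNormalizedWave {U : Set (Fin m → 𝕜)} {W : Set (Fin 3 → 𝕜)}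
    {w : (Fin 3 → 𝕜) → Fin m → 𝕜} {lamW muW : Fin 2 → (Fin 3 → 𝕜) → 𝕜}
    (h : IsDoubleWave A B U W w lamW muW) (h0 : 0 ∈ W) :
    ∃ u lam mu R, IsNormalizedWave A B u lam mu R ∧ ∀ᶠ z in 𝓝 0, w z = u (R z) ∧
      ∀ i, lamW i z = lam i (R z) ∧ muW i z = mu i (R z) := by
  obtain ⟨-, Ω, v, l, k, R, hv, hR, hw⟩ := h
  have sR : SmoothNear 𝕜 R 0 := HydrodynamicType.ContDiffOn.smoothNear hR.smooth hR.isOpen h0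
  obtain ⟨r, hr⟩ : ∃ r : Fin 2 → 𝕜 → 𝕜, ∀ i a, r i a = R ![0, a, 0] i := ⟨_, fun _ _ => rfl⟩
  have sr : ∀ i, SmoothNear 𝕜 (r i) 0 := fun i => by
    rw [show r i = _ from funext (hr i)]
    exact (sR.comp_of_eq (smoothNear_axis 0) axis_zero).apply i
  have hr0 : (fun i => r i 0) = R 0 := by
    ext i; rw [hr, axis_zero]
  have hr' : ∀ i, deriv (r i) 0 ≠ 0 := by
    intro i
    have e1 : DifferentiableAt 𝕜 (fun z => R z i) (![0, 0, 0] : Fin 3 → 𝕜) := by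
      rw [axis_zero]; exact (sR.apply i).differentiableAt
    have e2 := e1.hasFDerivAt.comp_hasDerivAt (0 : 𝕜) (hasDerivAt_axis 0)
    rw [show r i = _ from funext (hr i)]
    refine ne_of_eq_of_ne e2.deriv ?_
    rw [axis_zero]
    exact hR.nonstationary 0 h0 i
  obtain ⟨ρ, hρ⟩ : ∃ ρ : (Fin 2 → 𝕜) → Fin 2 → 𝕜, ρ = fun S i => r i (S i) := ⟨_, rfl⟩
  have sρ : SmoothNear 𝕜 ρ 0 := by
    rw [hρ]
    exact SmoothNear.pi fun i => (sr i).comp_of_eq (smoothNear_id.apply i) rfl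
  have hρ0 : ρ 0 = R 0 := by rw [hρ, ← hr0]; rfl
  have hι : SmoothNear 𝕜 (fun z : (Fin 3 → 𝕜) × (Fin 2 → 𝕜) => z) (0, 0) := smoothNear_id
  have sΦ : SmoothNear 𝕜 (fun z : (Fin 3 → 𝕜) × (Fin 2 → 𝕜) => ρ z.2 - R z.1) (0, 0) :=
    (sρ.comp_of_eq hι.snd rfl).sub (sR.comp_of_eq hι.fst rfl)
  have hder : fderiv 𝕜 (fun z : (Fin 3 → 𝕜) × (Fin 2 → 𝕜) => ρ z.2 - R z.1) (0, 0) ∘L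
      .inr 𝕜 (Fin 3 → 𝕜) (Fin 2 → 𝕜) = (ContinuousLinearEquiv.piCongrRight fun i =>
        ContinuousLinearEquiv.unitsEquivAut 𝕜 (Units.mk0 _ (hr' i)) :
        (Fin 2 → 𝕜) ≃L[𝕜] (Fin 2 → 𝕜)) := by
    have c1 := sΦ.differentiableAt.hasFDerivAt.comp (0 : Fin 2 → 𝕜)
      (hasFDerivAt_prodMk_right (𝕜 := 𝕜) (0 : Fin 3 → 𝕜) (0 : Fin 2 → 𝕜))
    refine c1.unique ?_
    change HasFDerivAt (fun S => ρ S - R 0) _ 0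
    refine HasFDerivAt.sub_const _ ?_
    rw [hρ]
    refine hasFDerivAt_pi'.2 fun i => ?_
    have c2 := (sr i).differentiableAt.hasDerivAt.hasFDerivAt.comp (0 : Fin 2 → 𝕜)
      (f := fun S : Fin 2 → 𝕜 => S i) (hasFDerivAt_apply i 0)
    have c3 : ContinuousLinearMap.proj (R := 𝕜) (φ := fun _ : Fin 2 => 𝕜) i ∘L
        (ContinuousLinearEquiv.piCongrRight fun i =>
        ContinuousLinearEquiv.unitsEquivAut 𝕜 (Units.mk0 _ (hr' i)) :
        (Fin 2 → 𝕜) ≃L[𝕜] (Fin 2 → 𝕜)) = ContinuousLinearMap.toSpanSingleton 𝕜 (deriv (r i) 0) ∘L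
          ContinuousLinearMap.proj (R := 𝕜) (φ := fun _ : Fin 2 => 𝕜) i := by
      refine ContinuousLinearMap.ext fun S => ?_
      simp
    rw [c3]
    exact c2
  obtain ⟨S, h1, h2, h3, h4⟩ := sΦ.exists_implicitFunction (by simp [hρ0]) (by
    rw [hder]; exact ⟨_, rfl⟩)
  have hρt : Tendsto ρ (𝓝 0) (𝓝 (R 0)) := by
    simpa only [hρ0] using sρ.continuousAt.tendsto
  have hSt : Tendsto S (𝓝 0) (𝓝 0) := by
    simpa only [h2] using h1.continuousAt.tendsto
  have hRΩ := hR.mapsTo h0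
  have hρΩ : ∀ᶠ S in 𝓝 0, ρ S ∈ Ω := hρt.eventually_mem (hv.isOpen.mem_nhds hRΩ)
  have sv := HydrodynamicType.ContDiffOn.smoothNear hv.smooth_u hv.isOpen hRΩ
  have sl := fun i => HydrodynamicType.ContDiffOn.smoothNear (hv.smooth_lam i) hv.isOpen hRΩ
  have sk := fun i => HydrodynamicType.ContDiffOn.smoothNear (hv.smooth_mu i) hv.isOpen hRΩ
  have hti : ∀ i, Tendsto (fun S : Fin 2 → 𝕜 => S i) (𝓝 0) (𝓝 0) := fun i =>
    (continuous_apply i).tendsto' _ _ rfl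
  have hrd : ∀ᶠ S : Fin 2 → 𝕜 in 𝓝 0, ∀ i, DifferentiableAt 𝕜 (r i) (S i) ∧
      deriv (r i) (S i) ≠ 0 := by
    refine eventually_all.2 fun i => (hti i).eventually (p := fun a =>
      DifferentiableAt 𝕜 (r i) a ∧ deriv (r i) a ≠ 0) ((sr i).eventually_differentiableAt.and ?_)
    have : SmoothNear 𝕜 (fun a => deriv (r i) a) 0 := (sr i).fderiv_apply (smoothNear_const _)
    exact this.continuousAt.eventually_ne (hr' i)
  have hd : ∀ᶠ S in 𝓝 0, DifferentiableAt 𝕜 v (ρ S) ∧ (∀ i, DifferentiableAt 𝕜 (l i) (ρ S)) ∧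
      ∀ i, DifferentiableAt 𝕜 (k i) (ρ S) :=
    hρt.eventually (sv.eventually_differentiableAt.and
      ((eventually_all.2 fun i => (sl i).eventually_differentiableAt).and
        (eventually_all.2 fun i => (sk i).eventually_differentiableAt)))
  have hRS : ∀ᶠ z in 𝓝 0, R z = ρ (S z) := h3.mono fun z hz => (sub_eq_zero.1 hz).symm
  have hW : ∀ᶠ z in 𝓝 (0 : Fin 3 → 𝕜), z ∈ W := hR.isOpen.mem_nhds h0
  have hRpd : ∀ᶠ z in 𝓝 0, ∀ i, ∃ c : 𝕜, c ≠ 0 ∧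
      ∀ j, pd j (fun z => R z i) z = c * pd j (fun z => S z i) z := by
    filter_upwards [hRS.eventually_nhds, hSt.eventually hrd, h1.eventually_differentiableAt]
      with z z1 z2 z3 i
    refine ⟨_, (z2 i).2, fun j => ?_⟩
    have e : pd j (fun z => R z i) z = pd j (fun z => r i (S z i)) z :=
      pd_congr (z1.mono fun y hy => by dsimp only; rw [hy, hρ])
    rw [e, pd_comp (z2 i).1 (differentiableAt_pi.1 z3 i), mul_comm]
    exact fderiv_eq_smul_deriv _
  refine ⟨fun S => v (ρ S), fun i S => l i (ρ S), fun i S => k i (ρ S), S,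
    ⟨sv.comp_of_eq sρ hρ0, fun i => (sl i).comp_of_eq sρ hρ0, fun i => (sk i).comp_of_eq sρ hρ0, h1,
      ?_, ?_, ?_, ?_, ?_, ?_, ?_⟩, ?_⟩
  · have ht : Tendsto (fun a : 𝕜 => ((![0, a, 0] : Fin 3 → 𝕜), (fun _ => a : Fin 2 → 𝕜))) (𝓝 0)
        (𝓝 (0, 0)) := tendsto_axis.prodMk_nhds tendsto_diagonal
    filter_upwards [ht.eventually h4] with a ha
    refine (ha (sub_eq_zero.2 ?_)).symm
    ext i
    rw [hρ]
    exact hr i a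
  · filter_upwards [hρΩ, hrd, hd] with S s1 s2 s3 i
    subst hρ
    rw [pd_comp_reparametrization (fun i => (s2 i).1) s3.1]
    exact smul_ne_zero (s2 i).2 ((hv.surface _ s1).ne_zero i)
  · filter_upwards [hρΩ, hrd, hd] with S s1 s2 s3 i
    subst hρ
    rw [pd_comp_reparametrization (fun i => (s2 i).1) s3.1, mulVec_smul]
    exact (congrArg (fun y => deriv (r i) (S i) • y) (hv.eigen _ s1 i)).trans (smul_zero _)
  · filter_upwards [hρΩ, hrd, hd] with S s1 s2 s3 i j hij
    subst hρ
    rw [pd_comp_reparametrization (fun i => (s2 i).1) (s3.2.1 i),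
      pd_comp_reparametrization (fun i => (s2 i).1) (s3.2.2 i), smul_eq_mul, smul_eq_mul, mul_assoc,
      mul_assoc]
    exact congrArg (fun y => deriv (r j) (S j) * y) (hv.commute _ s1 i j hij)
  · filter_upwards [hW, hRpd] with z z1 z2 i
    obtain ⟨c, hc, hcp⟩ := z2 i
    have := hR.nonstationary z z1 i
    rw [hcp] at this
    exact right_ne_zero_of_mul this
  · filter_upwards [hW, hRpd, hRS] with z z1 z2 z3 i
    obtain ⟨c, hc, hcp⟩ := z2 i
    have := hR.eq_t z z1 i
    rw [hcp, hcp, z3] at this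
    exact mul_left_cancel₀ hc (this.trans (by ring))
  · filter_upwards [hW, hRpd, hRS] with z z1 z2 z3 i
    obtain ⟨c, hc, hcp⟩ := z2 i
    have := hR.eq_y z z1 i
    rw [hcp, hcp, z3] at this
    exact mul_left_cancel₀ hc (this.trans (by ring))
  · filter_upwards [hW, hRS] with z z1 z2
    rw [← z2]
    exact hw z z1

end Normalization
end HydrodynamicType

namespace HydrodynamicType
open Filter Matrix

/-! ### Hodograph functions of a normalized double wave -/

section HodographFunctions

universe v
variable {𝕜 : Type v} [RCLike 𝕜] {m : ℕ} {A B : (Fin m → 𝕜) → Matrix (Fin m) (Fin m) 𝕜}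
  {u : (Fin 2 → 𝕜) → Fin m → 𝕜} {lam mu : Fin 2 → (Fin 2 → 𝕜) → 𝕜} {R : (Fin 3 → 𝕜) → Fin 2 → 𝕜}

theorem eventually_eq_of_pd_eq_zero {n : ℕ} {f : (Fin n → 𝕜) → 𝕜} {k : Fin n}
    (hf : SmoothNear 𝕜 f 0) (h : ∀ᶠ z in 𝓝 0, pd k f z = 0) :
    ∀ᶠ z in 𝓝 0, f z = f (Function.update z k 0) := by
  obtain ⟨ε, hε, h1⟩ := Metric.eventually_nhds_iff_ball.1 (hf.eventually_differentiableAt.and h)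
  filter_upwards [Metric.ball_mem_nhds 0 hε] with z hz
  have hmem : ∀ t ∈ Metric.ball (0 : 𝕜) ε, Function.update z k t ∈ Metric.ball (0 : Fin n → 𝕜) ε := by
    intro t ht
    rw [mem_ball_zero_iff] at ht hz ⊢
    refine (pi_norm_lt_iff hε).2 fun i => ?_
    by_cases hi : i = k
    · subst hi; simpa using ht
    · rw [Function.update_of_ne hi]
      exact (norm_le_pi_norm z i).trans_lt hz
  have hd : ∀ t ∈ Metric.ball (0 : 𝕜) ε, HasDerivAt (fun t => f (Function.update z k t)) 0 t := by
    intro t ht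
    obtain ⟨k1, k2⟩ := h1 _ (hmem t ht)
    have := k1.hasFDerivAt.comp_hasDerivAt t (hasDerivAt_update z k t)
    rwa [show fderiv 𝕜 f (Function.update z k t) (Pi.single k 1) = 0 from k2] at this
  have hc := (convex_ball (0 : 𝕜) ε).is_const_of_fderivWithin_eq_zero (𝕜 := 𝕜)
    (fun t ht => (hd t ht).differentiableAt.differentiableWithinAt)
    (fun t ht => by
      rw [fderivWithin_of_isOpen Metric.isOpen_ball ht, (hd t ht).hasFDerivAt.fderiv]
      ext
      simp) (x := z k) (y := 0)
    (by
      rw [mem_ball_zero_iff] at hz ⊢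
      exact (norm_le_pi_norm z k).trans_lt hz) (Metric.mem_ball_self hε)
  simpa using hc

namespace IsNormalizedWave

theorem R_zero (h : IsNormalizedWave A B u lam mu R) : R 0 = 0 := by
  have := h.axis.self_of_nhds
  rwa [axis_zero] at this

theorem tendsto_R (h : IsNormalizedWave A B u lam mu R) : Tendsto R (𝓝 0) (𝓝 0) := by
  simpa only [h.R_zero] using h.smooth_R.continuousAt.tendsto

theorem pd_one (h : IsNormalizedWave A B u lam mu R) (i : Fin 2) : pd 1 (fun z => R z i) 0 = 1 := by
  have e1 : DifferentiableAt 𝕜 (fun z => R z i) (![0, 0, 0] : Fin 3 → 𝕜) := by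
    rw [axis_zero]; exact (h.smooth_R.apply i).differentiableAt
  have e2 := (e1.hasFDerivAt.comp_hasDerivAt (0 : 𝕜) (hasDerivAt_axis 0)).deriv
  have e3 : ((fun z => R z i) ∘ fun a : 𝕜 => (![0, a, 0] : Fin 3 → 𝕜)) =ᶠ[𝓝 0] fun a => a :=
    h.axis.mono fun a ha => congrFun ha i
  rw [e3.deriv_eq, deriv_id'', axis_zero] at e2
  exact e2.symm

/-- The coordinates `(t, x, y)` as functions of `(t, R⁰, R¹)`. -/
theorem exists_inverse (h : IsNormalizedWave A B u lam mu R) (hmu : mu 1 0 - mu 0 0 ≠ 0) :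
    ∃ Ξ : (Fin 3 → 𝕜) → Fin 3 → 𝕜, SmoothNear 𝕜 Ξ 0 ∧ Ξ 0 = 0 ∧ (∀ T, Ξ T 0 = T 0) ∧
      (∀ᶠ T in 𝓝 0, R (Ξ T) = ![T 1, T 2]) ∧ ∀ᶠ z in 𝓝 0, Ξ ![z 0, R z 0, R z 1] = z := by
  have hι : SmoothNear 𝕜 (fun z : (Fin 3 → 𝕜) × (Fin 2 → 𝕜) => z) (0, 0) := smoothNear_id
  obtain ⟨Z, hZ⟩ : ∃ Z : (Fin 3 → 𝕜) × (Fin 2 → 𝕜) → Fin 3 → 𝕜,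
    Z = fun z => ![z.1 0, z.2 0, z.2 1] := ⟨_, rfl⟩
  have sZ : SmoothNear 𝕜 Z (0, 0) := by
    rw [hZ]
    refine SmoothNear.pi fun i => ?_
    fin_cases i
    exacts [hι.fst.apply 0, hι.snd.apply 0, hι.snd.apply 1]
  have hZ0 : Z (0, 0) = 0 := by
    rw [hZ]; exact axis_zero
  obtain ⟨Φ, hΦ⟩ : ∃ Φ : (Fin 3 → 𝕜) × (Fin 2 → 𝕜) → Fin 2 → 𝕜,
    Φ = fun z => R (Z z) - ![z.1 1, z.1 2] := ⟨_, rfl⟩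
  have sΦ : SmoothNear 𝕜 Φ (0, 0) := by
    rw [hΦ]
    refine (h.smooth_R.comp_of_eq sZ hZ0).sub (SmoothNear.pi fun i => ?_)
    fin_cases i
    exacts [hι.fst.apply 1, hι.fst.apply 2]
  have hΦ0 : Φ (0, 0) = 0 := by
    simp only [hΦ, hZ0, h.R_zero]
    ext i; fin_cases i <;> simp
  have hder : ∀ (X : Fin 2 → 𝕜) (i : Fin 2), (fderiv 𝕜 Φ (0, 0) ∘L
      .inr 𝕜 (Fin 3 → 𝕜) (Fin 2 → 𝕜)) X i = X 0 + mu i 0 * X 1 := by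
    intro X i
    have c1 := sΦ.differentiableAt.hasFDerivAt.comp (0 : Fin 2 → 𝕜)
      (hasFDerivAt_prodMk_right (𝕜 := 𝕜) (0 : Fin 3 → 𝕜) (0 : Fin 2 → 𝕜))
    have c2 : (Φ ∘ fun X : Fin 2 → 𝕜 => ((0 : Fin 3 → 𝕜), X)) = fun X => R ![0, X 0, X 1] := by
      funext X i
      rw [hΦ, hZ]
      change R ![0, X 0, X 1] i - (![0, 0] : Fin 2 → 𝕜) i = _
      have : (![0, 0] : Fin 2 → 𝕜) i = 0 := by fin_cases i <;> rfl
      rw [this, sub_zero]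
    rw [c2] at c1
    have c3 : DifferentiableAt 𝕜 (fun X : Fin 2 → 𝕜 => (![0, X 0, X 1] : Fin 3 → 𝕜)) 0 := by
      refine differentiableAt_pi.2 fun i => ?_
      fin_cases i
      · exact differentiableAt_const _
      · exact (smoothNear_id.apply 0).differentiableAt
      · exact (smoothNear_id.apply 1).differentiableAt
    have hz : (![0, (0 : Fin 2 → 𝕜) 0, (0 : Fin 2 → 𝕜) 1] : Fin 3 → 𝕜) = 0 := axis_zero
    have hRd : DifferentiableAt 𝕜 (fun z => R z i) (![0, (0 : Fin 2 → 𝕜) 0, (0 : Fin 2 → 𝕜) 1]) := by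
      rw [hz]; exact (h.smooth_R.apply i).differentiableAt
    have c4 : ∀ j : Fin 2, pd j (fun X : Fin 2 → 𝕜 => R ![0, X 0, X 1] i) 0
        = ![1, mu i 0] j := by
      intro j
      have c5 := pd_comp_pi (g := fun z => R z i) (R := fun X : Fin 2 → 𝕜 => ![0, X 0, X 1])
        (z := 0) hRd c3 j
      rw [c5, Fin.sum_univ_three, hz, h.pd_one, h.eq_y.self_of_nhds, h.pd_one, h.R_zero]
      have d0 : pd j (fun X : Fin 2 → 𝕜 => X 0) 0 = (Pi.single j 1 : Fin 2 → 𝕜) 0 := by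
        rw [pd_apply differentiableAt_fun_id]; simp [pd]
      have d1 : pd j (fun X : Fin 2 → 𝕜 => X 1) 0 = (Pi.single j 1 : Fin 2 → 𝕜) 1 := by
        rw [pd_apply differentiableAt_fun_id]; simp [pd]
      have d2 : pd j (fun _ : Fin 2 → 𝕜 => (0 : 𝕜)) 0 = 0 := by simp [pd]
      change pd j (fun _ : Fin 2 → 𝕜 => (0 : 𝕜)) 0 • _ + pd j (fun X : Fin 2 → 𝕜 => X 0) 0 • _
        + pd j (fun X : Fin 2 → 𝕜 => X 1) 0 • _ = _
      rw [d0, d1, d2]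
      fin_cases j <;> simp
    have c6 := hasFDerivAt_pi'.1 c1 i
    have c7 : X = X 0 • Pi.single 0 1 + X 1 • Pi.single 1 1 := by
      ext k; fin_cases k <;> simp
    have c8 := c6.fderiv
    have c9 := c4 0
    have c10 := c4 1
    rw [pd, c8] at c9 c10
    change ((ContinuousLinearMap.proj (R := 𝕜) (φ := fun _ : Fin 2 => 𝕜) i) ∘L (fderiv 𝕜 Φ (0, 0) ∘L
      .inr 𝕜 (Fin 3 → 𝕜) (Fin 2 → 𝕜))) X = _
    conv_lhs => rw [c7]
    rw [map_add, map_smul, map_smul, c9, c10]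
    simp [mul_comm]
  obtain ⟨ψ, h1, h2, h3, h4⟩ := sΦ.exists_implicitFunction hΦ0 (by
    set L := fderiv 𝕜 Φ (0, 0) ∘L .inr 𝕜 (Fin 3 → 𝕜) (Fin 2 → 𝕜) with hL
    have hinj : Function.Injective (L : (Fin 2 → 𝕜) →ₗ[𝕜] (Fin 2 → 𝕜)) := by
      rw [← LinearMap.ker_eq_bot, LinearMap.ker_eq_bot']
      intro X hX
      have e0 : X 0 + mu 0 0 * X 1 = 0 := by
        rw [← hder]; exact congrFun hX 0
      have e1 : X 0 + mu 1 0 * X 1 = 0 := by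
        rw [← hder]; exact congrFun hX 1
      have e2 : X 1 = 0 := by
        refine (mul_eq_zero (a := mu 1 0 - mu 0 0).1 ?_).resolve_left hmu
        linear_combination e1 - e0
      rw [e2, mul_zero, add_zero] at e0
      ext k; fin_cases k
      exacts [e0, e2]
    refine ⟨(LinearEquiv.ofInjectiveEndo _ hinj).toContinuousLinearEquiv, ?_⟩
    ext1 X
    rfl)
  have ht : Tendsto (fun z : Fin 3 → 𝕜 => ((![z 0, R z 0, R z 1] : Fin 3 → 𝕜),
      (![z 1, z 2] : Fin 2 → 𝕜))) (𝓝 0) (𝓝 (0, 0)) := by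
    have c : ContinuousAt (fun z : Fin 3 → 𝕜 => ((![z 0, R z 0, R z 1] : Fin 3 → 𝕜),
        (![z 1, z 2] : Fin 2 → 𝕜))) 0 := by
      have hR := h.smooth_R.continuousAt
      have hR0 := continuousAt_pi.1 hR 0
      have hR1 := continuousAt_pi.1 hR 1
      refine ContinuousAt.prodMk (continuousAt_pi.2 fun i => ?_) (continuousAt_pi.2 fun i => ?_)
      · fin_cases i
        exacts [continuousAt_apply 0 _, hR0, hR1]
      · fin_cases i
        exacts [continuousAt_apply 1 _, continuousAt_apply 2 _]
    have e : (((![(0 : Fin 3 → 𝕜) 0, R 0 0, R 0 1] : Fin 3 → 𝕜),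
        (![(0 : Fin 3 → 𝕜) 1, (0 : Fin 3 → 𝕜) 2] : Fin 2 → 𝕜))) = (0, 0) := by
      rw [h.R_zero]
      refine Prod.ext axis_zero ?_
      ext i; fin_cases i <;> rfl
    rw [ContinuousAt, e] at c
    exact c
  refine ⟨fun T => ![T 0, ψ T 0, ψ T 1], ?_, ?_, fun T => rfl, ?_, ?_⟩
  · refine SmoothNear.pi fun i => ?_
    fin_cases i
    exacts [smoothNear_id.apply 0, h1.apply 0, h1.apply 1]
  · dsimp only
    rw [h2]; exact axis_zero
  · filter_upwards [h3] with T hT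
    simp only [hΦ, hZ] at hT
    exact sub_eq_zero.1 hT
  · filter_upwards [ht.eventually h4] with z hz
    have e1 := hz (by
      simp only [hΦ, hZ]
      have : (![(![z 0, R z 0, R z 1] : Fin 3 → 𝕜) 0, (![z 1, z 2] : Fin 2 → 𝕜) 0,
          (![z 1, z 2] : Fin 2 → 𝕜) 1] : Fin 3 → 𝕜) = z := by
        ext i; fin_cases i <;> rfl
      rw [this, sub_eq_zero]
      ext i; fin_cases i <;> rfl)
    rw [← e1]
    ext i; fin_cases i <;> rfl

/-- The functions of the generalized hodograph method: `x + λⁱ t + μⁱ y` is a function of the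
Riemann invariants. -/
theorem exists_hodograph (h : IsNormalizedWave A B u lam mu R) (hmu : mu 1 0 - mu 0 0 ≠ 0) :
    ∃ w : Fin 2 → (Fin 2 → 𝕜) → 𝕜, (∀ i, SmoothNear 𝕜 (w i) 0) ∧
      (∀ᶠ S in 𝓝 0, ∀ i j, i ≠ j →
        pd j (w i) S * (mu j S - mu i S) = pd j (mu i) S * (w j S - w i S)) ∧
      (∀ᶠ a : 𝕜 in 𝓝 0, ∀ i, w i (fun _ => a) = a) ∧
      ∀ᶠ z in 𝓝 0, ∀ i, w i (R z) = z 1 + lam i (R z) * z 0 + mu i (R z) * z 2 := by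
  obtain ⟨Ξ, h1, h2, h3, h4, h5⟩ := h.exists_inverse hmu
  obtain ⟨τ, hτ⟩ : ∃ τ : (Fin 3 → 𝕜) → Fin 2 → 𝕜, τ = fun T => ![T 1, T 2] := ⟨_, rfl⟩
  obtain ⟨e, he⟩ : ∃ e : (Fin 2 → 𝕜) → Fin 3 → 𝕜, e = fun S => ![0, S 0, S 1] := ⟨_, rfl⟩
  have sτ : ∀ T, SmoothNear 𝕜 τ T := by
    intro T
    rw [hτ]
    refine SmoothNear.pi fun i => ?_
    fin_cases i
    exacts [smoothNear_id.apply 1, smoothNear_id.apply 2]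
  have se : ∀ S, SmoothNear 𝕜 e S := by
    intro S
    rw [he]
    refine SmoothNear.pi fun i => ?_
    fin_cases i
    exacts [smoothNear_const _, smoothNear_id.apply 0, smoothNear_id.apply 1]
  have hτ0 : τ 0 = 0 := by
    rw [hτ]; ext i; fin_cases i <;> rfl
  have he0 : e 0 = 0 := by rw [he]; exact axis_zero
  have hτe : ∀ S, τ (e S) = S := by
    intro S; rw [hτ, he]; ext i; fin_cases i <;> rfl
  have tτ : Tendsto τ (𝓝 0) (𝓝 0) := by
    simpa only [hτ0] using (sτ 0).continuousAt.tendsto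
  have te : Tendsto e (𝓝 0) (𝓝 0) := by
    simpa only [he0] using (se 0).continuousAt.tendsto
  have tΞ : Tendsto Ξ (𝓝 0) (𝓝 0) := by
    simpa only [h2] using h1.continuousAt.tendsto
  have pdτ : ∀ (k : Fin 3) (T : Fin 3 → 𝕜), pd k τ T
      = ![(Pi.single k 1 : Fin 3 → 𝕜) 1, (Pi.single k 1 : Fin 3 → 𝕜) 2] := by
    intro k T
    ext i
    rw [← pd_apply (sτ T).differentiableAt, hτ]
    fin_cases i
    · change pd k (fun T : Fin 3 → 𝕜 => T 1) T = _
      rw [pd_apply differentiableAt_fun_id]; simp [pd]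
    · change pd k (fun T : Fin 3 → 𝕜 => T 2) T = _
      rw [pd_apply differentiableAt_fun_id]; simp [pd]
  have pde : ∀ (k : Fin 2) (S : Fin 2 → 𝕜), pd k e S = Pi.single k.succ 1 := by
    intro k S
    ext i
    rw [← pd_apply (se S).differentiableAt, he]
    fin_cases i
    · change pd k (fun _ : Fin 2 → 𝕜 => (0 : 𝕜)) S = _
      fin_cases k <;> simp [pd]
    · change pd k (fun T : Fin 2 → 𝕜 => T 0) S = _
      rw [pd_apply differentiableAt_fun_id]
      fin_cases k <;> simp [pd]
    · change pd k (fun T : Fin 2 → 𝕜 => T 1) S = _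
      rw [pd_apply differentiableAt_fun_id]
      fin_cases k <;> simp [pd]
  -- the functions `x + λⁱ t + μⁱ y` in the coordinates `(t, R⁰, R¹)`
  obtain ⟨W, hW⟩ : ∃ W : Fin 2 → (Fin 3 → 𝕜) → 𝕜,
    W = fun i T => Ξ T 1 + lam i (τ T) * Ξ T 0 + mu i (τ T) * Ξ T 2 := ⟨_, rfl⟩
  have sl := fun i => (h.smooth_lam i).comp_of_eq (sτ 0) hτ0
  have sm := fun i => (h.smooth_mu i).comp_of_eq (sτ 0) hτ0
  have sW : ∀ i, SmoothNear 𝕜 (W i) 0 := by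
    intro i
    rw [hW]
    exact ((h1.apply 1).add ((sl i).mul (h1.apply 0))).add ((sm i).mul (h1.apply 2))
  have hWpd : ∀ᶠ T in 𝓝 0, ∀ (i : Fin 2) (k : Fin 3), k ≠ i.succ → pd k (W i) T
      = pd k (fun T => lam i (τ T)) T * Ξ T 0 + pd k (fun T => mu i (τ T)) T * Ξ T 2 := by
    filter_upwards [h4.eventually_nhds, tΞ.eventually h.eq_t, tΞ.eventually h.eq_y,
      tΞ.eventually h.nonstationary, h1.eventually_differentiableAt,
      tΞ.eventually h.smooth_R.eventually_differentiableAt,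
      eventually_all.2 fun i => (sl i).eventually_differentiableAt,
      eventually_all.2 fun i => (sm i).eventually_differentiableAt]
      with T t1 t2 t3 t4 t5 t6 t7 t8 i k hki
    have dΞ := differentiableAt_pi.1 t5
    have e1 : pd k (fun T => R (Ξ T) i) T = 0 := by
      have : pd k (fun T => R (Ξ T) i) T = pd k (fun T => τ T i) T :=
        pd_congr (t1.mono fun S hS => by dsimp only; rw [hS, hτ])
      rw [this, pd_apply (sτ T).differentiableAt, pdτ]
      fin_cases i
      · exact Pi.single_eq_of_ne (show (1 : Fin 3) ≠ k from hki.symm) 1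
      · exact Pi.single_eq_of_ne (show (2 : Fin 3) ≠ k from hki.symm) 1
    rw [pd_comp_pi (g := fun z => R z i) (differentiableAt_pi.1 t6 i) t5, Fin.sum_univ_three,
      t2, t3, t1.self_of_nhds] at e1
    have e2 : pd k (fun z => Ξ z 1) T + lam i (τ T) * pd k (fun z => Ξ z 0) T
        + mu i (τ T) * pd k (fun z => Ξ z 2) T = 0 := by
      refine (mul_eq_zero.1 ?_).resolve_right (t4 i)
      subst hτ
      simp only [smul_eq_mul] at e1
      linear_combination e1
    have e3 : pd k (W i) T = pd k (fun T => Ξ T 1 + lam i (τ T) * Ξ T 0 + mu i (τ T) * Ξ T 2) T := by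
      rw [hW]
    rw [e3, pd_add ((dΞ 1).fun_add ((t7 i).fun_mul (dΞ 0))) ((t8 i).fun_mul (dΞ 2)),
      pd_add (dΞ 1) ((t7 i).fun_mul (dΞ 0)), pd_mul (t7 i) (dΞ 0), pd_mul (t8 i) (dΞ 2)]
    linear_combination e2
  have hpdc : ∀ (g : (Fin 2 → 𝕜) → 𝕜), SmoothNear 𝕜 g 0 → ∀ᶠ T in 𝓝 0,
      pd 0 (fun T => g (τ T)) T = 0 ∧ ∀ j : Fin 2, pd j.succ (fun T => g (τ T)) T = pd j g (τ T) := by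
    intro g hg
    filter_upwards [tτ.eventually hg.eventually_differentiableAt] with T hT
    have e1 : ∀ k, pd k (fun T => g (τ T)) T = fderiv 𝕜 g (τ T) (pd k τ T) := fun k =>
      pd_comp hT (sτ T).differentiableAt
    refine ⟨?_, fun j => ?_⟩
    · have : (![(Pi.single 0 1 : Fin 3 → 𝕜) 1, (Pi.single 0 1 : Fin 3 → 𝕜) 2] : Fin 2 → 𝕜) = 0 := by
        ext i; fin_cases i <;> simp
      rw [e1, pdτ, this, map_zero]
    · rw [e1, pdτ, pd]
      congr 1
      ext i; fin_cases i <;> fin_cases j <;> simp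
  have hlpd := eventually_all.2 fun i => hpdc _ (h.smooth_lam i)
  have hmpd := eventually_all.2 fun i => hpdc _ (h.smooth_mu i)
  have hconst : ∀ᶠ T in 𝓝 0, ∀ i, W i T = W i (e (τ T)) := by
    refine eventually_all.2 fun i => ?_
    have : ∀ᶠ T in 𝓝 0, pd 0 (W i) T = 0 := by
      filter_upwards [hWpd, hlpd, hmpd] with T t1 t2 t3
      rw [t1 i 0 (Fin.succ_ne_zero i).symm, (t2 i).1, (t3 i).1, zero_mul, zero_mul, add_zero]
    filter_upwards [eventually_eq_of_pd_eq_zero (sW i) this] with T hT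
    rw [hT]
    congr 1
    rw [he, hτ]
    ext k; fin_cases k <;> rfl
  have haxis : ∀ᶠ z in 𝓝 0, ∀ i, W i (e (R z)) = z 1 + lam i (R z) * z 0 + mu i (R z) * z 2 := by
    have ht : Tendsto (fun z : Fin 3 → 𝕜 => (![z 0, R z 0, R z 1] : Fin 3 → 𝕜)) (𝓝 0) (𝓝 0) := by
      have c : ContinuousAt (fun z : Fin 3 → 𝕜 => (![z 0, R z 0, R z 1] : Fin 3 → 𝕜)) 0 := by
        have hR := h.smooth_R.continuousAt
        have hR0 := continuousAt_pi.1 hR 0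
        have hR1 := continuousAt_pi.1 hR 1
        refine continuousAt_pi.2 fun i => ?_
        fin_cases i
        exacts [continuousAt_apply 0 _, hR0, hR1]
      rw [ContinuousAt, h.R_zero] at c
      exact axis_zero (𝕜 := 𝕜) ▸ c
    filter_upwards [h5, ht.eventually hconst] with z z1 z2 i
    have e1 : τ ![z 0, R z 0, R z 1] = R z := by
      rw [hτ]; ext i; fin_cases i <;> rfl
    rw [e1] at z2
    rw [← z2 i, hW]
    dsimp only
    rw [z1, e1]
  refine ⟨fun i S => W i (e S), fun i => (sW i).comp_of_eq (se 0) he0, ?_, ?_, haxis⟩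
  · filter_upwards [te.eventually hWpd, te.eventually hlpd, te.eventually hmpd,
      te.eventually (eventually_all.2 fun i => (sW i).eventually_differentiableAt)]
      with S s1 s2 s3 s4 i j hij
    have e1 : pd j (fun S => W i (e S)) S = pd j.succ (W i) (e S) := by
      rw [pd_comp (s4 i) (se S).differentiableAt, pde]; rfl
    have e2 : Ξ (e S) 0 = 0 := by rw [h3, he]; rfl
    rw [e1, s1 i j.succ (fun h => hij (Fin.succ_injective _ h).symm), e2, (s3 i).2, hτe, hW]
    simp only [e2, hτe]
    ring
  · filter_upwards [tendsto_axis.eventually haxis, h.axis] with a a1 a2 i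
    rw [a2] at a1
    rw [a1 i]
    simp

end IsNormalizedWave

end HodographFunctions
end HydrodynamicType

namespace HydrodynamicType
open Filter Matrix

/-! ### Uniqueness of double waves -/

section DoubleWaveUniqueness

universe v
variable {𝕜 : Type v} [RCLike 𝕜] {m : ℕ} {A B : (Fin m → 𝕜) → Matrix (Fin m) (Fin m) 𝕜}
  {u : (Fin 2 → 𝕜) → Fin m → 𝕜} {lam mu : Fin 2 → (Fin 2 → 𝕜) → 𝕜} {R : (Fin 3 → 𝕜) → Fin 2 → 𝕜}
  {u₀ : Fin m → 𝕜} {lam₀ mu₀ : Fin 2 → 𝕜}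

namespace IsNormalizedWave

/-- The speeds of a normalized wave lie on the branches of the dispersion curve through the base
points. -/
theorem lam_eq (h : IsNormalizedWave A B u lam mu R)
    (P : TransversalBranches A B (fun _ => 1) u₀ mu₀ lam₀) (hu : u 0 = u₀)
    (hl : ∀ i, lam i 0 = lam₀ i) (hm : ∀ i, mu i 0 = mu₀ i) :
    ∀ᶠ S in 𝓝 0, ∀ i, lam i S = P.q i (u S, fun k => mu k S) := by
  have hun : ∀ i, ∀ᶠ S in 𝓝 0,
      (pencil A B (fun _ => 1) (u S) (mu i S) (lam i S)).det = 0 →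
        lam i S = (P.β i).Q (u S, mu i S) := by
    intro i
    have c := ((h.smooth_u.prodMk (h.smooth_mu i)).prodMk (h.smooth_lam i)).continuousAt
    rw [ContinuousAt, hu, hm, hl] at c
    exact c.eventually (P.β i).unique
  filter_upwards [eventually_all.2 hun, h.eigen, h.ne_zero] with S s1 s2 s3 i
  exact s1 i (exists_mulVec_eq_zero_iff.1 ⟨_, s3 i, s2 i⟩)

/-- The equations for the speeds, and for the lengths `pᵢ` of the vectors `∂ᵢu` relative to the
kernel vectors `ξᵢ`, follow from those of a reduction. -/
theorem exists_isWaveSolution (h : IsNormalizedWave A B u lam mu R)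
    (P : BranchPair A B (fun _ => 1) u₀ mu₀ lam₀) (hu : u 0 = u₀)
    (hl : ∀ i, lam i 0 = lam₀ i) (hm : ∀ i, mu i 0 = mu₀ i) (hmu : mu₀ 1 - mu₀ 0 ≠ 0) :
    ∃ p w, IsWaveSolution P.coefficients u mu p w ∧
      (∀ᶠ a : 𝕜 in 𝓝 0, ∀ i, w i (fun _ => a) = a) ∧
      ∀ᶠ z in 𝓝 0, ∀ i, w i (R z) = z 1 + lam i (R z) * z 0 + mu i (R z) * z 2 := by
  obtain ⟨w, w1, w2, w3, w4⟩ := h.exists_hodograph (by rwa [hm, hm])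
  have spt : SmoothNear 𝕜 (fun S => (u S, fun k => mu k S)) 0 :=
    h.smooth_u.prodMk (SmoothNear.pi h.smooth_mu)
  have hpt0 : (u 0, fun k => mu k 0) = (u₀, mu₀) := by rw [hu, funext hm]
  have tpt : Tendsto (fun S => (u S, fun k => mu k S)) (𝓝 0) (𝓝 (u₀, mu₀)) := by
    simpa only [hpt0] using spt.continuousAt.tendsto
  have sξ : ∀ i, SmoothNear 𝕜 (fun S => P.ξ i (u S, fun k => mu k S)) 0 := fun i =>
    (P.smooth_ξ i).comp_of_eq spt hpt0
  have hmin := tpt.eventually P.minor_ne_zero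
  have smin : SmoothNear 𝕜 (fun S => P.minor (P.ξ 0 (u S, fun k => mu k S))
      (P.ξ 1 (u S, fun k => mu k S))) 0 := P.smooth_minor (sξ 0) (sξ 1)
  obtain ⟨p, hp⟩ : ∃ p : Fin 2 → (Fin 2 → 𝕜) → 𝕜, p = ![fun S => P.minor (pd 0 u S)
      (P.ξ 1 (u S, fun k => mu k S)) / P.minor (P.ξ 0 (u S, fun k => mu k S))
        (P.ξ 1 (u S, fun k => mu k S)),
    fun S => P.minor (P.ξ 0 (u S, fun k => mu k S)) (pd 1 u S) /
      P.minor (P.ξ 0 (u S, fun k => mu k S)) (P.ξ 1 (u S, fun k => mu k S))] := ⟨_, rfl⟩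
  have sp : ∀ i, SmoothNear 𝕜 (p i) 0 := by
    intro i
    rw [hp]
    fin_cases i
    · exact (P.smooth_minor (h.smooth_u.pd 0) (sξ 1)).div smin hmin.self_of_nhds
    · exact (P.smooth_minor (sξ 0) (h.smooth_u.pd 1)).div smin hmin.self_of_nhds
  have hlam := h.lam_eq P.toTransversalBranches hu hl hm
  have eu : ∀ᶠ S in 𝓝 0, ∀ i, pd i u S = p i S • P.ξ i (u S, fun k => mu k S) := by
    filter_upwards [hlam, h.eigen, tpt.eventually P.isSimplePair, hmin] with S s1 s2 s3 s4 i
    have e1 : P.V i (u S, fun k => mu k S) *ᵥ pd i u S = 0 := by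
      have := s2 i
      rw [s1 i] at this
      exact this
    obtain ⟨c, hc⟩ := (s3 i).ker _ e1
    suffices p i S = c by rw [this, hc]
    rw [hp]
    fin_cases i
    · change P.minor (pd 0 u S) _ / _ = c
      rw [div_eq_iff s4, show pd 0 u S = c • P.ξ 0 (u S, fun k => mu k S) from hc]
      simp only [TransversalBranches.minor, Pi.smul_apply, smul_eq_mul]; ring
    · change P.minor _ (pd 1 u S) / _ = c
      rw [div_eq_iff s4, show pd 1 u S = c • P.ξ 1 (u S, fun k => mu k S) from hc]
      simp only [TransversalBranches.minor, Pi.smul_apply, smul_eq_mul]; ring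
  have hne : ∀ᶠ S in 𝓝 0, ∀ i, mu (1 - i) S - mu i S ≠ 0 := by
    refine eventually_all.2 fun i =>
      ((h.smooth_mu (1 - i)).sub (h.smooth_mu i)).continuousAt.eventually_ne ?_
    rw [hm, hm]
    fin_cases i
    · exact hmu
    · change mu₀ 0 - mu₀ 1 ≠ 0
      rw [← neg_sub]; exact neg_ne_zero.2 hmu
  have es : ∀ᶠ S in 𝓝 0, ∀ i j, i ≠ j → pd j (mu i) S
      = p j S * P.γ i (u S, fun k => mu k S) * (mu j S - mu i S) := by
    have hQd := eventually_all.2 fun i => tpt.eventually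
      ((TransversalBranches.tendsto_pt (u₀ := u₀) (s₀ := mu₀) i).eventually
        (P.β i).smooth_Q.eventually_differentiableAt)
    have hk := eventually_all.2 fun i => tpt.eventually
      ((TransversalBranches.tendsto_pt (u₀ := u₀) (s₀ := mu₀) i).eventually (P.β i).deriv_kernel)
    filter_upwards [hlam.eventually_nhds, eu, tpt.eventually P.isSimplePair,
      tpt.eventually P.chord', hne, h.commute, hQd, hk, h.smooth_u.eventually_differentiableAt,
      eventually_all.2 fun i => (h.smooth_mu i).eventually_differentiableAt]
      with S s1 s2 s3 s4 s5 s6 s7 s8 s9 s10 i j hij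
    obtain rfl := eq_one_sub hij
    obtain ⟨c, hc⟩ : ∃ c, c = pd (1 - i) (mu i) S / (mu (1 - i) S - mu i S) := ⟨_, rfl⟩
    have hcm : pd (1 - i) (mu i) S = c * (mu (1 - i) S - mu i S) := by
      rw [hc, div_mul_cancel₀ _ (s5 i)]
    have hcl : pd (1 - i) (lam i) S = c * (lam (1 - i) S - lam i S) := by
      refine mul_right_cancel₀ (s5 i) ((s6 i _ hij).trans ?_)
      rw [hcm]; ring
    have e1 : pd (1 - i) (lam i) S = fderiv 𝕜 (P.β i).Q (u S, mu i S)
        (p (1 - i) S • P.ξ (1 - i) (u S, fun k => mu k S), c * (mu (1 - i) S - mu i S)) := by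
      have : pd (1 - i) (lam i) S = pd (1 - i) (fun S => (P.β i).Q (u S, mu i S)) S :=
        pd_congr (s1.mono fun T hT => hT i)
      rw [this, pd_comp (g := (P.β i).Q) (f := fun S => (u S, mu i S)) (s7 i) (s9.prodMk (s10 i)),
        pd_prodMk s9 (s10 i), s2, hcm]
    have e2 := s8 i (p (1 - i) S • P.ξ (1 - i) (u S, fun k => mu k S))
      (c * (mu (1 - i) S - mu i S))
    have e3 := congrArg (fun y => P.η i (u S, fun k => mu k S) ⬝ᵥ y) e2
    have hη : ∀ y, P.η i (u S, fun k => mu k S) ⬝ᵥ (P.β i).V (u S, mu i S) *ᵥ y = 0 := by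
      intro y
      have : P.η i (u S, fun k => mu k S) ᵥ* (P.β i).V (u S, mu i S) = 0 := (s3 i).vecMul_eq
      rw [dotProduct_mulVec, this, zero_dotProduct]
    have e4 : (c * (mu (1 - i) S - mu i S)) • B (u S) + fderiv 𝕜 (P.β i).Q (u S, mu i S)
        (p (1 - i) S • P.ξ (1 - i) (u S, fun k => mu k S), c * (mu (1 - i) S - mu i S)) •
          (1 : Matrix (Fin m) (Fin m) 𝕜)
        = c • (P.V (1 - i) (u S, fun k => mu k S) - P.V i (u S, fun k => mu k S)) := by
      have l := s1.self_of_nhds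
      rw [← e1, hcl, P.V_sub, l i, l (1 - i)]
      module
    rw [e4, dotProduct_add, dotProduct_add, hη, add_zero, dotProduct_zero, pencilDeriv_smul,
      smul_mulVec, smul_mulVec, dotProduct_smul, dotProduct_smul, smul_eq_mul, smul_eq_mul] at e3
    have e5 : P.γ i (u S, fun k => mu k S) * (P.η i (u S, fun k => mu k S) ⬝ᵥ
        (P.V (1 - i) (u S, fun k => mu k S) - P.V i (u S, fun k => mu k S)) *ᵥ
          P.ξ i (u S, fun k => mu k S))
        = -(P.η i (u S, fun k => mu k S) ⬝ᵥ pencilDeriv A B (fun _ => 1) (u S) (mu i S)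
          ((P.β i).Q (u S, mu i S)) (P.ξ (1 - i) (u S, fun k => mu k S)) *ᵥ
            P.ξ i (u S, fun k => mu k S)) :=
      div_mul_cancel₀ _ (s4 i)
    have e6 : c = p (1 - i) S * P.γ i (u S, fun k => mu k S) := by
      refine mul_right_cancel₀ (s4 i) ?_
      have e7 : p (1 - i) S * (P.η i (u S, fun k => mu k S) ⬝ᵥ pencilDeriv A B (fun _ => 1) (u S)
          (mu i S) ((P.β i).Q (u S, mu i S)) (P.ξ (1 - i) (u S, fun k => mu k S)) *ᵥ
            P.ξ i (u S, fun k => mu k S)) + c * (P.η i (u S, fun k => mu k S) ⬝ᵥ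
        (P.V (1 - i) (u S, fun k => mu k S) - P.V i (u S, fun k => mu k S)) *ᵥ
          P.ξ i (u S, fun k => mu k S)) = 0 := e3
      linear_combination e7 - p (1 - i) S * e5
    rw [hcm, e6]
  have ep : ∀ᶠ S in 𝓝 0, ∀ i j, i ≠ j → pd j (p i) S
      = p 0 S * p 1 S * P.κ i (u S, fun k => mu k S) := by
    have hξd := eventually_all.2 fun i => tpt.eventually
      ((TransversalBranches.tendsto_pt (u₀ := u₀) (s₀ := mu₀) i).eventually
        (P.β i).smooth_ξ.eventually_differentiableAt)
    filter_upwards [eu.eventually_nhds, es, hξd, h.smooth_u.eventually, hmin,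
      eventually_all.2 fun i => (h.smooth_mu i).eventually_differentiableAt,
      eventually_all.2 fun i => (sp i).eventually_differentiableAt,
      eventually_all.2 fun i => (sξ i).eventually_differentiableAt,
      tpt.eventually (P.compatible_iff.and P.compatible)] with S s1 s2 s3 s4 s5 s6 s7 s8 s9
    have l := s1.self_of_nhds
    have mixed : ∀ i, pd (1 - i) (pd i u) S = pd (1 - i) (p i) S • P.ξ i (u S, fun k => mu k S)
        + (p i S * p (1 - i) S) • P.δ i (u S, fun k => mu k S) := by
      intro i
      have e1 : pd (1 - i) (pd i u) S
          = pd (1 - i) (fun S => p i S • P.ξ i (u S, fun k => mu k S)) S :=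
        pd_congr (s1.mono fun T hT => hT i)
      have e2 : pd (1 - i) (fun S => P.ξ i (u S, fun k => mu k S)) S
          = p (1 - i) S • P.δ i (u S, fun k => mu k S) := by
        have := pd_comp (i := 1 - i) (g := (P.β i).ξ) (f := fun S => (u S, mu i S)) (s3 i)
          (s4.differentiableAt.prodMk (s6 i))
        refine this.trans ?_
        rw [pd_prodMk s4.differentiableAt (s6 i), l, s2 i _ (ne_one_sub i)]
        have e3 : (p (1 - i) S • P.ξ (1 - i) (u S, fun k => mu k S),
            p (1 - i) S * P.γ i (u S, fun k => mu k S) * (mu (1 - i) S - mu i S))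
            = p (1 - i) S • (P.ξ (1 - i) (u S, fun k => mu k S),
              P.γ i (u S, fun k => mu k S) * (mu (1 - i) S - mu i S)) := by
          rw [Prod.smul_mk, smul_eq_mul, mul_assoc]
        rw [e3, map_smul]
        rfl
      rw [e1, pd_smul (s7 i) (s8 i), e2]
      module
    have hcomp := s9.1.1 s9.2
    have e := pd_comm (i := 1) (j := 0) s4
    have m0 := mixed 0
    have m1 := mixed 1
    change pd 1 (pd 0 u) S = pd 1 (p 0) S • _ + (p 0 S * p 1 S) • _ at m0
    change pd 0 (pd 1 u) S = pd 0 (p 1) S • _ + (p 1 S * p 0 S) • _ at m1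
    rw [m0, m1] at e
    have e4 : (pd 1 (p 0) S - p 0 S * p 1 S * P.κ 0 (u S, fun k => mu k S)) •
        P.ξ 0 (u S, fun k => mu k S)
        + (-(pd 0 (p 1) S - p 0 S * p 1 S * P.κ 1 (u S, fun k => mu k S))) •
          P.ξ 1 (u S, fun k => mu k S)
        = (0 : 𝕜) • P.ξ 0 (u S, fun k => mu k S) + (0 : 𝕜) • P.ξ 1 (u S, fun k => mu k S) := by
      have e5 := congrArg (fun y => (p 0 S * p 1 S) • y) hcomp
      simp only [smul_add, smul_smul] at e5
      rw [zero_smul, zero_smul, add_zero]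
      rw [mul_comm (p 1 S) (p 0 S)] at e
      rw [← sub_eq_zero] at e e5
      refine Eq.trans ?_ ((sub_eq_zero.2 (e.trans e5.symm)))
      module
    obtain ⟨k0, k1⟩ := P.eq_of_minor_ne_zero s5 e4
    intro i j hij
    fin_cases i <;> fin_cases j
    exacts [absurd rfl hij, sub_eq_zero.1 k0, sub_eq_zero.1 (neg_eq_zero.1 k1), absurd rfl hij]
  refine ⟨p, w, ⟨hu, hm, h.smooth_u, h.smooth_mu, sp, w1, eu, es, ep, ?_⟩, w3, w4⟩
  filter_upwards [w2, es, hne] with S s1 s2 s3 i j hij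
  have e1 := s1 i j hij
  obtain rfl := eq_one_sub hij
  refine mul_right_cancel₀ (s3 i) (e1.trans ?_)
  rw [s2 i _ hij]
  change _ = p (1 - i) S * P.γ i _ * _ * _
  ring

end IsNormalizedWave

/-- Two double waves with the same data on the axis coincide near the origin. -/
theorem BranchPair.eventuallyEq_of_isDoubleWaveWithData {U : Set (Fin m → 𝕜)}
    (P : BranchPair A B (fun _ => 1) u₀ mu₀ lam₀) (hmu : mu₀ 1 - mu₀ 0 ≠ 0) {f : Fin 4 → 𝕜 → 𝕜}
    (hf : ∀ a, SmoothNear 𝕜 (f a) 0) (h2 : f 2 0 = mu₀ 0) (h3 : f 3 0 = mu₀ 1)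
    {w w' : (Fin 3 → 𝕜) → Fin m → 𝕜} {lamW muW lamW' muW' : Fin 2 → (Fin 3 → 𝕜) → 𝕜}
    (h : IsDoubleWaveWithData A B U u₀ lam₀ mu₀ P.rows.1 P.rows.2 f w lamW muW)
    (h' : IsDoubleWaveWithData A B U u₀ lam₀ mu₀ P.rows.1 P.rows.2 f w' lamW' muW') :
    w =ᶠ[𝓝 0] w' ∧ ∀ i, lamW i =ᶠ[𝓝 0] lamW' i ∧ muW i =ᶠ[𝓝 0] muW' i := by
  obtain ⟨σ, hσ⟩ : ∃ σ : Fin 2 → 𝕜 → 𝕜, σ = ![f 2, f 3] := ⟨_, rfl⟩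
  have hσs : ∀ i, SmoothNear 𝕜 (σ i) 0 := by
    intro i; rw [hσ]; fin_cases i
    exacts [hf 2, hf 3]
  have hσ0 : ∀ i, σ i 0 = mu₀ i := by
    intro i; rw [hσ]; fin_cases i
    exacts [h2, h3]
  have key : ∀ {w : (Fin 3 → 𝕜) → Fin m → 𝕜} {lamW muW : Fin 2 → (Fin 3 → 𝕜) → 𝕜},
      IsDoubleWaveWithData A B U u₀ lam₀ mu₀ P.rows.1 P.rows.2 f w lamW muW →
      ∃ u mu p v R, IsWaveSolution P.coefficients u mu p v ∧ Tendsto R (𝓝 0) (𝓝 0) ∧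
        (∀ᶠ z in 𝓝 0, w z = u (R z) ∧ ∀ i, muW i z = mu i (R z) ∧
          lamW i z = P.q i (u (R z), fun k => mu k (R z)) ∧
          v i (R z) = z 1 + P.q i (u (R z), fun k => mu k (R z)) * z 0 + mu i (R z) * z 2) ∧
        (∀ᶠ a : 𝕜 in 𝓝 0, u (fun _ => a) P.rows.1 = f 0 a ∧ u (fun _ => a) P.rows.2 = f 1 a ∧
          ∀ i, mu i (fun _ => a) = σ i a ∧ v i (fun _ => a) = a) ∧
        ∀ᶠ a : 𝕜 in 𝓝 0, deriv (fun a => u fun _ => a) a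
          = p 0 (fun _ => a) • (P.β 0).ξ (u (fun _ => a), σ 0 a)
            + p 1 (fun _ => a) • (P.β 1).ξ (u (fun _ => a), σ 1 a) := by
    rintro w lamW muW ⟨⟨W, h0W, hW⟩, hw0, hlm0, hax⟩
    obtain ⟨u, lam, mu, R, hn, hz⟩ := hW.exists_isNormalizedWave h0W
    have z0 := hz.self_of_nhds
    rw [hn.R_zero] at z0
    have hu : u 0 = u₀ := z0.1.symm.trans hw0
    have hl : ∀ i, lam i 0 = lam₀ i := fun i => (z0.2 i).1.symm.trans (hlm0 i).1
    have hm : ∀ i, mu i 0 = mu₀ i := fun i => (z0.2 i).2.symm.trans (hlm0 i).2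
    obtain ⟨p, v, hs, hvd, hv⟩ := hn.exists_isWaveSolution P hu hl hm hmu
    have hdiag : ∀ᶠ a : 𝕜 in 𝓝 0, u (fun _ => a) P.rows.1 = f 0 a ∧
        u (fun _ => a) P.rows.2 = f 1 a ∧ ∀ i, mu i (fun _ => a) = σ i a ∧ v i (fun _ => a) = a := by
      filter_upwards [hn.axis, tendsto_axis.eventually hz, hax, hvd] with a a1 a2 a3 a4
      rw [a1] at a2
      refine ⟨?_, ?_, fun i => ⟨?_, a4 i⟩⟩
      · rw [← a2.1]; exact a3.1
      · rw [← a2.1]; exact a3.2.1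
      · rw [← (a2.2 i).2, hσ]
        fin_cases i
        exacts [a3.2.2.1, a3.2.2.2]
    refine ⟨u, mu, p, v, R, hs, hn.tendsto_R, ?_, hdiag, ?_⟩
    · filter_upwards [hz, hv, hn.tendsto_R.eventually
        (hn.lam_eq P.toTransversalBranches hu hl hm)] with z z1 z2 z3
      refine ⟨z1.1, fun i => ⟨(z1.2 i).2, ?_, ?_⟩⟩
      · rw [(z1.2 i).1, z3]
      · rw [z2, z3]
    · filter_upwards [tendsto_diagonal.eventually hs.eq_u,
        tendsto_diagonal.eventually hs.smooth_u.eventually_differentiableAt, hdiag] with a a1 a2 a3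
      have b2 : HasDerivAt (fun a : 𝕜 => (fun _ => a : Fin 2 → 𝕜)) (fun _ => 1) a :=
        hasDerivAt_pi.2 fun _ => hasDerivAt_id a
      have b3 := (a2.hasFDerivAt.comp_hasDerivAt (f := fun a : 𝕜 => (fun _ => a : Fin 2 → 𝕜)) a
        b2).deriv
      refine b3.trans ?_
      have b4 : (fun _ => 1 : Fin 2 → 𝕜) = Pi.single 0 1 + Pi.single 1 1 := by
        ext i; fin_cases i <;> simp
      rw [b4, map_add]
      change pd 0 u _ + pd 1 u _ = _
      rw [a1, a1, (a3.2.2 0).1, (a3.2.2 1).1]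
      rfl
  obtain ⟨u, mu, p, v, R, hs, hRt, hz, hd, hder⟩ := key h
  obtain ⟨u', mu', p', v', R', hs', hRt', hz', hd', hder'⟩ := key h'
  have hdiag0 : ((fun _ => 0) : Fin 2 → 𝕜) = 0 := rfl
  have sx : ∀ {u : (Fin 2 → 𝕜) → Fin m → 𝕜}, SmoothNear 𝕜 u 0 →
      SmoothNear 𝕜 (fun a : 𝕜 => u fun _ => a) 0 := fun hu =>
    hu.comp_of_eq (f := fun a : 𝕜 => (fun _ => a : Fin 2 → 𝕜))
      (SmoothNear.pi fun _ => smoothNear_id) rfl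
  have hcurve := P.curve_unique (p := fun i a => p i fun _ => a) (p' := fun i a => p' i fun _ => a)
    hσs hσ0 (sx hs.smooth_u) (sx hs'.smooth_u) hs.u_zero hs'.u_zero hder hder'
    (by filter_upwards [hd, hd'] with a a1 a2
        rw [a1.1, a1.2.1, a2.1, a2.2.1]
        exact ⟨rfl, rfl⟩)
  have heq := hs.eventuallyEq hs' (hcurve.mono fun a ha => ha.1)
    (by filter_upwards [hd, hd'] with a a1 a2 i
        rw [(a1.2.2 i).1, (a2.2.2 i).1])
    (hcurve.mono fun a ha => ha.2)
    (by filter_upwards [hd, hd'] with a a1 a2 i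
        rw [(a1.2.2 i).2, (a2.2.2 i).2])
  obtain ⟨S, -, -, hS, -⟩ := hs.exists_riemannInvariants (hd.mono fun a ha i => (ha.2.2 i).2)
  have hR : ∀ᶠ z in 𝓝 0, R z = S z := by
    filter_upwards [(tendsto_id.prodMk_nhds hRt).eventually hS, hz] with z z1 z2
    exact z1 fun i => (z2.2 i).2.2
  have hR' : ∀ᶠ z in 𝓝 0, R' z = S z := by
    filter_upwards [(tendsto_id.prodMk_nhds hRt').eventually hS, hz', hRt'.eventually heq]
      with z z1 z2 z3
    refine z1 fun i => ?_
    have e := (z2.2 i).2.2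
    rw [← z3.1, ← z3.2.2 i, ← z3.2.1 i, ← funext z3.2.1] at e
    exact e
  have hall : ∀ᶠ z in 𝓝 0, w z = w' z ∧ ∀ i, lamW i z = lamW' i z ∧ muW i z = muW' i z := by
    filter_upwards [hz, hz', hR, hR', hRt.eventually heq] with z z1 z2 z3 z4 z5
    rw [z4, ← z3] at z2
    refine ⟨?_, fun i => ⟨?_, ?_⟩⟩
    · rw [z1.1, z2.1, z5.1]
    · rw [(z1.2 i).2.1, (z2.2 i).2.1, z5.1, funext z5.2.1]
    · rw [(z1.2 i).1, (z2.2 i).1, z5.2.1]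
  exact ⟨hall.mono fun z hz => hz.1, fun i => ⟨hall.mono fun z hz => (hz.2 i).1,
    hall.mono fun z hz => (hz.2 i).2⟩⟩

/-- The branches of the dispersion curve through the base pair are parametrized by `μ`, so that the
data `f₃` and `f₄` are the parameters of the two branches on the axis. -/
theorem AllCompatible.hasDoubleWavesOfFourFunctions {U : Set (Fin m → 𝕜)}
    (h : AllCompatible A B U) (hm : 2 ≤ m) (hU : IsOpen U) (hA : ∀ u ∈ U, SmoothField A u)
    (hB : ∀ u ∈ U, SmoothField B u) (hsimple : ∀ u ∈ U, SimpleSpectrumAt A B u) :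
    HasDoubleWavesOfFourFunctions A B U := by
  intro u₀ hu₀
  obtain ⟨lam₀, mu₀, hg, hmu, ht⟩ := (hsimple u₀ hu₀).exists_basePair hm (hA u₀ hu₀) (hB u₀ hu₀)
  have hB' : ∀ u, B u = ((0, 1) : 𝕜 × 𝕜).2 • B u + ((0, 1) : 𝕜 × 𝕜).1 • 1 := by simp
  have hC' : ∀ u, (fun _ => 1 : (Fin m → 𝕜) → Matrix (Fin m) (Fin m) 𝕜) u
      = ((1, 0) : 𝕜 × 𝕜).2 • B u + ((1, 0) : 𝕜 × 𝕜).1 • 1 := by simp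
  obtain ⟨P⟩ := h.exists_branchPair hU hu₀ (hA u₀ hu₀) (hB u₀ hu₀) hB' hC' (s₀ := mu₀) (q₀ := lam₀)
    (by simpa using hg) ht
  refine ⟨lam₀, mu₀, P.rows.1, P.rows.2, P.admissible, P.isOpen_admissible, P.dense_admissible,
    fun I f hI h0 hf f0 f1 f2 f3 hJ => ?_⟩
  have hfs : ∀ a, SmoothNear 𝕜 (f a) 0 := fun a =>
    HydrodynamicType.ContDiffOn.smoothNear (hf a) hI h0
  exact ⟨P.exists_isDoubleWaveWithData hU hu₀ hfs f0 f1 f2 f3 hJ,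
    fun w lamW muW w' lamW' muW' => P.eventuallyEq_of_isDoubleWaveWithData hmu hfs f2 f3⟩

end DoubleWaveUniqueness
end HydrodynamicType

theorem theorem2 {𝕜 : Type*} [RCLike 𝕜] {m : ℕ} (hm : 2 ≤ m)
    (U : Set (Fin m → 𝕜)) (hU : IsOpen U)
    (A B : (Fin m → 𝕜) → Matrix (Fin m) (Fin m) 𝕜)
    (hA : ∀ i j, ContDiffOn 𝕜 ∞ (fun u => A u i j) U)
    (hB : ∀ i j, ContDiffOn 𝕜 ∞ (fun u => B u i j) U)
    (hsimple : ∀ u ∈ U, HydrodynamicType.SimpleSpectrumAt A B u) :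
    HydrodynamicType.HaantjesVanishes A B U ↔
      HydrodynamicType.HasDoubleWavesOfFourFunctions A B U ∧
      HydrodynamicType.SpeedsUnrestricted A B U := by
  have hA' : ∀ u ∈ U, HydrodynamicType.SmoothField A u := fun u hu i j =>
    HydrodynamicType.ContDiffOn.smoothNear (hA i j) hU hu
  have hB' : ∀ u ∈ U, HydrodynamicType.SmoothField B u := fun u hu i j =>
    HydrodynamicType.ContDiffOn.smoothNear (hB i j) hU hu
  constructor
  · intro h
    have hc := h.allCompatible hA' hB'
    exact ⟨hc.hasDoubleWavesOfFourFunctions hm hU hA' hB' hsimple,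
      hc.speedsUnrestricted hU hA' hB'⟩
  · rintro ⟨-, h⟩
    exact (h.allCompatible hA' hB').haantjesVanishes hA' hB' hsimple
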